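/- **The model.** Fix $\gamma\in(2,3)$, $\delta\in\{1,2,\dots\}$, $\zeta\in(0,\frac1{\gamma-1}]$, $\beta\in(1,2)$, an integer $s>\delta$, $\tau\in(\zeta,1)$ and $\xi\in(0,1)$. For integers $1\le a\le b$ let $\mathcal P(\alpha,a,b)$ be the law on $\{a,\dots,b\}$ with mass $\int_k^{k+1}x^{-\alpha}dx\big/\int_a^{b+1}x^{-\alpha}dx$ at $k$. Consider the random multigraph $G_n$ on $n$ nodes that the first four phases of the ABCD construction produce: 1. Draw $n$ i.i.d. degrees from $\mathcal P(\gamma,\delta,\lfloor n^{\zeta}\rfloor)$ and sort them as $d_1\ge\dots\ge d_n$; if their sum is odd, decrease $d_1$ by $1$ and sort again. 2. Draw i.i.d. community sizes from $\mathcal P(\beta,s,\lfloor n^{\tau}\rfloor)$ until their sum is at least $n$, say $n+k$. If the last size $c$ is at least $k+s$, reduce it by $k$; otherwise delete the last community and enlarge $c-k$ of the others by one node each. Let $L$ be the resulting number of communities $C_1,\dots,C_L$. 3. Let $\phi=1-n^{-2}\sum_j|C_j|^2$. For $i=1,\dots,n$ in turn, give label $i$ and degree $d_i$ to a uniformly random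 unassigned node among those whose community $C$ satisfies $d_i\le(|C|-1)/(1-\xi\phi)$ (among all unassigned nodes, if there is no such node). 4. Independently for all $i$ let $Y_i$ be the random rounding of $(1-\xi)d_i$, i.e. $Y_i\in\{\lfloor(1-\xi)d_i\rfloor,\lfloor(1-\xi)d_i\rfloor+1\}$ with $\mathbb E[Y_i\mid d_i]=(1-\xi)d_i$, and let $Z_i=d_i-Y_i$. In every community in which $\sum_iY_i$ is odd, take a node $i$ of maximum degree and replace $(Y_i,Z_i)$ by $(Y_i+1,Z_i-1)$, or by $(Y_i-1,Z_i+1)$ if $Z_i=0$. Then, independently, form for every $j$ the community graph, a configuration model (uniform pairing of half-edges) on $C_j$ with degrees $(Y_i)_{i\in C_j}$, and the background graph, a configuration model on $[n]$ with degrees $(Z_i)_{i\in[n]}$. **Collisions.** Let $S_c$ and $S_b$ be the numbers of self-loops in the community graphs and in the background graph. Let $M_c$ and $M_b$ be the numbers of multi-edges in them, that is, of pairs of distinct nodes joined by at least two edges of the community graphs, respectively of the background graph; let $M'_c\ge M_c$ and $M'_b\ge M_b$ be the corresponding numbers of unordered pairs of parallel non-loop edges. Let $M_{bc}$ be the number of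 background edges that are also community edges. **Theorem.** Expectations are taken over all four phases, constants may depend on the parameters but not on $n$, and $n\to\infty$. Then 1. $\mathbb E[S_c]=O\big(n^{1-\tau(2-\beta)}(1+n^{\zeta(4-\gamma-\beta)})\big)$ if $\gamma+\beta\ne4$, and $\mathbb E[S_c]=O\big(n^{1-\tau(2-\beta)}\log n\big)$ if $\gamma+\beta=4$; 2. $\mathbb E[M_c]=O\big(n^{1-\tau(2-\beta)}(1+n^{\zeta(7-2\gamma-\beta)})\big)$; the same bound holds for $\mathbb E[M'_c]$ if $2\gamma+\beta\ne7$, and $\mathbb E[M'_c]=O\big(n^{1-\tau(2-\beta)}\log n\big)$ if $2\gamma+\beta=7$; 3. $\mathbb E[S_b]=O(n^{\zeta(3-\gamma)})$; 4. $\mathbb E[M_b]=O(n^{\zeta(6-2\gamma)})$ and $\mathbb E[M'_b]=O(n^{\zeta(6-2\gamma)})$; 5. $\mathbb E[M_{bc}]=o(\mathbb E[M_c])$. Moreover, in comparison with the random number $L$ of communities, the following hold with high probability, i.e. for suitable positive constants (independent of $n$) the inequalities hold with probability tending to $1$: - $\mathbb E[S_c]=\Omega(L)$, for all parameters as above; -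 if $\gamma+\beta>4$, then $\mathbb E[S_c+M_c+M_{bc}]=\Theta(L)$; - if $2\zeta(3-\gamma)+\tau(2-\beta)\le1$, then $\mathbb E[S_b+M_b]=O(L)$; - if both inequalities hold, then $\mathbb E[S_c+M_c+S_b+M_b+M_{bc}]=\Theta(L)$. The last three statements also hold with $M'_c,M'_b$ in place of $M_c,M_b$ and the condition $2\gamma+\beta>7$ in place of $\gamma+\beta>4$. -/

import Mathlib

open scoped ENNReal Topology
open Filter

namespace ABCD

/-! ### Basic random ingredients -/

/-- The expected value of a natural-valued random variable under a discrete law (as an extended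
nonnegative real, so that no integrability convention is involved). -/
noncomputable def mean {Ω : Type*} (p : PMF Ω) (X : Ω → ℕ) : ℝ≥0∞ :=
  ∑' ω, p ω * (X ω : ℝ≥0∞)

theorem tsum_pi_prod {α : Type*} : ∀ (k : ℕ) (p : Fin k → PMF α),
    ∑' f : Fin k → α, ∏ i, p i (f i) = 1
  | 0, p => by simp [tsum_fintype]
  | k + 1, p => by
    rw [← (Fin.consEquiv fun _ : Fin (k + 1) => α).tsum_eq, ENNReal.tsum_prod']
    simp only [Fin.consEquiv_apply, Fin.prod_univ_succ, Fin.cons_zero, Fin.cons_succ]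
    simp_rw [ENNReal.tsum_mul_left, tsum_pi_prod k fun i => p i.succ, mul_one]
    exact (p 0).tsum_coe

/-- The joint law of independent random variables with laws `p 0, …, p (k - 1)`. -/
noncomputable def indep {α : Type*} {k : ℕ} (p : Fin k → PMF α) : PMF (Fin k → α) :=
  ⟨fun f => ∏ i, p i (f i), by
    have h := (ENNReal.summable (f := fun f : Fin k → α => ∏ i, p i (f i))).hasSum
    rwa [tsum_pi_prod] at h⟩

/-- The mass at `k` of the truncated power law on `{δ, …, Δ}` with exponent `γ`. -/
noncomputable def tplMass (γ : ℝ) (δ Δ k : ℕ) : ℝ :=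
  (∫ x in (k : ℝ)..(k + 1 : ℝ), x ^ (-γ)) / ∫ x in (δ : ℝ)..(Δ + 1 : ℝ), x ^ (-γ)

theorem sum_tplMass (γ : ℝ) {δ Δ : ℕ} (h : 1 ≤ δ ∧ δ ≤ Δ) :
    ∑ k ∈ Finset.Icc δ Δ, ENNReal.ofReal (tplMass γ δ Δ k) = 1 := by
  have hδ : (1 : ℝ) ≤ δ := by exact_mod_cast h.1
  have hΔ : (δ : ℝ) ≤ Δ := by exact_mod_cast h.2
  have hpos : 0 < ∫ x in (δ : ℝ)..(Δ + 1 : ℝ), x ^ (-γ) := by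
    apply intervalIntegral.intervalIntegral_pos_of_pos_on
    · apply intervalIntegral.intervalIntegrable_rpow
      right
      rw [Set.uIcc_of_le (by linarith)]
      intro h0
      linarith [h0.1]
    · intro x hx
      exact Real.rpow_pos_of_pos (by linarith [hx.1]) _
    · linarith
  have hnn : ∀ k ∈ Finset.Icc δ Δ, 0 ≤ tplMass γ δ Δ k := by
    intro k hk
    refine div_nonneg ?_ hpos.le
    apply intervalIntegral.integral_nonneg (by linarith)
    intro x hx
    exact Real.rpow_nonneg (le_trans (Nat.cast_nonneg k) hx.1) _
  rw [← ENNReal.ofReal_sum_of_nonneg hnn]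
  have hs : ∑ k ∈ Finset.Icc δ Δ, ∫ x in (k : ℝ)..(k + 1 : ℝ), x ^ (-γ)
      = ∫ x in (δ : ℝ)..(Δ + 1 : ℝ), x ^ (-γ) := by
    have := intervalIntegral.sum_integral_adjacent_intervals_Ico (μ := MeasureTheory.volume)
      (f := fun x : ℝ => x ^ (-γ)) (a := fun k : ℕ => (k : ℝ)) (m := δ) (n := Δ + 1)
      (by omega) (by
        intro k hk
        apply intervalIntegral.intervalIntegrable_rpow
        right
        have hk1 : (δ : ℝ) ≤ k := by exact_mod_cast hk.1
        push_cast
        rw [Set.uIcc_of_le (by linarith)]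
        intro h0
        linarith [h0.1])
    push_cast at this
    rw [← this]
    rfl
  simp only [tplMass]
  rw [← Finset.sum_div, hs, div_self hpos.ne', ENNReal.ofReal_one]

open Classical in
/-- The truncated power law on `{δ, …, Δ}` with exponent `γ`. (Outside the range `1 ≤ δ ≤ Δ` it is
not defined; the point mass at `δ` is used as a placeholder.) -/
noncomputable def tpl (γ : ℝ) (δ Δ : ℕ) : PMF ℕ :=
  if h : 1 ≤ δ ∧ δ ≤ Δ then
    PMF.ofFinset (fun k => if k ∈ Finset.Icc δ Δ then ENNReal.ofReal (tplMass γ δ Δ k) else 0)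
      (Finset.Icc δ Δ)
      (by rw [← sum_tplMass γ h]; exact Finset.sum_congr rfl fun k hk => if_pos hk)
      (fun k hk => if_neg hk)
  else PMF.pure δ

/-- Random rounding of `x ≥ 0`: the value is `⌊x⌋ + 1` with probability equal to the fractional
part of `x`, and `⌊x⌋` otherwise. -/
noncomputable def randRound (x : ℝ) : PMF ℕ :=
  (PMF.ofFintype
    (fun b : Bool => if b then ENNReal.ofReal (Int.fract x) else ENNReal.ofReal (1 - Int.fract x))
    (by
      simp only [Fintype.sum_bool, if_true, Bool.false_eq_true, if_false]
      rw [← ENNReal.ofReal_add (Int.fract_nonneg x) (by linarith [Int.fract_lt_one x])]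
      simp)).map fun b => if b then ⌊x⌋₊ + 1 else ⌊x⌋₊

/-! ### Multigraphs and the configuration model -/

/-- A multigraph on `V`: a multiset of edges, a loop at `v` being `s(v, v)`. -/
abbrev Multigraph (V : Type) := Multiset (Sym2 V)

open Classical in
/-- The number of loops. -/
noncomputable def loops {V : Type} (g : Multigraph V) : ℕ :=
  (g.filter fun e => e.IsDiag).card

open Classical in
/-- The number of pairs of distinct nodes that are joined by a multi-edge (at least two edges). -/
noncomputable def multiEdges {V : Type} (g : Multigraph V) : ℕ :=
  (g.toFinset.filter fun e => ¬ e.IsDiag ∧ 2 ≤ g.count e).card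

open Classical in
/-- The number of (unordered) pairs of parallel non-loop edges. -/
noncomputable def parallelPairs {V : Type} (g : Multigraph V) : ℕ :=
  ∑ e ∈ g.toFinset.filter (fun e => ¬ e.IsDiag), (g.count e).choose 2

/-- Half-edges of a degree sequence. -/
abbrev HalfEdge {n : ℕ} (d : Fin n → ℕ) := (i : Fin n) × Fin (d i)

open Classical in
/-- Perfect matchings of the half-edges, as involutions without fixed points. -/
noncomputable def matchings {n : ℕ} (d : Fin n → ℕ) : Finset (Equiv.Perm (HalfEdge d)) :=
  Finset.univ.filter fun σ => ∀ h, σ h ≠ h ∧ σ (σ h) = h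

open Classical in
/-- The multigraph obtained from a perfect matching: every matched pair of half-edges gives one
edge. -/
noncomputable def edgesOf {n : ℕ} {d : Fin n → ℕ} (σ : Equiv.Perm (HalfEdge d)) :
    Multigraph (Fin n) :=
  (Finset.univ.image fun h => s(h, σ h)).val.map (Sym2.map Sigma.fst)

open Classical in
/-- The configuration model: the half-edges are paired by a uniformly random perfect matching.
(A perfect matching exists exactly if the degree sum is even; otherwise the empty graph is used as
a placeholder.) -/
noncomputable def configModel {n : ℕ} (d : Fin n → ℕ) : PMF (Multigraph (Fin n)) :=
  if h : (matchings d).Nonempty then (PMF.uniformOfFinset _ h).map edgesOf else PMF.pure 0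

/-! ### The model -/

/-- Parameters of the model (other than the number `n` of nodes). -/
structure Params where
  /-- exponent of the degree distribution -/
  γ : ℝ
  /-- minimum degree -/
  δ : ℕ
  /-- the maximum degree is at most `n ^ ζ` -/
  ζ : ℝ
  /-- exponent of the distribution of the community sizes -/
  β : ℝ
  /-- minimum community size -/
  s : ℕ
  /-- the maximum community size is at most `n ^ τ` -/
  τ : ℝ
  /-- level of noise -/
  ξ : ℝ

/-- The admissible ranges of the parameters. -/
structure Params.Valid (P : Params) : Prop where
  two_lt_γ : 2 < P.γ
  γ_lt_three : P.γ < 3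
  one_le_δ : 1 ≤ P.δ
  ζ_pos : 0 < P.ζ
  ζ_le : P.ζ ≤ 1 / (P.γ - 1)
  one_lt_β : 1 < P.β
  β_lt_two : P.β < 2
  δ_lt_s : P.δ < P.s
  ζ_lt_τ : P.ζ < P.τ
  τ_lt_one : P.τ < 1
  ξ_pos : 0 < P.ξ
  ξ_lt_one : P.ξ < 1

/-- Rearrangement of a sequence in nonincreasing order. -/
def sortDesc {n : ℕ} (d : Fin n → ℕ) : Fin n → ℕ :=
  d ∘ Tuple.sort fun i => OrderDual.toDual (d i)

/-- If the sum of the nonincreasing sequence `d` is odd, its first term is decreased by one and the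
sequence is sorted again. -/
def makeEven {n : ℕ} (d : Fin n → ℕ) : Fin n → ℕ :=
  if Even (∑ i, d i) then d else sortDesc fun i => if (i : ℕ) = 0 then d i - 1 else d i

/-- Phase 1: the degree sequence. -/
noncomputable def degrees (P : Params) (n : ℕ) : PMF (Fin n → ℕ) :=
  (indep fun _ : Fin n => tpl P.γ P.δ ⌊(n : ℝ) ^ P.ζ⌋₊).map fun x => makeEven (sortDesc x)

/-- The shortest initial segment of a list whose sum is at least the given number (the whole list if
there is none). -/
def takeUntil : ℕ → List ℕ → List ℕ
  | 0, _ => []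
  | _ + 1, [] => []
  | m + 1, a :: l => a :: takeUntil (m + 1 - a) l

/-- Let the sizes in `c` have sum `n + k`. If the last size is at least `k + s`, it is reduced by
`k`. Otherwise the last community is deleted, which leaves `last - k` nodes, and that many of the
old communities are enlarged by one node each. -/
def adjustSizes (s n : ℕ) (c : List ℕ) : List ℕ :=
  let k := c.sum - n
  let last := c.getLastD 0
  let old := c.dropLast
  if k + s ≤ last then old ++ [last - k]
  else (old.take (last - k)).map (· + 1) ++ old.drop (last - k)

/-- Phase 2: the list of community sizes. Independent sizes are generated until their sum is at
least `n` (since sizes are positive, `n` of them always suffice); then the sum is adjusted to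
be `n`. -/
noncomputable def communitySizes (P : Params) (n : ℕ) : PMF (List ℕ) :=
  (indep fun _ : Fin n => tpl P.β P.s ⌊(n : ℝ) ^ P.τ⌋₊).map fun x =>
    adjustSizes P.s n (takeUntil n (List.ofFn x))

/-- Nodes, before they get their labels: `⟨j, a⟩` is the `a`-th node of the `j`-th community. -/
abbrev Slot (c : List ℕ) := (j : Fin c.length) × Fin (c.get j)

/-- The quantity `φ = 1 - n⁻² ∑ⱼ |Cⱼ|²`. -/
noncomputable def phi (n : ℕ) (c : List ℕ) : ℝ :=
  1 - (∑ j : Fin c.length, ((c.get j : ℕ) : ℝ) ^ 2) / (n : ℝ) ^ 2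

open Classical in
/-- The nodes among which the node that receives degree `d` is chosen, when `U` is the set of
unassigned nodes: those whose community `C` satisfies `d ≤ (|C| - 1) / (1 - ξ φ)`. (If there is no
such node, the constraint is dropped.) -/
noncomputable def candidates (P : Params) (n : ℕ) (c : List ℕ) (U : Finset (Slot c)) (d : ℕ) :
    Finset (Slot c) :=
  let A := U.filter fun u => (d : ℝ) ≤ (((c.get u.1 : ℕ) : ℝ) - 1) / (1 - P.ξ * phi n c)
  if A.Nonempty then A else U

open Classical in
/-- Phase 3: labels and degrees are assigned successively to uniformly random candidates. The result
gives for every label the community of the node with this label (`none` only if the nodes are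
exhausted). -/
noncomputable def assign (P : Params) (n : ℕ) (c : List ℕ) :
    (k : ℕ) → (Fin k → ℕ) → Finset (Slot c) → PMF (Fin k → Option (Fin c.length))
  | 0, _, _ => PMF.pure fun _ => none
  | k + 1, d, U =>
    if h : (candidates P n c U (d 0)).Nonempty then
      (PMF.uniformOfFinset _ h).bind fun u =>
        (assign P n c k (fun i => d i.succ) (U.erase u)).map fun f => Fin.cons (some u.1) f
    else PMF.pure fun _ => none

open Classical in
/-- Adjustment of the numbers `y` of community half-edges. If their sum over a community is odd,
then one half-edge of a node of maximum degree in the community (as degrees are nonincreasing, the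
node with the least label) is turned from a background into a community half-edge (from a community
into a background half-edge if the node has no background half-edge). -/
noncomputable def fixParity {n L : ℕ} (d : Fin n → ℕ) (comm : Fin n → Option (Fin L))
    (y : Fin n → ℕ) : Fin n → ℕ := fun i =>
  if (∀ i', comm i' = comm i → i ≤ i') ∧
      Odd (∑ i' ∈ Finset.univ.filter (fun i' => comm i' = comm i), y i') then
    (if y i < d i then y i + 1 else y i - 1)
  else y i

/-- The multigraph after phase 4, with its communities. -/
structure Outcome (n : ℕ) where
  /-- degrees -/
  deg : Fin n → ℕ
  /-- the number of communities -/
  L : ℕ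
  /-- the community of each node -/
  comm : Fin n → Option (Fin L)
  /-- the community graphs -/
  communityGraph : Fin L → Multigraph (Fin n)
  /-- the background graph -/
  background : Multigraph (Fin n)

open Classical in
/-- The law of the multigraph on `n` nodes that phases 1 to 4 produce. -/
noncomputable def law (P : Params) (n : ℕ) : PMF (Outcome n) :=
  (degrees P n).bind fun d =>
  (communitySizes P n).bind fun c =>
  (assign P n c n d Finset.univ).bind fun comm =>
  (indep fun i : Fin n => randRound ((1 - P.ξ) * d i)).bind fun y₀ =>
  let y := fixParity d comm y₀
  (indep fun j : Fin c.length =>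
    configModel fun i => if comm i = some j then y i else 0).bind fun g =>
  (configModel fun i => d i - y i).map fun b =>
  { deg := d, L := c.length, comm := comm, communityGraph := g, background := b }

namespace Outcome

variable {n : ℕ}

/-- Number of self-loops in community graphs. -/
noncomputable def Sc (G : Outcome n) : ℕ := ∑ j, loops (G.communityGraph j)

/-- Number of multi-edges in community graphs (pairs of nodes joined by at least two edges). -/
noncomputable def Mc (G : Outcome n) : ℕ := ∑ j, multiEdges (G.communityGraph j)

/-- Number of pairs of parallel edges in community graphs. -/
noncomputable def Mc' (G : Outcome n) : ℕ := ∑ j, parallelPairs (G.communityGraph j)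

/-- Number of self-loops in the background graph. -/
noncomputable def Sb (G : Outcome n) : ℕ := loops G.background

/-- Number of multi-edges in the background graph (pairs of nodes joined by at least two edges). -/
noncomputable def Mb (G : Outcome n) : ℕ := multiEdges G.background

/-- Number of pairs of parallel edges in the background graph. -/
noncomputable def Mb' (G : Outcome n) : ℕ := parallelPairs G.background

open Classical in
/-- Number of background edges that are also community edges. -/
noncomputable def Mbc (G : Outcome n) : ℕ :=
  (G.background.filter fun e => ∃ j, e ∈ G.communityGraph j).card

end Outcome

/-! ### Asymptotics -/

/-- A family of events holds with high probability. -/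
def Whp (P : Params) (E : (n : ℕ) → Set (Outcome n)) : Prop :=
  Tendsto (fun n => (law P n).toOuterMeasure (E n)) atTop (𝓝 1)

/-- The expectation, over phases 1 to 4, of a statistic of the multigraph on `n` nodes. -/
noncomputable def expect (P : Params) (X : (n : ℕ) → Outcome n → ℕ) (n : ℕ) : ℝ≥0∞ :=
  mean (law P n) (X n)

/-- `e n = O(r n)` as `n → ∞`. -/
def BigO (e : ℕ → ℝ≥0∞) (r : ℕ → ℝ) : Prop :=
  ∃ C : ℝ, 0 < C ∧ ∀ᶠ n in atTop, e n ≤ ENNReal.ofReal (C * r n)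

/-- `e n = o(f n)` as `n → ∞`. -/
def LittleO (e f : ℕ → ℝ≥0∞) : Prop :=
  ∀ ε : ℝ, 0 < ε → ∀ᶠ n in atTop, e n ≤ ENNReal.ofReal ε * f n

/-- With high probability, `e n = O(L)`, where `L` is the random number of communities. -/
def WhpBigOL (P : Params) (e : ℕ → ℝ≥0∞) : Prop :=
  ∃ C : ℝ, 0 < C ∧ Whp P fun n => {G | e n ≤ ENNReal.ofReal (C * G.L)}

/-- With high probability, `e n = Ω(L)`, where `L` is the random number of communities. -/
def WhpBigOmegaL (P : Params) (e : ℕ → ℝ≥0∞) : Prop :=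
  ∃ c : ℝ, 0 < c ∧ Whp P fun n => {G | ENNReal.ofReal (c * G.L) ≤ e n}

/-- With high probability, `e n = Θ(L)`, where `L` is the random number of communities. -/
def WhpThetaL (P : Params) (e : ℕ → ℝ≥0∞) : Prop :=
  ∃ c C : ℝ, 0 < c ∧ 0 < C ∧
    Whp P fun n => {G | ENNReal.ofReal (c * G.L) ≤ e n ∧ e n ≤ ENNReal.ofReal (C * G.L)}

end ABCD

/-!
Every expectation is a finite sum over the four phases, so each quantity is computed by conditioning
from the last phase backwards.

*Pairings.* In a uniform pairing of `m` half-edges, transposing the partners of two half-edges is a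
symmetry; counting with it (`card_matching_step`, `Ex_descFactorial_crossCount`) bounds the
factorial moments of the number of edges between two nodes of degrees `x` and `y` by powers of
`x * y / m`, and similarly for loops. What remains after conditioning on the degrees are sums of
products of degrees over powers of the total degree of a community or of the background graph.

*Rounding.* The total degree of a community of size `z` is at least of order `z`, in the sense of
inverse moments, even though individual rounded degrees may vanish
(`IsPartition.Ex_inv_commTotal_le`). The rounded degrees may hence be replaced by the drawn degrees
and the totals by the sizes.

*Sizes.* Wald's identity for the renewal sequence of sizes (`Ex_sum_takeUntil`) with exponential
bounds shows that the number of communities is concentrated at the scale `n ^ (1 - τ * (2 - β))`,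
called `commRate` (`SizeRange.Pr_length_ge`, `SizeRange.Pr_length_le`, `exists_whp_L`), and that
most nodes lie in communities larger than the maximum degree (`SizeRange.Pr_small_ge`), which admit
every label.

*Assignment.* The first quarter of the labels is assigned while most nodes are still free, so such
a label, of degree `d`, enters a given community of size `z` with probability at most `2 * z / n`,
and only if `(1 - ξ) * d ≤ z` (`GoodSizes.average_le`). All remaining labels have bounded degree
outside an event of negligible probability (`Pr_degrees_high_le`). Summing moments of the truncated
power law of degrees, cut off at `z`, against the power law of sizes produces the exponents
`4 - γ - β` and `7 - 2 * γ - β` for the communities, and `3 - γ` and `6 - 2 * γ` for the background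
graph, where no cut-off acts.

When `γ + β > 4`, the number of adjacent pairs joined at least twice is bounded through
`min 1 (x ^ 2) ≤ x ^ a` with `3 - β < a < γ - 1`, for which the resulting power sums converge
(`bigO_Mc_of_lt`). For background edges that repeat community edges the analogous device is
`min 1 x ≤ x ^ b`, combined with the fact that the sizes add up to `n` (`bigO_Mbc`,
`bigO_Mbc_of_lt`).

*Lower bounds.* A community of given size receives, with probability at least a quarter, several
nodes of degrees in a prescribed range while its total degree stays of the order of its size
(`GoodSizes.quarter_le_Pr`, `exists_le_Ex_law`), and then the pairing produces a loop or a double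
edge with probability bounded below (`le_Ex_two_le_mult`). Communities of a suitable constant order
of size give `E[S_c] = Ω(commRate)` (`exists_le_expect_Sc`). For `M_c` the communities of size about
`n ^ θ` and their nodes of degree about `n ^ (θ / 2)` are used (`exists_le_expect_Mc`); with
`θ = min (2 * ζ) τ` this exceeds the upper bound for `M_bc` by a positive power of `n`
(`littleO_Mbc_Mc`).
-/

namespace ABCD

/-! ### Expectations under discrete laws -/

/-- The expected value of an extended nonnegative random variable under a discrete law. -/
noncomputable def Ex {Ω : Type*} (p : PMF Ω) (f : Ω → ℝ≥0∞) : ℝ≥0∞ := ∑' ω, p ω * f ω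

section Ex

variable {Ω Ω' α : Type*}

theorem expect_eq_Ex (P : Params) (X : (n : ℕ) → Outcome n → ℕ) (n : ℕ) :
    expect P X n = Ex (law P n) fun G => (X n G : ℝ≥0∞) := rfl

theorem Ex_mono_support {p : PMF Ω} {f g : Ω → ℝ≥0∞} (h : ∀ ω ∈ p.support, f ω ≤ g ω) :
    Ex p f ≤ Ex p g := by
  refine ENNReal.tsum_le_tsum fun ω => ?_
  by_cases hω : p ω = 0
  · simp [hω]
  · exact mul_le_mul_right (h ω ((p.mem_support_iff ω).2 hω)) _

theorem Ex_mono {p : PMF Ω} {f g : Ω → ℝ≥0∞} (h : ∀ ω, f ω ≤ g ω) : Ex p f ≤ Ex p g :=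
  Ex_mono_support fun ω _ => h ω

theorem Ex_congr_support {p : PMF Ω} {f g : Ω → ℝ≥0∞} (h : ∀ ω ∈ p.support, f ω = g ω) :
    Ex p f = Ex p g :=
  le_antisymm (Ex_mono_support fun ω hω => (h ω hω).le)
    (Ex_mono_support fun ω hω => (h ω hω).ge)

theorem Ex_add (p : PMF Ω) (f g : Ω → ℝ≥0∞) :
    Ex p (fun ω => f ω + g ω) = Ex p f + Ex p g := by
  simp only [Ex, mul_add, ENNReal.tsum_add]

theorem Ex_const_mul (p : PMF Ω) (a : ℝ≥0∞) (f : Ω → ℝ≥0∞) :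
    Ex p (fun ω => a * f ω) = a * Ex p f := by
  simp only [Ex, ← ENNReal.tsum_mul_left]
  exact tsum_congr fun ω => mul_left_comm _ _ _

theorem Ex_mul_const (p : PMF Ω) (a : ℝ≥0∞) (f : Ω → ℝ≥0∞) :
    Ex p (fun ω => f ω * a) = Ex p f * a := by
  simp only [mul_comm _ a, Ex_const_mul]

@[simp] theorem Ex_const (p : PMF Ω) (a : ℝ≥0∞) : Ex p (fun _ => a) = a := by
  simp only [Ex, ENNReal.tsum_mul_right, p.tsum_coe, one_mul]

@[simp] theorem Ex_zero (p : PMF Ω) : Ex p (fun _ => 0) = 0 := Ex_const p 0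

theorem Ex_sum {ι : Type*} (p : PMF Ω) (s : Finset ι) (f : ι → Ω → ℝ≥0∞) :
    Ex p (fun ω => ∑ i ∈ s, f i ω) = ∑ i ∈ s, Ex p (f i) := by
  simp only [Ex, Finset.mul_sum]
  exact Summable.tsum_finsetSum fun i _ => ENNReal.summable

theorem Ex_le_of_support {p : PMF Ω} {f : Ω → ℝ≥0∞} {a : ℝ≥0∞}
    (h : ∀ ω ∈ p.support, f ω ≤ a) : Ex p f ≤ a :=
  (Ex_mono_support h).trans (Ex_const p a).le

theorem le_Ex_of_support {p : PMF Ω} {f : Ω → ℝ≥0∞} {a : ℝ≥0∞}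
    (h : ∀ ω ∈ p.support, a ≤ f ω) : a ≤ Ex p f :=
  (Ex_const p a).ge.trans (Ex_mono_support h)

@[simp] theorem Ex_pure (a : Ω) (f : Ω → ℝ≥0∞) : Ex (PMF.pure a) f = f a := by
  classical
  rw [Ex, tsum_eq_single a]
  · simp
  · intro b hb
    simp [PMF.pure_apply, hb]

theorem Ex_bind (p : PMF Ω) (q : Ω → PMF Ω') (f : Ω' → ℝ≥0∞) :
    Ex (p.bind q) f = Ex p fun ω => Ex (q ω) f := by
  simp only [Ex, PMF.bind_apply, ← ENNReal.tsum_mul_right, ← ENNReal.tsum_mul_left]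
  rw [ENNReal.tsum_comm]
  exact tsum_congr fun a => tsum_congr fun b => mul_assoc _ _ _

theorem Ex_map (p : PMF Ω) (g : Ω → Ω') (f : Ω' → ℝ≥0∞) :
    Ex (p.map g) f = Ex p fun ω => f (g ω) := by
  rw [← PMF.bind_pure_comp, Ex_bind]
  simp

theorem Ex_uniformOfFinset {s : Finset Ω} (hs : s.Nonempty) (f : Ω → ℝ≥0∞) :
    Ex (PMF.uniformOfFinset s hs) f = (∑ a ∈ s, f a) / s.card := by
  classical
  rw [Ex, tsum_eq_sum (s := s)]
  · rw [div_eq_mul_inv, Finset.sum_mul]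
    refine Finset.sum_congr rfl fun a ha => ?_
    rw [PMF.uniformOfFinset_apply_of_mem hs ha, mul_comm]
  · intro a ha
    rw [PMF.uniformOfFinset_apply_of_notMem hs ha, zero_mul]

theorem toOuterMeasure_eq_Ex (p : PMF Ω) (s : Set Ω) :
    p.toOuterMeasure s = Ex p (s.indicator 1) := by
  rw [PMF.toOuterMeasure_apply, Ex]
  refine tsum_congr fun ω => ?_
  by_cases h : ω ∈ s <;> simp [h]

/-- The probability of an event. -/
noncomputable def Pr (p : PMF Ω) (s : Set Ω) : ℝ≥0∞ := Ex p (s.indicator 1)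

theorem Pr_mono {p : PMF Ω} {s t : Set Ω} (h : ∀ ω ∈ p.support, ω ∈ s → ω ∈ t) :
    Pr p s ≤ Pr p t := by
  classical
  refine Ex_mono_support fun ω hω => ?_
  by_cases hs : ω ∈ s
  · simp [hs, h ω hω hs]
  · simp [hs]

theorem Pr_le_one (p : PMF Ω) (s : Set Ω) : Pr p s ≤ 1 :=
  Ex_le_of_support fun ω _ => Set.indicator_le_self' (by simp) ω

theorem Pr_add_compl (p : PMF Ω) (s : Set Ω) : Pr p s + Pr p sᶜ = 1 := by
  rw [Pr, Pr, ← Ex_add, ← Ex_const p 1]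
  congr 1
  funext ω
  by_cases h : ω ∈ s <;> simp [h]

theorem Pr_union_le (p : PMF Ω) (s t : Set Ω) : Pr p (s ∪ t) ≤ Pr p s + Pr p t := by
  rw [Pr, Pr, Pr, ← Ex_add]
  refine Ex_mono fun ω => ?_
  by_cases h : ω ∈ s <;> by_cases h' : ω ∈ t <;> simp [h, h']

/-- Markov's inequality. -/
theorem mul_Pr_le_Ex {p : PMF Ω} {s : Set Ω} {f : Ω → ℝ≥0∞} {a : ℝ≥0∞}
    (h : ∀ ω ∈ p.support, ω ∈ s → a ≤ f ω) : a * Pr p s ≤ Ex p f := by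
  rw [Pr, ← Ex_const_mul]
  refine Ex_mono_support fun ω hω => ?_
  by_cases hs : ω ∈ s
  · simpa [hs] using h ω hω hs
  · simp [hs]

/-- A random variable that is bounded by `b` on a bad event costs at most `b` times the probability
of that event. -/
theorem Ex_le_add_mul_Pr {p : PMF Ω} {f g : Ω → ℝ≥0∞} {s : Set Ω} {b : ℝ≥0∞}
    (hg : ∀ ω ∈ p.support, ω ∉ s → f ω ≤ g ω) (hb : ∀ ω ∈ p.support, f ω ≤ b) :
    Ex p f ≤ Ex p g + b * Pr p s := by
  rw [Pr, ← Ex_const_mul, ← Ex_add]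
  refine Ex_mono_support fun ω hω => ?_
  by_cases hs : ω ∈ s
  · simpa [hs] using (hb ω hω).trans le_add_self
  · simpa [hs] using hg ω hω hs

theorem Ex_indep_succ {k : ℕ} (p : Fin (k + 1) → PMF α) (f : (Fin (k + 1) → α) → ℝ≥0∞) :
    Ex (indep p) f = Ex (p 0) fun a => Ex (indep fun i => p i.succ) fun ω => f (Fin.cons a ω) := by
  rw [Ex, ← (Fin.consEquiv fun _ : Fin (k + 1) => α).tsum_eq, ENNReal.tsum_prod']
  simp only [Ex, ← ENNReal.tsum_mul_left]
  refine tsum_congr fun a => tsum_congr fun ω => ?_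
  change (∏ i, p i (Fin.cons (α := fun _ => α) a ω i)) * f (Fin.cons a ω)
    = p 0 a * ((∏ i, p (Fin.succ i) (ω i)) * f (Fin.cons a ω))
  rw [Fin.prod_univ_succ, mul_assoc]
  simp

theorem Ex_indep_prod : ∀ {k : ℕ} (p : Fin k → PMF α) (f : Fin k → α → ℝ≥0∞),
    Ex (indep p) (fun ω => ∏ i, f i (ω i)) = ∏ i, Ex (p i) (f i)
  | 0, p, f => by simp
  | k + 1, p, f => by
    rw [Ex_indep_succ]
    simp only [Fin.prod_univ_succ, Fin.cons_zero, Fin.cons_succ, Ex_const_mul]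
    rw [Ex_indep_prod (fun i => p i.succ) fun i => f i.succ, Ex_mul_const]

theorem Ex_indep_apply {k : ℕ} (p : Fin k → PMF α) (i : Fin k) (f : α → ℝ≥0∞) :
    Ex (indep p) (fun ω => f (ω i)) = Ex (p i) f := by
  have h := Ex_indep_prod p fun j => if j = i then f else fun _ => 1
  have h1 : ∀ ω : Fin k → α, ∏ j, (if j = i then f else fun _ => 1) (ω j) = f (ω i) := by
    intro ω
    rw [Finset.prod_eq_single i] <;> simp +contextual
  have h2 : ∏ j, Ex (p j) (if j = i then f else fun _ => 1) = Ex (p i) f := by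
    rw [Finset.prod_eq_single i] <;> simp +contextual
  simpa only [h1, h2] using h

theorem Ex_indep_apply_mul {k : ℕ} (p : Fin k → PMF α) {i j : Fin k} (hij : i ≠ j)
    (f g : α → ℝ≥0∞) :
    Ex (indep p) (fun ω => f (ω i) * g (ω j)) = Ex (p i) f * Ex (p j) g := by
  have key : ∀ F : Fin k → ℝ≥0∞, (∀ l, l ≠ i → l ≠ j → F l = 1) → ∏ l, F l = F i * F j := by
    intro F hF
    rw [Fintype.prod_eq_mul i j hij]
    rintro l ⟨h1, h2⟩
    exact hF l h1 h2
  have h := Ex_indep_prod p fun l => if l = i then f else if l = j then g else fun _ => 1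
  have h1 : ∀ ω : Fin k → α,
      ∏ l, (if l = i then f else if l = j then g else fun _ => 1) (ω l) = f (ω i) * g (ω j) := by
    intro ω
    rw [key _ (by intro l h1 h2; simp [h1, h2])]
    simp [hij.symm]
  rw [key _ (by intro l h1 h2; simp [h1, h2])] at h
  simp only [h1] at h
  simpa [hij.symm] using h

theorem mem_support_indep {k : ℕ} {p : Fin k → PMF α} {ω : Fin k → α}
    (h : ω ∈ (indep p).support) (i : Fin k) : ω i ∈ (p i).support := by
  rw [PMF.mem_support_iff] at h ⊢
  intro h0
  exact h (Finset.prod_eq_zero (Finset.mem_univ i) h0)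

/-- Independent pairs: a function of two coordinates is averaged coordinate by coordinate. -/
theorem Ex_indep_apply₂ {k : ℕ} (q : PMF α) {i j : Fin k} (hij : i ≠ j) (f : α → α → ℝ≥0∞) :
    Ex (indep fun _ : Fin k => q) (fun ω => f (ω i) (ω j)) = Ex q fun a => Ex q fun b => f a b := by
  classical
  have h : ∀ ω : Fin k → α, f (ω i) (ω j)
      = ∑' a, (if ω i = a then 1 else 0) * f a (ω j) := by
    intro ω
    rw [tsum_eq_single (ω i)]
    · simp
    · intro b hb
      simp [Ne.symm hb]
  have hsw : ∀ F : α → (Fin k → α) → ℝ≥0∞, Ex (indep fun _ : Fin k => q) (fun ω => ∑' a, F a ω)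
      = ∑' a, Ex (indep fun _ : Fin k => q) (F a) := by
    intro F
    simp only [Ex, ← ENNReal.tsum_mul_left]
    rw [ENNReal.tsum_comm]
  simp only [h, hsw]
  rw [Ex]
  refine tsum_congr fun a => ?_
  rw [Ex_indep_apply_mul _ hij (fun x => if x = a then 1 else 0) (f a)]
  congr 1
  rw [Ex, tsum_eq_single a]
  · simp
  · intro b hb
    simp [hb]

end Ex

/-! ### Power sums and the truncated power law -/

theorem integral_rpow_neg_pos {γ : ℝ} {a b : ℕ} (ha : 1 ≤ a) (hab : a ≤ b) :
    0 < ∫ x in (a : ℝ)..(b + 1 : ℝ), x ^ (-γ) := by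
  have h1 : (1 : ℝ) ≤ a := by exact_mod_cast ha
  have h2 : (a : ℝ) ≤ b := by exact_mod_cast hab
  apply intervalIntegral.intervalIntegral_pos_of_pos_on
  · apply intervalIntegral.intervalIntegrable_rpow
    right
    rw [Set.uIcc_of_le (by linarith)]
    intro h0
    linarith [h0.1]
  · intro x hx
    exact Real.rpow_pos_of_pos (by linarith [hx.1]) _
  · linarith

theorem integral_succ_rpow_le {γ : ℝ} (hγ : 0 ≤ γ) {k : ℕ} (hk : 1 ≤ k) :
    ∫ x in (k : ℝ)..(k + 1 : ℝ), x ^ (-γ) ≤ (k : ℝ) ^ (-γ) := by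
  have h1 : (1 : ℝ) ≤ k := by exact_mod_cast hk
  have hi : IntervalIntegrable (fun x : ℝ => x ^ (-γ)) MeasureTheory.volume k (k + 1) := by
    apply intervalIntegral.intervalIntegrable_rpow
    right
    rw [Set.uIcc_of_le (by linarith)]
    intro h0
    linarith [h0.1]
  have := intervalIntegral.integral_mono_on (g := fun _ : ℝ => (k : ℝ) ^ (-γ)) (by linarith) hi
    (by simp) (fun x hx => Real.rpow_le_rpow_of_nonpos (by linarith) hx.1 (by linarith))
  simpa using this

theorem le_integral_succ_rpow {γ : ℝ} (hγ : 0 ≤ γ) {k : ℕ} (hk : 1 ≤ k) :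
    (2 * k : ℝ) ^ (-γ) ≤ ∫ x in (k : ℝ)..(k + 1 : ℝ), x ^ (-γ) := by
  have h1 : (1 : ℝ) ≤ k := by exact_mod_cast hk
  have hi : IntervalIntegrable (fun x : ℝ => x ^ (-γ)) MeasureTheory.volume k (k + 1) := by
    apply intervalIntegral.intervalIntegrable_rpow
    right
    rw [Set.uIcc_of_le (by linarith)]
    intro h0
    linarith [h0.1]
  have := intervalIntegral.integral_mono_on (f := fun _ : ℝ => (2 * k : ℝ) ^ (-γ)) (by linarith)
    (by simp) hi (fun x hx => Real.rpow_le_rpow_of_nonpos (by linarith [hx.1])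
      (by linarith [hx.2]) (by linarith))
  simpa using this

theorem tplMass_nonneg (γ : ℝ) {δ Δ k : ℕ} (hδ : 1 ≤ δ) (h : δ ≤ Δ) : 0 ≤ tplMass γ δ Δ k := by
  refine div_nonneg ?_ (integral_rpow_neg_pos hδ h).le
  apply intervalIntegral.integral_nonneg (by linarith)
  intro x hx
  exact Real.rpow_nonneg (le_trans (Nat.cast_nonneg k) hx.1) _

theorem tplMass_le {γ : ℝ} (hγ : 0 ≤ γ) {δ Δ k : ℕ} (hδ : 1 ≤ δ) (h : δ ≤ Δ) (hk : 1 ≤ k) :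
    tplMass γ δ Δ k ≤ (2 * δ : ℝ) ^ γ * (k : ℝ) ^ (-γ) := by
  have h1 : (1 : ℝ) ≤ δ := by exact_mod_cast hδ
  have h2 : (δ : ℝ) ≤ Δ := by exact_mod_cast h
  have hden : (2 * δ : ℝ) ^ (-γ) ≤ ∫ x in (δ : ℝ)..(Δ + 1 : ℝ), x ^ (-γ) := by
    refine (le_integral_succ_rpow hγ hδ).trans ?_
    apply intervalIntegral.integral_mono_interval le_rfl (by linarith) (by linarith)
    · filter_upwards [MeasureTheory.ae_restrict_mem measurableSet_Ioc] with x hx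
      exact Real.rpow_nonneg (by linarith [hx.1]) _
    · apply intervalIntegral.intervalIntegrable_rpow
      right
      rw [Set.uIcc_of_le (by linarith)]
      intro h0
      linarith [h0.1]
  have hp : (0 : ℝ) < (2 * δ : ℝ) ^ (-γ) := Real.rpow_pos_of_pos (by linarith) _
  rw [tplMass, div_le_iff₀ (hp.trans_le hden)]
  refine (integral_succ_rpow_le hγ hk).trans ?_
  have hk0 : 0 ≤ (k : ℝ) ^ (-γ) := Real.rpow_nonneg (Nat.cast_nonneg k) _
  calc (k : ℝ) ^ (-γ) = (2 * δ : ℝ) ^ γ * (k : ℝ) ^ (-γ) * (2 * δ : ℝ) ^ (-γ) := by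
        rw [mul_right_comm, ← Real.rpow_add (by linarith)]
        simp
    _ ≤ _ := mul_le_mul_of_nonneg_left hden
        (mul_nonneg (Real.rpow_nonneg (by linarith) _) hk0)

theorem le_tplMass {γ : ℝ} (hγ : 1 < γ) {δ Δ k : ℕ} (hδ : 1 ≤ δ) (h : δ ≤ Δ) (hk : 1 ≤ k) :
    (γ - 1) * (δ : ℝ) ^ (γ - 1) * 2 ^ (-γ) * (k : ℝ) ^ (-γ) ≤ tplMass γ δ Δ k := by
  have h1 : (1 : ℝ) ≤ δ := by exact_mod_cast hδ
  have h2 : (δ : ℝ) ≤ Δ := by exact_mod_cast h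
  have hden : ∫ x in (δ : ℝ)..(Δ + 1 : ℝ), x ^ (-γ) ≤ (δ : ℝ) ^ (1 - γ) / (γ - 1) := by
    rw [integral_rpow]
    · rw [show -γ + 1 = 1 - γ by ring, ← neg_div_neg_eq]
      rw [show -(1 - γ) = γ - 1 by ring]
      have : 0 ≤ ((Δ : ℝ) + 1) ^ (1 - γ) := Real.rpow_nonneg (by linarith) _
      apply div_le_div_of_nonneg_right _ (by linarith)
      linarith
    · right
      refine ⟨by linarith, ?_⟩
      rw [Set.uIcc_of_le (by linarith)]
      intro h0
      linarith [h0.1]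
  rw [tplMass, le_div_iff₀ (integral_rpow_neg_pos hδ h)]
  refine le_trans ?_ (le_integral_succ_rpow (by linarith) hk)
  have hk0 : 0 ≤ (k : ℝ) ^ (-γ) := Real.rpow_nonneg (Nat.cast_nonneg k) _
  have hc : 0 ≤ (γ - 1) * (δ : ℝ) ^ (γ - 1) * 2 ^ (-γ) * (k : ℝ) ^ (-γ) := by
    have : 0 ≤ γ - 1 := by linarith
    positivity
  refine (mul_le_mul_of_nonneg_left hden hc).trans (le_of_eq ?_)
  rw [Real.mul_rpow (by norm_num) (Nat.cast_nonneg k)]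
  have : (δ : ℝ) ^ (γ - 1) * (δ : ℝ) ^ (1 - γ) = 1 := by
    rw [← Real.rpow_add (by linarith)]
    simp
  have h3 : γ - 1 ≠ 0 := by linarith
  field_simp
  linear_combination this

/-- Tails of convergent power sums. -/
theorem sum_Icc_rpow_neg_le {γ : ℝ} (hγ : 1 < γ) {m : ℕ} (hm : 1 ≤ m) (n : ℕ) :
    ∑ k ∈ Finset.Icc m n, (k : ℝ) ^ (-γ) ≤ 2 ^ γ / (γ - 1) * (m : ℝ) ^ (1 - γ) := by
  have h1 : (1 : ℝ) ≤ m := by exact_mod_cast hm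
  have h3 : 0 < γ - 1 := by linarith
  rcases lt_or_ge n m with h | h
  · rw [Finset.Icc_eq_empty (by omega), Finset.sum_empty]
    positivity
  have hs := sum_tplMass γ ⟨hm, h⟩
  rw [← ENNReal.ofReal_sum_of_nonneg fun k _ => tplMass_nonneg γ hm h, ENNReal.ofReal_eq_one] at hs
  have hle : ∑ k ∈ Finset.Icc m n, (γ - 1) * (m : ℝ) ^ (γ - 1) * 2 ^ (-γ) * (k : ℝ) ^ (-γ) ≤ 1 := by
    refine (Finset.sum_le_sum fun k hk => le_tplMass hγ hm h ?_).trans hs.le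
    exact hm.trans (Finset.mem_Icc.1 hk).1
  rw [← Finset.mul_sum] at hle
  have hpos : 0 < (γ - 1) * (m : ℝ) ^ (γ - 1) * 2 ^ (-γ) := by positivity
  rw [mul_comm, ← le_div_iff₀ hpos] at hle
  refine hle.trans (le_of_eq ?_)
  rw [Real.rpow_neg (by norm_num), show 1 - γ = -(γ - 1) by ring, Real.rpow_neg (by linarith)]
  field_simp

/-- Divergent power sums. -/
theorem sum_Icc_rpow_le {a : ℝ} (ha : -1 < a) (n : ℕ) :
    ∑ k ∈ Finset.Icc 1 n, (k : ℝ) ^ a ≤ (1 + 1 / (a + 1)) * (n : ℝ) ^ (a + 1) := by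
  have hb : 0 < a + 1 := by linarith
  rcases le_or_gt 0 a with h | h
  · have : ∑ k ∈ Finset.Icc 1 n, (k : ℝ) ^ a ≤ (n : ℝ) ^ (a + 1) := by
      refine (Finset.sum_le_card_nsmul _ _ ((n : ℝ) ^ a) ?_).trans (le_of_eq ?_)
      · intro k hk
        exact Real.rpow_le_rpow (Nat.cast_nonneg k) (by exact_mod_cast (Finset.mem_Icc.1 hk).2) h
      · rcases Nat.eq_zero_or_pos n with rfl | hn
        · simp [Real.zero_rpow hb.ne']
        · have hn' : (0 : ℝ) < n := by exact_mod_cast hn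
          rw [Nat.card_Icc, Real.rpow_add hn', Real.rpow_one, nsmul_eq_mul]
          simp [mul_comm]
    have h0 : 0 ≤ 1 / (a + 1) * (n : ℝ) ^ (a + 1) := by positivity
    linarith
  · have : ∑ k ∈ Finset.Icc 1 n, (k : ℝ) ^ a ≤ 1 / (a + 1) * (n : ℝ) ^ (a + 1) := by
      induction n with
      | zero => simp [Real.zero_rpow hb.ne']
      | succ n ih =>
        rw [Finset.sum_Icc_succ_top (by omega)]
        have hn : (0 : ℝ) < (n + 1 : ℕ) := by positivity
        have key := rpow_one_add_le_one_add_mul_self (s := -1 / (n + 1 : ℕ)) (p := a + 1)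
          (by
            rw [le_div_iff₀ hn]
            push_cast
            linarith [(Nat.cast_nonneg n : (0 : ℝ) ≤ n)]) hb.le (by linarith)
        have e1 : (1 + -1 / ((n + 1 : ℕ) : ℝ)) * (n + 1 : ℕ) = n := by
          field_simp
          push_cast
          ring
        have h2 : (n : ℝ) ^ (a + 1)
            ≤ ((n + 1 : ℕ) : ℝ) ^ (a + 1) - (a + 1) * ((n + 1 : ℕ) : ℝ) ^ a := by
          have h3 : 0 ≤ 1 + -1 / ((n + 1 : ℕ) : ℝ) := by
            by_contra hneg
            have := mul_neg_of_neg_of_pos (not_le.1 hneg) hn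
            rw [e1] at this
            linarith [(Nat.cast_nonneg n : (0 : ℝ) ≤ n)]
          rw [← e1, Real.mul_rpow h3 hn.le]
          refine (mul_le_mul_of_nonneg_right key (Real.rpow_nonneg hn.le _)).trans (le_of_eq ?_)
          rw [Real.rpow_add hn, Real.rpow_one]
          field_simp
          ring
        have h4 : (a + 1) * (1 / (a + 1)) = 1 := by field_simp
        have h5 : 1 / (a + 1) * (n : ℝ) ^ (a + 1) ≤
          1 / (a + 1) * (((n + 1 : ℕ) : ℝ) ^ (a + 1) - (a + 1) * ((n + 1 : ℕ) : ℝ) ^ a) :=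
          mul_le_mul_of_nonneg_left h2 (by positivity)
        have h6 : 1 / (a + 1) * (((n + 1 : ℕ) : ℝ) ^ (a + 1) - (a + 1) * ((n + 1 : ℕ) : ℝ) ^ a)
          = 1 / (a + 1) * ((n + 1 : ℕ) : ℝ) ^ (a + 1) - ((n + 1 : ℕ) : ℝ) ^ a := by
          linear_combination (-((n + 1 : ℕ) : ℝ) ^ a) * h4
        linarith
    have h0 : 0 ≤ (n : ℝ) ^ (a + 1) := by positivity
    linarith

theorem sum_Icc_rpow_le_one_add {a : ℝ} (ha : a ≠ -1) : ∃ C : ℝ, 0 < C ∧ ∀ n : ℕ,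
    ∑ k ∈ Finset.Icc 1 n, (k : ℝ) ^ a ≤ C * (1 + (n : ℝ) ^ (a + 1)) := by
  rcases lt_or_gt_of_ne ha with h | h
  · refine ⟨2 ^ (-a) / (-a - 1), div_pos (by positivity) (by linarith), fun n => ?_⟩
    have := sum_Icc_rpow_neg_le (γ := -a) (by linarith) le_rfl n
    simp only [neg_neg, Nat.cast_one, Real.one_rpow, mul_one] at this
    refine this.trans (le_mul_of_one_le_right (div_pos (by positivity) (by linarith)).le ?_)
    have : 0 ≤ (n : ℝ) ^ (a + 1) := by positivity
    linarith
  · have h1 : 0 < a + 1 := by linarith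
    refine ⟨1 + 1 / (a + 1), by positivity, fun n => (sum_Icc_rpow_le h n).trans ?_⟩
    exact mul_le_mul_of_nonneg_left (by linarith) (by positivity)

theorem sum_Icc_rpow_neg_one_le (n : ℕ) :
    ∑ k ∈ Finset.Icc 1 n, (k : ℝ) ^ (-1 : ℝ) ≤ 1 + Real.log n := by
  have := harmonic_le_one_add_log n
  rw [harmonic_eq_sum_Icc] at this
  push_cast at this
  simpa [Real.rpow_neg_one] using this

theorem tpl_apply {γ : ℝ} {δ Δ : ℕ} (hδ : 1 ≤ δ) (h : δ ≤ Δ) (k : ℕ) :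
    tpl γ δ Δ k = if k ∈ Finset.Icc δ Δ then ENNReal.ofReal (tplMass γ δ Δ k) else 0 := by
  rw [tpl, dif_pos ⟨hδ, h⟩, PMF.ofFinset_apply]

theorem mem_support_tpl {γ : ℝ} {δ Δ k : ℕ} (hδ : 1 ≤ δ) (h : δ ≤ Δ)
    (hk : k ∈ (tpl γ δ Δ).support) : δ ≤ k ∧ k ≤ Δ := by
  rw [PMF.mem_support_iff, tpl_apply hδ h] at hk
  by_contra hc
  rw [← Finset.mem_Icc] at hc
  simp [hc] at hk

theorem Ex_tpl {γ : ℝ} {δ Δ : ℕ} (hδ : 1 ≤ δ) (h : δ ≤ Δ) (f : ℕ → ℝ≥0∞) :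
    Ex (tpl γ δ Δ) f = ∑ k ∈ Finset.Icc δ Δ, ENNReal.ofReal (tplMass γ δ Δ k) * f k := by
  rw [Ex, tsum_eq_sum (s := Finset.Icc δ Δ)]
  · refine Finset.sum_congr rfl fun k hk => ?_
    rw [tpl_apply hδ h, if_pos hk]
  · intro k hk
    rw [tpl_apply hδ h, if_neg hk, zero_mul]

theorem Ex_tpl_le {γ : ℝ} (hγ : 0 ≤ γ) {δ Δ : ℕ} (hδ : 1 ≤ δ) (h : δ ≤ Δ) (f : ℕ → ℝ≥0∞) :
    Ex (tpl γ δ Δ) f ≤ ENNReal.ofReal ((2 * δ : ℝ) ^ γ) *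
      ∑ k ∈ Finset.Icc δ Δ, ENNReal.ofReal ((k : ℝ) ^ (-γ)) * f k := by
  rw [Ex_tpl hδ h, Finset.mul_sum]
  refine Finset.sum_le_sum fun k hk => ?_
  rw [← mul_assoc, ← ENNReal.ofReal_mul (by positivity)]
  gcongr
  exact tplMass_le hγ hδ h (hδ.trans (Finset.mem_Icc.1 hk).1)

theorem Ex_tpl_ofReal_le {γ : ℝ} (hγ : 0 ≤ γ) {δ Δ : ℕ} (hδ : 1 ≤ δ) (h : δ ≤ Δ) (f : ℕ → ℝ)
    (hf : ∀ k, 0 ≤ f k) : Ex (tpl γ δ Δ) (fun k => ENNReal.ofReal (f k)) ≤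
      ENNReal.ofReal ((2 * δ : ℝ) ^ γ * ∑ k ∈ Finset.Icc 1 Δ, (k : ℝ) ^ (-γ) * f k) := by
  refine (Ex_tpl_le hγ hδ h _).trans ?_
  rw [ENNReal.ofReal_mul (by positivity), ENNReal.ofReal_sum_of_nonneg
    fun k _ => mul_nonneg (by positivity) (hf k)]
  gcongr
  refine (Finset.sum_le_sum_of_subset (Finset.Icc_subset_Icc_left hδ)).trans
    (Finset.sum_le_sum fun k _ => ?_)
  rw [ENNReal.ofReal_mul (by positivity)]

/-- Moments of the truncated power law are power sums. -/
theorem Ex_tpl_rpow_le {γ : ℝ} (hγ : 0 ≤ γ) {δ Δ : ℕ} (hδ : 1 ≤ δ) (h : δ ≤ Δ) (a : ℝ) :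
    Ex (tpl γ δ Δ) (fun k => ENNReal.ofReal ((k : ℝ) ^ a)) ≤
      ENNReal.ofReal ((2 * δ : ℝ) ^ γ * ∑ k ∈ Finset.Icc 1 Δ, (k : ℝ) ^ (a - γ)) := by
  refine (Ex_tpl_ofReal_le hγ hδ h _ fun k => by positivity).trans (le_of_eq ?_)
  congr 2
  refine Finset.sum_congr rfl fun k hk => ?_
  have : (0 : ℝ) < k := by exact_mod_cast (Finset.mem_Icc.1 hk).1
  rw [← Real.rpow_add this]
  ring_nf

theorem Pr_tpl_ge_le {γ : ℝ} (hγ : 1 < γ) {δ Δ m : ℕ} (hδ : 1 ≤ δ) (h : δ ≤ Δ) (hm : 1 ≤ m) :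
    Pr (tpl γ δ Δ) {k | m ≤ k} ≤
      ENNReal.ofReal ((2 * δ : ℝ) ^ γ * (2 ^ γ / (γ - 1)) * (m : ℝ) ^ (1 - γ)) := by
  refine (Ex_tpl_le (by linarith) hδ h _).trans ?_
  rw [mul_assoc, ENNReal.ofReal_mul (by positivity)]
  gcongr
  refine le_trans ?_ (ENNReal.ofReal_le_ofReal (sum_Icc_rpow_neg_le hγ hm Δ))
  rw [ENNReal.ofReal_sum_of_nonneg fun k _ => by positivity]
  simp only [Set.indicator_apply, Set.mem_ofPred_eq, Pi.one_apply, mul_ite, mul_one, mul_zero]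
  rw [← Finset.sum_filter]
  refine Finset.sum_le_sum_of_subset fun k hk => ?_
  simp only [Finset.mem_filter, Finset.mem_Icc] at hk ⊢
  omega

/-- The mass of a dyadic block under the truncated power law. -/
theorem le_Pr_tpl_block {γ : ℝ} (hγ : 1 < γ) {δ Δ Z : ℕ} (hδ : 1 ≤ δ) (hZ : δ ≤ Z)
    (hΔ : 2 * Z ≤ Δ) :
    ENNReal.ofReal ((γ - 1) * 2 ^ (-γ) * 2 ^ (-γ) * (Z : ℝ) ^ (1 - γ)) ≤
      Pr (tpl γ δ Δ) {k | Z ≤ k ∧ k < 2 * Z} := by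
  have hZ0 : (0 : ℝ) < Z := by exact_mod_cast (by omega : 0 < Z)
  have hδ1 : (1 : ℝ) ≤ δ := by exact_mod_cast hδ
  have hg : 0 < γ - 1 := by linarith
  rw [Pr, Ex_tpl hδ (by omega)]
  have hsub : Finset.Ico Z (2 * Z) ⊆ Finset.Icc δ Δ := by
    intro k hk
    simp only [Finset.mem_Ico, Finset.mem_Icc] at hk ⊢
    omega
  refine le_trans ?_ (Finset.sum_le_sum_of_subset hsub)
  have hterm : ∀ k ∈ Finset.Ico Z (2 * Z),
      ENNReal.ofReal ((γ - 1) * 2 ^ (-γ) * 2 ^ (-γ) * (Z : ℝ) ^ (-γ)) ≤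
      ENNReal.ofReal (tplMass γ δ Δ k) * {k | Z ≤ k ∧ k < 2 * Z}.indicator 1 k := by
    intro k hk
    have hk' := Finset.mem_Ico.1 hk
    rw [Set.indicator_of_mem (by simpa using hk')]
    simp only [Pi.one_apply, mul_one]
    refine ENNReal.ofReal_le_ofReal (le_trans ?_ (le_tplMass hγ hδ (by omega) (by omega)))
    have h1 : (1 : ℝ) ≤ (δ : ℝ) ^ (γ - 1) := Real.one_le_rpow hδ1 hg.le
    have h2 : (2 : ℝ) ^ (-γ) * (Z : ℝ) ^ (-γ) ≤ (k : ℝ) ^ (-γ) := by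
      rw [← Real.mul_rpow (by norm_num) hZ0.le]
      refine Real.rpow_le_rpow_of_nonpos ?_ ?_ (by linarith)
      · exact_mod_cast (by omega : 0 < k)
      · exact_mod_cast hk'.2.le
    have h3 : (0 : ℝ) < 2 ^ (-γ) := by positivity
    have h4 : 0 ≤ (k : ℝ) ^ (-γ) := by positivity
    calc (γ - 1) * 2 ^ (-γ) * 2 ^ (-γ) * (Z : ℝ) ^ (-γ)
        = (γ - 1) * 1 * 2 ^ (-γ) * (2 ^ (-γ) * (Z : ℝ) ^ (-γ)) := by ring
      _ ≤ (γ - 1) * (δ : ℝ) ^ (γ - 1) * 2 ^ (-γ) * (k : ℝ) ^ (-γ) := by gcongr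
  refine le_trans (le_of_eq ?_) (Finset.card_nsmul_le_sum _ _ _ hterm)
  rw [Nat.card_Ico, nsmul_eq_mul, ← ENNReal.ofReal_natCast, ← ENNReal.ofReal_mul (by positivity)]
  congr 1
  rw [show 2 * Z - Z = Z by omega, show 1 - γ = 1 + -γ by ring, Real.rpow_add hZ0, Real.rpow_one]
  ring

/-- For an exponent below two, the mean of the truncated power law is of the order of the
`2 - β`-th power of the upper end. -/
theorem le_Ex_tpl_id {β : ℝ} (hβ : 1 < β) {s M : ℕ} (hs : 1 ≤ s) (hM : 2 * s ≤ M) :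
    ENNReal.ofReal ((β - 1) * 2 ^ (-β) / 2 * (M : ℝ) ^ (2 - β)) ≤
      Ex (tpl β s M) (fun k => (k : ℝ≥0∞)) := by
  have hM0 : (0 : ℝ) < M := by exact_mod_cast (by omega : 0 < M)
  have hs1 : (1 : ℝ) ≤ s := by exact_mod_cast hs
  have hg : 0 < β - 1 := by linarith
  rw [Ex_tpl hs (by omega)]
  have hterm : ∀ k ∈ Finset.Icc s M,
      ENNReal.ofReal ((β - 1) * 2 ^ (-β) * (M : ℝ) ^ (1 - β)) ≤
      ENNReal.ofReal (tplMass β s M k) * (k : ℝ≥0∞) := by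
    intro k hk
    have hk' := Finset.mem_Icc.1 hk
    have hk0 : (0 : ℝ) < k := by exact_mod_cast (by omega : 0 < k)
    rw [← ENNReal.ofReal_natCast k, ← ENNReal.ofReal_mul (tplMass_nonneg β hs (by omega))]
    refine ENNReal.ofReal_le_ofReal ?_
    refine le_trans ?_ (mul_le_mul_of_nonneg_right (le_tplMass hβ hs (by omega) (by omega))
      hk0.le)
    have h1 : (1 : ℝ) ≤ (s : ℝ) ^ (β - 1) := Real.one_le_rpow hs1 hg.le
    have h2 : (M : ℝ) ^ (1 - β) ≤ (k : ℝ) ^ (1 - β) :=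
      Real.rpow_le_rpow_of_nonpos hk0 (by exact_mod_cast hk'.2) (by linarith)
    have h3 : (k : ℝ) ^ (1 - β) = (k : ℝ) ^ (-β) * k := by
      rw [show 1 - β = -β + 1 by ring, Real.rpow_add hk0, Real.rpow_one]
    calc (β - 1) * 2 ^ (-β) * (M : ℝ) ^ (1 - β)
        ≤ (β - 1) * 2 ^ (-β) * (k : ℝ) ^ (1 - β) := by gcongr
      _ = (β - 1) * 1 * 2 ^ (-β) * (k : ℝ) ^ (1 - β) := by ring
      _ ≤ (β - 1) * (s : ℝ) ^ (β - 1) * 2 ^ (-β) * (k : ℝ) ^ (1 - β) := by gcongr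
      _ = _ := by rw [h3]; ring
  refine le_trans ?_ (Finset.card_nsmul_le_sum _ _ _ hterm)
  rw [Nat.card_Icc, nsmul_eq_mul, ← ENNReal.ofReal_natCast, ← ENNReal.ofReal_mul (by positivity)]
  refine ENNReal.ofReal_le_ofReal ?_
  have h1 : (M : ℝ) / 2 ≤ ((M + 1 - s : ℕ) : ℝ) := by
    rw [Nat.cast_sub (by omega)]
    push_cast
    have : (2 * s : ℝ) ≤ M := by exact_mod_cast hM
    linarith
  have h2 : (M : ℝ) ^ (2 - β) = M * (M : ℝ) ^ (1 - β) := by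
    rw [show 2 - β = 1 + (1 - β) by ring, Real.rpow_add hM0, Real.rpow_one]
  rw [h2]
  calc (β - 1) * 2 ^ (-β) / 2 * (M * (M : ℝ) ^ (1 - β))
      = (M : ℝ) / 2 * ((β - 1) * 2 ^ (-β) * (M : ℝ) ^ (1 - β)) := by ring
    _ ≤ _ := by gcongr

/-! ### Uniform perfect matchings -/

theorem exists_matching {H : Type*} [Fintype H] (he : Even (Fintype.card H)) :
    ∃ σ : Equiv.Perm H, ∀ h, σ h ≠ h ∧ σ (σ h) = h := by
  obtain ⟨m, hm⟩ := he
  have hc : Fintype.card H = Fintype.card (Fin m × Bool) := by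
    simp [hm]
    omega
  let e := Fintype.equivOfCardEq hc
  let φ : Equiv.Perm (Fin m × Bool) := Equiv.prodCongrRight fun _ => Equiv.boolNot
  refine ⟨(e.trans φ).trans e.symm, fun h => ⟨fun h0 => ?_, ?_⟩⟩
  · have h1 : φ (e h) = e h := by
      simpa [Equiv.symm_apply_eq] using h0
    have h2 := congrArg Prod.snd h1
    simp [φ] at h2
  · simp [φ, Equiv.symm_apply_eq, Prod.ext_iff]

/-- The number of points of `A` whose partner lies in `B`. -/
def crossCount {H : Type*} [DecidableEq H] (σ : Equiv.Perm H) (A B : Finset H) : ℕ :=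
  (A.filter fun h => σ h ∈ B).card

theorem descFactorial_crossCount {H : Type*} [DecidableEq H] (σ : Equiv.Perm H)
    (A B : Finset H) (r : ℕ) :
    (crossCount σ A B).descFactorial r
      = ∑ f : Fin r ↪ A, ∑ g : Fin r ↪ B, if ∀ t, σ (f t) = g t then 1 else 0 := by
  have h1 : ∀ f : Fin r ↪ A, (∑ g : Fin r ↪ B, if ∀ t, σ (f t) = g t then 1 else 0)
      = if ∀ t, σ (f t) ∈ B then 1 else 0 := by
    intro f
    split_ifs with hf
    · let g₀ : Fin r ↪ B := ⟨fun t => ⟨σ (f t), hf t⟩, fun a b hab => by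
        simpa using hab⟩
      rw [Finset.sum_eq_single g₀]
      · exact if_pos fun t => rfl
      · intro g _ hg
        rw [if_neg]
        intro h
        apply hg
        ext t
        exact (h t).symm
      · simp
    · refine Finset.sum_eq_zero fun g _ => if_neg fun h => hf fun t => ?_
      rw [h t]
      exact (g t).2
  simp only [h1]
  rw [Finset.sum_boole, crossCount, Nat.cast_id]
  have hc : ((A.filter fun h => σ h ∈ B).card).descFactorial r
      = Fintype.card (Fin r ↪ {x // x ∈ A.filter fun h => σ h ∈ B}) := by
    rw [Fintype.card_embedding_eq, Fintype.card_coe, Fintype.card_fin]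
  rw [hc, ← Finset.card_univ]
  refine Finset.card_bij
    (fun e _ => ⟨fun t => ⟨(e t).1, (Finset.mem_filter.1 (e t).2).1⟩, fun a b hab => ?_⟩) ?_ ?_ ?_
  · apply e.injective
    simpa [Subtype.ext_iff] using hab
  · intro e _
    simp only [Finset.mem_filter, Finset.mem_univ, true_and]
    intro t
    exact (Finset.mem_filter.1 (e t).2).2
  · intro e _ e' _ hee
    ext t
    have := DFunLike.congr_fun hee t
    exact congrArg (fun x : A => (x : H)) this
  · intro f hf
    simp only [Finset.mem_filter, Finset.mem_univ, true_and] at hf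
    refine ⟨⟨fun t => ⟨(f t).1, Finset.mem_filter.2 ⟨(f t).2, hf t⟩⟩, fun a b hab => ?_⟩,
      Finset.mem_univ _, ?_⟩
    · apply f.injective
      simpa [Subtype.ext_iff] using hab
    · ext t
      rfl

section Matching

variable {H : Type*} [Fintype H] [DecidableEq H] {M : Finset (Equiv.Perm H)}

/-- Relabelling by a transposition preserves the set of perfect matchings. Hence, if an event is
invariant under transpositions outside a set `F` that it forces to be matched within itself, then
the partner of a point outside `F` is uniform among the remaining points. -/
theorem card_matching_step (hM : ∀ σ, σ ∈ M ↔ ∀ h, σ h ≠ h ∧ σ (σ h) = h)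
    (F : Finset H) (Q : Equiv.Perm H → Prop) [DecidablePred Q]
    (hinv : ∀ k k', k ∉ F → k' ∉ F → ∀ σ ∈ M, Q σ →
      Q (Equiv.swap k k' * σ * Equiv.swap k k'))
    (hcl : ∀ σ ∈ M, Q σ → ∀ f ∈ F, σ f ∈ F) {h k : H} (hh : h ∉ F) (hk : k ∉ F) (hhk : h ≠ k) :
    (M.filter fun σ => Q σ ∧ σ h = k).card * (Fintype.card H - F.card - 1)
      = (M.filter Q).card := by
  have hmem : ∀ a b : H, ∀ σ ∈ M, Equiv.swap a b * σ * Equiv.swap a b ∈ M := by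
    intro a b σ hσ
    rw [hM] at hσ ⊢
    intro x
    simp only [Equiv.Perm.mul_apply, Equiv.swap_apply_self]
    refine ⟨fun hx => ?_, by rw [(hσ _).2, Equiv.swap_apply_self]⟩
    apply (hσ (Equiv.swap a b x)).1
    have := congrArg (Equiv.swap a b) hx
    rwa [Equiv.swap_apply_self] at this
  -- conjugation with a transposition maps the matchings with `σ h = a` to those with `σ h = b`
  have hle : ∀ a b : H, a ∉ insert h F → b ∉ insert h F →
      (M.filter fun σ => Q σ ∧ σ h = a).card ≤ (M.filter fun σ => Q σ ∧ σ h = b).card := by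
    intro a b ha hb
    simp only [Finset.mem_insert, not_or] at ha hb
    refine Finset.card_le_card_of_injOn (fun σ => Equiv.swap a b * σ * Equiv.swap a b) ?_ ?_
    · intro σ hσ
      simp only [Finset.coe_filter, Set.mem_ofPred_eq] at hσ ⊢
      refine ⟨hmem a b σ hσ.1, hinv a b ha.2 hb.2 σ hσ.1 hσ.2.1, ?_⟩
      simp only [Equiv.Perm.mul_apply]
      rw [Equiv.swap_apply_of_ne_of_ne (Ne.symm ha.1) (Ne.symm hb.1), hσ.2.2,
        Equiv.swap_apply_left]
    · intro σ _ σ' _ he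
      simpa using he
  have hsum := Finset.card_eq_sum_card_fiberwise (s := M.filter Q) (f := fun σ => σ h)
    (t := Finset.univ \ insert h F) (by
      intro σ hσ
      simp only [Finset.coe_filter, Set.mem_ofPred_eq] at hσ
      have h1 := (hM σ).1 hσ.1 h
      simp only [Finset.coe_sdiff, Finset.coe_univ, Set.mem_sdiff, Set.mem_univ, true_and,
        Finset.mem_coe, Finset.mem_insert, not_or]
      refine ⟨h1.1, fun hF => hh ?_⟩
      rw [← h1.2]
      exact hcl σ hσ.1 hσ.2 _ hF)
  have hk' : k ∉ insert h F := by simp [hk, hhk.symm]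
  rw [hsum, Finset.sum_congr rfl (g := fun _ => (M.filter fun σ => Q σ ∧ σ h = k).card)]
  · rw [Finset.sum_const, smul_eq_mul, mul_comm]
    congr 1
    rw [Finset.card_sdiff_of_subset (Finset.subset_univ _), Finset.card_insert_of_notMem hh,
      Finset.card_univ]
    omega
  · intro b hb
    have hb' : b ∉ insert h F := (Finset.mem_sdiff.1 hb).2
    rw [Finset.filter_filter]
    exact le_antisymm (hle b k hb' hk') (hle k b hk' hb')

/-- The number of perfect matchings that contain `r` given disjoint pairs. -/
theorem card_matching_prescribed (hM : ∀ σ, σ ∈ M ↔ ∀ h, σ h ≠ h ∧ σ (σ h) = h) :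
    ∀ {r : ℕ} (f g : Fin r → H), Function.Injective f → Function.Injective g →
      (∀ t t', f t ≠ g t') →
      (M.filter fun σ => ∀ t, σ (f t) = g t).card *
        ∏ i ∈ Finset.range r, (Fintype.card H - 2 * i - 1) = M.card
  | 0, f, g, _, _, _ => by simp
  | r + 1, f, g, hf, hg, hfg => by
    have ih := card_matching_prescribed hM (fun t : Fin r => f t.castSucc)
      (fun t => g t.castSucc) (fun a b hab => Fin.castSucc_injective r (hf hab))
      (fun a b hab => Fin.castSucc_injective r (hg hab)) (fun t t' => hfg _ _)
    set F : Finset H := (Finset.univ.image fun t : Fin r => f t.castSucc) ∪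
      Finset.univ.image fun t : Fin r => g t.castSucc with hF
    have hFc : F.card = 2 * r := by
      rw [hF, Finset.card_union_of_disjoint]
      · rw [Finset.card_image_of_injective, Finset.card_image_of_injective]
        · simp
          omega
        · exact fun a b hab => Fin.castSucc_injective r (hg hab)
        · exact fun a b hab => Fin.castSucc_injective r (hf hab)
      · rw [Finset.disjoint_left]
        intro x hx hx'
        simp only [Finset.mem_image, Finset.mem_univ, true_and] at hx hx'
        obtain ⟨t, rfl⟩ := hx
        obtain ⟨t', ht'⟩ := hx'
        exact hfg _ _ ht'.symm
    have hFm : ∀ x, x ∈ F ↔ (∃ t : Fin r, f t.castSucc = x) ∨ ∃ t : Fin r, g t.castSucc = x := by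
      intro x
      simp [hF]
    have step := card_matching_step hM F (fun σ => ∀ t : Fin r, σ (f t.castSucc) = g t.castSucc)
      (h := f (Fin.last r)) (k := g (Fin.last r)) ?_ ?_ ?_ ?_ (hfg _ _)
    · rw [hFc] at step
      rw [Finset.prod_range_succ, ← ih, ← step]
      have : (M.filter fun σ => ∀ t, σ (f t) = g t) = M.filter fun σ =>
          (∀ t : Fin r, σ (f t.castSucc) = g t.castSucc) ∧ σ (f (Fin.last r)) = g (Fin.last r) := by
        refine Finset.filter_congr fun σ _ => ?_
        rw [Fin.forall_fin_succ']
      rw [this]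
      ring
    · intro k k' hk hk' σ _ hQ t
      rw [hFm, not_or] at hk hk'
      have e1 : Equiv.swap k k' (f t.castSucc) = f t.castSucc :=
        Equiv.swap_apply_of_ne_of_ne (fun h => hk.1 ⟨t, h⟩) (fun h => hk'.1 ⟨t, h⟩)
      have e2 : Equiv.swap k k' (g t.castSucc) = g t.castSucc :=
        Equiv.swap_apply_of_ne_of_ne (fun h => hk.2 ⟨t, h⟩) (fun h => hk'.2 ⟨t, h⟩)
      rw [Equiv.Perm.mul_apply, Equiv.Perm.mul_apply, e1, hQ, e2]
    · intro σ hσ hQ x hx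
      rw [hFm] at hx ⊢
      rcases hx with ⟨t, rfl⟩ | ⟨t, rfl⟩
      · exact Or.inr ⟨t, (hQ t).symm⟩
      · refine Or.inl ⟨t, ?_⟩
        rw [← hQ t, ((hM σ).1 hσ _).2]
    · rw [hFm]
      rintro (⟨t, ht⟩ | ⟨t, ht⟩)
      · exact (Fin.castSucc_lt_last t).ne (hf ht)
      · exact hfg _ _ ht.symm
    · rw [hFm]
      rintro (⟨t, ht⟩ | ⟨t, ht⟩)
      · exact hfg _ _ ht
      · exact (Fin.castSucc_lt_last t).ne (hg ht)

/-- Factorial moments of the number of pairs of a uniform perfect matching between two disjoint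
sets. -/
theorem Ex_descFactorial_crossCount (hM : ∀ σ, σ ∈ M ↔ ∀ h, σ h ≠ h ∧ σ (σ h) = h)
    (hne : M.Nonempty) {A B : Finset H} (hAB : Disjoint A B) (r : ℕ) :
    Ex (PMF.uniformOfFinset M hne) (fun σ => ((crossCount σ A B).descFactorial r : ℝ≥0∞)) *
      ((∏ i ∈ Finset.range r, (Fintype.card H - 2 * i - 1) : ℕ) : ℝ≥0∞)
      = (A.card.descFactorial r : ℝ≥0∞) * B.card.descFactorial r := by
  have hM0 : (M.card : ℝ≥0∞) ≠ 0 := by exact_mod_cast hne.card_ne_zero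
  rw [Ex_uniformOfFinset, div_eq_mul_inv, mul_right_comm, ← div_eq_mul_inv]
  symm
  rw [ENNReal.eq_div_iff hM0 (by simp)]
  symm
  have : (∑ σ ∈ M, (crossCount σ A B).descFactorial r) *
      ∏ i ∈ Finset.range r, (Fintype.card H - 2 * i - 1)
      = M.card * (A.card.descFactorial r * B.card.descFactorial r) := by
    simp only [descFactorial_crossCount]
    rw [Finset.sum_comm, Finset.sum_mul]
    have hcard : ∀ S : Finset H, Fintype.card (Fin r ↪ S) = S.card.descFactorial r := by
      intro S
      rw [Fintype.card_embedding_eq, Fintype.card_coe, Fintype.card_fin]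
    rw [Finset.sum_congr rfl (g := fun _ => B.card.descFactorial r * M.card)]
    · rw [Finset.sum_const, Finset.card_univ, hcard, smul_eq_mul]
      ring
    · intro f _
      rw [Finset.sum_comm, Finset.sum_mul, Finset.sum_congr rfl (g := fun _ => M.card)]
      · rw [Finset.sum_const, Finset.card_univ, hcard, smul_eq_mul]
      · intro g _
        rw [Finset.sum_boole, Nat.cast_id]
        refine card_matching_prescribed hM (fun t => (f t).1) (fun t => (g t).1) ?_ ?_ ?_
        · exact fun a b hab => f.injective (Subtype.ext hab)
        · exact fun a b hab => g.injective (Subtype.ext hab)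
        · intro t t' h
          exact (Finset.disjoint_left.1 hAB (f t).2) (h ▸ (g t').2)
  exact_mod_cast this

/-- The probability that two given points are matched. -/
theorem Ex_matched (hM : ∀ σ, σ ∈ M ↔ ∀ h, σ h ≠ h ∧ σ (σ h) = h)
    (hne : M.Nonempty) {h k : H} (hhk : h ≠ k) :
    Ex (PMF.uniformOfFinset M hne) (fun σ => if σ h = k then 1 else 0) *
      ((Fintype.card H - 1 : ℕ) : ℝ≥0∞) = 1 := by
  have := Ex_descFactorial_crossCount hM hne (A := {h}) (B := {k}) (by simpa using hhk) 1
  simpa [crossCount, Finset.filter_singleton, apply_ite Finset.card] using this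

end Matching

/-! ### The configuration model -/

section Config

variable {n : ℕ} {d : Fin n → ℕ}

theorem mem_matchings (σ : Equiv.Perm (HalfEdge d)) :
    σ ∈ matchings d ↔ ∀ h, σ h ≠ h ∧ σ (σ h) = h := by
  classical
  simp [matchings]

theorem card_halfEdge (d : Fin n → ℕ) : Fintype.card (HalfEdge d) = ∑ i, d i := by
  simp [HalfEdge]

/-- The half-edges at a node. -/
def halfEdgesAt (d : Fin n → ℕ) (i : Fin n) : Finset (HalfEdge d) :=
  Finset.univ.filter fun h => h.1 = i

theorem card_halfEdgesAt (d : Fin n → ℕ) (i : Fin n) : (halfEdgesAt d i).card = d i := by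
  have : halfEdgesAt d i =
      Finset.univ.map (Function.Embedding.sigmaMk (β := fun i => Fin (d i)) i) := by
    ext ⟨j, a⟩
    simp only [halfEdgesAt, Finset.mem_filter, Finset.mem_univ, true_and, Finset.mem_map,
      Function.Embedding.sigmaMk_apply]
    constructor
    · rintro rfl
      exact ⟨a, rfl⟩
    · rintro ⟨b, hb⟩
      exact (congrArg Sigma.fst hb).symm
  rw [this]
  simp

open Classical in
/-- The number of parallel edges in the place of `e`. -/
noncomputable def mult {V : Type} (g : Multigraph V) (e : Sym2 V) : ℕ := g.count e

theorem mult_edgesOf {σ : Equiv.Perm (HalfEdge d)} (hσ : σ ∈ matchings d) {i k : Fin n}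
    (hik : i ≠ k) : mult (edgesOf σ) s(i, k)
      = crossCount σ (halfEdgesAt d i) (halfEdgesAt d k) := by
  classical
  rw [mem_matchings] at hσ
  rw [mult, edgesOf, Multiset.count_map, ← Finset.filter_val, Finset.card_val, crossCount]
  symm
  refine Finset.card_bij (fun h _ => s(h, σ h)) ?_ ?_ ?_
  · intro h hh
    simp only [halfEdgesAt, Finset.mem_filter, Finset.mem_univ, true_and] at hh
    simp only [Finset.mem_filter, Finset.mem_image, Finset.mem_univ, true_and]
    exact ⟨⟨h, rfl⟩, by rw [Sym2.map_mk, hh.1, hh.2]⟩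
  · intro h hh h' hh' he
    simp only [halfEdgesAt, Finset.mem_filter, Finset.mem_univ, true_and] at hh hh'
    rw [Sym2.eq_iff] at he
    rcases he with he | he
    · exact he.1
    · exfalso
      apply hik
      rw [← hh.1, he.1, hh'.2]
  · intro e he
    simp only [Finset.mem_filter, Finset.mem_image, Finset.mem_univ, true_and] at he
    obtain ⟨⟨h, rfl⟩, he⟩ := he
    rw [Sym2.map_mk, Sym2.eq_iff] at he
    simp only [halfEdgesAt, Finset.mem_filter, Finset.mem_univ, true_and]
    rcases he with he | he
    · exact ⟨h, ⟨he.1.symm, he.2.symm⟩, rfl⟩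
    · refine ⟨σ h, ⟨he.1.symm, ?_⟩, ?_⟩
      · rw [(hσ h).2]
        exact he.2.symm
      · rw [(hσ h).2]
        exact Sym2.eq_swap

open Classical in
theorem loops_edgesOf_le (σ : Equiv.Perm (HalfEdge d)) :
    loops (edgesOf σ) ≤ (Finset.univ.filter fun h : HalfEdge d => (σ h).1 = h.1).card := by
  rw [loops, edgesOf, Multiset.filter_map, Multiset.card_map, ← Finset.filter_val, Finset.card_val]
  refine le_trans (Finset.card_le_card ?_) (Finset.card_image_le (f := fun h => s(h, σ h)))
  intro e he
  simp only [Finset.mem_filter, Finset.mem_image, Finset.mem_univ, true_and,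
    Function.comp_apply] at he ⊢
  obtain ⟨⟨h, rfl⟩, he⟩ := he
  refine ⟨h, ?_, rfl⟩
  rw [Sym2.map_mk, Sym2.mk_isDiag_iff] at he
  exact he.symm

theorem one_le_loops_edgesOf {σ : Equiv.Perm (HalfEdge d)} {h h' : HalfEdge d} (hσ : σ h = h')
    (hh : h.1 = h'.1) : 1 ≤ loops (edgesOf σ) := by
  classical
  rw [loops, Nat.one_le_iff_ne_zero, ← Nat.pos_iff_ne_zero, Multiset.card_pos_iff_exists_mem]
  refine ⟨Sym2.map Sigma.fst s(h, σ h), ?_⟩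
  simp only [Multiset.mem_filter]
  constructor
  · refine Multiset.mem_map_of_mem _ ?_
    rw [Finset.mem_val, Finset.mem_image]
    exact ⟨h, Finset.mem_univ _, rfl⟩
  · rw [Sym2.map_mk, Sym2.mk_isDiag_iff, hσ, hh]

theorem configModel_of_nonempty (h : (matchings d).Nonempty) :
    configModel d = (PMF.uniformOfFinset _ h).map edgesOf := by
  rw [configModel, dif_pos h]

theorem configModel_of_not_nonempty (h : ¬ (matchings d).Nonempty) :
    configModel d = PMF.pure 0 := by
  rw [configModel, dif_neg h]

theorem matchings_nonempty (he : Even (∑ i, d i)) : (matchings d).Nonempty := by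
  obtain ⟨σ, hσ⟩ := exists_matching (H := HalfEdge d) (by rwa [card_halfEdge])
  exact ⟨σ, (mem_matchings σ).2 hσ⟩

theorem even_of_matchings_nonempty (h : (matchings d).Nonempty) : Even (∑ i, d i) := by
  classical
  obtain ⟨σ, hσ⟩ := h
  rw [mem_matchings] at hσ
  rw [← card_halfEdge, ← Finset.card_univ]
  by_contra hodd
  obtain ⟨x, hx⟩ := Equiv.Perm.exists_fixed_point_of_prime (p := 2) (n := 1) (σ := σ)
    (by
      intro hd
      rw [Finset.card_univ] at hodd
      exact hodd (even_iff_two_dvd.2 hd))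
    (by
      refine Equiv.ext fun x => ?_
      rw [pow_one, pow_two, Equiv.Perm.mul_apply, (hσ x).2, Equiv.Perm.one_apply])
  exact (hσ x).1 hx

end Config

section Config

variable {n : ℕ} {d : Fin n → ℕ}

/-- To bound the expectation of a statistic of the configuration model that vanishes on the empty
graph, it may be assumed that a perfect matching exists. -/
theorem Ex_configModel_le {F : Multigraph (Fin n) → ℝ≥0∞} {a : ℝ≥0∞} (h0 : F 0 = 0)
    (h : ∀ hne : (matchings d).Nonempty,
      Ex (PMF.uniformOfFinset _ hne) (fun σ => F (edgesOf σ)) ≤ a) :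
    Ex (configModel d) F ≤ a := by
  by_cases hne : (matchings d).Nonempty
  · rw [configModel_of_nonempty hne, Ex_map]
    exact h hne
  · rw [configModel_of_not_nonempty hne, Ex_pure, h0]
    exact zero_le

theorem le_div_succ_of_mul_pred_le {T : ℕ} (hT : 2 ≤ T) {e a : ℝ≥0∞}
    (h : e * ((T - 1 : ℕ) : ℝ≥0∞) ≤ a) : e ≤ 3 * a / (T + 1) := by
  rw [ENNReal.le_div_iff_mul_le (by simp) (by simp)]
  have : ((T + 1 : ℕ) : ℝ≥0∞) ≤ 3 * ((T - 1 : ℕ) : ℝ≥0∞) := by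
    exact_mod_cast (by omega : T + 1 ≤ 3 * (T - 1))
  calc e * ((T : ℝ≥0∞) + 1) = e * ((T + 1 : ℕ) : ℝ≥0∞) := by push_cast; rfl
    _ ≤ e * (3 * ((T - 1 : ℕ) : ℝ≥0∞)) := by gcongr
    _ = 3 * (e * ((T - 1 : ℕ) : ℝ≥0∞)) := by ring
    _ ≤ 3 * a := by gcongr

/-- Two given half-edges are matched with probability `1 / (T - 1)`, where `T` is their total
number. The bound is stated with `T + 1`, so that it also makes sense for an empty graph. -/
theorem Ex_loops_le (d : Fin n → ℕ) : Ex (configModel d) (fun g => (loops g : ℝ≥0∞)) ≤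
    ∑ i, 3 * (d i : ℝ≥0∞) ^ 2 / ((∑ i, d i : ℕ) + 1) := by
  classical
  refine Ex_configModel_le (by simp [loops]) fun hne => ?_
  have hev := even_of_matchings_nonempty hne
  have hle : ∀ σ : Equiv.Perm (HalfEdge d), σ ∈ matchings d → (loops (edgesOf σ) : ℝ≥0∞) ≤
      ∑ i, ∑ h ∈ halfEdgesAt d i, ∑ k ∈ (halfEdgesAt d i).erase h, if σ h = k then 1 else 0 := by
    intro σ hσ
    refine le_trans (Nat.cast_le.2 (loops_edgesOf_le σ)) ?_
    rw [Finset.card_filter]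
    push_cast
    rw [← Finset.sum_fiberwise (s := Finset.univ) (g := fun h : HalfEdge d => h.1)]
    refine Finset.sum_le_sum fun i _ => ?_
    refine Finset.sum_le_sum fun h hh => ?_
    split_ifs with hs
    · rw [Finset.sum_eq_single (σ h)]
      · simp
      · intro b _ hb
        simp [Ne.symm hb]
      · intro hn
        exfalso
        apply hn
        simp only [Finset.mem_filter, Finset.mem_univ, true_and] at hh
        simp [halfEdgesAt, hs, hh, ((mem_matchings σ).1 hσ h).1]
    · exact zero_le
  refine (Ex_mono_support fun σ hσ => hle σ ?_).trans ?_
  · rwa [PMF.mem_support_uniformOfFinset_iff] at hσ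
  simp only [Ex_sum]
  refine Finset.sum_le_sum fun i _ => ?_
  rcases Nat.lt_or_ge (∑ i, d i) 2 with hT | hT
  · have hz : ∑ i, d i = 0 := by
      obtain ⟨m, hm⟩ := hev
      omega
    have : halfEdgesAt d i = ∅ := by
      rw [← Finset.card_eq_zero, card_halfEdgesAt]
      exact Finset.sum_eq_zero_iff.1 hz i (Finset.mem_univ i)
    simp [this]
  · refine le_div_succ_of_mul_pred_le hT ?_
    rw [Finset.sum_mul]
    have : ∀ h ∈ halfEdgesAt d i, (∑ k ∈ (halfEdgesAt d i).erase h,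
        Ex (PMF.uniformOfFinset _ hne) (fun σ => if σ h = k then 1 else 0)) *
        (((∑ i, d i) - 1 : ℕ) : ℝ≥0∞) ≤ d i := by
      intro h _
      rw [Finset.sum_mul, Finset.sum_congr rfl (g := fun _ => 1)]
      · rw [Finset.sum_const, nsmul_eq_mul, mul_one]
        refine Nat.cast_le.2 ((Finset.card_le_card (Finset.erase_subset _ _)).trans ?_)
        rw [card_halfEdgesAt]
      · intro k hk
        rw [← card_halfEdge d]
        exact Ex_matched mem_matchings hne (Finset.ne_of_mem_erase hk).symm
    refine (Finset.sum_le_card_nsmul _ _ _ this).trans ?_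
    rw [card_halfEdgesAt, nsmul_eq_mul, pow_two]

theorem Ex_mult_le (d : Fin n → ℕ) {i k : Fin n} (hik : i ≠ k) :
    Ex (configModel d) (fun g => (mult g s(i, k) : ℝ≥0∞)) ≤
      3 * ((d i : ℝ≥0∞) * d k) / ((∑ i, d i : ℕ) + 1) := by
  refine Ex_configModel_le (by simp [mult]) fun hne => ?_
  have hdis : Disjoint (halfEdgesAt d i) (halfEdgesAt d k) := by
    rw [Finset.disjoint_left]
    intro h h1 h2
    simp only [halfEdgesAt, Finset.mem_filter, Finset.mem_univ, true_and] at h1 h2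
    exact hik (h1.symm.trans h2)
  rw [Ex_congr_support (g := fun σ => ((crossCount σ (halfEdgesAt d i)
    (halfEdgesAt d k)).descFactorial 1 : ℝ≥0∞))]
  swap
  · intro σ hσ
    rw [PMF.mem_support_uniformOfFinset_iff] at hσ
    rw [mult_edgesOf hσ hik, Nat.descFactorial_one]
  have key := Ex_descFactorial_crossCount mem_matchings hne hdis 1
  rw [card_halfEdgesAt, card_halfEdgesAt, card_halfEdge, Finset.prod_range_one] at key
  rcases Nat.lt_or_ge (∑ i, d i) 2 with hT | hT
  · have hz : ∑ i, d i = 0 := by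
      obtain ⟨m, hm⟩ := even_of_matchings_nonempty hne
      omega
    have : halfEdgesAt d i = ∅ := by
      rw [← Finset.card_eq_zero, card_halfEdgesAt]
      exact Finset.sum_eq_zero_iff.1 hz i (Finset.mem_univ i)
    simp [this, crossCount]
  · refine le_div_succ_of_mul_pred_le hT ?_
    simpa using key.le

/-- The factorial moment counts the ordered pairs of parallel edges; it dominates the indicator of a
multi-edge as well as the number of unordered pairs of parallel edges. -/
theorem Ex_mult_descFactorial_two_le (d : Fin n → ℕ) {i k : Fin n} (hik : i ≠ k) :
    Ex (configModel d) (fun g => ((mult g s(i, k)).descFactorial 2 : ℝ≥0∞)) ≤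
      9 * ((d i : ℝ≥0∞) * d k) ^ 2 / ((∑ i, d i : ℕ) + 1) ^ 2 := by
  refine Ex_configModel_le (by simp [mult]) fun hne => ?_
  have hdis : Disjoint (halfEdgesAt d i) (halfEdgesAt d k) := by
    rw [Finset.disjoint_left]
    intro h h1 h2
    simp only [halfEdgesAt, Finset.mem_filter, Finset.mem_univ, true_and] at h1 h2
    exact hik (h1.symm.trans h2)
  rw [Ex_congr_support (g := fun σ => ((crossCount σ (halfEdgesAt d i)
    (halfEdgesAt d k)).descFactorial 2 : ℝ≥0∞))]
  swap
  · intro σ hσ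
    rw [PMF.mem_support_uniformOfFinset_iff] at hσ
    rw [mult_edgesOf hσ hik]
  have key := Ex_descFactorial_crossCount mem_matchings hne hdis 2
  rw [card_halfEdgesAt, card_halfEdgesAt, card_halfEdge, Finset.prod_range_succ,
    Finset.prod_range_one, mul_zero, Nat.sub_zero] at key
  set T := ∑ i, d i with hT
  set E := Ex (PMF.uniformOfFinset _ hne) (fun σ => ((crossCount σ (halfEdgesAt d i)
    (halfEdgesAt d k)).descFactorial 2 : ℝ≥0∞)) with hE
  rcases Nat.lt_or_ge T 4 with h4 | h4
  · -- with fewer than four half-edges there is no double edge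
    have hdd : d i + d k ≤ T := by
      rw [hT, ← Finset.sum_pair hik]
      exact Finset.sum_le_sum_of_subset (Finset.subset_univ _)
    have hle : E = 0 := by
      rw [hE, ← Ex_zero (PMF.uniformOfFinset _ hne)]
      refine Ex_congr_support fun σ _ => ?_
      rw [Nat.cast_eq_zero, Nat.descFactorial_eq_zero_iff_lt]
      have h1 : crossCount σ (halfEdgesAt d i) (halfEdgesAt d k) ≤ d i := by
        rw [← card_halfEdgesAt d i]
        exact Finset.card_filter_le _ _
      have h2 : crossCount σ (halfEdgesAt d i) (halfEdgesAt d k) ≤ d k := by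
        rw [← card_halfEdgesAt d k]
        refine Finset.card_le_card_of_injOn σ ?_ σ.injective.injOn
        intro x hx
        exact (Finset.mem_filter.1 hx).2
      omega
    rw [hle]
    exact zero_le
  · rw [ENNReal.le_div_iff_mul_le (by simp) (by simp)]
    have h1 : (((T + 1) ^ 2 : ℕ) : ℝ≥0∞) ≤ 9 * (((T - 1) * (T - 2 * 1 - 1) : ℕ) : ℝ≥0∞) := by
      have : (T + 1) ^ 2 ≤ 9 * ((T - 1) * (T - 2 * 1 - 1)) := by
        obtain ⟨m, hm⟩ := Nat.exists_eq_add_of_le h4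
        rw [hm]
        have e1 : 4 + m - 1 = m + 3 := by omega
        have e2 : 4 + m - 2 * 1 - 1 = m + 1 := by omega
        rw [e1, e2]
        nlinarith
      exact_mod_cast this
    have h2 : ((d i).descFactorial 2 : ℝ≥0∞) * (d k).descFactorial 2
        ≤ ((d i : ℝ≥0∞) * d k) ^ 2 := by
      rw [mul_pow]
      gcongr
      · exact_mod_cast Nat.descFactorial_le_pow _ _
      · exact_mod_cast Nat.descFactorial_le_pow _ _
    calc E * ((T : ℝ≥0∞) + 1) ^ 2 = E * (((T + 1) ^ 2 : ℕ) : ℝ≥0∞) := by push_cast; rfl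
      _ ≤ E * (9 * (((T - 1) * (T - 2 * 1 - 1) : ℕ) : ℝ≥0∞)) := by gcongr
      _ = 9 * (E * (((T - 1) * (T - 2 * 1 - 1) : ℕ) : ℝ≥0∞)) := by ring
      _ ≤ 9 * ((d i : ℝ≥0∞) * d k) ^ 2 := by
        rw [key]
        gcongr

theorem le_Ex_loops (he : Even (∑ i, d i)) {i : Fin n} (hi : 2 ≤ d i) :
    1 / ((∑ i, d i : ℕ) : ℝ≥0∞) ≤ Ex (configModel d) (fun g => (loops g : ℝ≥0∞)) := by
  classical
  have hne := matchings_nonempty he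
  rw [configModel_of_nonempty hne, Ex_map]
  let h : HalfEdge d := ⟨i, ⟨0, by omega⟩⟩
  let k : HalfEdge d := ⟨i, ⟨1, by omega⟩⟩
  have hhk : h ≠ k := by
    simp [h, k]
  have key := Ex_matched mem_matchings hne hhk
  rw [card_halfEdge] at key
  have hle : Ex (PMF.uniformOfFinset _ hne) (fun σ => if σ h = k then 1 else 0) ≤
      Ex (PMF.uniformOfFinset _ hne) (fun σ => (loops (edgesOf σ) : ℝ≥0∞)) := by
    refine Ex_mono fun σ => ?_
    split_ifs with hσ
    · exact_mod_cast one_le_loops_edgesOf hσ rfl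
    · exact zero_le
  refine le_trans ?_ hle
  refine ENNReal.div_le_of_le_mul ?_
  refine key.symm.le.trans ?_
  gcongr
  exact Nat.sub_le _ _

/-- Two nodes whose degrees are at least of the order of the square root of the number of
half-edges are joined by a multi-edge with probability bounded away from zero. This is Bonferroni's
inequality for the double edges between `a` half-edges at each of the nodes, where `a` is at most
the square root of the number of half-edges. -/
theorem le_Ex_two_le_mult (he : Even (∑ i, d i)) {i k : Fin n} (hik : i ≠ k) {y : ℕ}
    (hy : 5 ≤ y) (hi : y ≤ d i) (hk : y ≤ d k) {C : ℝ} (hC : 1 ≤ C)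
    (hT : ((∑ i, d i : ℕ) : ℝ) ≤ C * (y : ℝ) ^ 2) :
    ENNReal.ofReal (1 / (50 * C ^ 2)) ≤
      Ex (configModel d) (fun g => if 2 ≤ mult g s(i, k) then 1 else 0) := by
  have hne := matchings_nonempty he
  rw [configModel_of_nonempty hne, Ex_map]
  set T := ∑ i, d i with hTdef
  -- with at most `√T` half-edges on both sides the third factorial moment does not exceed the
  -- second
  set a := min y (Nat.sqrt T) with ha
  have hTy : 2 * y ≤ T := by
    have : d i + d k ≤ T := by
      rw [hTdef, ← Finset.sum_pair hik]
      exact Finset.sum_le_sum_of_subset (Finset.subset_univ _)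
    omega
  have ha3 : 3 ≤ a := by
    refine le_min (by omega) ?_
    rw [Nat.le_sqrt]
    omega
  have haT : a * a ≤ T := (Nat.mul_le_mul (min_le_right _ _) (min_le_right _ _)).trans
    (Nat.sqrt_le T)
  obtain ⟨A, hAs, hAc⟩ := Finset.exists_subset_card_eq (s := halfEdgesAt d i) (n := a) (by
    rw [card_halfEdgesAt]
    exact (min_le_left _ _).trans hi)
  obtain ⟨B, hBs, hBc⟩ := Finset.exists_subset_card_eq (s := halfEdgesAt d k) (n := a) (by
    rw [card_halfEdgesAt]
    exact (min_le_left _ _).trans hk)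
  have hdis : Disjoint A B := by
    rw [Finset.disjoint_left]
    intro h h1 h2
    have h1 := hAs h1
    have h2 := hBs h2
    simp only [halfEdgesAt, Finset.mem_filter, Finset.mem_univ, true_and] at h1 h2
    exact hik (h1.symm.trans h2)
  set μ := PMF.uniformOfFinset _ hne
  have k2 := Ex_descFactorial_crossCount mem_matchings hne hdis 2
  have k3 := Ex_descFactorial_crossCount mem_matchings hne hdis 3
  rw [hAc, hBc, card_halfEdge, ← hTdef] at k2 k3
  set E2 := Ex μ fun σ => ((crossCount σ A B).descFactorial 2 : ℝ≥0∞) with hE2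
  set E3 := Ex μ fun σ => ((crossCount σ A B).descFactorial 3 : ℝ≥0∞) with hE3
  set p := Ex μ fun σ => if 2 ≤ mult (edgesOf σ) s(i, k) then (1 : ℝ≥0∞) else 0 with hp
  -- Bonferroni: the indicator of `2 ≤ N` is at least `N.choose 2 - 2 * N.choose 3`
  have hbon : 3 * E2 ≤ 6 * p + 2 * E3 := by
    rw [hE2, hE3, hp, ← Ex_const_mul, ← Ex_const_mul, ← Ex_const_mul, ← Ex_add]
    refine Ex_mono_support fun σ hσ => ?_
    rw [PMF.mem_support_uniformOfFinset_iff] at hσ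
    rw [mult_edgesOf hσ hik]
    have hmono : crossCount σ A B ≤ crossCount σ (halfEdgesAt d i) (halfEdgesAt d k) := by
      refine Finset.card_le_card fun x hx => ?_
      rw [Finset.mem_filter] at hx ⊢
      exact ⟨hAs hx.1, hBs hx.2⟩
    generalize crossCount σ A B = N at *
    generalize crossCount σ (halfEdgesAt d i) (halfEdgesAt d k) = N' at *
    have : 3 * N.descFactorial 2 ≤ 6 * (if 2 ≤ N' then 1 else 0) + 2 * N.descFactorial 3 := by
      rcases Nat.lt_or_ge N 2 with h | h
      · rw [Nat.descFactorial_eq_zero_iff_lt.2 h]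
        omega
      · rw [if_pos (h.trans hmono)]
        obtain ⟨m, rfl⟩ := Nat.exists_eq_add_of_le h
        simp only [Nat.descFactorial_succ, Nat.descFactorial_zero]
        have e1 : 2 + m - 1 = m + 1 := by omega
        have e2 : 2 + m - 2 = m := by omega
        rw [e1, e2]
        rcases Nat.lt_or_ge m 2 with hm | hm
        · interval_cases m <;> norm_num
        · have : 3 * ((m + 1) * ((2 + m - 0) * 1)) ≤ 2 * (m * ((m + 1) * ((2 + m - 0) * 1))) := by
            have : 3 ≤ 2 * m := by omega
            calc 3 * ((m + 1) * ((2 + m - 0) * 1)) ≤ (2 * m) * ((m + 1) * ((2 + m - 0) * 1)) :=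
                  Nat.mul_le_mul_right _ this
              _ = _ := by ring
          omega
    exact_mod_cast this
  have hpr2 : ∏ i ∈ Finset.range 2, (T - 2 * i - 1) = (T - 1) * (T - 3) := by
    simp [Finset.prod_range_succ, Nat.sub_sub]
  have hpr3 : ∏ i ∈ Finset.range 3, (T - 2 * i - 1) = (T - 1) * (T - 3) * (T - 5) := by
    simp [Finset.prod_range_succ, Nat.sub_sub]
  rw [hpr2] at k2
  rw [hpr3] at k3
  have hE2t : E2 ≠ ∞ := by
    intro htop
    rw [htop, ENNReal.top_mul] at k2
    · exact (ENNReal.mul_ne_top (ENNReal.natCast_ne_top _) (ENNReal.natCast_ne_top _)) k2.symm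
    · simp only [Ne, Nat.cast_eq_zero, mul_eq_zero, not_or]
      omega
  have hE32 : E3 ≤ E2 := by
    have h5 : (a - 2) * (a - 2) ≤ T - 5 := by
      obtain ⟨m, hm⟩ := Nat.exists_eq_add_of_le ha3
      rw [hm] at haT ⊢
      have e1 : 3 + m - 2 = m + 1 := by omega
      rw [e1]
      have : (m + 1) * (m + 1) + 5 ≤ (3 + m) * (3 + m) := by nlinarith
      omega
    have hx : E3 * (((T - 1) * (T - 3) * (T - 5) : ℕ) : ℝ≥0∞)
        ≤ E2 * (((T - 1) * (T - 3) * (T - 5) : ℕ) : ℝ≥0∞) := by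
      rw [k3, Nat.cast_mul _ (T - 5), ← mul_assoc, k2]
      have : a.descFactorial 3 * a.descFactorial 3
          ≤ a.descFactorial 2 * a.descFactorial 2 * (T - 5) := by
        rw [Nat.descFactorial_succ a 2]
        calc (a - 2) * a.descFactorial 2 * ((a - 2) * a.descFactorial 2)
            = a.descFactorial 2 * a.descFactorial 2 * ((a - 2) * (a - 2)) := by ring
          _ ≤ _ := Nat.mul_le_mul_left _ h5
      exact_mod_cast this
    refine (ENNReal.mul_le_mul_iff_left ?_ (ENNReal.natCast_ne_top _)).1 hx
    simp only [Ne, Nat.cast_eq_zero, mul_eq_zero, not_or]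
    omega
  have hE2p : E2 ≤ 6 * p := by
    have h1 : E2 + 2 * E2 ≤ 6 * p + 2 * E2 := by
      calc E2 + 2 * E2 = 3 * E2 := by ring
        _ ≤ 6 * p + 2 * E3 := hbon
        _ ≤ 6 * p + 2 * E2 := by gcongr
    exact (ENNReal.add_le_add_iff_right (ENNReal.mul_ne_top (by simp) hE2t)).1 h1
  -- both choices of `a` make `a ^ 2` at least of the order of `T`
  have hreal : 1 / (50 * C ^ 2) * 6 * ((T : ℝ) ^ 2) ≤ ((a * (a - 1) : ℕ) : ℝ) ^ 2 := by
    have ha3' : (3 : ℝ) ≤ a := by exact_mod_cast ha3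
    have hT0 : (0 : ℝ) ≤ T := Nat.cast_nonneg T
    have hx : (0 : ℝ) ≤ (a : ℝ) * (a - 1) := by nlinarith
    have hb : (T : ℝ) ≤ 5 / 2 * (C * ((a : ℝ) * (a - 1))) := by
      rcases min_choice y (Nat.sqrt T) with h | h
      · have hay : (a : ℝ) = y := by rw [ha, h]
        rw [← hay] at hT
        have : (a : ℝ) ^ 2 ≤ 5 / 2 * ((a : ℝ) * (a - 1)) := by nlinarith
        calc (T : ℝ) ≤ C * (a : ℝ) ^ 2 := hT
          _ ≤ C * (5 / 2 * ((a : ℝ) * (a - 1))) := by gcongr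
          _ = _ := by ring
      · have hlt := Nat.lt_succ_sqrt T
        rw [← h, ← ha] at hlt
        have h1 : T + 1 ≤ (a + 1) * (a + 1) := hlt
        have h2 : (T : ℝ) + 1 ≤ (a + 1) * (a + 1) := by exact_mod_cast h1
        have h4 : (T : ℝ) ≤ 5 / 2 * ((a : ℝ) * (a - 1)) := by nlinarith
        have h5 : (a : ℝ) * (a - 1) ≤ C * ((a : ℝ) * (a - 1)) := le_mul_of_one_le_left hx hC
        linarith
    have hcast : ((a * (a - 1) : ℕ) : ℝ) = (a : ℝ) * (a - 1) := by
      rw [Nat.cast_mul, Nat.cast_sub (by omega), Nat.cast_one]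
    rw [hcast]
    have hsq : (T : ℝ) ^ 2 ≤ (5 / 2 * (C * ((a : ℝ) * (a - 1)))) ^ 2 := by gcongr
    have hC2 : 0 < C ^ 2 := by positivity
    calc 1 / (50 * C ^ 2) * 6 * (T : ℝ) ^ 2
        ≤ 1 / (50 * C ^ 2) * 6 * (5 / 2 * (C * ((a : ℝ) * (a - 1)))) ^ 2 := by gcongr
      _ = 3 / 4 * ((a : ℝ) * (a - 1)) ^ 2 := by
        field_simp
        ring
      _ ≤ ((a : ℝ) * (a - 1)) ^ 2 := by nlinarith [sq_nonneg ((a : ℝ) * (a - 1))]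
  have hd2 : a.descFactorial 2 = a * (a - 1) := by
    simp [Nat.descFactorial_succ, mul_comm]
  rw [hd2] at k2
  have hTpos : 0 < T := by omega
  -- the bound for `E2` in extended nonnegative reals
  have hlow : ((a * (a - 1) : ℕ) : ℝ≥0∞) * ((a * (a - 1) : ℕ) : ℝ≥0∞) ≤ E2 * ((T : ℝ≥0∞) ^ 2) := by
    rw [← k2]
    gcongr
    rw [pow_two]
    exact_mod_cast Nat.mul_le_mul (Nat.sub_le _ _) (Nat.sub_le _ _)
  have hfin : ENNReal.ofReal (1 / (50 * C ^ 2)) * 6 * (T : ℝ≥0∞) ^ 2 ≤ p * 6 * (T : ℝ≥0∞) ^ 2 := by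
    calc ENNReal.ofReal (1 / (50 * C ^ 2)) * 6 * (T : ℝ≥0∞) ^ 2
        = ENNReal.ofReal (1 / (50 * C ^ 2) * 6 * (T : ℝ) ^ 2) := by
          rw [ENNReal.ofReal_mul (by positivity), ENNReal.ofReal_mul (by positivity),
            ENNReal.ofReal_pow (by positivity), ENNReal.ofReal_natCast]
          norm_num
      _ ≤ ENNReal.ofReal (((a * (a - 1) : ℕ) : ℝ) ^ 2) := ENNReal.ofReal_le_ofReal hreal
      _ = ((a * (a - 1) : ℕ) : ℝ≥0∞) * ((a * (a - 1) : ℕ) : ℝ≥0∞) := by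
          rw [ENNReal.ofReal_pow (by positivity), ENNReal.ofReal_natCast, pow_two]
      _ ≤ E2 * ((T : ℝ≥0∞) ^ 2) := hlow
      _ ≤ 6 * p * (T : ℝ≥0∞) ^ 2 := by gcongr
      _ = p * 6 * (T : ℝ≥0∞) ^ 2 := by ring
  have hT0 : ((T : ℝ≥0∞)) ^ 2 ≠ 0 := by
    simp only [Ne, pow_eq_zero_iff, OfNat.ofNat_ne_zero, not_false_eq_true, Nat.cast_eq_zero]
    omega
  have h6 := (ENNReal.mul_le_mul_iff_left hT0 (by simp)).1 hfin
  exact (ENNReal.mul_le_mul_iff_left (by norm_num) (by simp)).1 h6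

end Config

section Statistics

variable {V : Type} [Fintype V]

open Classical in
/-- A sum over edges that are not loops is at most the sum over ordered pairs of distinct nodes. -/
theorem sum_edges_le_sum_offDiag (S : Finset (Sym2 V)) (hS : ∀ e ∈ S, ¬ e.IsDiag)
    (f : Sym2 V → ℕ) :
    ∑ e ∈ S, f e ≤ ∑ p ∈ (Finset.univ : Finset V).offDiag, f s(p.1, p.2) := by
  have hsub : S ⊆ (Finset.univ : Finset V).offDiag.image fun p => s(p.1, p.2) := by
    intro e he
    induction e using Sym2.ind with
    | _ a b =>
      refine Finset.mem_image.2 ⟨(a, b), ?_, rfl⟩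
      have := hS _ he
      rw [Sym2.mk_isDiag_iff] at this
      simp [this]
  refine (Finset.sum_le_sum_of_subset hsub).trans ?_
  rw [← Finset.sum_fiberwise_of_maps_to (s := (Finset.univ : Finset V).offDiag)
    (g := fun p => s(p.1, p.2)) fun p hp => Finset.mem_image_of_mem _ hp]
  refine Finset.sum_le_sum fun e he => ?_
  obtain ⟨p, hp, rfl⟩ := Finset.mem_image.1 he
  exact Finset.single_le_sum (f := fun q : V × V => f s(q.1, q.2)) (fun _ _ => Nat.zero_le _)
    (Finset.mem_filter.2 ⟨hp, rfl⟩)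

open Classical in
theorem parallelPairs_le (g : Multigraph V) : parallelPairs g ≤
    ∑ p ∈ (Finset.univ : Finset V).offDiag, (mult g s(p.1, p.2)).descFactorial 2 := by
  rw [parallelPairs]
  refine le_trans ?_ (sum_edges_le_sum_offDiag (g.toFinset.filter fun e => ¬ e.IsDiag)
    (fun e he => (Finset.mem_filter.1 he).2) fun e => (mult g e).descFactorial 2)
  refine Finset.sum_le_sum fun e _ => ?_
  rw [Nat.choose_eq_descFactorial_div_factorial]
  exact Nat.div_le_self _ _

open Classical in
theorem multiEdges_le (g : Multigraph V) : multiEdges g ≤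
    ∑ p ∈ (Finset.univ : Finset V).offDiag, if 2 ≤ mult g s(p.1, p.2) then 1 else 0 := by
  rw [multiEdges]
  refine le_trans ?_ (sum_edges_le_sum_offDiag
    (g.toFinset.filter fun e => ¬ e.IsDiag ∧ 2 ≤ g.count e)
    (fun e he => (Finset.mem_filter.1 he).2.1) fun e => if 2 ≤ mult g e then 1 else 0)
  rw [Finset.card_eq_sum_ones]
  refine Finset.sum_le_sum fun e he => ?_
  rw [if_pos (show 2 ≤ mult g e from (Finset.mem_filter.1 he).2.2)]

theorem multiEdges_le_parallelPairs {V : Type} (g : Multigraph V) :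
    multiEdges g ≤ parallelPairs g := by
  classical
  rw [multiEdges, parallelPairs, Finset.card_eq_sum_ones]
  refine le_trans (Finset.sum_le_sum (g := fun e => (g.count e).choose 2) fun e he => ?_)
    (Finset.sum_le_sum_of_subset fun e he => ?_)
  · exact Nat.choose_pos (Finset.mem_filter.1 he).2.2
  · rw [Finset.mem_filter] at he ⊢
    exact ⟨he.1, he.2.1⟩

open Classical in
theorem sum_offDiag_le_two_mul_multiEdges (g : Multigraph V) :
    (∑ p ∈ (Finset.univ : Finset V).offDiag, if 2 ≤ mult g s(p.1, p.2) then 1 else 0)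
      ≤ 2 * multiEdges g := by
  rw [← Finset.card_filter, multiEdges]
  refine Finset.card_le_mul_card_image_of_maps_to (f := fun p : V × V => s(p.1, p.2)) ?_ 2 ?_
  · rintro ⟨a, b⟩ hp
    simp only [Finset.mem_filter, Finset.mem_offDiag, Finset.mem_univ, true_and] at hp ⊢
    refine ⟨?_, by simpa using hp.1, hp.2⟩
    rw [Multiset.mem_toFinset, ← Multiset.one_le_count_iff_mem]
    exact le_trans (by norm_num) hp.2
  · intro e he
    induction e using Sym2.ind with
    | _ a b =>
      refine (Finset.card_le_card (t := {(a, b), (b, a)}) ?_).trans (Finset.card_le_two)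
      rintro ⟨x, y⟩ hp
      have := (Finset.mem_filter.1 hp).2
      rw [Sym2.eq_iff] at this
      simp only [Finset.mem_insert, Finset.mem_singleton, Prod.mk.injEq]
      exact this

open Classical in
theorem card_filter_le_loops_add (b : Multigraph V) (Q : Sym2 V → Prop) :
    (b.filter Q).card ≤ loops b +
      ∑ p ∈ (Finset.univ : Finset V).offDiag,
        mult b s(p.1, p.2) * if Q s(p.1, p.2) then 1 else 0 := by
  have h1 : (b.filter Q).card = ∑ e ∈ b.toFinset, b.count e * if Q e then 1 else 0 := by
    rw [← Multiset.toFinset_sum_count_eq, Multiset.toFinset_filter, Finset.sum_filter]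
    refine Finset.sum_congr rfl fun e _ => ?_
    split_ifs with h
    · rw [Multiset.count_filter_of_pos h, mul_one]
    · rw [mul_zero]
  have h2 : loops b = ∑ e ∈ b.toFinset.filter (fun e => e.IsDiag), b.count e := by
    rw [loops, ← Multiset.toFinset_sum_count_eq, Multiset.toFinset_filter]
    refine Finset.sum_congr (by congr) fun e he => ?_
    rw [Multiset.count_filter_of_pos (Finset.mem_filter.1 he).2]
  rw [h1, h2, ← Finset.sum_filter_add_sum_filter_not b.toFinset (fun e => e.IsDiag)]
  refine add_le_add (Finset.sum_le_sum fun e _ => ?_) ?_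
  · split_ifs <;> simp
  · exact sum_edges_le_sum_offDiag _ (fun e he => (Finset.mem_filter.1 he).2)
      fun e => mult b e * if Q e then 1 else 0

end Statistics

/-! ### The degree sequence -/

theorem antitone_sortDesc {n : ℕ} (x : Fin n → ℕ) : Antitone (sortDesc x) := by
  intro i j hij
  exact Tuple.monotone_sort (fun i => OrderDual.toDual (x i)) hij

theorem antitone_makeEven {n : ℕ} {x : Fin n → ℕ} (hx : Antitone x) : Antitone (makeEven x) := by
  rw [makeEven]
  split_ifs
  · exact hx
  · exact antitone_sortDesc _

/-- The degree sequence is a rearrangement of the sample, with at most one term decreased by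
one. -/
theorem exists_makeEven_sortDesc_eq {n : ℕ} (x : Fin n → ℕ) :
    ∃ (σ : Equiv.Perm (Fin n)) (e : Fin n → ℕ), makeEven (sortDesc x) = e ∘ σ ∧
      (∀ i, e i ≤ x i) ∧ ∃ S : Finset (Fin n), S.card ≤ 1 ∧ ∀ i ∉ S, e i = x i := by
  rw [makeEven]
  split_ifs
  · exact ⟨_, x, rfl, fun i => le_rfl, ∅, by simp, fun _ _ => rfl⟩
  · set τ := Tuple.sort fun i => OrderDual.toDual (x i) with hτ
    set e' : Fin n → ℕ := fun i => if (i : ℕ) = 0 then sortDesc x i - 1 else sortDesc x i with he'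
    have hxτ : ∀ i, sortDesc x (τ.symm i) = x i := by
      intro i
      simp [sortDesc, hτ]
    refine ⟨(Tuple.sort fun i => OrderDual.toDual (e' i)).trans τ, e' ∘ τ.symm, ?_, ?_,
      Finset.univ.filter fun i => (τ.symm i : ℕ) = 0, ?_, ?_⟩
    · funext i
      simp [sortDesc]
    · intro i
      simp only [he', Function.comp_apply, hxτ]
      split_ifs <;> omega
    · rw [Finset.card_le_one]
      intro a ha b hb
      simp only [Finset.mem_filter, Finset.mem_univ, true_and] at ha hb
      apply τ.symm.injective
      apply Fin.ext
      rw [ha, hb]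
    · intro i hi
      simp only [Finset.mem_filter, Finset.mem_univ, true_and] at hi
      simp [he', hi, hxτ]

section

variable {n : ℕ} (x : Fin n → ℕ)

/-- Lowering one degree and sorting can only decrease the sum of a monotone function. -/
theorem sum_makeEven_le {f : ℕ → ℝ≥0∞} (hf : Monotone f) :
    ∑ i, f (makeEven (sortDesc x) i) ≤ ∑ i, f (x i) := by
  obtain ⟨σ, e, h, he, -⟩ := exists_makeEven_sortDesc_eq x
  rw [h]
  simp only [Function.comp_apply]
  rw [Equiv.sum_comp σ fun i => f (e i)]
  exact Finset.sum_le_sum fun i _ => hf (he i)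

theorem sum_offDiag_makeEven_le {g : ℕ → ℕ → ℝ≥0∞} (hg : ∀ a b a' b', a ≤ a' → b ≤ b' →
    g a b ≤ g a' b') :
    ∑ p ∈ (Finset.univ : Finset (Fin n)).offDiag,
      g (makeEven (sortDesc x) p.1) (makeEven (sortDesc x) p.2) ≤
    ∑ p ∈ (Finset.univ : Finset (Fin n)).offDiag, g (x p.1) (x p.2) := by
  obtain ⟨σ, e, h, he, -⟩ := exists_makeEven_sortDesc_eq x
  rw [h]
  simp only [Function.comp_apply]
  refine le_trans (le_of_eq ?_) (Finset.sum_le_sum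
    (f := fun p : Fin n × Fin n => g (e p.1) (e p.2)) fun p _ => hg _ _ _ _ (he _) (he _))
  refine Finset.sum_equiv (σ.prodCongr σ) ?_ ?_
  · intro p
    simp
  · intro p _
    rfl

theorem card_filter_le_card_filter_makeEven_add_one (Q : ℕ → Prop) [DecidablePred Q] :
    (Finset.univ.filter fun i => Q (x i)).card
      ≤ (Finset.univ.filter fun i => Q (makeEven (sortDesc x) i)).card + 1 := by
  obtain ⟨σ, e, h, he, S, hS, heS⟩ := exists_makeEven_sortDesc_eq x
  rw [h]
  have h1 : (Finset.univ.filter fun i => Q ((e ∘ σ) i)).card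
      = (Finset.univ.filter fun i => Q (e i)).card := by
    refine Finset.card_equiv σ fun i => ?_
    simp
  rw [h1]
  have hsub : (Finset.univ.filter fun i => Q (x i))
      ⊆ (Finset.univ.filter fun i => Q (e i)) ∪ S := by
    intro i hi
    simp only [Finset.mem_filter, Finset.mem_univ, true_and, Finset.mem_union] at hi ⊢
    by_cases hiS : i ∈ S
    · exact Or.inr hiS
    · left
      rw [heS i hiS]
      exact hi
  exact (Finset.card_le_card hsub).trans ((Finset.card_union_le _ _).trans (by omega))

theorem card_zero_makeEven_le (hx : ∀ i, 1 ≤ x i) :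
    (Finset.univ.filter fun i => makeEven (sortDesc x) i = 0).card ≤ 1 := by
  have h := card_filter_le_card_filter_makeEven_add_one x (fun k => k ≠ 0)
  have h1 : (Finset.univ.filter fun i => x i ≠ 0) = Finset.univ := by
    rw [Finset.filter_eq_self]
    intro i _
    have := hx i
    omega
  rw [h1] at h
  have h2 := Finset.card_filter_add_card_filter_not (s := (Finset.univ : Finset (Fin n)))
    (fun i => makeEven (sortDesc x) i = 0)
  simp only [ne_eq] at h
  omega

end

section

variable {P : Params} {n : ℕ}

/-- The maximum degree allowed by the model. -/
noncomputable def maxDeg (P : Params) (n : ℕ) : ℕ := ⌊(n : ℝ) ^ P.ζ⌋₊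

/-- Properties of every possible degree sequence. -/
theorem mem_support_degrees (hδ : 1 ≤ P.δ) (hD : P.δ ≤ maxDeg P n) {d : Fin n → ℕ}
    (hd : d ∈ (degrees P n).support) : Antitone d ∧ (∀ i, d i ≤ maxDeg P n) ∧
      (Finset.univ.filter fun i => d i = 0).card ≤ 1 := by
  rw [degrees, PMF.mem_support_map_iff] at hd
  obtain ⟨x, hx, rfl⟩ := hd
  have hx' : ∀ i, P.δ ≤ x i ∧ x i ≤ maxDeg P n := fun i =>
    mem_support_tpl hδ hD (mem_support_indep hx i)
  refine ⟨antitone_makeEven (antitone_sortDesc x), ?_,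
    card_zero_makeEven_le x fun i => hδ.trans (hx' i).1⟩
  obtain ⟨σ, e, h, he, -⟩ := exists_makeEven_sortDesc_eq x
  intro i
  rw [h]
  exact (he _).trans (hx' _).2

theorem Ex_degrees_sum_le {f : ℕ → ℝ≥0∞} (hf : Monotone f) :
    Ex (degrees P n) (fun d => ∑ i, f (d i)) ≤ n * Ex (tpl P.γ P.δ (maxDeg P n)) f := by
  rw [degrees, Ex_map]
  refine (Ex_mono fun x => sum_makeEven_le x hf).trans ?_
  rw [Ex_sum]
  simp [Ex_indep_apply, maxDeg]

theorem Ex_degrees_sum_offDiag_le {g : ℕ → ℕ → ℝ≥0∞} (hg : ∀ a b a' b', a ≤ a' → b ≤ b' →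
    g a b ≤ g a' b') :
    Ex (degrees P n) (fun d => ∑ p ∈ (Finset.univ : Finset (Fin n)).offDiag, g (d p.1) (d p.2)) ≤
      (n : ℝ≥0∞) ^ 2 * Ex (tpl P.γ P.δ (maxDeg P n))
        (fun a => Ex (tpl P.γ P.δ (maxDeg P n)) fun b => g a b) := by
  rw [degrees, Ex_map]
  refine (Ex_mono fun x => sum_offDiag_makeEven_le x hg).trans ?_
  rw [Ex_sum]
  refine (Finset.sum_le_card_nsmul _ _ (Ex (tpl P.γ P.δ (maxDeg P n))
        (fun a => Ex (tpl P.γ P.δ (maxDeg P n)) fun b => g a b)) fun p hp => ?_).trans ?_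
  · exact (Ex_indep_apply₂ _ (Finset.mem_offDiag.1 hp).2.2 g).le
  · rw [nsmul_eq_mul]
    gcongr
    rw [Finset.offDiag_card, Finset.card_univ, Fintype.card_fin, pow_two]
    exact_mod_cast Nat.sub_le _ _

/-- It is exponentially unlikely that some label outside the first quarter has a high degree. -/
theorem Pr_degrees_high_le {K : ℕ} (hK : Pr (tpl P.γ P.δ (maxDeg P n)) {k | K ≤ k} ≤ 1 / 30) :
    Pr (degrees P n) {d | Antitone d ∧ ∃ i : Fin n, n ≤ 4 * (i + 1) ∧ K ≤ d i} ≤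
      ENNReal.ofReal ((3 / 4) ^ n) := by
  set q := tpl P.γ P.δ (maxDeg P n) with hq
  -- On this event at least `n / 4` degrees are high. A weight of `16` for each of them gives
  -- `16 ^ (n / 4) = 2 ^ n`, whereas the mean of the product of the weights is at most
  -- `(3 / 2) ^ n`.
  have h1 : (2 : ℝ≥0∞) ^ n * Pr (degrees P n)
      {d | Antitone d ∧ ∃ i : Fin n, n ≤ 4 * (i + 1) ∧ K ≤ d i} ≤
      Ex (indep fun _ : Fin n => q) fun x => ∏ i, (if K ≤ x i then (16 : ℝ≥0∞) else 1) := by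
    have hm : Pr (degrees P n) {d | Antitone d ∧ ∃ i : Fin n, n ≤ 4 * (i + 1) ∧ K ≤ d i}
        = Pr (indep fun _ : Fin n => q)
          {x | makeEven (sortDesc x) ∈ {d | Antitone d ∧ ∃ i : Fin n, n ≤ 4 * (i + 1) ∧ K ≤ d i}} := by
      rw [Pr, Pr, degrees, Ex_map]
      rfl
    rw [hm]
    refine mul_Pr_le_Ex fun x _ hx => ?_
    obtain ⟨hanti, i, hi, hKi⟩ := hx
    have hc1 : (i : ℕ) + 1 ≤ (Finset.univ.filter fun j => K ≤ makeEven (sortDesc x) j).card := by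
      have : (Finset.Iic i).card = i + 1 := by simp
      rw [← this]
      refine Finset.card_le_card fun j hj => ?_
      simp only [Finset.mem_filter, Finset.mem_univ, true_and]
      exact hKi.trans (hanti (Finset.mem_Iic.1 hj))
    have hc2 : (Finset.univ.filter fun j => K ≤ makeEven (sortDesc x) j).card
        ≤ (Finset.univ.filter fun j => K ≤ x j).card := by
      have := sum_makeEven_le x (f := fun k => if K ≤ k then 1 else 0) (by
        intro a b hab
        by_cases h : K ≤ a
        · simp [h, h.trans hab]
        · simp [h])
      rw [Finset.sum_boole, Finset.sum_boole] at this
      exact_mod_cast this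
    rw [Finset.prod_ite, Finset.prod_const, Finset.prod_const_one, mul_one,
      show (16 : ℝ≥0∞) = 2 ^ 4 by norm_num, ← pow_mul]
    exact pow_le_pow_right₀ (by norm_num) (by omega)
  rw [Ex_indep_prod (fun _ => q) (fun _ k => if K ≤ k then (16 : ℝ≥0∞) else 1)] at h1
  have h2 : Ex q (fun k => if K ≤ k then (16 : ℝ≥0∞) else 1) ≤ 3 / 2 := by
    calc Ex q (fun k => if K ≤ k then (16 : ℝ≥0∞) else 1)
        = Ex q fun k => 1 + 15 * ({k | K ≤ k} : Set ℕ).indicator 1 k := by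
          congr 1
          funext k
          by_cases h : K ≤ k
          · simp [h]
            norm_num
          · simp [h]
      _ = 1 + 15 * Pr q {k | K ≤ k} := by rw [Ex_add, Ex_const, Ex_const_mul, Pr]
      _ ≤ 1 + 15 * (1 / 30) := by gcongr
      _ = 3 / 2 := by
        rw [← ENNReal.toReal_eq_toReal_iff' (by finiteness) (by finiteness),
          ENNReal.toReal_add (by finiteness) (by finiteness)]
        norm_num
  simp only [Finset.prod_const, Finset.card_univ, Fintype.card_fin] at h1
  have h3 : (2 : ℝ≥0∞) ^ n * Pr (degrees P n)
      {d | Antitone d ∧ ∃ i : Fin n, n ≤ 4 * (i + 1) ∧ K ≤ d i} ≤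
      2 ^ n * ENNReal.ofReal ((3 / 4) ^ n) := by
    refine h1.trans ((pow_le_pow_left₀ zero_le h2 n).trans (le_of_eq ?_))
    rw [ENNReal.ofReal_pow (by norm_num), ← mul_pow]
    congr 1
    rw [← ENNReal.toReal_eq_toReal_iff' (by finiteness) (by finiteness), ENNReal.toReal_mul,
      ENNReal.toReal_ofReal (by norm_num)]
    norm_num
  exact (ENNReal.mul_le_mul_iff_right (by positivity) (by finiteness)).1 h3

/-- It is unlikely that a block of degrees has much less than its expected number of nodes. -/
theorem Pr_degrees_block_le {a b : ℕ} {q : ℝ} (hq0 : 0 ≤ q)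
    (hq : ENNReal.ofReal q ≤ Pr (tpl P.γ P.δ (maxDeg P n)) {k | a ≤ k ∧ k < b}) :
    Pr (degrees P n)
      {d | ((Finset.univ.filter fun i => a ≤ d i ∧ d i < b).card : ℝ) + 1 ≤ n * q / 4} ≤
      ENNReal.ofReal (Real.exp (-(n * q / 4))) := by
  set p := tpl P.γ P.δ (maxDeg P n) with hp
  -- Markov's inequality for the generating function at `1 / 2`; the adjustment of the parity moves
  -- at most one degree out of the block, which the summand `1` in the event accounts for.
  have h1 : ENNReal.ofReal (Real.exp (-(n * q / 4))) * Pr (degrees P n)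
      {d | ((Finset.univ.filter fun i => a ≤ d i ∧ d i < b).card : ℝ) + 1 ≤ n * q / 4} ≤
      Ex (indep fun _ : Fin n => p) fun x =>
        ∏ i, (if a ≤ x i ∧ x i < b then (ENNReal.ofReal (1 / 2)) else 1) := by
    have hm : Pr (degrees P n)
          {d | ((Finset.univ.filter fun i => a ≤ d i ∧ d i < b).card : ℝ) + 1 ≤ n * q / 4}
        = Pr (indep fun _ : Fin n => p) {x | makeEven (sortDesc x) ∈
          {d | ((Finset.univ.filter fun i => a ≤ d i ∧ d i < b).card : ℝ) + 1 ≤ n * q / 4}} := by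
      rw [Pr, Pr, degrees, Ex_map]
      rfl
    rw [hm]
    refine mul_Pr_le_Ex fun x _ hx => ?_
    have hc := card_filter_le_card_filter_makeEven_add_one x (fun k => a ≤ k ∧ k < b)
    have hc' : ((Finset.univ.filter fun i => a ≤ x i ∧ x i < b).card : ℝ) ≤ n * q / 4 :=
      le_trans (by exact_mod_cast hc) hx
    rw [Finset.prod_ite, Finset.prod_const, Finset.prod_const_one, mul_one,
      ← ENNReal.ofReal_pow (by norm_num)]
    refine ENNReal.ofReal_le_ofReal ?_
    rw [← Real.rpow_natCast, show (1 / 2 : ℝ) = 2⁻¹ by norm_num,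
      Real.inv_rpow (by norm_num), ← Real.rpow_neg (by norm_num), Real.rpow_def_of_pos (by norm_num)]
    refine Real.exp_le_exp.2 ?_
    have hl0 : 0 ≤ Real.log 2 := Real.log_nonneg (by norm_num)
    have hl : Real.log 2 ≤ 1 := by linarith [Real.log_two_lt_d9]
    nlinarith [(Nat.cast_nonneg _ : (0 : ℝ) ≤ (Finset.univ.filter fun i => a ≤ x i ∧ x i < b).card)]
  rw [Ex_indep_prod (fun _ => p) (fun _ k => if a ≤ k ∧ k < b then ENNReal.ofReal (1 / 2) else 1)]
    at h1
  have h2 : Ex p (fun k => if a ≤ k ∧ k < b then ENNReal.ofReal (1 / 2) else 1)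
      ≤ ENNReal.ofReal (Real.exp (-(q / 2))) := by
    have hs : Ex p (fun k => if a ≤ k ∧ k < b then ENNReal.ofReal (1 / 2) else 1)
        + ENNReal.ofReal (1 / 2) * Pr p {k | a ≤ k ∧ k < b} = 1 := by
      rw [Pr, ← Ex_const_mul, ← Ex_add, ← Ex_const p 1]
      congr 1
      funext k
      by_cases h : a ≤ k ∧ k < b
      · simp only [h, and_self, if_true, Set.indicator_apply, Set.mem_ofPred_eq, Pi.one_apply,
          mul_one]
        rw [← ENNReal.ofReal_add (by norm_num) (by norm_num)]
        norm_num
      · simp [h]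
    have hs' : Ex p (fun k => if a ≤ k ∧ k < b then ENNReal.ofReal (1 / 2) else 1)
        + ENNReal.ofReal (q / 2) ≤ 1 := by
      refine le_trans ?_ hs.le
      gcongr
      rw [show q / 2 = 1 / 2 * q by ring, ENNReal.ofReal_mul (by norm_num)]
      gcongr
    refine (ENNReal.le_sub_of_add_le_right (by simp) hs').trans ?_
    rw [← ENNReal.ofReal_one, ← ENNReal.ofReal_sub _ (by linarith)]
    exact ENNReal.ofReal_le_ofReal (by linarith [Real.add_one_le_exp (-(q / 2))])
  simp only [Finset.prod_const, Finset.card_univ, Fintype.card_fin] at h1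
  have h3 := h1.trans (pow_le_pow_left₀ zero_le h2 n)
  rw [← ENNReal.ofReal_pow (Real.exp_nonneg _), ← Real.exp_nat_mul,
    show (n : ℝ) * -(q / 2) = -(n * q / 4) + -(n * q / 4) by ring, Real.exp_add,
    ENNReal.ofReal_mul (Real.exp_nonneg _)] at h3
  refine (ENNReal.mul_le_mul_iff_right ?_ (by finiteness)).1 h3
  simp [Real.exp_pos]

end

/-! ### The community sizes -/

section TakeUntil

theorem takeUntil_sublist : ∀ (m : ℕ) (l : List ℕ), (takeUntil m l).Sublist l
  | 0, l => by simp [takeUntil]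
  | m + 1, [] => by simp [takeUntil]
  | m + 1, a :: l => by
    rw [takeUntil]
    exact (takeUntil_sublist _ l).cons_cons a

theorem le_sum_takeUntil : ∀ (m : ℕ) (l : List ℕ), (∀ a ∈ l, 1 ≤ a) → m ≤ l.length →
    m ≤ (takeUntil m l).sum
  | 0, l, _, _ => by simp
  | m + 1, [], _, h => by simp at h
  | m + 1, a :: l, hl, h => by
    have ha := hl a (by simp)
    have := le_sum_takeUntil (m + 1 - a) l (fun b hb => hl b (by simp [hb])) (by
      simp only [List.length_cons] at h
      omega)
    rw [takeUntil, List.sum_cons]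
    omega

theorem sum_takeUntil_le {M : ℕ} : ∀ (m : ℕ) (l : List ℕ), (∀ a ∈ l, a ≤ M) →
    (takeUntil m l).sum ≤ m + M
  | 0, l, _ => by simp [takeUntil]
  | m + 1, [], _ => by simp [takeUntil]
  | m + 1, a :: l, hl => by
    have ha := hl a (by simp)
    rw [takeUntil, List.sum_cons]
    rcases Nat.lt_or_ge (m + 1) a with h | h
    · rw [show m + 1 - a = 0 by omega, takeUntil]
      simp
      omega
    · have := sum_takeUntil_le (m + 1 - a) l (fun b hb => hl b (by simp [hb]))
      omega

theorem sum_dropLast_takeUntil_lt : ∀ (m : ℕ) (l : List ℕ), 0 < m →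
    (takeUntil m l).dropLast.sum < m
  | 0, l, h => by simp at h
  | m + 1, [], _ => by simp [takeUntil]
  | m + 1, a :: l, _ => by
    rw [takeUntil]
    rcases Nat.lt_or_ge a (m + 1) with h | h
    · have ih := sum_dropLast_takeUntil_lt (m + 1 - a) l (by omega)
      by_cases hn : takeUntil (m + 1 - a) l = []
      · simp [hn]
      · rw [List.dropLast_cons_of_ne_nil hn, List.sum_cons]
        omega
    · rw [show m + 1 - a = 0 by omega, takeUntil]
      simp

variable {p : PMF ℕ} {M : ℕ}

theorem Ex_takeUntil_succ (m k : ℕ) (F : List ℕ → ℝ≥0∞) :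
    Ex (indep fun _ : Fin (k + 1) => p) (fun x => F (takeUntil (m + 1) (List.ofFn x))) =
      Ex p fun a => Ex (indep fun _ : Fin k => p) fun x =>
        F (a :: takeUntil (m + 1 - a) (List.ofFn x)) := by
  rw [Ex_indep_succ]
  congr 1
  funext a
  congr 1
  funext x
  rw [List.ofFn_succ]
  simp [takeUntil]

theorem takeUntil_nil (m : ℕ) : takeUntil m [] = [] := by
  cases m <;> simp [takeUntil]

theorem takeUntil_ofFn_zero (m : ℕ) (x : Fin 0 → ℕ) : takeUntil m (List.ofFn x) = [] := by
  rw [List.ofFn_zero, takeUntil_nil]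

/-- Wald's identity. -/
theorem Ex_sum_takeUntil (g : ℕ → ℝ≥0∞) : ∀ k m : ℕ,
    Ex (indep fun _ : Fin k => p) (fun x => ((takeUntil m (List.ofFn x)).map g).sum) =
      Ex p g * Ex (indep fun _ : Fin k => p)
        (fun x => ((takeUntil m (List.ofFn x)).length : ℝ≥0∞))
  | 0, m => by simp [takeUntil_nil]
  | k + 1, 0 => by simp [takeUntil]
  | k + 1, m + 1 => by
    rw [Ex_takeUntil_succ m k (fun l => (l.map g).sum),
      Ex_takeUntil_succ m k (fun l => (l.length : ℝ≥0∞))]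
    simp only [List.map_cons, List.sum_cons, List.length_cons, Nat.cast_add, Nat.cast_one, Ex_add,
      Ex_const, Ex_sum_takeUntil g k, Ex_const_mul]
    rw [mul_add, mul_one, add_comm]

/-- Exponential bound for products along the sequence of sizes, in terms of the sum `m` that has to
be reached; `M` bounds the last size. -/
theorem Ex_prod_takeUntil_le (hM : ∀ a ∈ p.support, a ≤ M) {h : ℕ → ℝ≥0∞} {t : ℝ} (ht : 0 ≤ t)
    (hh : Ex p (fun a => h a * ENNReal.ofReal (Real.exp (-(t * a)))) ≤ 1) : ∀ k m : ℕ,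
    Ex (indep fun _ : Fin k => p) (fun x => ((takeUntil m (List.ofFn x)).map h).prod) ≤
      ENNReal.ofReal (Real.exp (t * (m + M)))
  | 0, m => by
    simp only [takeUntil_ofFn_zero, List.map_nil, List.prod_nil, Ex_const]
    rw [← ENNReal.ofReal_one]
    exact ENNReal.ofReal_le_ofReal (Real.one_le_exp (by positivity))
  | k + 1, 0 => by
    simp only [takeUntil, List.map_nil, List.prod_nil, Ex_const]
    rw [← ENNReal.ofReal_one]
    exact ENNReal.ofReal_le_ofReal (Real.one_le_exp (by positivity))
  | k + 1, m + 1 => by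
    rw [Ex_takeUntil_succ m k (fun l => (l.map h).prod)]
    simp only [List.map_cons, List.prod_cons, Ex_const_mul]
    have : ∀ a ∈ p.support, h a * Ex (indep fun _ : Fin k => p)
        (fun x => ((takeUntil (m + 1 - a) (List.ofFn x)).map h).prod) ≤
        h a * ENNReal.ofReal (Real.exp (-(t * a))) *
          ENNReal.ofReal (Real.exp (t * ((m + 1 : ℕ) + M))) := by
      intro a ha
      rw [mul_assoc, ← ENNReal.ofReal_mul (Real.exp_nonneg _), ← Real.exp_add]
      gcongr
      rcases Nat.lt_or_ge (m + 1) a with hlt | hle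
      · rw [show m + 1 - a = 0 by omega]
        simp only [takeUntil, List.map_nil, List.prod_nil, Ex_const]
        rw [← ENNReal.ofReal_one]
        refine ENNReal.ofReal_le_ofReal (Real.one_le_exp ?_)
        have h1 : (a : ℝ) ≤ M := by exact_mod_cast hM a ha
        have h2 : (0 : ℝ) ≤ ((m + 1 : ℕ) : ℝ) := Nat.cast_nonneg _
        nlinarith
      · refine (Ex_prod_takeUntil_le hM ht hh k (m + 1 - a)).trans ?_
        refine ENNReal.ofReal_le_ofReal (Real.exp_le_exp.2 (le_of_eq ?_))
        rw [Nat.cast_sub hle]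
        ring
    refine (Ex_mono_support this).trans ?_
    rw [Ex_mul_const]
    exact mul_le_of_le_one_left' hh

/-- Exponential bound for products along the sequence of sizes that decays in the sum `m` to be
reached. There have to be enough sizes for `m` to be reached. -/
theorem Ex_prod_takeUntil_le_exp_neg (h1 : ∀ a ∈ p.support, 1 ≤ a) {h : ℕ → ℝ≥0∞} {t : ℝ}
    (ht : 0 ≤ t)
    (hh : Ex p (fun a => h a * ENNReal.ofReal (Real.exp (t * a))) ≤ 1) : ∀ k m : ℕ, m ≤ k →
    Ex (indep fun _ : Fin k => p) (fun x => ((takeUntil m (List.ofFn x)).map h).prod) ≤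
      ENNReal.ofReal (Real.exp (-(t * m)))
  | 0, m, hm => by
    obtain rfl : m = 0 := by omega
    simp [takeUntil_nil]
  | k + 1, 0, _ => by simp [takeUntil]
  | k + 1, m + 1, hm => by
    rw [Ex_takeUntil_succ m k (fun l => (l.map h).prod)]
    simp only [List.map_cons, List.prod_cons, Ex_const_mul]
    have : ∀ a ∈ p.support, h a * Ex (indep fun _ : Fin k => p)
        (fun x => ((takeUntil (m + 1 - a) (List.ofFn x)).map h).prod) ≤
        h a * ENNReal.ofReal (Real.exp (t * a)) *
          ENNReal.ofReal (Real.exp (-(t * (m + 1 : ℕ)))) := by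
      intro a ha
      have ha1 := h1 a ha
      rw [mul_assoc, ← ENNReal.ofReal_mul (Real.exp_nonneg _), ← Real.exp_add]
      gcongr
      refine (Ex_prod_takeUntil_le_exp_neg h1 ht hh k (m + 1 - a) (by omega)).trans ?_
      refine ENNReal.ofReal_le_ofReal (Real.exp_le_exp.2 ?_)
      have : ((m + 1 : ℕ) : ℝ) ≤ ((m + 1 - a : ℕ) : ℝ) + a := by
        exact_mod_cast (by omega : m + 1 ≤ m + 1 - a + a)
      nlinarith
    refine (Ex_mono_support this).trans ?_
    rw [Ex_mul_const]
    exact mul_le_of_le_one_left' hh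

end TakeUntil

section Adjust

/-- The final sizes arise from the drawn ones by dropping the last one, enlarging some of the others
by one, and possibly appending a smaller last size. -/
theorem exists_adjustSizes_eq {s n : ℕ} {l : List ℕ} (hl : l ≠ []) (hsum : n ≤ l.sum)
    (hlt : l.dropLast.sum < n) (hlen : s ≤ l.dropLast.length) :
    ∃ old tail, adjustSizes s n l = old ++ tail ∧
      List.Forall₂ (fun a b => a ≤ b ∧ b ≤ a + 1) l.dropLast old ∧
      (tail = [] ∨ ∃ t, tail = [t] ∧ s ≤ t ∧ t ≤ l.getLast hl) ∧ (old ++ tail).sum = n := by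
  have hD : l.sum = l.dropLast.sum + l.getLast hl := by
    conv_lhs => rw [← List.dropLast_append_getLast hl]
    simp
  have hrefl : ∀ l' : List ℕ, List.Forall₂ (fun a b => a ≤ b ∧ b ≤ a + 1) l' l' := fun l' =>
    List.forall₂_same.2 fun a _ => ⟨le_rfl, by omega⟩
  have hlast : l.getLastD 0 = l.getLast hl := by
    rw [List.getLastD_eq_getLast?, List.getLast?_eq_getLast_of_ne_nil hl]
    rfl
  rw [adjustSizes]
  simp only [hlast]
  split_ifs with h
  · refine ⟨_, _, rfl, hrefl _, Or.inr ⟨_, rfl, by omega, by omega⟩, ?_⟩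
    rw [List.sum_append, List.sum_singleton]
    omega
  · set j := l.getLast hl - (l.sum - n) with hj
    refine ⟨(l.dropLast.take j).map (· + 1) ++ l.dropLast.drop j, [], by simp, ?_, Or.inl rfl, ?_⟩
    · conv_lhs => rw [← List.take_append_drop j l.dropLast]
      refine List.rel_append ?_ (hrefl _)
      rw [List.forall₂_map_right_iff]
      exact List.forall₂_same.2 fun a _ => ⟨by omega, le_rfl⟩
    · have h1 : ((l.dropLast.take j).map (· + 1)).sum = (l.dropLast.take j).sum + j := by
        have hmin : (l.dropLast.take j).length = j := by
          rw [List.length_take]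
          omega
        rw [List.sum_map_add, List.map_id', List.map_const', List.sum_replicate, hmin]
        simp
      have h2 : (l.dropLast.take j).sum + (l.dropLast.drop j).sum = l.dropLast.sum := by
        rw [← List.sum_append, List.take_append_drop]
      rw [List.append_nil, List.sum_append, h1]
      omega

theorem sum_map_le_of_forall₂ {α : Type*} [AddCommMonoid α] [PartialOrder α]
    [IsOrderedAddMonoid α] {R : ℕ → ℕ → Prop} {l l' : List ℕ} (h : List.Forall₂ R l l')
    {f g : ℕ → α} (hfg : ∀ a b, R a b → f a ≤ g b) : (l.map f).sum ≤ (l'.map g).sum := by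
  induction h with
  | nil => simp
  | cons hab _ ih =>
    simp only [List.map_cons, List.sum_cons]
    exact add_le_add (hfg _ _ hab) ih

end Adjust

section Sizes

variable {P : Params} {n : ℕ}

/-- The maximum size of the communities that are drawn. -/
noncomputable def maxComm (P : Params) (n : ℕ) : ℕ := ⌊(n : ℝ) ^ P.τ⌋₊

/-- The number of nodes is large compared with the maximum community size. -/
structure SizeRange (P : Params) (n : ℕ) : Prop where
  two_le : 2 ≤ P.s
  le_max : 2 * P.s ≤ maxComm P n
  max_mul_le : maxComm P n * (P.s + 1) ≤ n

/-- The law of a single community size. -/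
noncomputable def sizeLaw (P : Params) (n : ℕ) : PMF ℕ := tpl P.β P.s (maxComm P n)

/-- The sizes that are drawn. -/
noncomputable def drawnSizes (P : Params) (n : ℕ) : PMF (List ℕ) :=
  (indep fun _ : Fin n => sizeLaw P n).map fun x => takeUntil n (List.ofFn x)

theorem communitySizes_eq (P : Params) (n : ℕ) :
    communitySizes P n = (drawnSizes P n).map (adjustSizes P.s n) := by
  rw [drawnSizes, PMF.map_comp]
  rfl

theorem SizeRange.mem_sizeLaw (h : SizeRange P n) {a : ℕ} (ha : a ∈ (sizeLaw P n).support) :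
    P.s ≤ a ∧ a ≤ maxComm P n :=
  mem_support_tpl (by linarith [h.two_le]) (by linarith [h.le_max, h.two_le]) ha

theorem SizeRange.mem_drawnSizes (h : SizeRange P n) {l : List ℕ}
    (hl : l ∈ (drawnSizes P n).support) :
    (∀ a ∈ l, P.s ≤ a ∧ a ≤ maxComm P n) ∧ n ≤ l.sum ∧ l.sum ≤ n + maxComm P n ∧
      l.dropLast.sum < n ∧ l ≠ [] ∧ P.s ≤ l.dropLast.length := by
  have h2 := h.two_le
  have h3 := h.le_max
  have h4 := h.max_mul_le
  rw [drawnSizes, PMF.mem_support_map_iff] at hl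
  obtain ⟨x, hx, rfl⟩ := hl
  have hall : ∀ a ∈ List.ofFn x, P.s ≤ a ∧ a ≤ maxComm P n := by
    intro a ha
    rw [List.mem_ofFn] at ha
    obtain ⟨i, rfl⟩ := ha
    exact h.mem_sizeLaw (mem_support_indep hx i)
  have hall' : ∀ a ∈ takeUntil n (List.ofFn x), P.s ≤ a ∧ a ≤ maxComm P n := fun a ha =>
    hall a ((takeUntil_sublist _ _).subset ha)
  have hsum : n ≤ (takeUntil n (List.ofFn x)).sum :=
    le_sum_takeUntil n _ (fun a ha => by linarith [(hall a ha).1]) (by simp)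
  have hn : 0 < n := by nlinarith
  have hne : takeUntil n (List.ofFn x) ≠ [] := by
    intro h0
    rw [h0] at hsum
    simp at hsum
    omega
  have hdl : n ≤ (takeUntil n (List.ofFn x)).dropLast.sum + maxComm P n := by
    refine hsum.trans ?_
    conv_lhs => rw [← List.dropLast_append_getLast hne]
    simp only [List.sum_append, List.sum_singleton]
    have := (hall' _ (List.getLast_mem hne)).2
    omega
  refine ⟨hall', hsum, sum_takeUntil_le n _ fun a ha => (hall a ha).2,
    sum_dropLast_takeUntil_lt n _ hn, hne, ?_⟩
  by_contra hlt
  have : (takeUntil n (List.ofFn x)).dropLast.sum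
      ≤ (takeUntil n (List.ofFn x)).dropLast.length * maxComm P n := by
    rw [← smul_eq_mul]
    exact List.sum_le_card_nsmul _ _ fun a ha => (hall' a (List.dropLast_subset _ ha)).2
  have h5 : (takeUntil n (List.ofFn x)).dropLast.length * maxComm P n + maxComm P n
      ≤ P.s * maxComm P n := by
    have : (takeUntil n (List.ofFn x)).dropLast.length + 1 ≤ P.s := by omega
    nlinarith
  nlinarith

/-- Comparison of the final sizes with the drawn ones. -/
theorem SizeRange.adjustSizes_spec (h : SizeRange P n) {l : List ℕ}
    (hl : l ∈ (drawnSizes P n).support) :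
    (adjustSizes P.s n l).sum = n ∧
    (∀ z ∈ adjustSizes P.s n l, P.s ≤ z ∧ z ≤ maxComm P n + 1) ∧
    (∀ g : ℕ → ℝ≥0∞, Monotone g →
      ((adjustSizes P.s n l).map g).sum ≤ (l.map fun a => g (a + 1)).sum) ∧
    (∀ D : ℕ, ((adjustSizes P.s n l).map fun z => if z ≤ D then z else 0).sum ≤
      (l.map fun a => if a ≤ D then a + 1 else 0).sum + D) ∧
    (adjustSizes P.s n l).length ≤ l.length ∧ l.length ≤ (adjustSizes P.s n l).length + 1 ∧
    (∀ Z : ℕ, (l.map fun a => if Z ≤ a ∧ a < 2 * Z then 1 else 0).sum ≤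
      ((adjustSizes P.s n l).map fun z => if Z ≤ z ∧ z ≤ 2 * Z then 1 else 0).sum + 1) := by
  obtain ⟨hall, hsum, -, hlt, hne, hlen⟩ := h.mem_drawnSizes hl
  have h2 := h.two_le
  obtain ⟨old, tail, heq, hold, htail, hs⟩ := exists_adjustSizes_eq hne hsum hlt hlen
  rw [heq]
  set last := l.getLast hne with hlast
  have hl' : l = l.dropLast ++ [last] := (List.dropLast_append_getLast hne).symm
  have hlast' := hall last (List.getLast_mem hne)
  have hmap : ∀ {α : Type} [AddMonoid α] (g : ℕ → α),
      (l.map g).sum = (l.dropLast.map g).sum + g last := by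
    intro α _ g
    conv_lhs => rw [hl']
    simp
  have hlen1 : l.length = l.dropLast.length + 1 := by
    conv_lhs => rw [hl']
    simp
  have hlen2 := hold.length_eq
  refine ⟨hs, ?_, ?_, ?_, ?_, ?_, ?_⟩
  · intro z hz
    rw [List.mem_append] at hz
    rcases hz with hz | hz
    · have : ∀ b ∈ old, ∃ a ∈ l.dropLast, a ≤ b ∧ b ≤ a + 1 := by
        intro b hb
        obtain ⟨i, hi, rfl⟩ := List.getElem_of_mem hb
        exact ⟨l.dropLast[i], List.getElem_mem _, hold.get (by omega) hi⟩
      obtain ⟨a, ha, hab⟩ := this z hz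
      have := hall a (List.dropLast_subset _ ha)
      omega
    · rcases htail with rfl | ⟨t, rfl, ht⟩
      · simp at hz
      · rw [List.mem_singleton] at hz
        omega
  · intro g hg
    rw [hmap, List.map_append, List.sum_append]
    refine add_le_add (sum_map_le_of_forall₂ hold.flip fun b a hab => hg hab.2) ?_
    rcases htail with rfl | ⟨t, rfl, ht⟩
    · simp
    · simpa using hg (by omega : t ≤ last + 1)
  · intro D
    rw [hmap, List.map_append, List.sum_append, add_assoc]
    refine add_le_add ?_ ?_
    · refine sum_map_le_of_forall₂ hold.flip fun b a hab => ?_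
      have hab' : a ≤ b ∧ b ≤ a + 1 := hab
      change (if b ≤ D then b else 0) ≤ (if a ≤ D then a + 1 else 0)
      split_ifs <;> omega
    · rcases htail with rfl | ⟨t, rfl, ht⟩
      · simp
      · simp only [List.map_cons, List.map_nil, List.sum_cons, List.sum_nil]
        split_ifs <;> omega
  · rw [List.length_append]
    rcases htail with rfl | ⟨t, rfl, ht⟩
    · simp
      omega
    · simp
      omega
  · rw [List.length_append]
    omega
  · intro Z
    rw [hmap, List.map_append, List.sum_append]
    have := sum_map_le_of_forall₂ hold (f := fun a => if Z ≤ a ∧ a < 2 * Z then 1 else 0)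
      (g := fun z => if Z ≤ z ∧ z ≤ 2 * Z then 1 else 0) (by
        intro a b hab
        split_ifs <;> omega)
    have h3 : (if Z ≤ last ∧ last < 2 * Z then 1 else 0) ≤ 1 := by split_ifs <;> omega
    omega

end Sizes

/-! ### Tail bounds for the community sizes -/

section SizeTails

variable {P : Params} {n : ℕ}

/-- The mean size of a drawn community. -/
noncomputable def meanSize (P : Params) (n : ℕ) : ℝ≥0∞ := Ex (sizeLaw P n) fun a => (a : ℝ≥0∞)

theorem SizeRange.pos (h : SizeRange P n) : 0 < n := by
  have := h.two_le
  have := h.le_max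
  have := h.max_mul_le
  nlinarith

theorem SizeRange.maxComm_pos (h : SizeRange P n) : 0 < maxComm P n := by
  have := h.two_le
  have := h.le_max
  omega

theorem SizeRange.maxComm_le (h : SizeRange P n) : maxComm P n ≤ n := by
  have := h.two_le
  have := h.max_mul_le
  nlinarith

theorem SizeRange.meanSize_le (h : SizeRange P n) : meanSize P n ≤ maxComm P n :=
  Ex_le_of_support fun a ha => by exact_mod_cast (h.mem_sizeLaw ha).2

theorem SizeRange.one_le_meanSize (h : SizeRange P n) : 1 ≤ meanSize P n :=
  le_Ex_of_support fun a ha => by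
    have := (h.mem_sizeLaw ha).1
    have := h.two_le
    exact_mod_cast (by omega : 1 ≤ a)

theorem SizeRange.meanSize_ne_top (h : SizeRange P n) : meanSize P n ≠ ∞ :=
  ne_top_of_le_ne_top (ENNReal.natCast_ne_top _) h.meanSize_le

theorem Ex_drawnSizes_sum (P : Params) (n : ℕ) (g : ℕ → ℝ≥0∞) :
    Ex (drawnSizes P n) (fun l => (l.map g).sum) =
      Ex (sizeLaw P n) g * Ex (drawnSizes P n) fun l => (l.length : ℝ≥0∞) := by
  rw [drawnSizes, Ex_map, Ex_map, Ex_sum_takeUntil]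

theorem SizeRange.meanSize_mul_Ex_length (h : SizeRange P n) :
    (n : ℝ≥0∞) ≤ meanSize P n * Ex (drawnSizes P n) (fun l => (l.length : ℝ≥0∞)) ∧
      meanSize P n * Ex (drawnSizes P n) (fun l => (l.length : ℝ≥0∞)) ≤ 2 * n := by
  rw [meanSize, ← Ex_drawnSizes_sum]
  have hsum : ∀ l : List ℕ, (l.map fun a : ℕ => (a : ℝ≥0∞)).sum = (l.sum : ℝ≥0∞) := by
    intro l
    exact (Nat.cast_list_sum l).symm
  simp only [hsum]
  constructor
  · exact le_Ex_of_support fun l hl => by exact_mod_cast (h.mem_drawnSizes hl).2.1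
  · refine Ex_le_of_support fun l hl => ?_
    have h1 := (h.mem_drawnSizes hl).2.2.1
    have h2 := h.maxComm_le
    exact_mod_cast (by omega : l.sum ≤ 2 * n)

/-- The expectation of a sum over the communities of a monotone function of their sizes. -/
theorem SizeRange.meanSize_mul_Ex_sum_le (h : SizeRange P n) {g : ℕ → ℝ≥0∞} (hg : Monotone g) :
    meanSize P n * Ex (communitySizes P n) (fun c => (c.map g).sum) ≤
      2 * n * Ex (sizeLaw P n) fun a => g (a + 1) := by
  rw [communitySizes_eq, Ex_map]
  have h1 : Ex (drawnSizes P n) (fun l => ((adjustSizes P.s n l).map g).sum) ≤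
      Ex (drawnSizes P n) (fun l => (l.map fun a => g (a + 1)).sum) :=
    Ex_mono_support fun l hl => (h.adjustSizes_spec hl).2.2.1 g hg
  rw [Ex_drawnSizes_sum] at h1
  calc _ ≤ meanSize P n * (Ex (sizeLaw P n) (fun a => g (a + 1)) *
        Ex (drawnSizes P n) fun l => (l.length : ℝ≥0∞)) := by gcongr
    _ = meanSize P n * Ex (drawnSizes P n) (fun l => (l.length : ℝ≥0∞)) *
        Ex (sizeLaw P n) (fun a => g (a + 1)) := by ring
    _ ≤ _ := mul_le_mul' h.meanSize_mul_Ex_length.2 le_rfl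

/-- The expected number of communities of a given order of size is at least of the expected
order. -/
theorem SizeRange.le_Ex_block (h : SizeRange P n) (Z : ℕ) :
    n * Pr (sizeLaw P n) {a | Z ≤ a ∧ a < 2 * Z} ≤ meanSize P n *
      (Ex (communitySizes P n) (fun c => (c.map fun z => if Z ≤ z ∧ z ≤ 2 * Z then 1 else 0).sum)
        + 1) := by
  rw [communitySizes_eq, Ex_map]
  have h1 : Ex (drawnSizes P n)
        (fun l => (l.map fun a => {a | Z ≤ a ∧ a < 2 * Z}.indicator (1 : ℕ → ℝ≥0∞) a).sum) ≤
      Ex (drawnSizes P n) (fun l => ((adjustSizes P.s n l).map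
        fun z => if Z ≤ z ∧ z ≤ 2 * Z then (1 : ℝ≥0∞) else 0).sum) + 1 := by
    rw [← Ex_const (drawnSizes P n) 1, ← Ex_add]
    refine Ex_mono_support fun l hl => ?_
    have := (h.adjustSizes_spec hl).2.2.2.2.2.2 Z
    have hc := (Nat.cast_le (α := ℝ≥0∞)).2 this
    rw [Nat.cast_add, Nat.cast_list_sum, Nat.cast_list_sum, List.map_map, List.map_map] at hc
    refine le_trans (le_of_eq ?_) (hc.trans (le_of_eq ?_))
    · congr 2
      funext a
      by_cases ha : Z ≤ a ∧ a < 2 * Z <;> simp [ha]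
    · simp [Function.comp_def]
  rw [Ex_drawnSizes_sum] at h1
  calc _ ≤ meanSize P n * Ex (drawnSizes P n) (fun l => (l.length : ℝ≥0∞)) *
        Pr (sizeLaw P n) {a | Z ≤ a ∧ a < 2 * Z} := by
        gcongr
        exact h.meanSize_mul_Ex_length.1
    _ = meanSize P n * (Ex (sizeLaw P n) (fun a => {a | Z ≤ a ∧ a < 2 * Z}.indicator 1 a) *
        Ex (drawnSizes P n) fun l => (l.length : ℝ≥0∞)) := by
        rw [Pr]
        ring
    _ ≤ _ := by gcongr

theorem Pr_communitySizes_le {A : Set (List ℕ)} {B : Set (List ℕ)}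
    (hAB : ∀ l ∈ (drawnSizes P n).support, adjustSizes P.s n l ∈ A → l ∈ B) :
    Pr (communitySizes P n) A ≤ Pr (drawnSizes P n) B := by
  rw [communitySizes_eq, Pr, Ex_map]
  exact Pr_mono (p := drawnSizes P n) (s := adjustSizes P.s n ⁻¹' A) hAB

/-- Chernoff's bound along the drawn sizes. -/
theorem SizeRange.Pr_drawnSizes_le (h : SizeRange P n) {w : ℕ → ℝ} {t u : ℝ} (ht : 0 ≤ t)
    (hw : Ex (sizeLaw P n) (fun a => ENNReal.ofReal (Real.exp (w a - t * a))) ≤ 1)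
    {B : Set (List ℕ)} (hB : ∀ l ∈ (drawnSizes P n).support, l ∈ B → u ≤ (l.map w).sum) :
    Pr (drawnSizes P n) B ≤ ENNReal.ofReal (Real.exp (2 * t * n - u)) := by
  have key : ENNReal.ofReal (Real.exp u) * Pr (drawnSizes P n) B ≤
      ENNReal.ofReal (Real.exp (t * (n + maxComm P n))) := by
    have h1 := Ex_prod_takeUntil_le (p := sizeLaw P n) (M := maxComm P n)
      (fun a ha => (h.mem_sizeLaw ha).2) (h := fun a => ENNReal.ofReal (Real.exp (w a))) ht (by
        refine le_trans (le_of_eq ?_) hw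
        congr 1
        funext a
        rw [← ENNReal.ofReal_mul (Real.exp_nonneg _), ← Real.exp_add, ← sub_eq_add_neg]) n n
    refine le_trans ?_ h1
    have h2 : Ex (indep fun _ : Fin n => sizeLaw P n) (fun x =>
        ((takeUntil n (List.ofFn x)).map fun a => ENNReal.ofReal (Real.exp (w a))).prod)
        = Ex (drawnSizes P n) fun l => (l.map fun a => ENNReal.ofReal (Real.exp (w a))).prod := by
      rw [drawnSizes, Ex_map]
    rw [h2]
    refine mul_Pr_le_Ex fun l hl hlB => ?_
    have h3 : ∀ l : List ℕ, (l.map fun a => ENNReal.ofReal (Real.exp (w a))).prod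
        = ENNReal.ofReal (Real.exp (l.map w).sum) := by
      intro l
      induction l with
      | nil => simp
      | cons a l ih =>
        rw [List.map_cons, List.prod_cons, ih, List.map_cons, List.sum_cons, Real.exp_add,
          ENNReal.ofReal_mul (Real.exp_nonneg _)]
    rw [h3]
    exact ENNReal.ofReal_le_ofReal (Real.exp_le_exp.2 (hB l hl hlB))
  have h4 : ENNReal.ofReal (Real.exp u) * Pr (drawnSizes P n) B ≤
      ENNReal.ofReal (Real.exp u) * ENNReal.ofReal (Real.exp (2 * t * n - u)) := by
    refine key.trans ?_
    rw [← ENNReal.ofReal_mul (Real.exp_nonneg _), ← Real.exp_add]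
    refine ENNReal.ofReal_le_ofReal (Real.exp_le_exp.2 ?_)
    have : (maxComm P n : ℝ) ≤ n := by exact_mod_cast h.maxComm_le
    nlinarith
  refine (ENNReal.mul_le_mul_iff_right ?_ (by finiteness)).1 h4
  simp [Real.exp_pos]

theorem exp_neg_le_one_sub_half {u : ℝ} (h0 : 0 ≤ u) (h1 : u ≤ 1 / 2) :
    Real.exp (-u) ≤ 1 - u / 2 := by
  have := (abs_le.1 (Real.abs_exp_sub_one_sub_id_le (x := -u) (by
    rw [abs_neg, abs_of_nonneg h0]
    linarith))).2
  nlinarith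

theorem exp_le_one_add_two_mul {u : ℝ} (h0 : 0 ≤ u) (h1 : u ≤ 1) : Real.exp u ≤ 1 + 2 * u := by
  have := (abs_le.1 (Real.abs_exp_sub_one_sub_id_le (x := u) (by rwa [abs_of_nonneg h0]))).2
  nlinarith

theorem SizeRange.ofReal_meanSize (h : SizeRange P n) :
    Ex (sizeLaw P n) (fun a => (a : ℝ≥0∞)) = ENNReal.ofReal (meanSize P n).toReal :=
  (ENNReal.ofReal_toReal h.meanSize_ne_top).symm

theorem SizeRange.meanSize_toReal (h : SizeRange P n) :
    1 ≤ (meanSize P n).toReal ∧ (meanSize P n).toReal ≤ maxComm P n := by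
  constructor
  · rw [← ENNReal.toReal_one]
    exact ENNReal.toReal_mono h.meanSize_ne_top h.one_le_meanSize
  · rw [← ENNReal.toReal_natCast]
    exact ENNReal.toReal_mono (ENNReal.natCast_ne_top _) h.meanSize_le

/-- An upper tail bound for the number of communities. -/
theorem SizeRange.Pr_length_ge (h : SizeRange P n) :
    Pr (communitySizes P n) {c | 8 * n / (meanSize P n).toReal ≤ c.length} ≤
      ENNReal.ofReal (Real.exp (-(n / maxComm P n))) := by
  obtain ⟨hμ1, hμ2⟩ := h.meanSize_toReal
  set μ := (meanSize P n).toReal with hμ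
  have hM : (0 : ℝ) < maxComm P n := by exact_mod_cast h.maxComm_pos
  set t : ℝ := 1 / (2 * maxComm P n) with ht
  have ht0 : 0 < t := by positivity
  have htM : t * maxComm P n = 1 / 2 := by
    rw [ht]
    field_simp
  refine (Pr_communitySizes_le (B := {l | 8 * n / μ ≤ l.length}) ?_).trans ?_
  · intro l hl hc
    have hc' : 8 * n / μ ≤ ((adjustSizes P.s n l).length : ℝ) := hc
    change 8 * n / μ ≤ (l.length : ℝ)
    exact hc'.trans (by exact_mod_cast (h.adjustSizes_spec hl).2.2.2.2.1)
  -- each size has the weight `exp (t * μ / 2)`, compensated by `exp (-t * a)`, as `t * a ≤ 1 / 2`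
  refine (h.Pr_drawnSizes_le (w := fun _ => t * μ / 2) (u := 4 * t * n) ht0.le ?_ ?_).trans
    (le_of_eq ?_)
  · have h1 : Ex (sizeLaw P n) (fun a => ENNReal.ofReal (Real.exp (-(t * a)))) ≤
        ENNReal.ofReal (Real.exp (-(t * μ / 2))) := by
      have h2 : Ex (sizeLaw P n) (fun a => ENNReal.ofReal (Real.exp (-(t * a))))
          + ENNReal.ofReal (t / 2) * Ex (sizeLaw P n) (fun a => (a : ℝ≥0∞)) ≤ 1 := by
        rw [← Ex_const_mul, ← Ex_add]
        refine Ex_le_of_support fun a ha => ?_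
        have ha' : (a : ℝ) ≤ maxComm P n := by exact_mod_cast (h.mem_sizeLaw ha).2
        rw [← ENNReal.ofReal_natCast, ← ENNReal.ofReal_mul (by positivity),
          ← ENNReal.ofReal_add (Real.exp_nonneg _) (by positivity), ← ENNReal.ofReal_one]
        refine ENNReal.ofReal_le_ofReal ?_
        have := exp_neg_le_one_sub_half (u := t * a) (by positivity) (by nlinarith)
        linarith
      rw [h.ofReal_meanSize, ← ENNReal.ofReal_mul (by positivity)] at h2
      refine (ENNReal.le_sub_of_add_le_right (by simp) h2).trans ?_
      rw [← ENNReal.ofReal_one, ← ENNReal.ofReal_sub _ (by positivity)]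
      refine ENNReal.ofReal_le_ofReal ?_
      have := Real.add_one_le_exp (-(t * μ / 2))
      linarith
    have h3 : ∀ a : ℕ, ENNReal.ofReal (Real.exp (t * μ / 2 - t * a)) =
        ENNReal.ofReal (Real.exp (t * μ / 2)) * ENNReal.ofReal (Real.exp (-(t * a))) := by
      intro a
      rw [← ENNReal.ofReal_mul (Real.exp_nonneg _), ← Real.exp_add, sub_eq_add_neg]
    simp only [h3, Ex_const_mul]
    refine (mul_le_mul_right h1 _).trans (le_of_eq ?_)
    rw [← ENNReal.ofReal_mul (Real.exp_nonneg _), ← Real.exp_add]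
    simp
  · intro l _ hlB
    have hlB' : 8 * n / μ ≤ l.length := hlB
    rw [div_le_iff₀ (by linarith)] at hlB'
    rw [List.map_const', List.sum_replicate, nsmul_eq_mul]
    nlinarith
  · congr 2
    rw [ht]
    field_simp
    ring

/-- A lower tail bound for the number of communities. -/
theorem SizeRange.Pr_length_le (h : SizeRange P n) :
    Pr (communitySizes P n) {c | (c.length : ℝ) ≤ n / (16 * (meanSize P n).toReal)} ≤
      ENNReal.ofReal (Real.exp (1 - n / (4 * maxComm P n))) := by
  obtain ⟨hμ1, hμ2⟩ := h.meanSize_toReal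
  set μ := (meanSize P n).toReal with hμ
  have hM : (0 : ℝ) < maxComm P n := by exact_mod_cast h.maxComm_pos
  set t : ℝ := 1 / (2 * maxComm P n) with ht
  have ht0 : 0 < t := by positivity
  have htM : t * maxComm P n = 1 / 2 := by
    rw [ht]
    field_simp
  -- the last of the drawn communities may have been deleted
  refine (Pr_communitySizes_le (B := {l | (l.length : ℝ) ≤ n / (16 * μ) + 1}) ?_).trans ?_
  · intro l hl hc
    have h1 : (l.length : ℝ) ≤ (adjustSizes P.s n l).length + 1 := by
      exact_mod_cast (h.adjustSizes_spec hl).2.2.2.2.2.1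
    have h2 : ((adjustSizes P.s n l).length : ℝ) ≤ n / (16 * μ) := hc
    change (l.length : ℝ) ≤ _
    linarith
  have key := Ex_prod_takeUntil_le_exp_neg (p := sizeLaw P n)
    (fun a ha => by linarith [(h.mem_sizeLaw ha).1, h.two_le])
    (h := fun a => ENNReal.ofReal (Real.exp (-(2 * t * μ)))) ht0.le (by
      have h1 : Ex (sizeLaw P n) (fun a => ENNReal.ofReal (Real.exp (t * a))) ≤
          ENNReal.ofReal (Real.exp (2 * t * μ)) := by
        have h2 : Ex (sizeLaw P n) (fun a => ENNReal.ofReal (Real.exp (t * a))) ≤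
            1 + ENNReal.ofReal (2 * t) * Ex (sizeLaw P n) (fun a => (a : ℝ≥0∞)) := by
          rw [← Ex_const_mul, ← Ex_const (sizeLaw P n) 1, ← Ex_add]
          refine Ex_mono_support fun a ha => ?_
          have ha' : (a : ℝ) ≤ maxComm P n := by exact_mod_cast (h.mem_sizeLaw ha).2
          rw [← ENNReal.ofReal_natCast, ← ENNReal.ofReal_mul (by positivity),
            ← ENNReal.ofReal_one, ← ENNReal.ofReal_add zero_le_one (by positivity)]
          refine ENNReal.ofReal_le_ofReal ?_
          have := exp_le_one_add_two_mul (u := t * a) (by positivity) (by nlinarith)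
          linarith
        refine h2.trans ?_
        rw [h.ofReal_meanSize, ← ENNReal.ofReal_mul (by positivity), ← ENNReal.ofReal_one,
          ← ENNReal.ofReal_add zero_le_one (by positivity)]
        refine ENNReal.ofReal_le_ofReal ?_
        have := Real.add_one_le_exp (2 * t * μ)
        linarith
      rw [Ex_const_mul]
      refine (mul_le_mul_right h1 _).trans (le_of_eq ?_)
      rw [← ENNReal.ofReal_mul (Real.exp_nonneg _), ← Real.exp_add]
      simp) n n le_rfl
  have h2 : Ex (indep fun _ : Fin n => sizeLaw P n) (fun x =>
      ((takeUntil n (List.ofFn x)).map fun _ => ENNReal.ofReal (Real.exp (-(2 * t * μ)))).prod)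
      = Ex (drawnSizes P n) fun l =>
        (l.map fun _ => ENNReal.ofReal (Real.exp (-(2 * t * μ)))).prod := by
    rw [drawnSizes, Ex_map]
  rw [h2] at key
  have h3 : ENNReal.ofReal (Real.exp (-(t * n / 8 + 1))) *
      Pr (drawnSizes P n) {l | (l.length : ℝ) ≤ n / (16 * μ) + 1} ≤
      ENNReal.ofReal (Real.exp (-(t * n / 8 + 1))) *
        ENNReal.ofReal (Real.exp (1 - n / (4 * maxComm P n))) := by
    refine (mul_Pr_le_Ex (f := fun l : List ℕ =>
      (l.map fun _ => ENNReal.ofReal (Real.exp (-(2 * t * μ)))).prod) ?_).trans (key.trans ?_)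
    · intro l _ hlB
      have hlB' : (l.length : ℝ) ≤ n / (16 * μ) + 1 := hlB
      rw [List.map_const', List.prod_replicate, ← ENNReal.ofReal_pow (Real.exp_nonneg _),
        ← Real.exp_nat_mul]
      refine ENNReal.ofReal_le_ofReal (Real.exp_le_exp.2 ?_)
      have e1 : 2 * t * μ * (n / (16 * μ)) = t * n / 8 := by
        field_simp
        ring
      have e2 : 2 * t * μ ≤ 1 := by nlinarith
      have e3 : 0 ≤ 2 * t * μ := by positivity
      nlinarith
    · rw [← ENNReal.ofReal_mul (Real.exp_nonneg _), ← Real.exp_add]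
      refine ENNReal.ofReal_le_ofReal (Real.exp_le_exp.2 ?_)
      have : (n : ℝ) / (4 * maxComm P n) = t * n / 2 := by
        rw [ht]
        field_simp
        ring
      rw [this]
      have : 0 ≤ t * n := by positivity
      nlinarith
  refine (ENNReal.mul_le_mul_iff_right ?_ (by finiteness)).1 h3
  simp [Real.exp_pos]

/-- It is unlikely that small communities contain a quarter of the nodes. -/
theorem SizeRange.Pr_small_ge (h : SizeRange P n) {D : ℕ} (hD : 8 * D ≤ n)
    (hs : Ex (sizeLaw P n) (fun a => if a ≤ D then (a : ℝ≥0∞) + 1 else 0) ≤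
      meanSize P n / 500) :
    Pr (communitySizes P n) {c | n < 4 * (c.map fun z => if z ≤ D then z else 0).sum} ≤
      ENNReal.ofReal (Real.exp (-(n / (64 * maxComm P n)))) := by
  obtain ⟨hμ1, hμ2⟩ := h.meanSize_toReal
  set μ := (meanSize P n).toReal with hμ
  have hM : (0 : ℝ) < maxComm P n := by exact_mod_cast h.maxComm_pos
  set t : ℝ := 1 / (4 * maxComm P n) with ht
  have ht0 : 0 < t := by positivity
  have htM : t * maxComm P n = 1 / 4 := by
    rw [ht]
    field_simp
  set g : ℕ → ℝ := fun a => if a ≤ D then (a : ℝ) + 1 else 0 with hg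
  refine (Pr_communitySizes_le (B := {l | (n : ℝ) / 8 ≤ (l.map g).sum}) ?_).trans ?_
  · intro l hl hc
    have h1 := (h.adjustSizes_spec hl).2.2.2.1 D
    have h2 : n < 4 * ((adjustSizes P.s n l).map fun z => if z ≤ D then z else 0).sum := hc
    have h3 : n ≤ 8 * (l.map fun a => if a ≤ D then a + 1 else 0).sum := by omega
    have h4 : (l.map g).sum = ((l.map fun a => if a ≤ D then a + 1 else 0).sum : ℕ) := by
      rw [Nat.cast_list_sum, List.map_map]
      congr 2
      funext a
      simp only [hg, Function.comp_apply]
      split_ifs <;> simp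
    change (n : ℝ) / 8 ≤ _
    rw [h4]
    have : (n : ℝ) ≤ 8 * ((l.map fun a => if a ≤ D then a + 1 else 0).sum : ℕ) := by
      exact_mod_cast h3
    linarith
  -- Pointwise, `exp (t * g a - t / 32 * a) + t / 64 * a ≤ 1 + 3 * t * g a`, and the mean of `3 * g`
  -- is at most `μ / 64` by assumption.
  refine (h.Pr_drawnSizes_le (w := fun a => t * g a) (t := t / 32) (u := t * n / 8)
    (by positivity) ?_ ?_).trans (le_of_eq ?_)
  · have h2 : Ex (sizeLaw P n) (fun a => ENNReal.ofReal (Real.exp (t * g a - t / 32 * a)))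
        + ENNReal.ofReal (t / 64) * Ex (sizeLaw P n) (fun a => (a : ℝ≥0∞)) ≤
        1 + ENNReal.ofReal (3 * t) *
          Ex (sizeLaw P n) (fun a => if a ≤ D then (a : ℝ≥0∞) + 1 else 0) := by
      rw [← Ex_const_mul, ← Ex_const_mul, ← Ex_const (sizeLaw P n) 1, ← Ex_add, ← Ex_add]
      refine Ex_mono_support fun a ha => ?_
      have ha' : (a : ℝ) ≤ maxComm P n := by exact_mod_cast (h.mem_sizeLaw ha).2
      have ha1 : (1 : ℝ) ≤ a := by
        have := (h.mem_sizeLaw ha).1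
        have := h.two_le
        exact_mod_cast (by omega : 1 ≤ a)
      have hga : (if a ≤ D then (a : ℝ≥0∞) + 1 else 0) = ENNReal.ofReal (g a) := by
        simp only [hg]
        split_ifs
        · rw [ENNReal.ofReal_add (Nat.cast_nonneg _) zero_le_one, ENNReal.ofReal_natCast,
            ENNReal.ofReal_one]
        · simp
      have hg0 : 0 ≤ g a := by
        simp only [hg]
        split_ifs <;> positivity
      rw [Ex_const, hga, ← ENNReal.ofReal_natCast a, ← ENNReal.ofReal_mul (by positivity),
        ← ENNReal.ofReal_mul (by positivity), ← ENNReal.ofReal_one,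
        ← ENNReal.ofReal_add (Real.exp_nonneg _) (by positivity),
        ← ENNReal.ofReal_add zero_le_one (by positivity)]
      refine ENNReal.ofReal_le_ofReal ?_
      have hta : t * a ≤ 1 / 4 := by nlinarith
      by_cases haD : a ≤ D
      · have hgv : g a = a + 1 := by simp [hg, haD]
        rw [hgv]
        have h1 : Real.exp (t * (a + 1) - t / 32 * a) ≤ Real.exp (t * (a + 1)) := by
          refine Real.exp_le_exp.2 ?_
          have : 0 ≤ t / 32 * a := by positivity
          linarith
        have := exp_le_one_add_two_mul (u := t * (a + 1)) (by positivity) (by nlinarith)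
        nlinarith
      · have hgv : g a = 0 := by simp [hg, haD]
        rw [hgv, mul_zero, zero_sub]
        have := exp_neg_le_one_sub_half (u := t / 32 * a) (by positivity) (by nlinarith)
        nlinarith
    have h3 : ENNReal.ofReal (3 * t) *
          Ex (sizeLaw P n) (fun a => if a ≤ D then (a : ℝ≥0∞) + 1 else 0) ≤
        ENNReal.ofReal (t / 64) * Ex (sizeLaw P n) (fun a => (a : ℝ≥0∞)) := by
      refine (mul_le_mul_right hs _).trans ?_
      have hmean : meanSize P n = ENNReal.ofReal μ :=
        (ENNReal.ofReal_toReal h.meanSize_ne_top).symm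
      rw [h.ofReal_meanSize, ← hμ, hmean,
        show (500 : ℝ≥0∞) = ENNReal.ofReal 500 by norm_num, ← ENNReal.ofReal_div_of_pos (by norm_num),
        ← ENNReal.ofReal_mul (by positivity), ← ENNReal.ofReal_mul (by positivity)]
      refine ENNReal.ofReal_le_ofReal ?_
      have : 0 ≤ t * μ := by positivity
      nlinarith
    have h4 := h2.trans (add_le_add le_rfl h3)
    refine (ENNReal.add_le_add_iff_right ?_).1 h4
    rw [h.ofReal_meanSize]
    finiteness
  · intro l _ hlB
    have hlB' : (n : ℝ) / 8 ≤ (l.map g).sum := hlB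
    rw [List.sum_map_mul_left]
    nlinarith
  · congr 2
    rw [ht]
    field_simp
    ring

end SizeTails

/-! ### The assignment of the degrees to the communities -/

section Assign

theorem sum_get_eq {α : Type*} [AddCommMonoid α] (c : List ℕ) (g : ℕ → α) :
    ∑ j : Fin c.length, g (c.get j) = (c.map g).sum := by
  simp

theorem sum_slot_eq {c : List ℕ} (F : Fin c.length → ℝ≥0∞) :
    ∑ u : Slot c, F u.1 = ∑ j, (c.get j : ℝ≥0∞) * F j := by
  rw [Fintype.sum_sigma]
  simp

theorem card_slot (c : List ℕ) : Fintype.card (Slot c) = c.sum := by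
  have := sum_get_eq c id
  simp only [id, List.map_id] at this
  rw [← this]
  simp [Slot]

variable {P : Params} {n : ℕ} {c : List ℕ}

theorem phi_nonneg (hc : c.sum = n) : 0 ≤ phi n c := by
  have h1 : ∑ j : Fin c.length, ((c.get j : ℕ) : ℝ) = n := by
    rw [sum_get_eq c (fun a => (a : ℝ)), ← hc]
    exact (Nat.cast_list_sum c).symm
  have h2 : ∑ j : Fin c.length, ((c.get j : ℕ) : ℝ) ^ 2 ≤ (n : ℝ) ^ 2 := by
    rw [← h1]
    exact Finset.sum_sq_le_sq_sum_of_nonneg fun _ _ => Nat.cast_nonneg _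
  rw [phi, sub_nonneg]
  exact div_le_one_of_le₀ h2 (by positivity)

theorem phi_le_one : phi n c ≤ 1 := by
  rw [phi, sub_le_self_iff]
  positivity

theorem one_sub_mul_phi_mem (hξ0 : 0 < P.ξ) (hξ1 : P.ξ < 1) (hc : c.sum = n) :
    1 - P.ξ ≤ 1 - P.ξ * phi n c ∧ 1 - P.ξ * phi n c ≤ 1 ∧ 0 < 1 - P.ξ * phi n c := by
  have h1 := phi_nonneg hc
  have h2 : phi n c ≤ 1 := phi_le_one
  have h3 : P.ξ * phi n c ≤ P.ξ := by nlinarith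
  have h4 : 0 ≤ P.ξ * phi n c := by positivity
  refine ⟨?_, ?_, ?_⟩ <;> linarith

theorem candidates_subset (U : Finset (Slot c)) (d : ℕ) : candidates P n c U d ⊆ U := by
  classical
  rw [candidates]
  split_ifs
  · exact Finset.filter_subset _ _
  · exact subset_rfl

theorem candidates_nonempty {U : Finset (Slot c)} (hU : U.Nonempty) (d : ℕ) :
    (candidates P n c U d).Nonempty := by
  classical
  rw [candidates]
  split_ifs with h
  · exact h
  · exact hU

open Classical in
theorem Ex_assign_succ {k : ℕ} (d : Fin (k + 1) → ℕ) {U : Finset (Slot c)} (hU : U.Nonempty)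
    (F : (Fin (k + 1) → Option (Fin c.length)) → ℝ≥0∞) :
    Ex (assign P n c (k + 1) d U) F = (∑ u ∈ candidates P n c U (d 0),
      Ex (assign P n c k (fun i => d i.succ) (U.erase u)) fun f => F (Fin.cons (some u.1) f)) /
        (candidates P n c U (d 0)).card := by
  rw [assign, dif_pos (candidates_nonempty hU _), Ex_bind, Ex_uniformOfFinset]
  simp only [Ex_map]

/-- The labels are assigned one after the other, so the expectation of a product over the labels is
at most the product of bounds that hold for each label whatever nodes are still unassigned. -/
theorem Ex_assign_prod_le : ∀ (k : ℕ) (d : Fin k → ℕ) (U : Finset (Slot c)), k ≤ U.card →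
    ∀ (f : Fin k → Option (Fin c.length) → ℝ≥0∞) (B : Fin k → ℝ≥0∞),
    (∀ i : Fin k, ∀ V ⊆ U, V.card + i = U.card →
      (∑ u ∈ candidates P n c V (d i), f i (some u.1)) / (candidates P n c V (d i)).card ≤ B i) →
    Ex (assign P n c k d U) (fun comm => ∏ i, f i (comm i)) ≤ ∏ i, B i
  | 0, d, U, _, f, B, _ => by simp [assign]
  | k + 1, d, U, hk, f, B, h => by
    classical
    have hU : U.Nonempty := Finset.card_pos.1 (by omega)
    rw [Ex_assign_succ d hU]
    have hrec : ∀ u ∈ candidates P n c U (d 0),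
        Ex (assign P n c k (fun i => d i.succ) (U.erase u))
          (fun comm => ∏ i, f i ((Fin.cons (some u.1) comm : Fin (k + 1) → _) i)) ≤
        f 0 (some u.1) * ∏ i : Fin k, B i.succ := by
      intro u hu
      have huU := candidates_subset _ _ hu
      have hcard := Finset.card_erase_of_mem huU
      simp only [Fin.prod_univ_succ, Fin.cons_zero, Fin.cons_succ, Ex_const_mul]
      gcongr
      refine Ex_assign_prod_le k (fun i => d i.succ) (U.erase u) (by omega)
        (fun i => f i.succ) (fun i => B i.succ) fun i V hV hVc => ?_
      refine h i.succ V (hV.trans (Finset.erase_subset _ _)) ?_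
      rw [Fin.val_succ]
      omega
    refine (ENNReal.div_le_div_right (Finset.sum_le_sum hrec) _).trans ?_
    rw [← Finset.sum_mul, Fin.prod_univ_succ, ENNReal.mul_div_right_comm]
    gcongr
    exact h 0 U subset_rfl (by simp)

open Classical in
/-- If all nodes are assigned, then each community receives as many labels as it has nodes. -/
theorem card_comm_eq : ∀ (k : ℕ) (d : Fin k → ℕ) (U : Finset (Slot c)), U.card = k →
    ∀ comm ∈ (assign P n c k d U).support, ∀ j,
      (Finset.univ.filter fun i => comm i = some j).card = (U.filter fun u => u.1 = j).card
  | 0, d, U, hU, comm, _, j => by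
    rw [Finset.card_eq_zero] at hU
    simp [hU]
  | k + 1, d, U, hU, comm, hcomm, j => by
    have hUn : U.Nonempty := Finset.card_pos.1 (by omega)
    rw [assign, dif_pos (candidates_nonempty hUn _), PMF.mem_support_bind_iff] at hcomm
    obtain ⟨u, hu, hcomm⟩ := hcomm
    rw [PMF.mem_support_uniformOfFinset_iff] at hu
    rw [PMF.mem_support_map_iff] at hcomm
    obtain ⟨f, hf, rfl⟩ := hcomm
    have huU := candidates_subset _ _ hu
    have ih := card_comm_eq k _ (U.erase u) (by rw [Finset.card_erase_of_mem huU]; omega) f hf j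
    rw [Finset.card_filter] at ih ⊢
    rw [Fin.sum_univ_succ]
    simp only [Fin.cons_zero, Fin.cons_succ]
    rw [ih, Finset.filter_erase]
    by_cases huj : u.1 = j
    · have hmem : u ∈ U.filter fun u => u.1 = j := Finset.mem_filter.2 ⟨huU, huj⟩
      have := Finset.card_pos.2 ⟨u, hmem⟩
      rw [Finset.card_erase_of_mem hmem, if_pos (by rw [huj])]
      omega
    · rw [Finset.erase_eq_of_notMem (by simp [huj]), if_neg (by simpa using huj), zero_add]

theorem card_filter_slot (j : Fin c.length) :
    ((Finset.univ : Finset (Slot c)).filter fun u => u.1 = j).card = c.get j := by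
  have := sum_slot_eq (c := c) fun i => if i = j then 1 else 0
  rw [Finset.sum_boole] at this
  simp only [mul_ite, mul_one, mul_zero, Finset.sum_ite_eq', Finset.mem_univ, if_true] at this
  exact_mod_cast this

end Assign

section Good

/-- A sequence of community sizes that leaves enough room for the nodes of high degree. -/
structure GoodSizes (P : Params) (n : ℕ) (c : List ℕ) : Prop where
  sum_eq : c.sum = n
  two_le : ∀ z ∈ c, 2 ≤ z
  small : 4 * (c.map fun z => if z ≤ maxDeg P n then z else 0).sum ≤ n

/-- A degree sequence in which at most a quarter of the nodes have degree `K` or more. -/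
structure GoodDegrees (P : Params) (n K : ℕ) (d : Fin n → ℕ) : Prop where
  anti : Antitone d
  le_max : ∀ i, d i ≤ maxDeg P n
  low : ∀ i : Fin n, n ≤ 4 * (i + 1) → d i < K

open Classical in
/-- The indicator that a community of size `z` may be large enough for a node of degree `a`. -/
noncomputable def adm (P : Params) (a z : ℕ) : ℝ≥0∞ := if (1 - P.ξ) * a ≤ z then 1 else 0

theorem adm_le_one (P : Params) (a z : ℕ) : adm P a z ≤ 1 := by
  rw [adm]
  split_ifs <;> simp

theorem monotone_adm (P : Params) (a : ℕ) : Monotone (adm P a) := by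
  intro z z' h
  rw [adm, adm]
  split_ifs with h1 h2
  · rfl
  · exact absurd (h1.trans (by exact_mod_cast h)) h2
  · simp
  · rfl

variable {P : Params} {n K : ℕ} {c : List ℕ} {d : Fin n → ℕ}

/-- The chance of a community to receive a given label among the first quarter is at most twice its
share of the nodes. -/
theorem GoodSizes.average_le (hc : GoodSizes P n c) (hP : P.Valid) {a : ℕ} (ha : a ≤ maxDeg P n)
    {V : Finset (Slot c)} {i : ℕ} (hV : V.card + i = n) (hi : 4 * (i + 1) < n)
    (j : Fin c.length) :
    (∑ u ∈ candidates P n c V a, if some u.1 = some j then (1 : ℝ≥0∞) else 0) /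
      (candidates P n c V a).card ≤ 2 * c.get j / n * adm P a (c.get j) := by
  classical
  obtain ⟨h1, h2, h3⟩ := one_sub_mul_phi_mem hP.ξ_pos hP.ξ_lt_one hc.sum_eq
  set A := V.filter fun u => (a : ℝ) ≤ (((c.get u.1 : ℕ) : ℝ) - 1) / (1 - P.ξ * phi n c) with hA
  have hbig : (V.filter fun u => maxDeg P n < c.get u.1) ⊆ A := by
    intro u hu
    rw [Finset.mem_filter] at hu
    rw [hA, Finset.mem_filter, le_div_iff₀ h3]
    refine ⟨hu.1, ?_⟩
    have h4 : (a : ℝ) + 1 ≤ c.get u.1 := by exact_mod_cast (by omega : a + 1 ≤ c.get u.1)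
    have h5 : (a : ℝ) * (1 - P.ξ * phi n c) ≤ a := mul_le_of_le_one_right (Nat.cast_nonneg a) h2
    linarith
  have hsmall : (V.filter fun u => ¬ maxDeg P n < c.get u.1).card
      ≤ (c.map fun z => if z ≤ maxDeg P n then z else 0).sum := by
    have h4 := sum_slot_eq (c := c) fun j => if c.get j ≤ maxDeg P n then 1 else 0
    rw [Finset.sum_boole] at h4
    have h5 : (V.filter fun u => ¬ maxDeg P n < c.get u.1).card
        ≤ ((Finset.univ : Finset (Slot c)).filter fun u => c.get u.1 ≤ maxDeg P n).card := by
      refine Finset.card_le_card fun u hu => ?_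
      rw [Finset.mem_filter] at hu ⊢
      exact ⟨Finset.mem_univ _, not_lt.1 hu.2⟩
    refine h5.trans (le_of_eq ?_)
    rw [← sum_get_eq c fun z => if z ≤ maxDeg P n then z else 0]
    have h6 : (∑ j : Fin c.length, (c.get j : ℝ≥0∞) * if c.get j ≤ maxDeg P n then 1 else 0)
        = ((∑ j : Fin c.length, if c.get j ≤ maxDeg P n then c.get j else 0 : ℕ) : ℝ≥0∞) := by
      push_cast
      refine Finset.sum_congr rfl fun j _ => ?_
      split_ifs <;> simp
    rw [h6] at h4
    exact_mod_cast h4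
  -- While a label of the first quarter is assigned, at least `3 n / 4` nodes are free, at most
  -- `n / 4` of them in communities that are not larger than the maximum degree; the others admit
  -- every label.
  have hAcard : n ≤ 2 * A.card := by
    have h4 := Finset.card_filter_add_card_filter_not (s := V) (fun u => maxDeg P n < c.get u.1)
    have h5 := Finset.card_le_card hbig
    have h6 := hc.small
    omega
  have hAne : A.Nonempty := Finset.card_pos.1 (by omega)
  have hcand : candidates P n c V a = A := by
    rw [candidates]
    exact if_pos hAne
  rw [hcand]
  have hsum : (∑ u ∈ A, if some u.1 = some j then (1 : ℝ≥0∞) else 0)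
      ≤ c.get j * adm P a (c.get j) := by
    by_cases hz : (1 - P.ξ) * a ≤ c.get j
    · rw [adm, if_pos hz, mul_one, Finset.sum_boole]
      rw [← card_filter_slot j]
      refine Nat.cast_le.2 (Finset.card_le_card fun u hu => ?_)
      rw [Finset.mem_filter] at hu ⊢
      exact ⟨Finset.mem_univ _, Option.some_injective _ hu.2⟩
    · rw [adm, if_neg hz, mul_zero, Finset.sum_eq_zero]
      intro u hu
      rw [if_neg]
      intro huj
      apply hz
      rw [hA, Finset.mem_filter, le_div_iff₀ h3, Option.some_injective _ huj] at hu
      have h4 : (a : ℝ) * (1 - P.ξ) ≤ a * (1 - P.ξ * phi n c) := by gcongr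
      linarith [hu.2]
  have hn0 : (n : ℝ≥0∞) ≠ 0 := by
    simp only [Ne, Nat.cast_eq_zero]
    omega
  have hA0 : (A.card : ℝ≥0∞) ≠ 0 := by
    simp only [Ne, Nat.cast_eq_zero]
    exact hAne.card_ne_zero
  refine (ENNReal.div_le_div_right hsum _).trans ?_
  rw [ENNReal.mul_div_right_comm]
  refine mul_le_mul' ?_ le_rfl
  rw [ENNReal.div_le_iff hA0 (by simp), ENNReal.mul_div_right_comm, mul_right_comm]
  have : (n : ℝ≥0∞) ≤ 2 * A.card := by exact_mod_cast hAcard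
  calc (c.get j : ℝ≥0∞) = (n / n : ℝ≥0∞) * c.get j := by
        rw [ENNReal.div_self hn0 (by simp), one_mul]
    _ ≤ (2 * A.card) / n * c.get j := by gcongr
    _ = 2 / n * A.card * c.get j := by rw [ENNReal.mul_div_right_comm]

/-- The law of the assignment of labels to communities. -/
noncomputable abbrev commLaw (P : Params) (n : ℕ) (c : List ℕ) (d : Fin n → ℕ) :
    PMF (Fin n → Option (Fin c.length)) := assign P n c n d Finset.univ

theorem GoodSizes.card_univ (hc : GoodSizes P n c) :
    (Finset.univ : Finset (Slot c)).card = n := by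
  rw [Finset.card_univ, card_slot, hc.sum_eq]

/-- Labels of the first quarter enter a given community as if they chose their nodes independently,
up to a factor two for each of them. -/
theorem GoodSizes.Ex_comm_prod_le (hc : GoodSizes P n c) (hP : P.Valid)
    (hd : GoodDegrees P n K d) (S : Finset (Fin n)) (hS : ∀ i ∈ S, 4 * ((i : ℕ) + 1) < n)
    (j : Fin c.length) :
    Ex (commLaw P n c d) (fun comm => ∏ i ∈ S, if comm i = some j then 1 else 0) ≤
      ∏ i ∈ S, (2 * c.get j / n * adm P (d i) (c.get j)) := by
  classical
  have h := Ex_assign_prod_le (P := P) (n := n) n d (Finset.univ : Finset (Slot c))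
    hc.card_univ.ge (fun i o => if i ∈ S then (if o = some j then 1 else 0) else 1)
    (fun i => if i ∈ S then 2 * c.get j / n * adm P (d i) (c.get j) else 1) (by
      intro i V hV hVc
      by_cases hiS : i ∈ S
      · simp only [hiS, if_true]
        rw [hc.card_univ] at hVc
        exact hc.average_le hP (hd.le_max i) hVc (hS i hiS) j
      · simp only [hiS, if_false, Finset.sum_const, nsmul_eq_mul, mul_one]
        exact ENNReal.div_self_le_one)
  simpa only [Finset.prod_ite_mem, Finset.univ_inter] using h

theorem GoodSizes.Ex_comm_le (hc : GoodSizes P n c) (hP : P.Valid) (hd : GoodDegrees P n K d)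
    {i : Fin n} (hi : 4 * ((i : ℕ) + 1) < n) (j : Fin c.length) :
    Ex (commLaw P n c d) (fun comm => if comm i = some j then 1 else 0) ≤
      2 * c.get j / n * adm P (d i) (c.get j) := by
  simpa using hc.Ex_comm_prod_le hP hd {i} (by simpa using hi) j

theorem GoodSizes.Ex_comm_pair_le (hc : GoodSizes P n c) (hP : P.Valid) (hd : GoodDegrees P n K d)
    {i k : Fin n} (hik : i ≠ k) (hi : 4 * ((i : ℕ) + 1) < n) (hk : 4 * ((k : ℕ) + 1) < n)
    (j : Fin c.length) :
    Ex (commLaw P n c d)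
      (fun comm => (if comm i = some j then 1 else 0) * if comm k = some j then 1 else 0) ≤
      (2 * c.get j / n) ^ 2 * (adm P (d i) (c.get j) * adm P (d k) (c.get j)) := by
  have := hc.Ex_comm_prod_le hP hd {i, k} (by simp [hi, hk]) j
  simp only [Finset.prod_pair hik] at this
  refine this.trans (le_of_eq ?_)
  ring

theorem GoodSizes.card_comm (hc : GoodSizes P n c) {comm : Fin n → Option (Fin c.length)}
    (h : comm ∈ (commLaw P n c d).support) (j : Fin c.length) :
    (Finset.univ.filter fun i => comm i = some j).card = c.get j := by
  classical
  rw [card_comm_eq n d _ hc.card_univ comm h j, card_filter_slot]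

/-- First moment of a sum over the nodes of a community. -/
theorem GoodSizes.Ex_sum_comm_le (hc : GoodSizes P n c) (hP : P.Valid) (hd : GoodDegrees P n K d)
    {f : ℕ → ℝ≥0∞} (hf : Monotone f) (j : Fin c.length) :
    Ex (commLaw P n c d) (fun comm => ∑ i, if comm i = some j then f (d i) else 0) ≤
      c.get j * (f K + 2 / n * ∑ i, f (d i) * adm P (d i) (c.get j)) := by
  classical
  have hle : ∀ comm ∈ (commLaw P n c d).support, (∑ i, if comm i = some j then f (d i) else 0) ≤
      c.get j * f K + ∑ i : Fin n, (if 4 * ((i : ℕ) + 1) < n then f (d i) else 0) *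
        if comm i = some j then 1 else 0 := by
    intro comm hcomm
    -- outside the first quarter, the degrees are below `K`
    have h1 : (c.get j : ℝ≥0∞) * f K = ∑ i, if comm i = some j then f K else 0 := by
      rw [← Finset.sum_filter, Finset.sum_const, hc.card_comm hcomm, nsmul_eq_mul]
    rw [h1, ← Finset.sum_add_distrib]
    refine Finset.sum_le_sum fun i _ => ?_
    by_cases hij : comm i = some j
    · by_cases hi : 4 * ((i : ℕ) + 1) < n
      · simp [hij, hi]
      · simp only [hij, hi, if_true, if_false, zero_mul, add_zero]
        exact hf (hd.low i (by omega)).le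
    · simp [hij]
  refine (Ex_mono_support hle).trans ?_
  rw [Ex_add, Ex_const, Ex_sum, mul_add]
  gcongr
  simp only [Ex_const_mul]
  rw [← mul_assoc, Finset.mul_sum]
  refine Finset.sum_le_sum fun i _ => ?_
  by_cases hi : 4 * ((i : ℕ) + 1) < n
  · rw [if_pos hi]
    refine (mul_le_mul_right (hc.Ex_comm_le hP hd hi j) _).trans (le_of_eq ?_)
    simp only [div_eq_mul_inv]
    ring
  · simp [hi]

/-- Second moment of a sum over the nodes of a community, without the diagonal. -/
theorem GoodSizes.Ex_sum_comm_pair_le (hc : GoodSizes P n c) (hP : P.Valid)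
    (hd : GoodDegrees P n K d) {f : ℕ → ℝ≥0∞} (hf : Monotone f) (j : Fin c.length) :
    Ex (commLaw P n c d) (fun comm => ∑ p ∈ (Finset.univ : Finset (Fin n)).offDiag,
      if comm p.1 = some j ∧ comm p.2 = some j then f (d p.1) * f (d p.2) else 0) ≤
      (c.get j : ℝ≥0∞) ^ 2 * (f K ^ 2 + 4 / n * f K * ∑ i, f (d i) * adm P (d i) (c.get j) +
        4 / n ^ 2 * ∑ p ∈ (Finset.univ : Finset (Fin n)).offDiag,
          f (d p.1) * f (d p.2) * (adm P (d p.1) (c.get j) * adm P (d p.2) (c.get j))) := by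
  classical
  set g : Fin n → ℝ≥0∞ := fun i => if 4 * ((i : ℕ) + 1) < n then f (d i) else 0 with hg
  set e : (Fin n → Option (Fin c.length)) → Fin n → ℝ≥0∞ :=
    fun comm i => if comm i = some j then 1 else 0 with he
  -- outside the first quarter, the degrees are below `K`
  have hfg : ∀ i, f (d i) ≤ g i + f K := by
    intro i
    by_cases hi : 4 * ((i : ℕ) + 1) < n
    · simp [hg, hi]
    · simp only [hg, hi, if_false, zero_add]
      exact hf (hd.low i (by omega)).le
  have hle : ∀ comm ∈ (commLaw P n c d).support,
      (∑ p ∈ (Finset.univ : Finset (Fin n)).offDiag,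
        if comm p.1 = some j ∧ comm p.2 = some j then f (d p.1) * f (d p.2) else 0) ≤
      (∑ p ∈ (Finset.univ : Finset (Fin n)).offDiag, g p.1 * g p.2 * (e comm p.1 * e comm p.2)) +
        2 * f K * c.get j * (∑ i, g i * e comm i) + f K ^ 2 * (c.get j : ℝ≥0∞) ^ 2 := by
    intro comm hcomm
    have hz : ∑ i, e comm i = c.get j := by
      simp only [he]
      rw [Finset.sum_boole, hc.card_comm hcomm]
    have h1 : ∀ p : Fin n × Fin n,
        (if comm p.1 = some j ∧ comm p.2 = some j then f (d p.1) * f (d p.2) else 0) ≤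
        g p.1 * g p.2 * (e comm p.1 * e comm p.2) + (f K * (g p.1 * e comm p.1 * e comm p.2) +
          f K * (e comm p.1 * (g p.2 * e comm p.2)) + f K ^ 2 * (e comm p.1 * e comm p.2)) := by
      intro p
      split_ifs with hp
      · have e1 : e comm p.1 = 1 := by simp [he, hp.1]
        have e2 : e comm p.2 = 1 := by simp [he, hp.2]
        rw [e1, e2]
        refine (mul_le_mul' (hfg p.1) (hfg p.2)).trans (le_of_eq ?_)
        ring
      · exact zero_le
    refine (Finset.sum_le_sum fun p _ => h1 p).trans ?_
    rw [Finset.sum_add_distrib, add_assoc]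
    gcongr
    refine (Finset.sum_le_sum_of_subset (Finset.subset_univ _)).trans (le_of_eq ?_)
    rw [← Finset.univ_product_univ, Finset.sum_product]
    simp only [Finset.sum_add_distrib, ← Finset.mul_sum, ← Finset.sum_mul, hz]
    ring
  refine (Ex_mono_support hle).trans ?_
  rw [Ex_add, Ex_add, Ex_const, Ex_sum, Ex_const_mul, Ex_sum]
  simp only [Ex_const_mul]
  have hA : (∑ p ∈ (Finset.univ : Finset (Fin n)).offDiag, g p.1 * g p.2 *
        Ex (commLaw P n c d) fun comm => e comm p.1 * e comm p.2) ≤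
      (c.get j : ℝ≥0∞) ^ 2 * (4 / n ^ 2 * ∑ p ∈ (Finset.univ : Finset (Fin n)).offDiag,
        f (d p.1) * f (d p.2) * (adm P (d p.1) (c.get j) * adm P (d p.2) (c.get j))) := by
    rw [← mul_assoc, Finset.mul_sum]
    refine Finset.sum_le_sum fun p hp => ?_
    have hpne := (Finset.mem_offDiag.1 hp).2.2
    by_cases h1 : 4 * ((p.1 : ℕ) + 1) < n
    · by_cases h2 : 4 * ((p.2 : ℕ) + 1) < n
      · simp only [hg, h1, h2, if_true]
        refine (mul_le_mul_right (hc.Ex_comm_pair_le hP hd hpne h1 h2 j) _).trans (le_of_eq ?_)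
        simp only [div_eq_mul_inv, mul_pow, ENNReal.inv_pow]
        ring
      · simp [hg, h2]
    · simp [hg, h1]
  have hB : (∑ i, g i * Ex (commLaw P n c d) fun comm => e comm i) ≤
      2 * c.get j / n * ∑ i, f (d i) * adm P (d i) (c.get j) := by
    rw [Finset.mul_sum]
    refine Finset.sum_le_sum fun i _ => ?_
    by_cases h1 : 4 * ((i : ℕ) + 1) < n
    · simp only [hg, h1, if_true]
      refine (mul_le_mul_right (hc.Ex_comm_le hP hd h1 j) _).trans (le_of_eq ?_)
      ring
    · simp [hg, h1]
  refine (add_le_add (add_le_add hA (mul_le_mul_right hB _)) le_rfl).trans (le_of_eq ?_)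
  simp only [div_eq_mul_inv]
  ring

end Good

/-! ### Lower bounds on the numbers of nodes of high degree in a community -/

section Potential

variable {P : Params} {n : ℕ} {c : List ℕ}

open Classical in
/-- The number of labels of degree at least `a` in the community `j`. -/
noncomputable def highCount {k : ℕ} (d : Fin k → ℕ) (a : ℕ) (j : Fin c.length)
    (comm : Fin k → Option (Fin c.length)) : ℕ :=
  (Finset.univ.filter fun i => a ≤ d i ∧ comm i = some j).card

open Classical in
/-- The number of nodes of high degree in a community is at least of the order of its expectation:
as long as the community has more than `w` unassigned nodes, each label whose degree is at least `a`
and fits the community enters it with probability at least `z / (2n)`. -/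
theorem Ex_half_pow_highCount_le (hξ0 : 0 < P.ξ) (hξ1 : P.ξ < 1) (hc : c.sum = n)
    (j : Fin c.length) {a w : ℕ} (hw : c.get j ≤ 2 * (w + 1)) (hzn : c.get j ≤ n) (hn : 0 < n) :
    ∀ (k : ℕ) (d : Fin k → ℕ) (U : Finset (Slot c)), Antitone d → k ≤ U.card →
    Ex (assign P n c k d U) (fun comm => ENNReal.ofReal ((1 / 2) ^ highCount d a j comm)) ≤
      ENNReal.ofReal ((1 - (c.get j : ℝ) / (4 * n)) ^
        (Finset.univ.filter fun i => a ≤ d i ∧ d i + 1 ≤ c.get j).card +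
        (1 / 2) ^ (U.filter fun u => u.1 = j).card * 2 ^ w)
  | 0, d, U, _, _ => by
    refine Ex_le_of_support fun comm _ => ENNReal.ofReal_le_ofReal ?_
    simp only [highCount, Finset.univ_eq_empty, Finset.filter_empty, Finset.card_empty, pow_zero]
    have : (0 : ℝ) ≤ (1 / 2) ^ (U.filter fun u => u.1 = j).card * 2 ^ w := by positivity
    linarith
  | k + 1, d, U, hd, hk => by
    have hnR : (0 : ℝ) < n := by exact_mod_cast hn
    have hznR : (c.get j : ℝ) ≤ n := by exact_mod_cast hzn
    set z := c.get j with hz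
    set t : ℝ := 1 - (z : ℝ) / (4 * n) with ht
    set u := (U.filter fun u => u.1 = j).card with hu
    set r := (Finset.univ.filter fun i => a ≤ d i ∧ d i + 1 ≤ z).card with hr
    have hq : (z : ℝ) / (4 * n) ≤ 1 / 4 := by
      rw [div_le_iff₀ (by positivity)]
      linarith
    have hq0 : 0 ≤ (z : ℝ) / (4 * n) := by positivity
    have ht0 : 0 ≤ t := by rw [ht]; linarith
    have ht1 : t ≤ 1 := by rw [ht]; linarith
    have hone : ∀ (comm : Fin (k + 1) → Option (Fin c.length)),
        ENNReal.ofReal ((1 / 2) ^ highCount d a j comm) ≤ 1 := by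
      intro comm
      rw [← ENNReal.ofReal_one]
      exact ENNReal.ofReal_le_ofReal (pow_le_one₀ (by norm_num) (by norm_num))
    have hE0 : (0 : ℝ) ≤ (1 / 2) ^ u * 2 ^ w := by positivity
    rcases Nat.lt_or_ge (d 0) a with h0 | h0
    · -- the labels come in the order of decreasing degrees, so none of degree at least `a` is left
      have hr0 : r = 0 := by
        rw [hr, Finset.card_eq_zero, Finset.filter_eq_empty_iff]
        intro i _ hi
        have := hd (Fin.zero_le i)
        omega
      refine (Ex_le_of_support fun comm _ => hone comm).trans ?_
      rw [hr0, pow_zero, ← ENNReal.ofReal_one]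
      exact ENNReal.ofReal_le_ofReal (by linarith)
    rcases Nat.lt_or_ge w u with huw | huw
    swap
    · refine (Ex_le_of_support fun comm _ => hone comm).trans ?_
      rw [← ENNReal.ofReal_one]
      refine ENNReal.ofReal_le_ofReal ?_
      -- few unassigned nodes are left in the community: the second summand is at least one
      have h1 : (1 : ℝ) ≤ (1 / 2) ^ u * 2 ^ w := by
        obtain ⟨m, rfl⟩ := Nat.exists_eq_add_of_le huw
        rw [pow_add, ← mul_assoc, ← mul_pow]
        norm_num
        exact one_le_pow₀ (by norm_num)
      have h2 : 0 ≤ t ^ r := pow_nonneg ht0 _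
      linarith
    have hU : U.Nonempty := Finset.card_pos.1 (by omega)
    rw [Ex_assign_succ d hU]
    set A := candidates P n c U (d 0) with hA
    have hAU : A ⊆ U := candidates_subset _ _
    have hAne : A.Nonempty := candidates_nonempty hU _
    set r' := (Finset.univ.filter fun i : Fin k => a ≤ d i.succ ∧ d i.succ + 1 ≤ z).card with hr'
    have hrr : r = (if d 0 + 1 ≤ z then 1 else 0) + r' := by
      rw [hr, hr', Finset.card_filter, Finset.card_filter, Fin.sum_univ_succ]
      simp [h0]
    set E0 : ℝ := (1 / 2) ^ u * 2 ^ w with hE0def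
    have hrec : ∀ v ∈ A, Ex (assign P n c k (fun i => d i.succ) (U.erase v))
        (fun f => ENNReal.ofReal ((1 / 2) ^ highCount d a j
          (Fin.cons (some v.1) f : Fin (k + 1) → Option (Fin c.length)))) ≤
        ENNReal.ofReal ((if v.1 = j then 1 / 2 else 1) * t ^ r' + E0) := by
      intro v hv
      have hvU := hAU hv
      have ih := Ex_half_pow_highCount_le hξ0 hξ1 hc j hw hzn hn (a := a) k (fun i => d i.succ)
        (U.erase v) (fun i i' hii => hd (Fin.succ_le_succ_iff.2 hii))
        (by rw [Finset.card_erase_of_mem hvU]; omega)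
      have hcnt : ∀ f : Fin k → Option (Fin c.length), highCount d a j
          (Fin.cons (some v.1) f : Fin (k + 1) → Option (Fin c.length)) =
          (if v.1 = j then 1 else 0) + highCount (fun i => d i.succ) a j f := by
        intro f
        rw [highCount, highCount, Finset.card_filter, Finset.card_filter, Fin.sum_univ_succ]
        simp [h0]
      simp only [hcnt, pow_add]
      have hnn : (0 : ℝ) ≤ (1 / 2) ^ (if v.1 = j then 1 else 0) := by positivity
      simp only [ENNReal.ofReal_mul hnn, Ex_const_mul]
      refine (mul_le_mul_right ih _).trans ?_
      rw [← ENNReal.ofReal_mul hnn]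
      refine ENNReal.ofReal_le_ofReal (le_of_eq ?_)
      rw [Finset.filter_erase]
      by_cases hvj : v.1 = j
      · have hmem : v ∈ U.filter fun u => u.1 = j := Finset.mem_filter.2 ⟨hvU, hvj⟩
        rw [Finset.card_erase_of_mem hmem, if_pos hvj, if_pos hvj, pow_one, mul_add, ← mul_assoc,
          ← pow_succ', ← hu, Nat.sub_add_cancel (by omega)]
      · rw [Finset.erase_eq_of_notMem (by simp [hvj]), if_neg hvj, if_neg hvj, pow_zero, one_mul,
          one_mul]
    refine (ENNReal.div_le_div_right (Finset.sum_le_sum hrec) _).trans ?_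
    have hAc : (0 : ℝ) < A.card := by exact_mod_cast hAne.card_pos
    rw [← ENNReal.ofReal_sum_of_nonneg fun v _ => by positivity, ← ENNReal.ofReal_natCast,
      ← ENNReal.ofReal_div_of_pos hAc]
    refine ENNReal.ofReal_le_ofReal ?_
    rw [div_le_iff₀ hAc, Finset.sum_add_distrib, ← Finset.sum_mul, Finset.sum_const, nsmul_eq_mul,
      add_mul, mul_comm (A.card : ℝ) E0]
    refine add_le_add ?_ le_rfl
    have hs : ∑ v ∈ A, (if v.1 = j then (1 / 2 : ℝ) else 1)
        = A.card - (A.filter fun v => v.1 = j).card / 2 := by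
      have h1 : ∀ v : Slot c, (if v.1 = j then (1 / 2 : ℝ) else 1)
          = 1 - (if v.1 = j then 1 else 0) / 2 := by
        intro v
        split_ifs <;> norm_num
      simp only [h1]
      rw [Finset.sum_sub_distrib, ← Finset.sum_div, Finset.sum_boole]
      simp
    rw [hs, hrr]
    have htr : 0 ≤ t ^ r' := pow_nonneg ht0 _
    split_ifs with hfit
    · -- a label that fits may choose any of the at least `z / 2` free nodes of the community, out
      -- of at most `n` candidates
      have hsub : (U.filter fun u => u.1 = j) ⊆ A.filter fun v => v.1 = j := by
        intro v hv
        rw [Finset.mem_filter] at hv ⊢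
        refine ⟨?_, hv.2⟩
        obtain ⟨h1, h2, h3⟩ := one_sub_mul_phi_mem hξ0 hξ1 hc
        have hvA : v ∈ U.filter fun u =>
            (d 0 : ℝ) ≤ (((c.get u.1 : ℕ) : ℝ) - 1) / (1 - P.ξ * phi n c) := by
          rw [Finset.mem_filter, le_div_iff₀ h3, hv.2]
          refine ⟨hv.1, ?_⟩
          have h4 : (d 0 : ℝ) + 1 ≤ c.get j := by exact_mod_cast hfit
          have h5 : (d 0 : ℝ) * (1 - P.ξ * phi n c) ≤ d 0 :=
            mul_le_of_le_one_right (Nat.cast_nonneg _) h2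
          linarith
        have hcand : candidates P n c U (d 0) = U.filter fun u =>
            (d 0 : ℝ) ≤ (((c.get u.1 : ℕ) : ℝ) - 1) / (1 - P.ξ * phi n c) := by
          rw [candidates]
          exact if_pos ⟨v, hvA⟩
        rw [hA, hcand]
        exact hvA
      have hcard := Finset.card_le_card hsub
      have h1 : (z : ℝ) / 2 ≤ (A.filter fun v => v.1 = j).card := by
        have h2 : z ≤ 2 * (A.filter fun v => v.1 = j).card := by omega
        have h3 : (z : ℝ) ≤ 2 * (A.filter fun v => v.1 = j).card := by exact_mod_cast h2
        linarith
      have h2 : (A.card : ℝ) ≤ n := by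
        have h3 : A.card ≤ Fintype.card (Slot c) := Finset.card_le_univ A
        rw [card_slot, hc] at h3
        exact_mod_cast h3
      have h4 : (A.card : ℝ) - (A.filter fun v => v.1 = j).card / 2 ≤ t * A.card := by
        rw [ht, sub_mul, one_mul]
        have : (z : ℝ) / (4 * n) * A.card ≤ z / 4 := by
          rw [div_mul_eq_mul_div, div_le_iff₀ (by positivity)]
          nlinarith [(Nat.cast_nonneg z : (0 : ℝ) ≤ z)]
        linarith
      rw [pow_add, pow_one]
      nlinarith
    · rw [zero_add]
      have : (0 : ℝ) ≤ (A.filter fun v => v.1 = j).card := Nat.cast_nonneg _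
      nlinarith

open Classical in
/-- Each sufficiently large community has, with probability at least a quarter, many nodes of high
degree and an average degree of constant order. -/
theorem GoodSizes.quarter_le_Pr (hc : GoodSizes P n c) (hP : P.Valid) {K : ℕ} {d : Fin n → ℕ}
    (hd : GoodDegrees P n K d) {C : ℝ} (hC : 0 ≤ C) (hdC : ((∑ i, d i : ℕ) : ℝ) ≤ C * n)
    (j : Fin c.length) {a x : ℕ} {y : ℝ}
    (hy : y ≤ (Finset.univ.filter fun i => a ≤ d i ∧ d i + 1 ≤ c.get j).card)
    (hx : 2 ^ x * (Real.exp (-(c.get j * y / (4 * n))) + (1 / 2) ^ (c.get j / 2)) ≤ (1 / 2 : ℝ)) :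
    1 / 4 ≤ Pr (commLaw P n c d) {comm | x ≤ highCount d a j comm ∧
      ((∑ i, if comm i = some j then d i else 0 : ℕ) : ℝ) ≤ 4 * (K + 2 * C) * c.get j} := by
  have hzmem : c.get j ∈ c := List.get_mem c j
  have hz2 : 2 ≤ c.get j := hc.two_le _ hzmem
  have hzn : c.get j ≤ n := by
    rw [← hc.sum_eq]
    exact List.le_sum_of_mem hzmem
  have hn : 0 < n := by omega
  have hnR : (0 : ℝ) < n := by exact_mod_cast hn
  have hzR : (0 : ℝ) < c.get j := by exact_mod_cast (by omega : 0 < c.get j)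
  set z := c.get j with hz
  set μ := commLaw P n c d with hμ
  set r := (Finset.univ.filter fun i => a ≤ d i ∧ d i + 1 ≤ z).card with hr
  -- few nodes of high degree
  -- the choice `w = z / 2` bounds the error term by `(1 / 2) ^ (z / 2)`
  have hX : Pr μ {comm | ¬ x ≤ highCount d a j comm} ≤ ENNReal.ofReal (1 / 2) := by
    have h1 := Ex_half_pow_highCount_le hP.ξ_pos hP.ξ_lt_one hc.sum_eq j (a := a) (w := z / 2)
      (by omega) hzn hn n d Finset.univ hd.anti hc.card_univ.ge
    rw [card_filter_slot] at h1
    have h2 : ENNReal.ofReal ((1 / 2) ^ x) * Pr μ {comm | ¬ x ≤ highCount d a j comm} ≤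
        ENNReal.ofReal ((1 / 2) ^ x) * ENNReal.ofReal (1 / 2) := by
      refine (mul_Pr_le_Ex fun comm _ hcomm => ?_).trans (h1.trans ?_)
      · refine ENNReal.ofReal_le_ofReal (pow_le_pow_of_le_one (by norm_num) (by norm_num) ?_)
        exact (not_le.1 hcomm).le
      · rw [← ENNReal.ofReal_mul (by positivity)]
        refine ENNReal.ofReal_le_ofReal ?_
        have e1 : (1 - (z : ℝ) / (4 * n)) ^ r ≤ Real.exp (-(z * y / (4 * n))) := by
          have hq : (z : ℝ) / (4 * n) ≤ 1 := by
            rw [div_le_one (by positivity)]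
            have : (z : ℝ) ≤ n := by exact_mod_cast hzn
            linarith
          have h3 : 1 - (z : ℝ) / (4 * n) ≤ Real.exp (-((z : ℝ) / (4 * n))) := by
            have := Real.add_one_le_exp (-((z : ℝ) / (4 * n)))
            linarith
          refine (pow_le_pow_left₀ (by linarith) h3 r).trans ?_
          rw [← Real.exp_nat_mul]
          refine Real.exp_le_exp.2 ?_
          have h4 : 0 ≤ (z : ℝ) / (4 * n) := by positivity
          have h5 : (z : ℝ) * y / (4 * n) = y * (z / (4 * n)) := by ring
          rw [h5]
          nlinarith
        have e2 : ((1 : ℝ) / 2) ^ z * 2 ^ (z / 2) ≤ (1 / 2) ^ (z / 2) := by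
          have h3 : ((1 : ℝ) / 2) ^ z ≤ (1 / 2) ^ (z / 2) * (1 / 2) ^ (z / 2) := by
            rw [← pow_add]
            exact pow_le_pow_of_le_one (by norm_num) (by norm_num) (by omega)
          calc ((1 : ℝ) / 2) ^ z * 2 ^ (z / 2)
              ≤ (1 / 2) ^ (z / 2) * (1 / 2) ^ (z / 2) * 2 ^ (z / 2) := by gcongr
            _ = (1 / 2) ^ (z / 2) * ((1 / 2) * 2) ^ (z / 2) := by rw [mul_pow]; ring
            _ = (1 / 2) ^ (z / 2) := by norm_num
        have e3 : ((1 : ℝ) / 2) ^ x * 2 ^ x = 1 := by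
          rw [← mul_pow]
          norm_num
        calc (1 - (z : ℝ) / (4 * n)) ^ r + (1 / 2) ^ z * 2 ^ (z / 2)
            ≤ Real.exp (-(z * y / (4 * n))) + (1 / 2) ^ (z / 2) := add_le_add e1 e2
          _ = (1 / 2) ^ x * (2 ^ x * (Real.exp (-(z * y / (4 * n))) + (1 / 2) ^ (z / 2))) := by
            rw [← mul_assoc, e3, one_mul]
          _ ≤ (1 / 2) ^ x * (1 / 2) := by gcongr
    exact (ENNReal.mul_le_mul_iff_right (by simp) (by finiteness)).1 h2
  -- a large total degree
  -- Markov's inequality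
  have hT : Pr μ {comm | ¬ ((∑ i, if comm i = some j then d i else 0 : ℕ) : ℝ)
      ≤ 4 * (K + 2 * C) * z} ≤ ENNReal.ofReal (1 / 4) := by
    have h1 := hc.Ex_sum_comm_le hP hd (f := fun k => (k : ℝ≥0∞)) Nat.mono_cast j
    have h2 : (c.get j : ℝ≥0∞) * (K + 2 / n * ∑ i, (d i : ℝ≥0∞) * adm P (d i) (c.get j)) ≤
        ENNReal.ofReal ((K + 2 * C) * z) := by
      rw [mul_comm, ENNReal.ofReal_mul (by positivity), ENNReal.ofReal_natCast]
      gcongr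
      rw [ENNReal.ofReal_add (by positivity) (by positivity), ENNReal.ofReal_natCast]
      gcongr
      have h3 : ∑ i, (d i : ℝ≥0∞) * adm P (d i) (c.get j) ≤ ENNReal.ofReal (C * n) := by
        calc ∑ i, (d i : ℝ≥0∞) * adm P (d i) (c.get j) ≤ ∑ i, (d i : ℝ≥0∞) :=
              Finset.sum_le_sum fun i _ => mul_le_of_le_one_right' (adm_le_one _ _ _)
          _ = ENNReal.ofReal ((∑ i, d i : ℕ) : ℝ) := by
              rw [ENNReal.ofReal_natCast]
              push_cast
              rfl
          _ ≤ _ := ENNReal.ofReal_le_ofReal hdC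
      calc 2 / (n : ℝ≥0∞) * ∑ i, (d i : ℝ≥0∞) * adm P (d i) (c.get j)
          ≤ 2 / (n : ℝ≥0∞) * ENNReal.ofReal (C * n) := by gcongr
        _ = ENNReal.ofReal (2 / n * (C * n)) := by
          rw [ENNReal.ofReal_mul (p := 2 / (n : ℝ)) (by positivity), ENNReal.ofReal_div_of_pos hnR,
            ENNReal.ofReal_natCast]
          norm_num
        _ = ENNReal.ofReal (2 * C) := by
          congr 1
          field_simp
    rcases eq_or_lt_of_le (show 0 ≤ (K + 2 * C) * (z : ℝ) by positivity) with h0 | h0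
    · have h5 : Pr μ {comm | ¬ ((∑ i, if comm i = some j then d i else 0 : ℕ) : ℝ)
          ≤ 4 * (K + 2 * C) * z} ≤ 0 := by
        rw [← h0, ENNReal.ofReal_zero] at h2
        refine le_trans ?_ (h1.trans h2)
        rw [← one_mul (Pr _ _)]
        refine mul_Pr_le_Ex fun comm _ hcomm => ?_
        have h6 : 4 * (K + 2 * C) * (z : ℝ) = 0 := by linarith
        have h7 : ¬ ((∑ i, if comm i = some j then d i else 0 : ℕ) : ℝ)
          ≤ 4 * (K + 2 * C) * z := hcomm
        rw [h6] at h7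
        have h8 : 1 ≤ ∑ i, if comm i = some j then d i else 0 := by
          by_contra h9
          apply h7
          have : (∑ i, if comm i = some j then d i else 0) = 0 := by omega
          rw [this]
          simp
        have h9 := (Nat.cast_le (α := ℝ≥0∞)).2 h8
        push_cast at h9
        exact h9
      exact h5.trans zero_le
    · have h5 : ENNReal.ofReal (4 * ((K + 2 * C) * z)) *
          Pr μ {comm | ¬ ((∑ i, if comm i = some j then d i else 0 : ℕ) : ℝ)
            ≤ 4 * (K + 2 * C) * z} ≤
          ENNReal.ofReal (4 * ((K + 2 * C) * z)) * ENNReal.ofReal (1 / 4) := by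
        refine (mul_Pr_le_Ex fun comm _ hcomm => ?_).trans (h1.trans (h2.trans (le_of_eq ?_)))
        · have h7 : ¬ ((∑ i, if comm i = some j then d i else 0 : ℕ) : ℝ)
            ≤ 4 * (K + 2 * C) * z := hcomm
          have h8 := ENNReal.ofReal_le_ofReal (not_le.1 h7).le
          rw [ENNReal.ofReal_natCast] at h8
          push_cast at h8
          rw [← mul_assoc]
          exact h8
        · rw [← ENNReal.ofReal_mul (by positivity)]
          congr 1
          ring
      exact (ENNReal.mul_le_mul_iff_right (by simpa using by linarith) (by finiteness)).1 h5
  -- conclusion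
  set S := {comm | x ≤ highCount d a j comm ∧
      ((∑ i, if comm i = some j then d i else 0 : ℕ) : ℝ) ≤ 4 * (K + 2 * C) * z} with hS
  have hcompl : Pr μ Sᶜ ≤ ENNReal.ofReal (3 / 4) := by
    refine (Pr_mono (t := {comm | ¬ x ≤ highCount d a j comm} ∪
      {comm | ¬ ((∑ i, if comm i = some j then d i else 0 : ℕ) : ℝ) ≤ 4 * (K + 2 * C) * z})
      fun comm _ h => ?_).trans ((Pr_union_le _ _ _).trans ((add_le_add hX hT).trans ?_))
    · by_cases hxx : x ≤ highCount d a j comm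
      · exact Or.inr fun h' => h ⟨hxx, h'⟩
      · exact Or.inl hxx
    · rw [← ENNReal.ofReal_add (by norm_num) (by norm_num)]
      norm_num
  have hone := Pr_add_compl μ S
  have h6 : (1 / 4 : ℝ≥0∞) + ENNReal.ofReal (3 / 4) ≤ Pr μ S + ENNReal.ofReal (3 / 4) := by
    calc (1 / 4 : ℝ≥0∞) + ENNReal.ofReal (3 / 4)
        = ENNReal.ofReal (1 / 4) + ENNReal.ofReal (3 / 4) := by
          congr 1
          rw [ENNReal.ofReal_div_of_pos (by norm_num)]
          norm_num
      _ = 1 := by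
        rw [← ENNReal.ofReal_add (by norm_num) (by norm_num)]
        norm_num
      _ = Pr μ S + Pr μ Sᶜ := hone.symm
      _ ≤ _ := by gcongr
  exact (ENNReal.add_le_add_iff_right (by finiteness)).1 h6

end Potential

/-! ### Rounding, parity and inverse moments of degree sums -/

section Rounding

theorem Ex_randRound (x : ℝ) (f : ℕ → ℝ≥0∞) :
    Ex (randRound x) f = ENNReal.ofReal (Int.fract x) * f (⌊x⌋₊ + 1) +
      ENNReal.ofReal (1 - Int.fract x) * f ⌊x⌋₊ := by
  rw [randRound, Ex_map, Ex, tsum_fintype, Fintype.sum_bool]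
  simp

theorem mem_support_randRound {x : ℝ} {y : ℕ} (h : y ∈ (randRound x).support) :
    y = ⌊x⌋₊ ∨ y = ⌊x⌋₊ + 1 ∧ 0 < Int.fract x := by
  rw [randRound, PMF.mem_support_map_iff] at h
  obtain ⟨b, hb, rfl⟩ := h
  cases b
  · simp
  · right
    simpa using hb

variable {P : Params}

theorem randRound_le (hP : P.Valid) {a y : ℕ} (h : y ∈ (randRound ((1 - P.ξ) * a)).support) :
    y ≤ a := by
  have hx0 : 0 ≤ (1 - P.ξ) * a := mul_nonneg (by linarith [hP.ξ_lt_one]) (Nat.cast_nonneg a)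
  have hxa : (1 - P.ξ) * a ≤ a := by
    nlinarith [hP.ξ_pos, (Nat.cast_nonneg a : (0 : ℝ) ≤ a)]
  rcases mem_support_randRound h with rfl | ⟨rfl, hf⟩
  · exact Nat.floor_le_of_le hxa
  · have h1 : ((⌊(1 - P.ξ) * a⌋₊ : ℕ) : ℝ) < (1 - P.ξ) * a := by
      have h2 := Int.floor_add_fract ((1 - P.ξ) * (a : ℝ))
      rw [← natCast_floor_eq_intCast_floor hx0] at h2
      linarith
    have : ((⌊(1 - P.ξ) * a⌋₊ : ℕ) : ℝ) < a := h1.trans_le hxa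
    exact_mod_cast this

theorem floor_le_randRound {x : ℝ} {y : ℕ} (h : y ∈ (randRound x).support) : ⌊x⌋₊ ≤ y := by
  rcases mem_support_randRound h with rfl | ⟨rfl, _⟩ <;> omega

/-- A bound on the probability generating functions at `1 / 2` of the numbers of community and
background half-edges of a node of positive degree. -/
noncomputable def roundRate (P : Params) : ℝ := 1 - min P.ξ (1 - P.ξ) / 2

theorem roundRate_lt_one (hP : P.Valid) : roundRate P < 1 := by
  have : 0 < min P.ξ (1 - P.ξ) := lt_min hP.ξ_pos (by linarith [hP.ξ_lt_one])
  rw [roundRate]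
  linarith

theorem roundRate_pos (hP : P.Valid) : 0 < roundRate P := by
  have : min P.ξ (1 - P.ξ) ≤ P.ξ := min_le_left _ _
  rw [roundRate]
  linarith [hP.ξ_lt_one]

theorem half_le_roundRate (hP : P.Valid) : 1 / 2 ≤ roundRate P := by
  have : min P.ξ (1 - P.ξ) ≤ P.ξ := min_le_left _ _
  rw [roundRate]
  linarith [hP.ξ_lt_one]

theorem Ex_half_pow_randRound_le (hP : P.Valid) {a : ℕ} (ha : 1 ≤ a) :
    Ex (randRound ((1 - P.ξ) * a)) (fun y => ENNReal.ofReal ((1 / 2) ^ y)) ≤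
      ENNReal.ofReal (roundRate P) := by
  have haR : (1 : ℝ) ≤ a := by exact_mod_cast ha
  set x := (1 - P.ξ) * (a : ℝ) with hx
  have hx0 : 1 - P.ξ ≤ x := by nlinarith [hP.ξ_lt_one]
  rcases Nat.eq_zero_or_pos ⌊x⌋₊ with h0 | h0
  · have hx1 : x < 1 := Nat.floor_eq_zero.1 h0
    have hfr : Int.fract x = x := Int.fract_eq_self.2 ⟨by linarith [hP.ξ_lt_one], hx1⟩
    rw [Ex_randRound, h0, hfr, ← ENNReal.ofReal_mul (by linarith [hP.ξ_lt_one]),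
      ← ENNReal.ofReal_mul (by linarith), ← ENNReal.ofReal_add
        (mul_nonneg (by linarith [hP.ξ_lt_one]) (by positivity))
        (mul_nonneg (by linarith) (by positivity))]
    refine ENNReal.ofReal_le_ofReal ?_
    have : min P.ξ (1 - P.ξ) ≤ 1 - P.ξ := min_le_right _ _
    rw [roundRate]
    norm_num
    linarith
  · refine Ex_le_of_support fun y hy => ENNReal.ofReal_le_ofReal ?_
    refine le_trans ?_ (half_le_roundRate hP)
    have := floor_le_randRound hy
    calc ((1 : ℝ) / 2) ^ y ≤ (1 / 2) ^ 1 :=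
          pow_le_pow_of_le_one (by norm_num) (by norm_num) (by omega)
      _ = 1 / 2 := pow_one _

theorem Ex_half_pow_sub_randRound_le (hP : P.Valid) {a : ℕ} (ha : 1 ≤ a) :
    Ex (randRound ((1 - P.ξ) * a)) (fun y => ENNReal.ofReal ((1 / 2) ^ (a - y))) ≤
      ENNReal.ofReal (roundRate P) := by
  have haR : (1 : ℝ) ≤ a := by exact_mod_cast ha
  set x := (1 - P.ξ) * (a : ℝ) with hx
  have hx0 : 0 ≤ x := mul_nonneg (by linarith [hP.ξ_lt_one]) (by linarith)
  have hxa : x ≤ a - P.ξ := by nlinarith [hP.ξ_pos]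
  have hfl : ⌊x⌋₊ < a := (Nat.floor_lt hx0).2 (by linarith [hP.ξ_pos])
  have h2 := Int.floor_add_fract x
  rw [← natCast_floor_eq_intCast_floor hx0] at h2
  rcases Nat.lt_or_ge (⌊x⌋₊ + 1) a with h0 | h0
  · refine Ex_le_of_support fun y hy => ENNReal.ofReal_le_ofReal ?_
    refine le_trans ?_ (half_le_roundRate hP)
    have : y ≤ ⌊x⌋₊ + 1 := by
      rcases mem_support_randRound hy with rfl | ⟨rfl, _⟩ <;> omega
    calc ((1 : ℝ) / 2) ^ (a - y) ≤ (1 / 2) ^ 1 :=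
          pow_le_pow_of_le_one (by norm_num) (by norm_num) (by omega)
      _ = 1 / 2 := pow_one _
  · have h1 : a = ⌊x⌋₊ + 1 := by omega
    have h3 : (a : ℝ) = ⌊x⌋₊ + 1 := by exact_mod_cast h1
    have hfr : Int.fract x ≤ 1 - P.ξ := by linarith
    have hfr0 := Int.fract_nonneg x
    have hfr1 := Int.fract_lt_one x
    have e1 : a - (⌊x⌋₊ + 1) = 0 := by omega
    have e2 : a - ⌊x⌋₊ = 1 := by omega
    rw [Ex_randRound, e1, e2, ← ENNReal.ofReal_mul hfr0, ← ENNReal.ofReal_mul (by linarith),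
      ← ENNReal.ofReal_add (by simp) (mul_nonneg (by linarith) (by positivity))]
    refine ENNReal.ofReal_le_ofReal ?_
    have : min P.ξ (1 - P.ξ) ≤ P.ξ := min_le_left _ _
    rw [roundRate]
    norm_num
    linarith

/-- The numbers of community half-edges of the nodes before the adjustment of the parity. -/
noncomputable def roundLaw (P : Params) {n : ℕ} (d : Fin n → ℕ) : PMF (Fin n → ℕ) :=
  indep fun i : Fin n => randRound ((1 - P.ξ) * d i)

/-- A node of positive degree keeps a community half-edge, and likewise a background half-edge, with
probability bounded away from zero, independently of the others. -/
theorem Ex_half_pow_sum_le (hP : P.Valid) {n : ℕ} {d : Fin n → ℕ} {S : Finset (Fin n)}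
    (hS : ∀ i ∈ S, 1 ≤ d i) :
    Ex (roundLaw P d) (fun y => ENNReal.ofReal ((1 / 2) ^ ∑ i ∈ S, y i)) ≤
        ENNReal.ofReal (roundRate P ^ S.card) ∧
      Ex (roundLaw P d) (fun y => ENNReal.ofReal ((1 / 2) ^ ∑ i ∈ S, (d i - y i))) ≤
        ENNReal.ofReal (roundRate P ^ S.card) := by
  have key : ∀ h : Fin n → ℕ → ℕ, (∀ i ∈ S, Ex (randRound ((1 - P.ξ) * d i))
      (fun y => ENNReal.ofReal ((1 / 2) ^ h i y)) ≤ ENNReal.ofReal (roundRate P)) →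
      Ex (roundLaw P d) (fun y => ENNReal.ofReal ((1 / 2) ^ ∑ i ∈ S, h i (y i))) ≤
        ENNReal.ofReal (roundRate P ^ S.card) := by
    intro h hh
    classical
    have h1 := Ex_indep_prod (fun i : Fin n => randRound ((1 - P.ξ) * d i))
      fun i y => if i ∈ S then ENNReal.ofReal ((1 / 2) ^ h i y) else 1
    have h2 : ∀ y : Fin n → ℕ, ENNReal.ofReal ((1 / 2) ^ ∑ i ∈ S, h i (y i)) =
        ∏ i, if i ∈ S then ENNReal.ofReal ((1 / 2) ^ h i (y i)) else 1 := by
      intro y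
      rw [Finset.prod_ite_mem, Finset.univ_inter, ← Finset.prod_pow_eq_pow_sum,
        ENNReal.ofReal_prod_of_nonneg fun _ _ => by positivity]
    simp only [h2]
    rw [roundLaw, h1]
    calc _ ≤ ∏ i : Fin n, (if i ∈ S then ENNReal.ofReal (roundRate P) else 1) := by
          refine Finset.prod_le_prod' fun i _ => ?_
          by_cases hi : i ∈ S
          · simpa [hi] using hh i hi
          · simp [hi]
      _ = _ := by
          rw [Finset.prod_ite_mem, Finset.univ_inter, Finset.prod_const,
            ENNReal.ofReal_pow (roundRate_pos hP).le]
  exact ⟨key (fun _ y => y) fun i hi => Ex_half_pow_randRound_le hP (hS i hi),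
    key (fun i y => d i - y) fun i hi => Ex_half_pow_sub_randRound_le hP (hS i hi)⟩

end Rounding

section InverseMoments

variable {Ω : Type*} {p : PMF Ω} {B : Ω → ℕ} {ρ : ℝ} {κ m : ℕ}

/-- The lower tail of a random variable with an exponentially small generating function at
`1 / 2`. -/
theorem Pr_lt_le_of_half_pow (h0 : 0 ≤ ρ) (h1 : ρ ≤ 1) (hκ : ρ ^ κ ≤ 1 / 4)
    (h : Ex p (fun ω => ENNReal.ofReal ((1 / 2) ^ B ω)) ≤ ENNReal.ofReal (ρ ^ m)) :
    Pr p {ω | B ω < m / κ} ≤ ENNReal.ofReal ((1 / 2) ^ (m / κ)) := by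
  set q := m / κ with hq
  have h2 : ENNReal.ofReal ((1 / 2) ^ q) * Pr p {ω | B ω < q} ≤
      ENNReal.ofReal ((1 / 2) ^ q) * ENNReal.ofReal ((1 / 2) ^ q) := by
    refine (mul_Pr_le_Ex (f := fun ω => ENNReal.ofReal ((1 / 2) ^ B ω)) fun ω _ hω => ?_).trans
      (h.trans ?_)
    · refine ENNReal.ofReal_le_ofReal (pow_le_pow_of_le_one (by norm_num) (by norm_num) ?_)
      exact (show B ω < q from hω).le
    · rw [← ENNReal.ofReal_mul (by positivity), ← mul_pow]
      refine ENNReal.ofReal_le_ofReal ?_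
      calc ρ ^ m ≤ ρ ^ (κ * q) := pow_le_pow_of_le_one h0 h1 (Nat.mul_div_le m κ)
        _ = (ρ ^ κ) ^ q := pow_mul _ _ _
        _ ≤ (1 / 4) ^ q := by gcongr
        _ = (1 / 2 * (1 / 2)) ^ q := by norm_num
  exact (ENNReal.mul_le_mul_iff_right (by simp) (by finiteness)).1 h2

/-- A random variable with an exponentially small generating function at `1 / 2` has inverse moments
of the order of those of `m`. -/
theorem Ex_inv_pow_le (h0 : 0 ≤ ρ) (h1 : ρ ≤ 1) (hκ : ρ ^ κ ≤ 1 / 4)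
    (h : Ex p (fun ω => ENNReal.ofReal ((1 / 2) ^ B ω)) ≤ ENNReal.ofReal (ρ ^ m)) :
    Ex p (fun ω => ((B ω : ℝ≥0∞) + 1)⁻¹) ≤ 2 * κ * ((m : ℝ≥0∞) + 1)⁻¹ ∧
      Ex p (fun ω => ((B ω : ℝ≥0∞) + 1)⁻¹ ^ 2) ≤ 5 * κ ^ 2 * ((m : ℝ≥0∞) + 1)⁻¹ ^ 2 := by
  have hP := Pr_lt_le_of_half_pow h0 h1 hκ h
  have hκ0 : 0 < κ := by
    rcases Nat.eq_zero_or_pos κ with rfl | h'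
    · norm_num at hκ
    · exact h'
  set q := m / κ with hq
  have hmq : m + 1 ≤ κ * (q + 1) := Nat.lt_mul_div_succ m hκ0
  have hinv : ((q : ℝ≥0∞) + 1)⁻¹ ≤ κ * ((m : ℝ≥0∞) + 1)⁻¹ := by
    rw [ENNReal.inv_le_iff_inv_le, ENNReal.mul_inv (Or.inl (by simpa using hκ0.ne'))
      (Or.inl (by simp)), inv_inv, mul_comm, ← div_eq_mul_inv]
    refine ENNReal.div_le_of_le_mul ?_
    rw [mul_comm]
    exact_mod_cast hmq
  have hhalf : ENNReal.ofReal ((1 / 2) ^ q) = ((2 : ℝ≥0∞) ^ q)⁻¹ := by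
    rw [one_div, inv_pow, ENNReal.ofReal_inv_of_pos (by positivity)]
    norm_num
  rw [hhalf] at hP
  have hpt : ∀ k : ℕ, Ex p (fun ω => ((B ω : ℝ≥0∞) + 1)⁻¹ ^ k) ≤
      ((q : ℝ≥0∞) + 1)⁻¹ ^ k + ((2 : ℝ≥0∞) ^ q)⁻¹ := by
    intro k
    refine (Ex_le_add_mul_Pr (s := {ω | B ω < q}) (b := 1)
      (g := fun _ => ((q : ℝ≥0∞) + 1)⁻¹ ^ k) (fun ω _ hω => ?_) (fun ω _ => ?_)).trans ?_
    · have : q ≤ B ω := not_lt.1 hω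
      gcongr
    · refine pow_le_one₀ zero_le (ENNReal.inv_le_one.2 le_add_self)
    · rw [Ex_const, one_mul]
      gcongr
  constructor
  · have h3 := hpt 1
    simp only [pow_one] at h3
    refine h3.trans ?_
    have h4 : ((2 : ℝ≥0∞) ^ q)⁻¹ ≤ ((q : ℝ≥0∞) + 1)⁻¹ := by
      refine ENNReal.inv_le_inv.2 ?_
      exact_mod_cast Nat.lt_two_pow_self (n := q)
    calc _ ≤ ((q : ℝ≥0∞) + 1)⁻¹ + ((q : ℝ≥0∞) + 1)⁻¹ := by gcongr
      _ ≤ κ * ((m : ℝ≥0∞) + 1)⁻¹ + κ * ((m : ℝ≥0∞) + 1)⁻¹ := by gcongr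
      _ = _ := by ring
  · refine (hpt 2).trans ?_
    have hsq : ∀ q : ℕ, (q + 1) ^ 2 ≤ 4 * 2 ^ q := by
      intro q
      induction q using Nat.twoStepInduction with
      | zero => norm_num
      | one => norm_num
      | more q ih1 ih2 =>
        have h5 := Nat.lt_two_pow_self (n := q)
        have h6 : 2 ^ (q + 2) = 4 * 2 ^ q := by ring
        rw [h6]
        linarith [show (q + 2 + 1) ^ 2 = (q + 1) ^ 2 + 4 * q + 8 by ring]
    have h4 : ((2 : ℝ≥0∞) ^ q)⁻¹ ≤ 4 * ((q : ℝ≥0∞) + 1)⁻¹ ^ 2 := by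
      rw [← ENNReal.inv_pow, ENNReal.inv_le_iff_inv_le, ENNReal.mul_inv (by simp) (by simp),
        inv_inv, mul_comm, ← div_eq_mul_inv]
      refine ENNReal.div_le_of_le_mul ?_
      rw [mul_comm]
      exact_mod_cast hsq q
    calc _ ≤ ((q : ℝ≥0∞) + 1)⁻¹ ^ 2 + 4 * ((q : ℝ≥0∞) + 1)⁻¹ ^ 2 := by gcongr
      _ = 5 * ((q : ℝ≥0∞) + 1)⁻¹ ^ 2 := by ring
      _ ≤ 5 * (κ * ((m : ℝ≥0∞) + 1)⁻¹) ^ 2 := by gcongr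
      _ = _ := by ring

end InverseMoments

section Parity

variable {n L : ℕ} {d y : Fin n → ℕ} {comm : Fin n → Option (Fin L)}

/-- The node with the least label of its community. -/
def IsLeader (comm : Fin n → Option (Fin L)) (i : Fin n) : Prop :=
  ∀ i', comm i' = comm i → i ≤ i'

theorem fixParity_of_not_isLeader {i : Fin n} (h : ¬ IsLeader comm i) :
    fixParity d comm y i = y i := by
  rw [fixParity]
  exact if_neg fun h' => h h'.1

theorem fixParity_le (hy : ∀ i, y i ≤ d i) (i : Fin n) : fixParity d comm y i ≤ d i := by
  have := hy i
  rw [fixParity]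
  split_ifs <;> omega

theorem le_fixParity_add_one (i : Fin n) : y i ≤ fixParity d comm y i + 1 := by
  rw [fixParity]
  split_ifs <;> omega

/-- The degrees of the community graph `j`. -/
def commDeg (comm : Fin n → Option (Fin L)) (y : Fin n → ℕ) (j : Fin L) (i : Fin n) : ℕ :=
  if comm i = some j then y i else 0

theorem exists_isLeader {i : Fin n} :
    ∃ l, IsLeader comm l ∧ comm l = comm i ∧ l ≤ i := by
  classical
  set S := Finset.univ.filter fun i' => comm i' = comm i with hS
  have hSne : S.Nonempty := ⟨i, by simp [hS]⟩
  have hmem := S.min'_mem hSne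
  have h1 : comm (S.min' hSne) = comm i := (Finset.mem_filter.1 hmem).2
  exact ⟨S.min' hSne, fun i' hi' => S.min'_le _ (Finset.mem_filter.2
    ⟨Finset.mem_univ _, hi'.trans h1⟩), h1, S.min'_le _ (by simp [hS])⟩

/-- After the adjustment, all community graphs have even degree sums. -/
theorem even_sum_commDeg (hd : Antitone d) (hy : ∀ i, y i ≤ d i) (j : Fin L) :
    Even (∑ i, commDeg comm (fixParity d comm y) j i) := by
  classical
  have hsum : ∀ y' : Fin n → ℕ, ∑ i, commDeg comm y' j i =
      ∑ i ∈ Finset.univ.filter (fun i => comm i = some j), y' i := by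
    intro y'
    rw [Finset.sum_filter]
    rfl
  rw [hsum]
  set S := Finset.univ.filter (fun i => comm i = some j) with hS
  by_cases hodd : Odd (∑ i ∈ S, y i)
  · have hpos : ∑ i ∈ S, y i ≠ 0 := by
      intro h0
      rw [h0] at hodd
      exact absurd hodd (by decide)
    obtain ⟨i, hiS, hi⟩ := Finset.exists_ne_zero_of_sum_ne_zero hpos
    have hij : comm i = some j := (Finset.mem_filter.1 hiS).2
    obtain ⟨l, hl, hlc, hli⟩ := exists_isLeader (comm := comm) (i := i)
    have hlS : l ∈ S := by simp [hS, hlc, hij]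
    have hdl : 1 ≤ d l := by
      have := hd hli
      have := hy i
      omega
    have hfl : fixParity d comm y l = if y l < d l then y l + 1 else y l - 1 := by
      rw [fixParity, hlc, hij]
      refine if_pos ⟨fun i' hi' => hl i' (by rw [hi', hlc, hij]), ?_⟩
      convert hodd
    have hrest : ∑ i ∈ S.erase l, fixParity d comm y i = ∑ i ∈ S.erase l, y i := by
      refine Finset.sum_congr rfl fun i' hi' => fixParity_of_not_isLeader fun hlead => ?_
      obtain ⟨hne, hi'S⟩ := Finset.mem_erase.1 hi'
      have hi'j : comm i' = some j := (Finset.mem_filter.1 hi'S).2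
      exact hne (le_antisymm (hlead l (by rw [hlc, hij, hi'j])) (hl i' (by rw [hlc, hij, hi'j])))
    rw [← Finset.add_sum_erase S _ hlS] at hodd ⊢
    rw [hrest, hfl]
    have := hy l
    rw [Nat.odd_iff] at hodd
    rw [Nat.even_iff]
    split_ifs <;> omega
  · have : ∑ i ∈ S, fixParity d comm y i = ∑ i ∈ S, y i := by
      refine Finset.sum_congr rfl fun i hi => ?_
      have hij : comm i = some j := (Finset.mem_filter.1 hi).2
      rw [fixParity, hij]
      refine if_neg fun h => hodd ?_
      convert h.2
    rw [this]
    exact Nat.not_odd_iff_even.1 hodd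

end Parity

/-! ### Collisions given the degrees and the communities -/

section Phase4

variable {P : Params} {n L : ℕ}

/-- The conditional law of the multigraph, given the degrees and the communities. -/
noncomputable def phase4 (P : Params) (d : Fin n → ℕ) (comm : Fin n → Option (Fin L)) :
    PMF (Outcome n) :=
  (roundLaw P d).bind fun y₀ =>
  (indep fun j : Fin L => configModel (commDeg comm (fixParity d comm y₀) j)).bind fun g =>
  (configModel fun i => d i - fixParity d comm y₀ i).map fun b =>
  { deg := d, L := L, comm := comm, communityGraph := g, background := b }

theorem law_eq (P : Params) (n : ℕ) : law P n = (degrees P n).bind fun d =>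
    (communitySizes P n).bind fun c => (commLaw P n c d).bind fun comm => phase4 P d comm := rfl

theorem Ex_law (P : Params) (n : ℕ) (X : Outcome n → ℝ≥0∞) :
    Ex (law P n) X = Ex (degrees P n) fun d => Ex (communitySizes P n) fun c =>
      Ex (commLaw P n c d) fun comm => Ex (phase4 P d comm) X := by
  rw [law_eq, Ex_bind]
  simp only [Ex_bind]

variable {d : Fin n → ℕ} {comm : Fin n → Option (Fin L)}

theorem Ex_phase4 (X : Outcome n → ℝ≥0∞) : Ex (phase4 P d comm) X =
    Ex (roundLaw P d) fun y₀ =>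
      Ex (indep fun j : Fin L => configModel (commDeg comm (fixParity d comm y₀) j)) fun g =>
      Ex (configModel fun i => d i - fixParity d comm y₀ i) fun b => X ⟨d, L, comm, g, b⟩ := by
  rw [phase4, Ex_bind]
  simp only [Ex_bind, Ex_map]

theorem Ex_phase4_sum_community (F : Multigraph (Fin n) → ℝ≥0∞) :
    Ex (phase4 P d comm) (fun G => ∑ j, F (G.communityGraph j)) = Ex (roundLaw P d) fun y₀ =>
      ∑ j : Fin L, Ex (configModel (commDeg comm (fixParity d comm y₀) j)) F := by
  rw [Ex_phase4]
  refine congrArg _ (funext fun y₀ => ?_)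
  change Ex _ (fun g : Fin L → Multigraph (Fin n) => Ex _ fun _ => ∑ j : Fin L, F (g j)) = _
  simp only [Ex_const]
  rw [Ex_sum]
  exact Finset.sum_congr rfl fun j _ => Ex_indep_apply _ j F

theorem Ex_phase4_background (F : Multigraph (Fin n) → ℝ≥0∞) :
    Ex (phase4 P d comm) (fun G => F G.background) = Ex (roundLaw P d) fun y₀ =>
      Ex (configModel fun i => d i - fixParity d comm y₀ i) F := by
  rw [Ex_phase4]
  simp only [Ex_const]

theorem le_of_mem_roundLaw (hP : P.Valid) {y₀ : Fin n → ℕ} (h : y₀ ∈ (roundLaw P d).support)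
    (i : Fin n) : y₀ i ≤ d i := randRound_le hP (mem_support_indep h i)

/-- The sum over all communities of a sum over the ordered pairs of distinct nodes of the
community. -/
noncomputable def pairSum (comm : Fin n → Option (Fin L)) (F : Fin L → Fin n × Fin n → ℝ≥0∞) :
    ℝ≥0∞ :=
  ∑ j, ∑ p ∈ (Finset.univ : Finset (Fin n)).offDiag,
    if comm p.1 = some j ∧ comm p.2 = some j then F j p else 0

theorem pairSum_mono {F G : Fin L → Fin n × Fin n → ℝ≥0∞}
    (h : ∀ j, ∀ p ∈ (Finset.univ : Finset (Fin n)).offDiag, F j p ≤ G j p) :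
    pairSum comm F ≤ pairSum comm G := by
  refine Finset.sum_le_sum fun j _ => Finset.sum_le_sum fun p hp => ?_
  split_ifs
  · exact h j p hp
  · rfl

theorem pairSum_const_mul (a : ℝ≥0∞) (F : Fin L → Fin n × Fin n → ℝ≥0∞) :
    pairSum comm (fun j p => a * F j p) = a * pairSum comm F := by
  simp only [pairSum, Finset.mul_sum, mul_ite, mul_zero]

theorem pairSum_add (F G : Fin L → Fin n × Fin n → ℝ≥0∞) :
    pairSum comm (fun j p => F j p + G j p) = pairSum comm F + pairSum comm G := by
  simp only [pairSum, ← Finset.sum_add_distrib]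
  refine Finset.sum_congr rfl fun j _ => Finset.sum_congr rfl fun p _ => ?_
  split_ifs <;> simp

theorem Ex_pairSum {Ω : Type*} (p : PMF Ω) (F : Ω → Fin L → Fin n × Fin n → ℝ≥0∞) :
    Ex p (fun ω => pairSum comm (F ω)) = pairSum comm fun j q => Ex p fun ω => F ω j q := by
  simp only [pairSum, Ex_sum]
  refine Finset.sum_congr rfl fun j _ => Finset.sum_congr rfl fun q _ => ?_
  split_ifs <;> simp

theorem pairSum_weight (w : Fin L → ℝ≥0∞) (F : Fin n × Fin n → ℝ≥0∞) :
    pairSum comm (fun j p => w j * F p) = ∑ j, w j *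
      ∑ p ∈ (Finset.univ : Finset (Fin n)).offDiag,
        if comm p.1 = some j ∧ comm p.2 = some j then F p else 0 := by
  simp only [pairSum, Finset.mul_sum, mul_ite, mul_zero]

theorem sum_ite_comm_le (o : Option (Fin L)) (a : ℝ≥0∞) :
    ∑ j, (if o = some j then a else 0) ≤ a := by
  cases o with
  | none => simp
  | some l => simp

theorem pairSum_le (F : Fin n × Fin n → ℝ≥0∞) : pairSum comm (fun _ p => F p) ≤
    ∑ p ∈ (Finset.univ : Finset (Fin n)).offDiag, F p := by
  rw [pairSum, Finset.sum_comm]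
  refine Finset.sum_le_sum fun p _ => ?_
  refine le_trans (Finset.sum_le_sum fun j _ => ?_) (sum_ite_comm_le (comm p.1) (F p))
  by_cases h : comm p.1 = some j
  · simp only [h, true_and, if_true]
    split_ifs <;> simp
  · simp [h]

/-- The degree sum of a community graph. -/
def commTotal (comm : Fin n → Option (Fin L)) (y : Fin n → ℕ) (j : Fin L) : ℕ :=
  ∑ i, commDeg comm y j i

theorem sum_Ex_loops_le {y : Fin n → ℕ} (hy : ∀ i, y i ≤ d i) :
    ∑ j : Fin L, Ex (configModel (commDeg comm y j)) (fun g => (loops g : ℝ≥0∞)) ≤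
    ∑ j, ((commTotal comm y j : ℝ≥0∞) + 1)⁻¹ *
      (3 * ∑ i, if comm i = some j then (d i : ℝ≥0∞) ^ 2 else 0) := by
  refine Finset.sum_le_sum fun j _ => (Ex_loops_le _).trans ?_
  rw [Finset.mul_sum, Finset.mul_sum]
  refine Finset.sum_le_sum fun i _ => ?_
  rw [div_eq_mul_inv, mul_comm, commTotal]
  gcongr
  rw [commDeg]
  split_ifs
  · exact pow_le_pow_left' (Nat.cast_le.2 (hy i)) 2
  · simp

theorem commDeg_mul_le {y : Fin n → ℕ} (hy : ∀ i, y i ≤ d i) (j : Fin L) (p : Fin n × Fin n) :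
    (commDeg comm y j p.1 : ℝ≥0∞) * commDeg comm y j p.2 ≤
      if comm p.1 = some j ∧ comm p.2 = some j then (d p.1 : ℝ≥0∞) * d p.2 else 0 := by
  rw [commDeg, commDeg]
  by_cases h1 : comm p.1 = some j <;> by_cases h2 : comm p.2 = some j
  · simp only [h1, h2, and_self, if_true]
    exact mul_le_mul' (Nat.cast_le.2 (hy _)) (Nat.cast_le.2 (hy _))
  all_goals simp [h1, h2]

theorem sum_Ex_parallelPairs_le {y : Fin n → ℕ} (hy : ∀ i, y i ≤ d i) :
    ∑ j : Fin L, Ex (configModel (commDeg comm y j)) (fun g => (parallelPairs g : ℝ≥0∞)) ≤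
    pairSum comm fun j p => ((commTotal comm y j : ℝ≥0∞) + 1)⁻¹ ^ 2 *
      (9 * ((d p.1 : ℝ≥0∞) * d p.2) ^ 2) := by
  refine Finset.sum_le_sum fun j _ => ?_
  refine (Ex_mono fun g => (Nat.cast_le (α := ℝ≥0∞)).2 (parallelPairs_le g)).trans ?_
  simp only [Nat.cast_sum]
  rw [Ex_sum]
  refine Finset.sum_le_sum fun p hp => ?_
  refine (Ex_mult_descFactorial_two_le _ (Finset.mem_offDiag.1 hp).2.2).trans ?_
  have h := commDeg_mul_le hy j p (comm := comm)
  rw [div_eq_mul_inv, mul_comm, ENNReal.inv_pow, commTotal]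
  split_ifs with hc
  · rw [if_pos hc] at h
    gcongr
  · rw [if_neg hc, nonpos_iff_eq_zero] at h
    simp [h]

theorem sum_Ex_multiEdges_le {y : Fin n → ℕ} (hy : ∀ i, y i ≤ d i) :
    ∑ j : Fin L, Ex (configModel (commDeg comm y j)) (fun g => (multiEdges g : ℝ≥0∞)) ≤
    pairSum comm fun j p => min 1 (((commTotal comm y j : ℝ≥0∞) + 1)⁻¹ ^ 2 *
      (9 * ((d p.1 : ℝ≥0∞) * d p.2) ^ 2)) := by
  refine Finset.sum_le_sum fun j _ => ?_
  refine (Ex_mono fun g => (Nat.cast_le (α := ℝ≥0∞)).2 (multiEdges_le g)).trans ?_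
  simp only [Nat.cast_sum]
  rw [Ex_sum]
  refine Finset.sum_le_sum fun p hp => ?_
  have h1 : Ex (configModel (commDeg comm y j))
      (fun g => ((if 2 ≤ mult g s(p.1, p.2) then 1 else 0 : ℕ) : ℝ≥0∞)) ≤
      9 * ((commDeg comm y j p.1 : ℝ≥0∞) * commDeg comm y j p.2) ^ 2 /
        ((∑ i, commDeg comm y j i : ℕ) + 1) ^ 2 := by
    refine le_trans (Ex_mono fun g => Nat.cast_le.2 ?_)
      (Ex_mult_descFactorial_two_le _ (Finset.mem_offDiag.1 hp).2.2)
    split_ifs with h2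
    · exact Nat.descFactorial_pos.2 h2
    · exact Nat.zero_le _
  have h := commDeg_mul_le hy j p (comm := comm)
  rw [div_eq_mul_inv, mul_comm, ENNReal.inv_pow] at h1
  split_ifs with hc
  · refine le_min (Ex_le_of_support fun g _ => ?_) (h1.trans ?_)
    · split_ifs <;> simp
    · rw [if_pos hc] at h
      rw [commTotal]
      gcongr
  · rw [if_neg hc, nonpos_iff_eq_zero] at h
    simpa [h] using h1

theorem Ex_background_loops_le_mul (d y : Fin n → ℕ) :
    Ex (configModel fun i => d i - y i) (fun g => (loops g : ℝ≥0∞)) ≤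
      (((∑ i, (d i - y i) : ℕ) : ℝ≥0∞) + 1)⁻¹ * (3 * ∑ i, (d i : ℝ≥0∞) ^ 2) := by
  refine (Ex_loops_le _).trans ?_
  rw [Finset.mul_sum, Finset.mul_sum]
  refine Finset.sum_le_sum fun i _ => ?_
  rw [div_eq_mul_inv, mul_comm]
  gcongr
  exact Nat.sub_le _ _

open Classical in
/-- A background edge coincides with a community edge only if it is a loop or joins two nodes of the
same community; the background graph and the community graphs are independent. -/
theorem Ex_Mbc_le {y : Fin n → ℕ} (hy : ∀ i, y i ≤ d i) :
    Ex (indep fun j : Fin L => configModel (commDeg comm y j)) (fun g =>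
      Ex (configModel fun i => d i - y i) fun b =>
        ((b.filter fun e => ∃ j, e ∈ g j).card : ℝ≥0∞)) ≤
    (((∑ i, (d i - y i) : ℕ) : ℝ≥0∞) + 1)⁻¹ * (3 * ∑ i, (d i : ℝ≥0∞) ^ 2) +
    pairSum comm fun j p => 3 * ((d p.1 : ℝ≥0∞) * d p.2) *
      (min 1 (((commTotal comm y j : ℝ≥0∞) + 1)⁻¹ * (3 * ((d p.1 : ℝ≥0∞) * d p.2))) *
        (((∑ i, (d i - y i) : ℕ) : ℝ≥0∞) + 1)⁻¹) := by
  set B : ℝ≥0∞ := (((∑ i, (d i - y i) : ℕ) : ℝ≥0∞) + 1)⁻¹ with hB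
  set E : (Fin L → Multigraph (Fin n)) → Fin n × Fin n → ℝ≥0∞ :=
    fun g p => if ∃ j, s(p.1, p.2) ∈ g j then 1 else 0 with hE
  have hpt : ∀ g : Fin L → Multigraph (Fin n), Ex (configModel fun i => d i - y i) (fun b =>
        ((b.filter fun e => ∃ j, e ∈ g j).card : ℝ≥0∞)) ≤ B * (3 * ∑ i, (d i : ℝ≥0∞) ^ 2) +
      ∑ p ∈ (Finset.univ : Finset (Fin n)).offDiag,
        3 * ((d p.1 : ℝ≥0∞) * d p.2) * B * E g p := by
    intro g
    refine (Ex_mono fun b => (Nat.cast_le (α := ℝ≥0∞)).2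
      (show _ ≤ loops b + ∑ p ∈ (Finset.univ : Finset (Fin n)).offDiag,
        mult b s(p.1, p.2) * if ∃ j, s(p.1, p.2) ∈ g j then 1 else 0 by
        convert card_filter_le_loops_add b fun e => ∃ j, e ∈ g j)).trans ?_
    simp only [Nat.cast_add, Nat.cast_sum, Nat.cast_mul]
    rw [Ex_add, Ex_sum]
    refine add_le_add (Ex_background_loops_le_mul d y) (Finset.sum_le_sum fun p hp => ?_)
    rw [Ex_mul_const]
    refine mul_le_mul' ((Ex_mult_le _ (Finset.mem_offDiag.1 hp).2.2).trans ?_) ?_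
    · rw [div_eq_mul_inv, ← hB]
      gcongr
      · exact Nat.sub_le _ _
      · exact Nat.sub_le _ _
    · simp only [hE]
      split_ifs <;> simp
  refine (Ex_mono hpt).trans ?_
  rw [Ex_add, Ex_const, Ex_sum, pairSum, Finset.sum_comm]
  refine add_le_add le_rfl (Finset.sum_le_sum fun p hp => ?_)
  rw [Ex_const_mul]
  have hpne := (Finset.mem_offDiag.1 hp).2.2
  have hEp : Ex (indep fun j : Fin L => configModel (commDeg comm y j)) (fun g => E g p) ≤
      ∑ j, if comm p.1 = some j ∧ comm p.2 = some j then
        min 1 (((commTotal comm y j : ℝ≥0∞) + 1)⁻¹ * (3 * ((d p.1 : ℝ≥0∞) * d p.2))) else 0 := by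
    have h1 : ∀ g : Fin L → Multigraph (Fin n), E g p ≤
        ∑ j, if s(p.1, p.2) ∈ g j then 1 else 0 := by
      intro g
      simp only [hE]
      split_ifs with hg
      · obtain ⟨j, hj⟩ := hg
        refine le_trans ?_ (Finset.single_le_sum (f := fun j =>
          if s(p.1, p.2) ∈ g j then (1 : ℝ≥0∞) else 0) (fun _ _ => zero_le)
          (Finset.mem_univ j))
        simp [hj]
      · exact zero_le
    refine (Ex_mono h1).trans ?_
    rw [Ex_sum]
    refine Finset.sum_le_sum fun j _ => ?_
    rw [Ex_indep_apply _ j fun g => if s(p.1, p.2) ∈ g then (1 : ℝ≥0∞) else 0]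
    have h2 : Ex (configModel (commDeg comm y j))
        (fun g => if s(p.1, p.2) ∈ g then (1 : ℝ≥0∞) else 0) ≤
        3 * ((commDeg comm y j p.1 : ℝ≥0∞) * commDeg comm y j p.2) /
          ((∑ i, commDeg comm y j i : ℕ) + 1) := by
      refine le_trans (Ex_mono fun g => ?_) (Ex_mult_le _ hpne)
      split_ifs with hg
      · refine Nat.one_le_cast.2 ?_
        rw [mult]
        exact (@Multiset.one_le_count_iff_mem _ (_) _ _).2 hg
      · exact zero_le
    have h := commDeg_mul_le hy j p (comm := comm)
    rw [div_eq_mul_inv, mul_comm] at h2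
    split_ifs with hc
    · refine le_min (Ex_le_of_support fun g _ => ?_) (h2.trans ?_)
      · split_ifs <;> simp
      · rw [if_pos hc] at h
        rw [commTotal]
        gcongr
    · rw [if_neg hc, nonpos_iff_eq_zero] at h
      simpa [h] using h2
  refine (mul_le_mul_right hEp _).trans (le_of_eq ?_)
  rw [Finset.mul_sum]
  refine Finset.sum_congr rfl fun j _ => ?_
  split_ifs
  · ring
  · simp

end Phase4

/-! ### Averages over the rounding -/

section Averages

variable {P : Params} {n L κ : ℕ} {d : Fin n → ℕ} {comm : Fin n → Option (Fin L)} {z : Fin L → ℕ}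

/-- The communities form a partition of the nodes into sets of the given sizes, which are at least
two, and at most one node has degree zero. -/
structure IsPartition (d : Fin n → ℕ) (comm : Fin n → Option (Fin L)) (z : Fin L → ℕ) : Prop where
  card_zero : (Finset.univ.filter fun i => d i = 0).card ≤ 1
  card_comm : ∀ j, (Finset.univ.filter fun i => comm i = some j).card = z j
  two_le : ∀ j, 2 ≤ z j
  sum_eq : ∑ j, z j = n

open Classical in
theorem IsPartition.card_not_isLeader (h : IsPartition d comm z) (j : Fin L) :
    z j ≤ (Finset.univ.filter fun i => comm i = some j ∧ ¬ IsLeader comm i).card + 1 := by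
  rw [← h.card_comm j, ← Finset.card_filter_add_card_filter_not
    (s := Finset.univ.filter fun i => comm i = some j) (fun i => ¬ IsLeader comm i),
    Finset.filter_filter, Finset.filter_filter]
  refine Nat.add_le_add_left (Finset.card_le_one.2 fun a ha b hb => ?_) _
  simp only [Finset.mem_filter, Finset.mem_univ, true_and, not_not] at ha hb
  exact le_antisymm (ha.2 b (hb.1.trans ha.1.symm)) (hb.2 a (ha.1.trans hb.1.symm))

open Classical in
theorem IsPartition.le_card_comm (h : IsPartition d comm z) (j : Fin L) :
    z j ≤ 2 * ((Finset.univ.filter fun i =>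
      (comm i = some j ∧ ¬ IsLeader comm i) ∧ 1 ≤ d i).card + 1) := by
  have h1 := h.card_not_isLeader j
  have h2 := h.card_zero
  have h3 := h.two_le j
  have h4 := Finset.card_filter_add_card_filter_not
    (s := Finset.univ.filter fun i => comm i = some j ∧ ¬ IsLeader comm i) (fun i => 1 ≤ d i)
  rw [Finset.filter_filter, Finset.filter_filter] at h4
  have h5 : (Finset.univ.filter fun i =>
      (comm i = some j ∧ ¬ IsLeader comm i) ∧ ¬ 1 ≤ d i).card ≤
      (Finset.univ.filter fun i => d i = 0).card := by
    refine Finset.card_le_card fun i hi => ?_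
    simp only [Finset.mem_filter, Finset.mem_univ, true_and] at hi ⊢
    omega
  omega

open Classical in
theorem IsPartition.le_card (h : IsPartition d comm z) :
    n ≤ 2 * ((Finset.univ.filter fun i => ¬ IsLeader comm i ∧ 1 ≤ d i).card + 1) := by
  have h1 : ∑ j, (Finset.univ.filter fun i => comm i = some j ∧ ¬ IsLeader comm i).card ≤
      (Finset.univ.filter fun i => ¬ IsLeader comm i).card := by
    simp only [Finset.card_filter]
    rw [Finset.sum_comm]
    refine Finset.sum_le_sum fun i _ => ?_
    by_cases hl : IsLeader comm i
    · simp [hl]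
    · cases hi : comm i with
      | none => simp
      | some l => simp [hl]
  have h2 : n ≤ 2 * ∑ j, (Finset.univ.filter fun i =>
      comm i = some j ∧ ¬ IsLeader comm i).card := by
    conv_lhs => rw [← h.sum_eq]
    rw [Finset.mul_sum]
    refine Finset.sum_le_sum fun j _ => ?_
    have := h.card_not_isLeader j
    have := h.two_le j
    omega
  have h4 := Finset.card_filter_add_card_filter_not
    (s := Finset.univ.filter fun i => ¬ IsLeader comm i) (fun i => 1 ≤ d i)
  rw [Finset.filter_filter, Finset.filter_filter] at h4
  have h5 : (Finset.univ.filter fun i => ¬ IsLeader comm i ∧ ¬ 1 ≤ d i).card ≤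
      (Finset.univ.filter fun i => d i = 0).card := by
    refine Finset.card_le_card fun i hi => ?_
    simp only [Finset.mem_filter, Finset.mem_univ, true_and] at hi ⊢
    omega
  have := h.card_zero
  omega

theorem inv_add_one_le {m z : ℕ} (h : z ≤ 2 * (m + 1)) :
    ((m : ℝ≥0∞) + 1)⁻¹ ≤ 2 * (z : ℝ≥0∞)⁻¹ := by
  have h1 : (z : ℝ≥0∞) ≤ 2 * (m + 1) := by exact_mod_cast h
  rw [ENNReal.inv_le_iff_inv_le, ENNReal.mul_inv (by simp) (by simp), inv_inv, mul_comm,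
    ← div_eq_mul_inv]
  refine ENNReal.div_le_of_le_mul ?_
  rwa [mul_comm]

/-- Inverse moments of the degree sum of a community graph. -/
theorem IsPartition.Ex_inv_commTotal_le (h : IsPartition d comm z) (hP : P.Valid)
    (hκ : roundRate P ^ κ ≤ 1 / 4) (j : Fin L) :
    Ex (roundLaw P d) (fun y₀ =>
      ((commTotal comm (fixParity d comm y₀) j : ℝ≥0∞) + 1)⁻¹) ≤ 4 * κ * (z j : ℝ≥0∞)⁻¹ ∧
    Ex (roundLaw P d) (fun y₀ =>
      ((commTotal comm (fixParity d comm y₀) j : ℝ≥0∞) + 1)⁻¹ ^ 2) ≤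
      20 * κ ^ 2 * (z j : ℝ≥0∞)⁻¹ ^ 2 := by
  classical
  -- all nodes but the leader keep their rounded degrees when the parity is adjusted
  set S := Finset.univ.filter fun i => (comm i = some j ∧ ¬ IsLeader comm i) ∧ 1 ≤ d i with hS
  have hle : ∀ y₀ : Fin n → ℕ, ∑ i ∈ S, y₀ i ≤ commTotal comm (fixParity d comm y₀) j := by
    intro y₀
    have h1 : ∑ i ∈ S, y₀ i = ∑ i ∈ S, commDeg comm (fixParity d comm y₀) j i := by
      refine Finset.sum_congr rfl fun i hi => ?_
      have hi' := (Finset.mem_filter.1 hi).2.1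
      rw [commDeg, if_pos hi'.1, fixParity_of_not_isLeader hi'.2]
    rw [h1]
    exact Finset.sum_le_sum_of_subset (Finset.subset_univ S)
  have hgen := (Ex_half_pow_sum_le hP (S := S) fun i hi => (Finset.mem_filter.1 hi).2.2).1
  obtain ⟨h1, h2⟩ := Ex_inv_pow_le (roundRate_pos hP).le (roundRate_lt_one hP).le hκ hgen
  have h3 := inv_add_one_le (h.le_card_comm j)
  have h4 : ∀ y₀ : Fin n → ℕ, ((commTotal comm (fixParity d comm y₀) j : ℝ≥0∞) + 1)⁻¹ ≤
      (((∑ i ∈ S, y₀ i : ℕ) : ℝ≥0∞) + 1)⁻¹ := by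
    intro y₀
    have := hle y₀
    gcongr
  constructor
  · calc _ ≤ _ := Ex_mono h4
      _ ≤ _ := h1
      _ ≤ 2 * κ * (2 * (z j : ℝ≥0∞)⁻¹) := by gcongr
      _ = _ := by ring
  · calc _ ≤ _ := Ex_mono fun y₀ => pow_le_pow_left' (h4 y₀) 2
      _ ≤ _ := h2
      _ ≤ 5 * κ ^ 2 * (2 * (z j : ℝ≥0∞)⁻¹) ^ 2 := by gcongr
      _ = _ := by ring

/-- Inverse moments of the degree sum of the background graph. The last statement allows a factor
that depends on the rounding: up to an exponentially small error, the degree sum may be replaced by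
its order `n`. -/
theorem IsPartition.Ex_inv_background_le (h : IsPartition d comm z) (hP : P.Valid)
    (hκ : roundRate P ^ κ ≤ 1 / 4) :
    Ex (roundLaw P d) (fun y₀ =>
      (((∑ i, (d i - fixParity d comm y₀ i) : ℕ) : ℝ≥0∞) + 1)⁻¹) ≤ 4 * κ * (n : ℝ≥0∞)⁻¹ ∧
    Ex (roundLaw P d) (fun y₀ =>
      (((∑ i, (d i - fixParity d comm y₀ i) : ℕ) : ℝ≥0∞) + 1)⁻¹ ^ 2) ≤
      20 * κ ^ 2 * (n : ℝ≥0∞)⁻¹ ^ 2 ∧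
    ∀ u : (Fin n → ℕ) → ℝ≥0∞, (∀ y₀, u y₀ ≤ 1) → Ex (roundLaw P d) (fun y₀ => u y₀ *
      (((∑ i, (d i - fixParity d comm y₀ i) : ℕ) : ℝ≥0∞) + 1)⁻¹) ≤
      2 * κ * (n : ℝ≥0∞)⁻¹ * Ex (roundLaw P d) u +
        ENNReal.ofReal ((1 / 2) ^ ((n - 2) / 2 / κ)) := by
  classical
  set S := Finset.univ.filter fun i => ¬ IsLeader comm i ∧ 1 ≤ d i with hS
  have hle : ∀ y₀ : Fin n → ℕ, ∑ i ∈ S, (d i - y₀ i) ≤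
      ∑ i, (d i - fixParity d comm y₀ i) := by
    intro y₀
    have h1 : ∑ i ∈ S, (d i - y₀ i) = ∑ i ∈ S, (d i - fixParity d comm y₀ i) := by
      refine Finset.sum_congr rfl fun i hi => ?_
      rw [fixParity_of_not_isLeader (Finset.mem_filter.1 hi).2.1]
    rw [h1]
    exact Finset.sum_le_sum_of_subset (Finset.subset_univ S)
  have hgen := (Ex_half_pow_sum_le hP (S := S) fun i hi => (Finset.mem_filter.1 hi).2.2).2
  obtain ⟨h1, h2⟩ := Ex_inv_pow_le (roundRate_pos hP).le (roundRate_lt_one hP).le hκ hgen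
  have hcard : n ≤ 2 * (S.card + 1) := by convert h.le_card
  have h3 := inv_add_one_le hcard
  have h4 : ∀ y₀ : Fin n → ℕ,
      (((∑ i, (d i - fixParity d comm y₀ i) : ℕ) : ℝ≥0∞) + 1)⁻¹ ≤
      (((∑ i ∈ S, (d i - y₀ i) : ℕ) : ℝ≥0∞) + 1)⁻¹ := by
    intro y₀
    have := hle y₀
    gcongr
  refine ⟨?_, ?_, fun u hu => ?_⟩
  · calc _ ≤ _ := Ex_mono h4
      _ ≤ _ := h1
      _ ≤ 2 * κ * (2 * (n : ℝ≥0∞)⁻¹) := by gcongr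
      _ = _ := by ring
  · calc _ ≤ _ := Ex_mono fun y₀ => pow_le_pow_left' (h4 y₀) 2
      _ ≤ _ := h2
      _ ≤ 5 * κ ^ 2 * (2 * (n : ℝ≥0∞)⁻¹) ^ 2 := by gcongr
      _ = _ := by ring
  · have hκ0 : 0 < κ := by
      rcases Nat.eq_zero_or_pos κ with rfl | h'
      · norm_num at hκ
      · exact h'
    have htail := Pr_lt_le_of_half_pow (roundRate_pos hP).le (roundRate_lt_one hP).le hκ hgen
    set q := S.card / κ with hq
    have hmq : S.card + 1 ≤ κ * (q + 1) := Nat.lt_mul_div_succ _ hκ0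
    have hinv : ((q : ℝ≥0∞) + 1)⁻¹ ≤ 2 * κ * (n : ℝ≥0∞)⁻¹ := by
      have h5 : n ≤ 2 * κ * (q + 1) := by nlinarith
      have h6 : (n : ℝ≥0∞) ≤ 2 * κ * (q + 1) := by exact_mod_cast h5
      rw [ENNReal.inv_le_iff_inv_le, ENNReal.mul_inv (Or.inl (by simp [hκ0.ne']))
        (Or.inl (by finiteness)), inv_inv, mul_comm, ← div_eq_mul_inv]
      refine ENNReal.div_le_of_le_mul ?_
      rwa [mul_comm]
    refine (Ex_le_add_mul_Pr (s := {y₀ | ∑ i ∈ S, (d i - y₀ i) < q}) (b := 1)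
      (g := fun y₀ => 2 * κ * (n : ℝ≥0∞)⁻¹ * u y₀) (fun y₀ _ hy₀ => ?_)
      (fun y₀ _ => ?_)).trans ?_
    · rw [mul_comm]
      refine mul_le_mul' ((h4 y₀).trans (le_trans ?_ hinv)) le_rfl
      have : q ≤ ∑ i ∈ S, (d i - y₀ i) := not_lt.1 hy₀
      gcongr
    · exact mul_le_one' (hu y₀) (ENNReal.inv_le_one.2 le_add_self)
    · rw [Ex_const_mul, one_mul]
      refine add_le_add le_rfl (htail.trans (ENNReal.ofReal_le_ofReal ?_))
      refine pow_le_pow_of_le_one (by norm_num) (by norm_num) (Nat.div_le_div_right ?_)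
      omega

theorem min_one_mul_le {a x : ℝ≥0∞} (ha : 1 ≤ a) : min 1 (a * x) ≤ a * min 1 x := by
  rcases le_total x 1 with h | h
  · rw [min_eq_right h]
    exact min_le_right _ _
  · rw [min_eq_left h, mul_one]
    exact (min_le_left _ _).trans ha

theorem min_one_le_rpow {x : ℝ≥0∞} {b : ℝ} (h0 : 0 < b) (h1 : b ≤ 1) : min 1 x ≤ x ^ b := by
  rcases le_total x 1 with h | h
  · rw [min_eq_right h]
    calc x = x ^ (1 : ℝ) := (ENNReal.rpow_one x).symm
      _ ≤ x ^ b := ENNReal.rpow_le_rpow_of_exponent_ge h h1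
  · rw [min_eq_left h]
    exact ENNReal.one_le_rpow h h0

theorem IsPartition.Ex_Sc_le (h : IsPartition d comm z) (hP : P.Valid)
    (hκ : roundRate P ^ κ ≤ 1 / 4) :
    Ex (phase4 P d comm) (fun G => (G.Sc : ℝ≥0∞)) ≤ 12 * κ *
      ∑ j, (z j : ℝ≥0∞)⁻¹ * ∑ i, if comm i = some j then (d i : ℝ≥0∞) ^ 2 else 0 := by
  simp only [Outcome.Sc, Nat.cast_sum]
  rw [Ex_phase4_sum_community fun g => (loops g : ℝ≥0∞)]
  refine (Ex_mono_support fun y₀ hy₀ => sum_Ex_loops_le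
    (fixParity_le (le_of_mem_roundLaw hP hy₀))).trans ?_
  rw [Ex_sum, Finset.mul_sum]
  refine Finset.sum_le_sum fun j _ => ?_
  rw [Ex_mul_const]
  refine (mul_le_mul_left (h.Ex_inv_commTotal_le hP hκ j).1 _).trans (le_of_eq ?_)
  ring

theorem IsPartition.Ex_parallelPairs_le (h : IsPartition d comm z) (hP : P.Valid)
    (hκ : roundRate P ^ κ ≤ 1 / 4) :
    Ex (phase4 P d comm) (fun G => (G.Mc' : ℝ≥0∞)) ≤ 180 * κ ^ 2 *
      pairSum comm fun j p => (z j : ℝ≥0∞)⁻¹ ^ 2 * ((d p.1 : ℝ≥0∞) ^ 2 * (d p.2 : ℝ≥0∞) ^ 2) := by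
  simp only [Outcome.Mc', Nat.cast_sum]
  rw [Ex_phase4_sum_community fun g => (parallelPairs g : ℝ≥0∞)]
  refine (Ex_mono_support fun y₀ hy₀ => sum_Ex_parallelPairs_le
    (fixParity_le (le_of_mem_roundLaw hP hy₀))).trans ?_
  rw [Ex_pairSum, ← pairSum_const_mul]
  refine pairSum_mono fun j p _ => ?_
  rw [Ex_mul_const]
  refine (mul_le_mul_left (h.Ex_inv_commTotal_le hP hκ j).2 _).trans (le_of_eq ?_)
  ring

/-- The probability of a multi-edge between two nodes is, up to a constant factor, at most
`min 1 (x ^ 2)`, where `x` is the product of their degrees over the size of the community, and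
`min 1 (x ^ 2) ≤ x ^ a`. -/
theorem IsPartition.Ex_multiEdges_le (h : IsPartition d comm z) (hP : P.Valid)
    (hκ : roundRate P ^ κ ≤ 1 / 4) (hκ1 : 1 ≤ κ) {a : ℝ} (ha : 0 < a) (ha2 : a ≤ 2) :
    Ex (phase4 P d comm) (fun G => (G.Mc : ℝ≥0∞)) ≤ 180 * κ ^ 2 *
      pairSum comm fun j p => (z j : ℝ≥0∞)⁻¹ ^ a * ((d p.1 : ℝ≥0∞) ^ a * (d p.2 : ℝ≥0∞) ^ a) := by
  simp only [Outcome.Mc, Nat.cast_sum]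
  rw [Ex_phase4_sum_community fun g => (multiEdges g : ℝ≥0∞)]
  refine (Ex_mono_support fun y₀ hy₀ => sum_Ex_multiEdges_le
    (fixParity_le (le_of_mem_roundLaw hP hy₀))).trans ?_
  rw [Ex_pairSum, ← pairSum_const_mul]
  refine pairSum_mono fun j p _ => ?_
  have hconst : (1 : ℝ≥0∞) ≤ 180 * κ ^ 2 := by
    have : 1 ≤ 180 * κ ^ 2 := by nlinarith
    exact_mod_cast this
  have h1 : Ex (roundLaw P d) (fun y₀ =>
      min 1 (((commTotal comm (fixParity d comm y₀) j : ℝ≥0∞) + 1)⁻¹ ^ 2 *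
        (9 * ((d p.1 : ℝ≥0∞) * d p.2) ^ 2))) ≤
      min 1 (180 * κ ^ 2 * ((z j : ℝ≥0∞)⁻¹ * ((d p.1 : ℝ≥0∞) * d p.2)) ^ 2) := by
    refine le_min (Ex_le_of_support fun _ _ => min_le_left _ _) ?_
    refine (Ex_mono fun _ => min_le_right _ _).trans ?_
    rw [Ex_mul_const]
    refine (mul_le_mul_left (h.Ex_inv_commTotal_le hP hκ j).2 _).trans (le_of_eq ?_)
    ring
  refine (h1.trans (min_one_mul_le hconst)).trans ?_
  gcongr
  set x : ℝ≥0∞ := (z j : ℝ≥0∞)⁻¹ * ((d p.1 : ℝ≥0∞) * d p.2) with hx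
  calc min 1 (x ^ 2) ≤ (x ^ 2) ^ (a / 2) := min_one_le_rpow (by linarith) (by linarith)
    _ = x ^ a := by
      rw [← ENNReal.rpow_natCast, ← ENNReal.rpow_mul]
      congr 1
      push_cast
      ring
    _ = _ := by
      rw [hx, ENNReal.mul_rpow_of_nonneg _ _ ha.le, ENNReal.mul_rpow_of_nonneg _ _ ha.le]

theorem IsPartition.Ex_Sb_le (h : IsPartition d comm z) (hP : P.Valid)
    (hκ : roundRate P ^ κ ≤ 1 / 4) :
    Ex (phase4 P d comm) (fun G => (G.Sb : ℝ≥0∞)) ≤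
      12 * κ * ((n : ℝ≥0∞)⁻¹ * ∑ i, (d i : ℝ≥0∞) ^ 2) := by
  simp only [Outcome.Sb]
  rw [Ex_phase4_background fun g => (loops g : ℝ≥0∞)]
  refine (Ex_mono fun y₀ => Ex_background_loops_le_mul d _).trans ?_
  rw [Ex_mul_const]
  refine (mul_le_mul_left (h.Ex_inv_background_le hP hκ).1 _).trans (le_of_eq ?_)
  ring

theorem IsPartition.Ex_background_parallelPairs_le (h : IsPartition d comm z) (hP : P.Valid)
    (hκ : roundRate P ^ κ ≤ 1 / 4) :
    Ex (phase4 P d comm) (fun G => (G.Mb' : ℝ≥0∞)) ≤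
      180 * κ ^ 2 * ((n : ℝ≥0∞)⁻¹ ^ 2 * ∑ p ∈ (Finset.univ : Finset (Fin n)).offDiag,
        (d p.1 : ℝ≥0∞) ^ 2 * (d p.2 : ℝ≥0∞) ^ 2) := by
  simp only [Outcome.Mb']
  rw [Ex_phase4_background fun g => (parallelPairs g : ℝ≥0∞)]
  have hpt : ∀ y : Fin n → ℕ, Ex (configModel fun i => d i - y i)
      (fun g => (parallelPairs g : ℝ≥0∞)) ≤ (((∑ i, (d i - y i) : ℕ) : ℝ≥0∞) + 1)⁻¹ ^ 2 *
      (9 * ∑ p ∈ (Finset.univ : Finset (Fin n)).offDiag,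
        (d p.1 : ℝ≥0∞) ^ 2 * (d p.2 : ℝ≥0∞) ^ 2) := by
    intro y
    refine (Ex_mono fun g => (Nat.cast_le (α := ℝ≥0∞)).2 (parallelPairs_le g)).trans ?_
    simp only [Nat.cast_sum]
    rw [Ex_sum, Finset.mul_sum, Finset.mul_sum]
    refine Finset.sum_le_sum fun p hp => ?_
    refine (Ex_mult_descFactorial_two_le _ (Finset.mem_offDiag.1 hp).2.2).trans ?_
    rw [div_eq_mul_inv, mul_comm, ENNReal.inv_pow, ← mul_pow]
    push_cast
    gcongr
    · exact_mod_cast Nat.sub_le (d p.1) (y p.1)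
    · exact_mod_cast Nat.sub_le (d p.2) (y p.2)
  refine (Ex_mono fun y₀ => hpt _).trans ?_
  rw [Ex_mul_const]
  refine (mul_le_mul_left (h.Ex_inv_background_le hP hκ).2.1 _).trans (le_of_eq ?_)
  ring

theorem Ex_phase4_Mbc (d : Fin n → ℕ) (comm : Fin n → Option (Fin L)) (hP : P.Valid) :
    Ex (phase4 P d comm) (fun G => (G.Mbc : ℝ≥0∞)) ≤ Ex (roundLaw P d) fun y₀ =>
    (((∑ i, (d i - fixParity d comm y₀ i) : ℕ) : ℝ≥0∞) + 1)⁻¹ * (3 * ∑ i, (d i : ℝ≥0∞) ^ 2) +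
    pairSum comm fun j p => 3 * ((d p.1 : ℝ≥0∞) * d p.2) *
      (min 1 (((commTotal comm (fixParity d comm y₀) j : ℝ≥0∞) + 1)⁻¹ *
        (3 * ((d p.1 : ℝ≥0∞) * d p.2))) *
        (((∑ i, (d i - fixParity d comm y₀ i) : ℕ) : ℝ≥0∞) + 1)⁻¹) := by
  rw [Ex_phase4]
  exact Ex_mono_support fun y₀ hy₀ => Ex_Mbc_le (fixParity_le (le_of_mem_roundLaw hP hy₀))

/-- Two nodes of a community are joined in the community graph with probability of the order of
`min 1 x ≤ x ^ b` at most, where `x` is the product of their degrees over the size of the community,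
and then in the background graph with probability of the order of the product of their degrees over
`n`. The last summand is the price for the dependence of the two degree sums. -/
theorem IsPartition.Ex_Mbc_le (h : IsPartition d comm z) (hP : P.Valid)
    (hκ : roundRate P ^ κ ≤ 1 / 4) (hκ1 : 1 ≤ κ) {b : ℝ} (hb : 0 < b) (hb1 : b ≤ 1) :
    Ex (phase4 P d comm) (fun G => (G.Mbc : ℝ≥0∞)) ≤
      12 * κ * ((n : ℝ≥0∞)⁻¹ * ∑ i, (d i : ℝ≥0∞) ^ 2) +
      72 * κ ^ 2 * ((n : ℝ≥0∞)⁻¹ * pairSum comm fun j p => (z j : ℝ≥0∞)⁻¹ ^ b *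
        ((d p.1 : ℝ≥0∞) ^ (1 + b) * (d p.2 : ℝ≥0∞) ^ (1 + b))) +
      3 * ENNReal.ofReal ((1 / 2) ^ ((n - 2) / 2 / κ)) *
        ∑ p ∈ (Finset.univ : Finset (Fin n)).offDiag, (d p.1 : ℝ≥0∞) * d p.2 := by
  refine (Ex_phase4_Mbc d comm hP).trans ?_
  rw [Ex_add, add_assoc]
  refine add_le_add ?_ ?_
  · rw [Ex_mul_const]
    refine (mul_le_mul_left (h.Ex_inv_background_le hP hκ).1 _).trans (le_of_eq ?_)
    ring
  set ε := ENNReal.ofReal ((1 / 2) ^ ((n - 2) / 2 / κ)) with hε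
  rw [Ex_pairSum]
  have hconst : (1 : ℝ≥0∞) ≤ 12 * κ := by
    have : 1 ≤ 12 * κ := by omega
    exact_mod_cast this
  have hmain : pairSum comm (fun j p => Ex (roundLaw P d) fun y₀ =>
      3 * ((d p.1 : ℝ≥0∞) * d p.2) *
      (min 1 (((commTotal comm (fixParity d comm y₀) j : ℝ≥0∞) + 1)⁻¹ *
        (3 * ((d p.1 : ℝ≥0∞) * d p.2))) *
        (((∑ i, (d i - fixParity d comm y₀ i) : ℕ) : ℝ≥0∞) + 1)⁻¹)) ≤
      pairSum comm fun j p => (72 * κ ^ 2 * (n : ℝ≥0∞)⁻¹ * ((z j : ℝ≥0∞)⁻¹ ^ b *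
        ((d p.1 : ℝ≥0∞) ^ (1 + b) * (d p.2 : ℝ≥0∞) ^ (1 + b))) +
        3 * ε * ((d p.1 : ℝ≥0∞) * d p.2)) := by
    refine pairSum_mono fun j p _ => ?_
    set x : ℝ≥0∞ := (d p.1 : ℝ≥0∞) * d p.2 with hx
    rw [Ex_const_mul]
    refine (mul_le_mul_right ((h.Ex_inv_background_le hP hκ).2.2 _
      fun _ => min_le_left _ _) _).trans ?_
    rw [mul_add]
    refine add_le_add ?_ (le_of_eq (by ring))
    have h1 : Ex (roundLaw P d) (fun y₀ =>
        min 1 (((commTotal comm (fixParity d comm y₀) j : ℝ≥0∞) + 1)⁻¹ * (3 * x))) ≤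
        12 * κ * ((z j : ℝ≥0∞)⁻¹ * x) ^ b := by
      refine le_trans (le_min (Ex_le_of_support fun _ _ => min_le_left _ _)
        ((Ex_mono fun _ => min_le_right _ _).trans ?_)) ((min_one_mul_le hconst).trans
          (mul_le_mul_right (min_one_le_rpow hb hb1) _))
      rw [Ex_mul_const]
      refine (mul_le_mul_left (h.Ex_inv_commTotal_le hP hκ j).1 _).trans (le_of_eq ?_)
      ring
    have h2 : x * x ^ b = (d p.1 : ℝ≥0∞) ^ (1 + b) * (d p.2 : ℝ≥0∞) ^ (1 + b) := by
      rw [← ENNReal.mul_rpow_of_nonneg _ _ (by linarith), ← hx,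
        ENNReal.rpow_add_of_nonneg _ _ zero_le_one hb.le, ENNReal.rpow_one]
    calc _ ≤ 3 * x * (2 * κ * (n : ℝ≥0∞)⁻¹ * (12 * κ * ((z j : ℝ≥0∞)⁻¹ * x) ^ b)) := by gcongr
      _ = 72 * κ ^ 2 * (n : ℝ≥0∞)⁻¹ * ((z j : ℝ≥0∞)⁻¹ ^ b * (x * x ^ b)) := by
        rw [ENNReal.mul_rpow_of_nonneg _ _ hb.le]
        ring
      _ = _ := by rw [h2]
  refine hmain.trans ?_
  rw [pairSum_add, pairSum_const_mul, pairSum_const_mul]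
  refine add_le_add (le_of_eq (by ring)) ?_
  gcongr
  exact pairSum_le _

/-- A crude bound on the number of collisions, for use on events of very small probability. -/
theorem Ex_phase4_le (hP : P.Valid) {D : ℕ} (hD : 1 ≤ D) (hd : ∀ i, d i ≤ D)
    (comm : Fin n → Option (Fin L)) :
    Ex (phase4 P d comm) (fun G => (G.Sc : ℝ≥0∞)) ≤ 9 * (n ^ 2 * D ^ 4 : ℕ) ∧
    Ex (phase4 P d comm) (fun G => (G.Mc' : ℝ≥0∞)) ≤ 9 * (n ^ 2 * D ^ 4 : ℕ) ∧
    Ex (phase4 P d comm) (fun G => (G.Mbc : ℝ≥0∞)) ≤ 9 * (n ^ 2 * D ^ 4 : ℕ) := by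
  have hinv : ∀ m : ℕ, ((m : ℝ≥0∞) + 1)⁻¹ ≤ 1 := fun m => ENNReal.inv_le_one.2 le_add_self
  have hsq : ∑ i, (d i : ℝ≥0∞) ^ 2 ≤ (n ^ 2 * D ^ 4 : ℕ) := by
    calc ∑ i, (d i : ℝ≥0∞) ^ 2 = ((∑ i, d i ^ 2 : ℕ) : ℝ≥0∞) := by push_cast; rfl
      _ ≤ _ := by
        refine Nat.cast_le.2 ?_
        calc ∑ i, d i ^ 2 ≤ ∑ _i : Fin n, D ^ 2 :=
              Finset.sum_le_sum fun i _ => Nat.pow_le_pow_left (hd i) 2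
          _ = n * D ^ 2 := by simp
          _ ≤ n ^ 2 * D ^ 4 :=
            Nat.mul_le_mul (Nat.le_self_pow two_ne_zero n) (Nat.pow_le_pow_right hD (by norm_num))
  have hpair : ∑ p ∈ (Finset.univ : Finset (Fin n)).offDiag, ((d p.1 : ℝ≥0∞) * d p.2) ^ 2 ≤
      (n ^ 2 * D ^ 4 : ℕ) := by
    calc ∑ p ∈ (Finset.univ : Finset (Fin n)).offDiag, ((d p.1 : ℝ≥0∞) * d p.2) ^ 2
        = ((∑ p ∈ (Finset.univ : Finset (Fin n)).offDiag, (d p.1 * d p.2) ^ 2 : ℕ) : ℝ≥0∞) := by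
          push_cast
          rfl
      _ ≤ _ := by
        refine Nat.cast_le.2 ?_
        calc ∑ p ∈ (Finset.univ : Finset (Fin n)).offDiag, (d p.1 * d p.2) ^ 2
            ≤ ∑ p ∈ (Finset.univ : Finset (Fin n)).offDiag, D ^ 4 := by
              refine Finset.sum_le_sum fun p _ => ?_
              calc (d p.1 * d p.2) ^ 2 ≤ (D * D) ^ 2 :=
                    Nat.pow_le_pow_left (Nat.mul_le_mul (hd _) (hd _)) 2
                _ = D ^ 4 := by ring
          _ ≤ ∑ p : Fin n × Fin n, D ^ 4 := Finset.sum_le_sum_of_subset (Finset.subset_univ _)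
          _ = n ^ 2 * D ^ 4 := by simp [sq]
  have hpair1 : ∑ p ∈ (Finset.univ : Finset (Fin n)).offDiag, (d p.1 : ℝ≥0∞) * d p.2 ≤
      (n ^ 2 * D ^ 4 : ℕ) := by
    refine le_trans (Finset.sum_le_sum fun p _ => ?_) hpair
    exact_mod_cast Nat.le_self_pow two_ne_zero (d p.1 * d p.2)
  refine ⟨?_, ?_, ?_⟩
  · simp only [Outcome.Sc, Nat.cast_sum]
    rw [Ex_phase4_sum_community fun g => (loops g : ℝ≥0∞)]
    refine Ex_le_of_support fun y₀ hy₀ => (sum_Ex_loops_le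
      (fixParity_le (le_of_mem_roundLaw hP hy₀))).trans ?_
    calc _ ≤ ∑ j : Fin L, 1 * (3 * ∑ i, if comm i = some j then (d i : ℝ≥0∞) ^ 2 else 0) := by
          gcongr
          exact hinv _
      _ = 3 * ∑ i, ∑ j : Fin L, if comm i = some j then (d i : ℝ≥0∞) ^ 2 else 0 := by
        rw [Finset.sum_comm, Finset.mul_sum]
        simp only [one_mul]
      _ ≤ 3 * ∑ i, (d i : ℝ≥0∞) ^ 2 := by
        gcongr
        exact sum_ite_comm_le _ _
      _ ≤ 9 * (n ^ 2 * D ^ 4 : ℕ) := by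
        gcongr
        norm_num
  · simp only [Outcome.Mc', Nat.cast_sum]
    rw [Ex_phase4_sum_community fun g => (parallelPairs g : ℝ≥0∞)]
    refine Ex_le_of_support fun y₀ hy₀ => (sum_Ex_parallelPairs_le
      (fixParity_le (le_of_mem_roundLaw hP hy₀))).trans ?_
    calc _ ≤ pairSum comm fun _ p => 9 * ((d p.1 : ℝ≥0∞) * d p.2) ^ 2 :=
          pairSum_mono fun j p _ => mul_le_of_le_one_left' (pow_le_one₀ zero_le (hinv _))
      _ ≤ ∑ p ∈ (Finset.univ : Finset (Fin n)).offDiag, 9 * ((d p.1 : ℝ≥0∞) * d p.2) ^ 2 :=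
        pairSum_le _
      _ = 9 * ∑ p ∈ (Finset.univ : Finset (Fin n)).offDiag, ((d p.1 : ℝ≥0∞) * d p.2) ^ 2 :=
        (Finset.mul_sum _ _ _).symm
      _ ≤ _ := by gcongr
  · refine (Ex_phase4_Mbc d comm hP).trans (Ex_le_of_support fun y₀ _ => ?_)
    calc _ ≤ 1 * (3 * ∑ i, (d i : ℝ≥0∞) ^ 2) +
          pairSum comm fun _ p => 3 * ((d p.1 : ℝ≥0∞) * d p.2) := by
          refine add_le_add (mul_le_mul_left (hinv _) _) (pairSum_mono fun j p _ => ?_)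
          exact mul_le_of_le_one_right' (mul_le_one' (min_le_left _ _) (hinv _))
      _ ≤ 3 * (n ^ 2 * D ^ 4 : ℕ) + 3 * (n ^ 2 * D ^ 4 : ℕ) := by
          rw [one_mul]
          gcongr
          refine (pairSum_le _).trans ?_
          rw [← Finset.mul_sum]
          gcongr
      _ = 6 * (n ^ 2 * D ^ 4 : ℕ) := by ring
      _ ≤ _ := by
          gcongr
          norm_num

end Averages

/-! ### Bounds on the expected numbers of collisions -/

section Regime

variable {P : Params} {n K κ : ℕ}

/-- The values of `n` for which the estimates hold; `K` is a bound on the degrees of all but the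
first quarter of the nodes. -/
structure Regime (P : Params) (n K : ℕ) : Prop where
  size : SizeRange P n
  deg : P.δ ≤ maxDeg P n
  tail : Pr (tpl P.γ P.δ (maxDeg P n)) {k | K ≤ k} ≤ 1 / 30
  deg_le : 8 * maxDeg P n ≤ n
  small : Ex (sizeLaw P n) (fun a => if a ≤ maxDeg P n then (a : ℝ≥0∞) + 1 else 0) ≤
    meanSize P n / 500

/-- A bound on the probability that the degrees or the community sizes are atypical. -/
noncomputable def badProb (P : Params) (n : ℕ) : ℝ≥0∞ :=
  ENNReal.ofReal ((3 / 4) ^ n) + ENNReal.ofReal (Real.exp (-(n / (64 * maxComm P n))))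

theorem Regime.maxDeg_pos (h : Regime P n K) (hP : P.Valid) : 1 ≤ maxDeg P n :=
  hP.one_le_δ.trans h.deg

theorem Regime.mem_communitySizes (h : Regime P n K) {c : List ℕ}
    (hc : c ∈ (communitySizes P n).support) :
    c.sum = n ∧ ∀ z ∈ c, P.s ≤ z ∧ z ≤ maxComm P n + 1 := by
  rw [communitySizes_eq, PMF.mem_support_map_iff] at hc
  obtain ⟨l, hl, rfl⟩ := hc
  have := h.size.adjustSizes_spec hl
  exact ⟨this.1, this.2.1⟩

theorem Regime.Pr_not_goodDegrees_le (h : Regime P n K) (hP : P.Valid) :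
    Pr (degrees P n) {d | ¬ GoodDegrees P n K d} ≤ ENNReal.ofReal ((3 / 4) ^ n) := by
  refine le_trans (Pr_mono fun d hd hbad => ?_) (Pr_degrees_high_le h.tail)
  obtain ⟨h1, h2, -⟩ := mem_support_degrees hP.one_le_δ h.deg hd
  refine ⟨h1, ?_⟩
  by_contra hcon
  push Not at hcon
  exact hbad ⟨h1, h2, hcon⟩

theorem Regime.Pr_not_goodSizes_le (h : Regime P n K) :
    Pr (communitySizes P n) {c | ¬ GoodSizes P n c} ≤
      ENNReal.ofReal (Real.exp (-(n / (64 * maxComm P n)))) := by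
  refine le_trans (Pr_mono fun c hc hbad => ?_) (h.size.Pr_small_ge h.deg_le h.small)
  obtain ⟨h1, h2⟩ := h.mem_communitySizes hc
  by_contra hcon
  exact hbad ⟨h1, fun z hz => h.size.two_le.trans (h2 z hz).1, not_lt.1 hcon⟩

theorem Regime.isPartition (h : Regime P n K) (hP : P.Valid) {d : Fin n → ℕ}
    (hd : d ∈ (degrees P n).support) {c : List ℕ} (hc : c ∈ (communitySizes P n).support)
    {comm : Fin n → Option (Fin c.length)} (hcomm : comm ∈ (commLaw P n c d).support) :
    IsPartition d comm c.get := by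
  classical
  obtain ⟨h1, h2⟩ := h.mem_communitySizes hc
  refine ⟨(mem_support_degrees hP.one_le_δ h.deg hd).2.2, fun j => ?_, fun j =>
    h.size.two_le.trans (h2 _ (List.get_mem c j)).1, ?_⟩
  · rw [card_comm_eq n d _ (by rw [Finset.card_univ, card_slot, h1]) comm hcomm j, card_filter_slot]
  · rw [← h1]
    simp

/-- Averages over typical degrees and sizes, up to the contribution of the atypical ones. -/
theorem Regime.Ex_law_le (h : Regime P n K) (hP : P.Valid) {X : Outcome n → ℝ≥0∞}
    {R : (Fin n → ℕ) → List ℕ → ℝ≥0∞} {b : ℝ≥0∞}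
    (hR : ∀ d ∈ (degrees P n).support, ∀ c ∈ (communitySizes P n).support, GoodDegrees P n K d →
      GoodSizes P n c → Ex (commLaw P n c d) (fun comm => Ex (phase4 P d comm) X) ≤ R d c)
    (hb : ∀ d ∈ (degrees P n).support, ∀ c ∈ (communitySizes P n).support,
      ∀ comm : Fin n → Option (Fin c.length), Ex (phase4 P d comm) X ≤ b) :
    Ex (law P n) X ≤ Ex (degrees P n) (fun d => Ex (communitySizes P n) (R d)) +
      b * badProb P n := by
  rw [Ex_law]
  have hHb : ∀ d ∈ (degrees P n).support, ∀ c ∈ (communitySizes P n).support,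
      Ex (commLaw P n c d) (fun comm => Ex (phase4 P d comm) X) ≤ b := fun d hd c hc =>
    Ex_le_of_support fun comm _ => hb d hd c hc comm
  refine (Ex_le_add_mul_Pr (s := {d | ¬ GoodDegrees P n K d}) (b := b)
    (g := fun d => Ex (communitySizes P n) (R d) + b * Pr (communitySizes P n)
      {c | ¬ GoodSizes P n c}) (fun d hd hgood => ?_)
    (fun d hd => Ex_le_of_support fun c hc => hHb d hd c hc)).trans ?_
  · refine Ex_le_add_mul_Pr (fun c hc hcgood => ?_) (hHb d hd)
    exact hR d hd c hc (not_not.1 hgood) (not_not.1 hcgood)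
  · rw [Ex_add, Ex_const, badProb, mul_add, add_assoc,
      add_comm (b * ENNReal.ofReal ((3 / 4) ^ n))]
    gcongr
    · exact h.Pr_not_goodSizes_le
    · exact h.Pr_not_goodDegrees_le hP

/-- The number of nodes divided by the mean size of a drawn community. -/
noncomputable def commCount (P : Params) (n : ℕ) : ℝ≥0∞ := n / meanSize P n

theorem Regime.Ex_sizes_sum_le (h : Regime P n K) {g : ℕ → ℝ≥0∞} (hg : Monotone g) :
    Ex (communitySizes P n) (fun c => (c.map g).sum) ≤
      2 * commCount P n * Ex (sizeLaw P n) fun a => g (a + 1) := by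
  have h1 := h.size.meanSize_mul_Ex_sum_le hg
  have h0 : meanSize P n ≠ 0 := (lt_of_lt_of_le one_pos h.size.one_le_meanSize).ne'
  rw [mul_comm, ← ENNReal.le_div_iff_mul_le (Or.inl h0) (Or.inl h.size.meanSize_ne_top)] at h1
  refine h1.trans (le_of_eq ?_)
  rw [commCount, div_eq_mul_inv, div_eq_mul_inv]
  ring

/-- The moments of the degree distribution. -/
noncomputable def moment (P : Params) (n : ℕ) (a : ℝ) : ℝ≥0∞ :=
  Ex (tpl P.γ P.δ (maxDeg P n)) fun k => (k : ℝ≥0∞) ^ a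

theorem monotone_natCast_rpow {a : ℝ} (ha : 0 ≤ a) : Monotone fun k : ℕ => (k : ℝ≥0∞) ^ a :=
  fun _ _ h => ENNReal.rpow_le_rpow (Nat.cast_le.2 h) ha

theorem Ex_degrees_inv_mul_sum_le {f : ℕ → ℝ≥0∞} (hf : Monotone f) :
    (n : ℝ≥0∞)⁻¹ * Ex (degrees P n) (fun d => ∑ i, f (d i)) ≤
      Ex (tpl P.γ P.δ (maxDeg P n)) f := by
  refine (mul_le_mul_right (Ex_degrees_sum_le hf) _).trans ?_
  rw [← mul_assoc]
  exact mul_le_of_le_one_left' (ENNReal.inv_mul_le_one _)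

theorem Ex_degrees_inv_mul_sum_offDiag_le {g : ℕ → ℕ → ℝ≥0∞}
    (hg : ∀ a b a' b', a ≤ a' → b ≤ b' → g a b ≤ g a' b') :
    (n : ℝ≥0∞)⁻¹ ^ 2 * Ex (degrees P n) (fun d =>
      ∑ p ∈ (Finset.univ : Finset (Fin n)).offDiag, g (d p.1) (d p.2)) ≤
      Ex (tpl P.γ P.δ (maxDeg P n)) fun a => Ex (tpl P.γ P.δ (maxDeg P n)) fun b => g a b := by
  refine (mul_le_mul_right (Ex_degrees_sum_offDiag_le hg) _).trans ?_
  rw [← mul_assoc, ← mul_pow]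
  exact mul_le_of_le_one_left' (pow_le_one₀ zero_le (ENNReal.inv_mul_le_one _))

theorem Ex_degrees_pair_le {a : ℝ} (ha : 0 ≤ a) :
    (n : ℝ≥0∞)⁻¹ ^ 2 * Ex (degrees P n) (fun d =>
      ∑ p ∈ (Finset.univ : Finset (Fin n)).offDiag, (d p.1 : ℝ≥0∞) ^ a * (d p.2 : ℝ≥0∞) ^ a) ≤
      moment P n a ^ 2 := by
  refine (Ex_degrees_inv_mul_sum_offDiag_le (g := fun x y => (x : ℝ≥0∞) ^ a * (y : ℝ≥0∞) ^ a)
    fun x y x' y' hx hy => mul_le_mul' (monotone_natCast_rpow ha hx)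
      (monotone_natCast_rpow ha hy)).trans (le_of_eq ?_)
  simp only [Ex_const_mul, Ex_mul_const]
  rw [sq]
  rfl

theorem Regime.Ex_Sb_le (h : Regime P n K) (hP : P.Valid) (hκ : roundRate P ^ κ ≤ 1 / 4) :
    Ex (law P n) (fun G => (G.Sb : ℝ≥0∞)) ≤ 12 * κ * moment P n 2 := by
  rw [Ex_law]
  refine (Ex_mono_support (g := fun d => 12 * κ * ((n : ℝ≥0∞)⁻¹ * ∑ i, (d i : ℝ≥0∞) ^ (2 : ℝ)))
    fun d hd => Ex_le_of_support fun c hc => Ex_le_of_support fun comm hcomm => ?_).trans ?_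
  · have := (h.isPartition hP hd hc hcomm).Ex_Sb_le hP hκ
    simpa only [ENNReal.rpow_two] using this
  · simp only [Ex_const_mul]
    gcongr
    exact Ex_degrees_inv_mul_sum_le (monotone_natCast_rpow zero_le_two)

theorem Regime.Ex_background_parallelPairs_le (h : Regime P n K) (hP : P.Valid)
    (hκ : roundRate P ^ κ ≤ 1 / 4) :
    Ex (law P n) (fun G => (G.Mb' : ℝ≥0∞)) ≤ 180 * κ ^ 2 * moment P n 2 ^ 2 := by
  rw [Ex_law]
  refine (Ex_mono_support (g := fun d => 180 * κ ^ 2 * ((n : ℝ≥0∞)⁻¹ ^ 2 *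
    ∑ p ∈ (Finset.univ : Finset (Fin n)).offDiag,
      (d p.1 : ℝ≥0∞) ^ (2 : ℝ) * (d p.2 : ℝ≥0∞) ^ (2 : ℝ)))
    fun d hd => Ex_le_of_support fun c hc => Ex_le_of_support fun comm hcomm => ?_).trans ?_
  · have := (h.isPartition hP hd hc hcomm).Ex_background_parallelPairs_le hP hκ
    simpa only [ENNReal.rpow_two] using this
  · simp only [Ex_const_mul]
    gcongr
    exact Ex_degrees_pair_le zero_le_two

/-- The error that the atypical degrees and sizes contribute to the expectations. -/
noncomputable def errorTerm (P : Params) (n : ℕ) : ℝ≥0∞ :=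
  9 * (n ^ 2 * maxDeg P n ^ 4 : ℕ) * badProb P n

theorem Regime.Ex_phase4_le (h : Regime P n K) (hP : P.Valid) {d : Fin n → ℕ}
    (hd : d ∈ (degrees P n).support) {L : ℕ} (comm : Fin n → Option (Fin L)) :
    Ex (phase4 P d comm) (fun G => (G.Sc : ℝ≥0∞)) ≤ 9 * (n ^ 2 * maxDeg P n ^ 4 : ℕ) ∧
    Ex (phase4 P d comm) (fun G => (G.Mc' : ℝ≥0∞)) ≤ 9 * (n ^ 2 * maxDeg P n ^ 4 : ℕ) ∧
    Ex (phase4 P d comm) (fun G => (G.Mbc : ℝ≥0∞)) ≤ 9 * (n ^ 2 * maxDeg P n ^ 4 : ℕ) :=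
  ABCD.Ex_phase4_le hP (h.maxDeg_pos hP) (mem_support_degrees hP.one_le_δ h.deg hd).2.1 comm

/-- The probability that a community is large enough for a node of degree `a`. -/
noncomputable def admProb (P : Params) (n a : ℕ) : ℝ≥0∞ :=
  Ex (sizeLaw P n) fun z => adm P a (z + 1)

theorem inv_mul_natCast_le_one (z : ℕ) : (z : ℝ≥0∞)⁻¹ * z ≤ 1 := ENNReal.inv_mul_le_one _

/-- The drawn degrees dominate the actual ones only in the averages of monotone functions, so a
monotone majorant `G` of the function of interest is needed. -/
theorem Regime.Ex_Sc_le (h : Regime P n K) (hP : P.Valid) (hκ : roundRate P ^ κ ≤ 1 / 4)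
    {G : ℕ → ℝ≥0∞} (hG : Monotone G) (hGA : ∀ a : ℕ, (a : ℝ≥0∞) ^ 2 * admProb P n a ≤ G a) :
    Ex (law P n) (fun G => (G.Sc : ℝ≥0∞)) ≤
      12 * κ * (2 * commCount P n * ((K : ℝ≥0∞) ^ 2 + 2 * Ex (tpl P.γ P.δ (maxDeg P n)) G)) +
        errorTerm P n := by
  refine (h.Ex_law_le hP (b := 9 * (n ^ 2 * maxDeg P n ^ 4 : ℕ))
    (R := fun d c => 12 * κ * (c.map fun z => ((K : ℝ≥0∞) ^ 2 + 2 / n *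
      ∑ i, (d i : ℝ≥0∞) ^ 2 * adm P (d i) z)).sum) (fun d hd c hc hdg hcg => ?_)
    fun d hd c _ comm => (h.Ex_phase4_le hP hd comm).1).trans ?_
  · refine (Ex_mono_support fun comm hcomm =>
      (h.isPartition hP hd hc hcomm).Ex_Sc_le hP hκ).trans ?_
    rw [Ex_const_mul, Ex_sum, ← sum_get_eq c fun z => ((K : ℝ≥0∞) ^ 2 + 2 / n *
      ∑ i, (d i : ℝ≥0∞) ^ 2 * adm P (d i) z)]
    gcongr with j
    rw [Ex_const_mul]
    refine (mul_le_mul_right (hcg.Ex_sum_comm_le hP hdg (f := fun k => (k : ℝ≥0∞) ^ 2)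
      (fun a b hab => pow_le_pow_left' (Nat.cast_le.2 hab) 2) j) _).trans ?_
    rw [← mul_assoc]
    exact mul_le_of_le_one_left' (inv_mul_natCast_le_one _)
  · rw [errorTerm]
    refine add_le_add ?_ le_rfl
    simp only [Ex_const_mul]
    gcongr
    have h1 : ∀ d : Fin n → ℕ, Ex (communitySizes P n) (fun c => (c.map fun z =>
        ((K : ℝ≥0∞) ^ 2 + 2 / n * ∑ i, (d i : ℝ≥0∞) ^ 2 * adm P (d i) z)).sum) ≤
        2 * commCount P n * ((K : ℝ≥0∞) ^ 2 + 2 * ((n : ℝ≥0∞)⁻¹ * ∑ i, G (d i))) := by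
      intro d
      refine (h.Ex_sizes_sum_le fun a b hab => ?_).trans ?_
      · gcongr
        exact monotone_adm P _ hab
      · rw [Ex_add, Ex_const, Ex_const_mul, Ex_sum, div_eq_mul_inv, mul_assoc 2 (n : ℝ≥0∞)⁻¹]
        simp only [Ex_const_mul]
        refine mul_le_mul_right (add_le_add le_rfl (mul_le_mul_right (mul_le_mul_right
          (Finset.sum_le_sum fun i _ => hGA (d i)) _) _)) _
    refine (Ex_mono h1).trans ?_
    simp only [Ex_const_mul, Ex_add, Ex_const]
    gcongr
    exact Ex_degrees_inv_mul_sum_le hG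

theorem adm_mul_adm_le (P : Params) (a b z : ℕ) : adm P a z * adm P b z ≤ adm P (max a b) z := by
  rcases le_total a b with hab | hab
  · rw [max_eq_right hab]
    exact mul_le_of_le_one_left' (adm_le_one _ _ _)
  · rw [max_eq_left hab]
    exact mul_le_of_le_one_right' (adm_le_one _ _ _)

/-- As for the self-loops, the functions of the degrees are replaced by monotone majorants. Two
nodes fit into a community if the one of larger degree does. -/
theorem Regime.Ex_parallelPairs_le (h : Regime P n K) (hP : P.Valid)
    (hκ : roundRate P ^ κ ≤ 1 / 4) {G : ℕ → ℝ≥0∞} (hG : Monotone G)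
    (hGA : ∀ a : ℕ, (a : ℝ≥0∞) ^ 2 * admProb P n a ≤ G a) {G₂ : ℕ → ℕ → ℝ≥0∞}
    (hG₂ : ∀ a b a' b', a ≤ a' → b ≤ b' → G₂ a b ≤ G₂ a' b')
    (hGA₂ : ∀ a b : ℕ, (a : ℝ≥0∞) ^ 2 * (b : ℝ≥0∞) ^ 2 * admProb P n (max a b) ≤ G₂ a b) :
    Ex (law P n) (fun G => (G.Mc' : ℝ≥0∞)) ≤
      180 * κ ^ 2 * (2 * commCount P n * ((K : ℝ≥0∞) ^ 4 +
        4 * (K : ℝ≥0∞) ^ 2 * Ex (tpl P.γ P.δ (maxDeg P n)) G +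
        4 * Ex (tpl P.γ P.δ (maxDeg P n)) fun a => Ex (tpl P.γ P.δ (maxDeg P n)) fun b =>
          G₂ a b)) + errorTerm P n := by
  set g : (Fin n → ℕ) → ℕ → ℝ≥0∞ := fun d z => ((K : ℝ≥0∞) ^ 2) ^ 2 + 4 / n * (K : ℝ≥0∞) ^ 2 *
    ∑ i, (d i : ℝ≥0∞) ^ 2 * adm P (d i) z + 4 / n ^ 2 *
      ∑ p ∈ (Finset.univ : Finset (Fin n)).offDiag,
        (d p.1 : ℝ≥0∞) ^ 2 * (d p.2 : ℝ≥0∞) ^ 2 * (adm P (d p.1) z * adm P (d p.2) z) with hg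
  refine (h.Ex_law_le hP (b := 9 * (n ^ 2 * maxDeg P n ^ 4 : ℕ))
    (R := fun d c => 180 * κ ^ 2 * (c.map (g d)).sum) (fun d hd c hc hdg hcg => ?_)
    fun d hd c _ comm => (h.Ex_phase4_le hP hd comm).2.1).trans ?_
  · refine (Ex_mono_support fun comm hcomm =>
      (h.isPartition hP hd hc hcomm).Ex_parallelPairs_le hP hκ).trans ?_
    rw [Ex_const_mul, ← sum_get_eq c (g d)]
    gcongr
    simp only [pairSum_weight (fun j : Fin c.length => (c.get j : ℝ≥0∞)⁻¹ ^ 2)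
      (fun p => (d p.1 : ℝ≥0∞) ^ 2 * (d p.2 : ℝ≥0∞) ^ 2)]
    rw [Ex_sum]
    refine Finset.sum_le_sum fun j _ => ?_
    rw [Ex_const_mul]
    refine (mul_le_mul_right (hcg.Ex_sum_comm_pair_le hP hdg (f := fun k => (k : ℝ≥0∞) ^ 2)
      (fun a b hab => pow_le_pow_left' (Nat.cast_le.2 hab) 2) j) _).trans ?_
    rw [← mul_assoc, ← mul_pow]
    exact mul_le_of_le_one_left' (pow_le_one₀ zero_le (inv_mul_natCast_le_one _))
  · rw [errorTerm]
    refine add_le_add ?_ le_rfl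
    simp only [Ex_const_mul]
    gcongr
    have h1 : ∀ d : Fin n → ℕ, Ex (communitySizes P n) (fun c => (c.map (g d)).sum) ≤
        2 * commCount P n * ((K : ℝ≥0∞) ^ 4 +
          4 * (K : ℝ≥0∞) ^ 2 * ((n : ℝ≥0∞)⁻¹ * ∑ i, G (d i)) + 4 * ((n : ℝ≥0∞)⁻¹ ^ 2 *
          ∑ p ∈ (Finset.univ : Finset (Fin n)).offDiag, G₂ (d p.1) (d p.2))) := by
      intro d
      refine (h.Ex_sizes_sum_le fun a b hab => ?_).trans ?_
      · simp only [hg]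
        gcongr <;> exact monotone_adm P _ hab
      · simp only [hg]
        rw [Ex_add, Ex_add, Ex_const, Ex_const_mul, Ex_const_mul, Ex_sum, Ex_sum]
        simp only [Ex_const_mul]
        have e1 : (4 / n : ℝ≥0∞) * (K : ℝ≥0∞) ^ 2 *
            ∑ i, (d i : ℝ≥0∞) ^ 2 * Ex (sizeLaw P n) (fun z => adm P (d i) (z + 1)) ≤
            4 * (K : ℝ≥0∞) ^ 2 * ((n : ℝ≥0∞)⁻¹ * ∑ i, G (d i)) := by
          calc _ = 4 * (K : ℝ≥0∞) ^ 2 * ((n : ℝ≥0∞)⁻¹ *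
                ∑ i, (d i : ℝ≥0∞) ^ 2 * admProb P n (d i)) := by
                simp only [admProb]
                rw [div_eq_mul_inv]
                ring
            _ ≤ _ := by
                gcongr with i
                exact hGA (d i)
        have e2 : (4 / (n : ℝ≥0∞) ^ 2) * ∑ p ∈ (Finset.univ : Finset (Fin n)).offDiag,
            (d p.1 : ℝ≥0∞) ^ 2 * (d p.2 : ℝ≥0∞) ^ 2 * Ex (sizeLaw P n)
              (fun z => adm P (d p.1) (z + 1) * adm P (d p.2) (z + 1)) ≤
            4 * ((n : ℝ≥0∞)⁻¹ ^ 2 *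
              ∑ p ∈ (Finset.univ : Finset (Fin n)).offDiag, G₂ (d p.1) (d p.2)) := by
          rw [div_eq_mul_inv, ENNReal.inv_pow, mul_assoc 4]
          gcongr with p
          refine le_trans ?_ (hGA₂ (d p.1) (d p.2))
          gcongr
          exact Ex_mono fun z => adm_mul_adm_le P _ _ _
        rw [← pow_mul]
        gcongr
    refine (Ex_mono h1).trans ?_
    simp only [Ex_const_mul, Ex_add, Ex_const]
    gcongr
    · exact Ex_degrees_inv_mul_sum_le hG
    · exact Ex_degrees_inv_mul_sum_offDiag_le hG₂

/-- Second moments within the communities, in terms of a power `a` of the degrees. -/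
theorem GoodSizes.Ex_pairSum_le {c : List ℕ} (hcg : GoodSizes P n c) (hP : P.Valid)
    {d : Fin n → ℕ} (hdg : GoodDegrees P n K d) {a : ℝ} (ha : 0 ≤ a) (w : ℕ → ℝ≥0∞) :
    Ex (commLaw P n c d) (fun comm => pairSum comm fun j p => w (c.get j) *
      ((d p.1 : ℝ≥0∞) ^ a * (d p.2 : ℝ≥0∞) ^ a)) ≤
    (c.map fun z => w z * (z : ℝ≥0∞) ^ 2).sum * (((K : ℝ≥0∞) ^ a) ^ 2 +
      4 * (K : ℝ≥0∞) ^ a * ((n : ℝ≥0∞)⁻¹ * ∑ i, (d i : ℝ≥0∞) ^ a) +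
      4 * ((n : ℝ≥0∞)⁻¹ ^ 2 * ∑ p ∈ (Finset.univ : Finset (Fin n)).offDiag,
        (d p.1 : ℝ≥0∞) ^ a * (d p.2 : ℝ≥0∞) ^ a)) := by
  simp only [pairSum_weight (fun j : Fin c.length => w (c.get j))
    (fun p => (d p.1 : ℝ≥0∞) ^ a * (d p.2 : ℝ≥0∞) ^ a)]
  rw [Ex_sum, ← sum_get_eq c fun z => w z * (z : ℝ≥0∞) ^ 2, Finset.sum_mul]
  refine Finset.sum_le_sum fun j _ => ?_
  rw [Ex_const_mul, mul_assoc]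
  gcongr
  refine (hcg.Ex_sum_comm_pair_le hP hdg (f := fun k => (k : ℝ≥0∞) ^ a)
    (monotone_natCast_rpow ha) j).trans ?_
  rw [div_eq_mul_inv, div_eq_mul_inv, ENNReal.inv_pow, mul_right_comm (4 : ℝ≥0∞),
    mul_assoc (4 * (K : ℝ≥0∞) ^ a), mul_assoc 4 ((n : ℝ≥0∞)⁻¹ ^ 2)]
  refine mul_le_mul_right (add_le_add (add_le_add le_rfl ?_) ?_) _
  · gcongr
    exact mul_le_of_le_one_right' (adm_le_one _ _ _)
  · refine mul_le_mul_right (mul_le_mul_right (Finset.sum_le_sum fun p _ => ?_) _) _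
    exact mul_le_of_le_one_right' (mul_le_one' (adm_le_one _ _ _) (adm_le_one _ _ _))

theorem Ex_degrees_quadratic_le {a : ℝ} (ha : 0 ≤ a) :
    Ex (degrees P n) (fun d => ((K : ℝ≥0∞) ^ a) ^ 2 +
      4 * (K : ℝ≥0∞) ^ a * ((n : ℝ≥0∞)⁻¹ * ∑ i, (d i : ℝ≥0∞) ^ a) +
      4 * ((n : ℝ≥0∞)⁻¹ ^ 2 * ∑ p ∈ (Finset.univ : Finset (Fin n)).offDiag,
        (d p.1 : ℝ≥0∞) ^ a * (d p.2 : ℝ≥0∞) ^ a)) ≤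
    ((K : ℝ≥0∞) ^ a + 2 * moment P n a) ^ 2 := by
  simp only [Ex_add, Ex_const, Ex_const_mul]
  calc _ ≤ ((K : ℝ≥0∞) ^ a) ^ 2 + 4 * (K : ℝ≥0∞) ^ a * moment P n a + 4 * moment P n a ^ 2 := by
        gcongr
        · exact Ex_degrees_inv_mul_sum_le (monotone_natCast_rpow ha)
        · exact Ex_degrees_pair_le ha
    _ = _ := by ring

/-- A bound on the number of multi-edges that trades moments of order `a` of the degrees for moments
of order `2 - a` of the sizes. -/
theorem Regime.Ex_multiEdges_le (h : Regime P n K) (hP : P.Valid)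
    (hκ : roundRate P ^ κ ≤ 1 / 4) (hκ1 : 1 ≤ κ) {a : ℝ} (ha : 0 < a) (ha2 : a ≤ 2) :
    Ex (law P n) (fun G => (G.Mc : ℝ≥0∞)) ≤
      180 * κ ^ 2 * (2 * commCount P n *
        Ex (sizeLaw P n) (fun z => ((z + 1 : ℕ) : ℝ≥0∞) ^ (2 - a)) *
        ((K : ℝ≥0∞) ^ a + 2 * moment P n a) ^ 2) + errorTerm P n := by
  refine (h.Ex_law_le hP (b := 9 * (n ^ 2 * maxDeg P n ^ 4 : ℕ))
    (R := fun d c => 180 * κ ^ 2 * ((c.map fun z : ℕ => (z : ℝ≥0∞) ^ (2 - a)).sum *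
      (((K : ℝ≥0∞) ^ a) ^ 2 +
      4 * (K : ℝ≥0∞) ^ a * ((n : ℝ≥0∞)⁻¹ * ∑ i, (d i : ℝ≥0∞) ^ a) +
      4 * ((n : ℝ≥0∞)⁻¹ ^ 2 * ∑ p ∈ (Finset.univ : Finset (Fin n)).offDiag,
        (d p.1 : ℝ≥0∞) ^ a * (d p.2 : ℝ≥0∞) ^ a)))) (fun d hd c hc hdg hcg => ?_)
    fun d hd c _ comm => ?_).trans ?_
  · refine (Ex_mono_support fun comm hcomm =>
      (h.isPartition hP hd hc hcomm).Ex_multiEdges_le hP hκ hκ1 ha ha2).trans ?_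
    rw [Ex_const_mul]
    refine mul_le_mul_right ((hcg.Ex_pairSum_le hP hdg ha.le
      fun z => (z : ℝ≥0∞)⁻¹ ^ a).trans (le_of_eq ?_)) _
    congr 2
    refine List.map_congr_left fun z hz => ?_
    have hz0 : (z : ℝ≥0∞) ≠ 0 := by
      have := hcg.two_le z hz
      simp only [ne_eq, Nat.cast_eq_zero]
      omega
    rw [ENNReal.inv_rpow, ← ENNReal.rpow_neg, ← ENNReal.rpow_two,
      ← ENNReal.rpow_add _ _ hz0 (by simp)]
    congr 1
    ring
  · refine (Ex_mono fun G => Nat.cast_le.2 ?_).trans (h.Ex_phase4_le hP hd comm).2.1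
    exact Finset.sum_le_sum fun j _ => multiEdges_le_parallelPairs _
  · rw [errorTerm]
    refine add_le_add ?_ le_rfl
    simp only [Ex_const_mul, Ex_mul_const]
    gcongr
    · exact h.Ex_sizes_sum_le (monotone_natCast_rpow (by linarith))
    · exact Ex_degrees_quadratic_le ha.le

/-- The expected number of background edges that are also community edges, in terms of the moment of
order `1 + b` of the degrees. -/
theorem Regime.Ex_Mbc_le (h : Regime P n K) (hP : P.Valid)
    (hκ : roundRate P ^ κ ≤ 1 / 4) (hκ1 : 1 ≤ κ) {b : ℝ} (hb : 0 < b) (hb1 : b ≤ 1) :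
    Ex (law P n) (fun G => (G.Mbc : ℝ≥0∞)) ≤
      12 * κ * moment P n 2 + 72 * κ ^ 2 * (((maxComm P n + 1 : ℕ) : ℝ≥0∞) ^ (1 - b) *
        ((K : ℝ≥0∞) ^ (1 + b) + 2 * moment P n (1 + b)) ^ 2) +
      3 * ENNReal.ofReal ((1 / 2) ^ ((n - 2) / 2 / κ)) * (n ^ 2 * maxDeg P n ^ 4 : ℕ) +
      errorTerm P n := by
  set ε := ENNReal.ofReal ((1 / 2) ^ ((n - 2) / 2 / κ)) with hε
  have hn0 : (n : ℝ≥0∞) ≠ 0 := by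
    have := h.size.pos
    simp only [ne_eq, Nat.cast_eq_zero]
    omega
  refine (h.Ex_law_le hP (b := 9 * (n ^ 2 * maxDeg P n ^ 4 : ℕ))
    (R := fun d c => 12 * κ * ((n : ℝ≥0∞)⁻¹ * ∑ i, (d i : ℝ≥0∞) ^ (2 : ℝ)) +
      72 * κ ^ 2 * (((maxComm P n + 1 : ℕ) : ℝ≥0∞) ^ (1 - b) *
      (((K : ℝ≥0∞) ^ (1 + b)) ^ 2 +
      4 * (K : ℝ≥0∞) ^ (1 + b) * ((n : ℝ≥0∞)⁻¹ * ∑ i, (d i : ℝ≥0∞) ^ (1 + b)) +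
      4 * ((n : ℝ≥0∞)⁻¹ ^ 2 * ∑ p ∈ (Finset.univ : Finset (Fin n)).offDiag,
        (d p.1 : ℝ≥0∞) ^ (1 + b) * (d p.2 : ℝ≥0∞) ^ (1 + b)))) +
      3 * ε * (n ^ 2 * maxDeg P n ^ 4 : ℕ))
    (fun d hd c hc hdg hcg => ?_)
    fun d hd c _ comm => (h.Ex_phase4_le hP hd comm).2.2).trans ?_
  · refine (Ex_mono_support fun comm hcomm =>
      (h.isPartition hP hd hc hcomm).Ex_Mbc_le hP hκ hκ1 hb hb1).trans ?_
    rw [Ex_add, Ex_add, Ex_const, Ex_const, Ex_const_mul, Ex_const_mul]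
    simp only [ENNReal.rpow_two]
    refine add_le_add (add_le_add le_rfl ?_) ?_
    · refine mul_le_mul_right ?_ _
      refine (mul_le_mul_right (hcg.Ex_pairSum_le hP hdg (a := 1 + b) (by linarith)
        fun z => (z : ℝ≥0∞)⁻¹ ^ b) _).trans ?_
      rw [← mul_assoc]
      refine mul_le_mul_left ?_ _
      -- the sizes add up to `n`
      have h1 : (c.map fun z : ℕ => (z : ℝ≥0∞)⁻¹ ^ b * (z : ℝ≥0∞) ^ 2).sum ≤
          (c.map fun z : ℕ => ((maxComm P n + 1 : ℕ) : ℝ≥0∞) ^ (1 - b) * (z : ℝ≥0∞)).sum := by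
        refine List.sum_le_sum fun z hz => ?_
        have hz0 : (z : ℝ≥0∞) ≠ 0 := by
          have := hcg.two_le z hz
          simp only [ne_eq, Nat.cast_eq_zero]
          omega
        have hzM := ((h.mem_communitySizes hc).2 z hz).2
        have e : (z : ℝ≥0∞)⁻¹ ^ b * (z : ℝ≥0∞) ^ 2 = (z : ℝ≥0∞) ^ (1 - b) * z := by
          conv_rhs => rw [← ENNReal.rpow_one (z : ℝ≥0∞), ← ENNReal.rpow_mul,
            ← ENNReal.rpow_add _ _ hz0 (by simp)]
          rw [ENNReal.inv_rpow, ← ENNReal.rpow_neg, ← ENNReal.rpow_two,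
            ← ENNReal.rpow_add _ _ hz0 (by simp)]
          congr 1
          ring
        rw [e]
        gcongr
      have h2 : (c.map fun z : ℕ => (z : ℝ≥0∞)).sum = n := by
        rw [← hcg.sum_eq]
        exact (Nat.cast_list_sum c).symm
      refine (mul_le_mul_right h1 _).trans (le_of_eq ?_)
      rw [List.sum_map_mul_left, h2, mul_left_comm, ENNReal.inv_mul_cancel hn0 (by simp), mul_one]
    · refine mul_le_mul_right ?_ _
      have hD := (mem_support_degrees hP.one_le_δ h.deg hd).2.1
      calc ∑ p ∈ (Finset.univ : Finset (Fin n)).offDiag, (d p.1 : ℝ≥0∞) * d p.2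
          = ((∑ p ∈ (Finset.univ : Finset (Fin n)).offDiag, d p.1 * d p.2 : ℕ) : ℝ≥0∞) := by
            push_cast
            rfl
        _ ≤ _ := by
          refine Nat.cast_le.2 ?_
          calc ∑ p ∈ (Finset.univ : Finset (Fin n)).offDiag, d p.1 * d p.2
              ≤ ∑ p ∈ (Finset.univ : Finset (Fin n)).offDiag, maxDeg P n ^ 4 := by
                refine Finset.sum_le_sum fun p _ => ?_
                calc d p.1 * d p.2 ≤ maxDeg P n * maxDeg P n := Nat.mul_le_mul (hD _) (hD _)
                  _ = maxDeg P n ^ 2 := (sq _).symm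
                  _ ≤ maxDeg P n ^ 4 := Nat.pow_le_pow_right (h.maxDeg_pos hP) (by norm_num)
            _ ≤ ∑ p : Fin n × Fin n, maxDeg P n ^ 4 :=
              Finset.sum_le_sum_of_subset (Finset.subset_univ _)
            _ = n ^ 2 * maxDeg P n ^ 4 := by simp [sq]
  · rw [errorTerm]
    refine add_le_add ?_ le_rfl
    simp only [Ex_const]
    rw [Ex_add, Ex_add, Ex_const]
    simp only [Ex_const_mul]
    refine add_le_add (add_le_add (mul_le_mul_right ?_ _) (mul_le_mul_right
      (mul_le_mul_right ?_ _) _)) le_rfl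
    · exact Ex_degrees_inv_mul_sum_le (monotone_natCast_rpow zero_le_two)
    · exact Ex_degrees_quadratic_le (by linarith)

end Regime

/-! ### Asymptotic estimates -/

section BigO

variable {e f : ℕ → ℝ≥0∞} {r r' : ℕ → ℝ}

theorem BigO.mono_left (hf : BigO f r) (h : ∀ᶠ n : ℕ in atTop, e n ≤ f n) : BigO e r := by
  obtain ⟨C, hC, hf⟩ := hf
  exact ⟨C, hC, by filter_upwards [hf, h] with n h1 h2 using h2.trans h1⟩

theorem BigO.mono_right (hf : BigO f r) {C : ℝ} (hC : 0 < C)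
    (h : ∀ᶠ n : ℕ in atTop, r n ≤ C * r' n) :
    BigO f r' := by
  obtain ⟨C', hC', hf⟩ := hf
  refine ⟨C' * C, mul_pos hC' hC, ?_⟩
  filter_upwards [hf, h] with n h1 h2
  refine h1.trans (ENNReal.ofReal_le_ofReal ?_)
  rw [mul_assoc]
  exact mul_le_mul_of_nonneg_left h2 hC'.le

theorem BigO.add (he : BigO e r) (hf : BigO f r) (hr : ∀ n, 0 ≤ r n) :
    BigO (fun n => e n + f n) r := by
  obtain ⟨C, hC, he⟩ := he
  obtain ⟨C', hC', hf⟩ := hf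
  refine ⟨C + C', add_pos hC hC', ?_⟩
  filter_upwards [he, hf] with n h1 h2
  rw [add_mul, ENNReal.ofReal_add (mul_nonneg hC.le (hr n)) (mul_nonneg hC'.le (hr n))]
  exact add_le_add h1 h2

theorem BigO.mul (he : BigO e r) (hf : BigO f r') (hr : ∀ n, 0 ≤ r n) :
    BigO (fun n => e n * f n) (fun n => r n * r' n) := by
  obtain ⟨C, hC, he⟩ := he
  obtain ⟨C', hC', hf⟩ := hf
  refine ⟨C * C', mul_pos hC hC', ?_⟩
  filter_upwards [he, hf] with n h1 h2
  rw [mul_mul_mul_comm, ENNReal.ofReal_mul (mul_nonneg hC.le (hr n))]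
  exact mul_le_mul' h1 h2

theorem BigO.const {c : ℝ≥0∞} (hc : c ≠ ∞) : BigO (fun _ => c) fun _ => 1 := by
  refine ⟨c.toReal + 1, by positivity, Eventually.of_forall fun n => ?_⟩
  rw [mul_one]
  exact (ENNReal.ofReal_toReal hc).ge.trans (ENNReal.ofReal_le_ofReal (by linarith))

theorem BigO.const_mul {c : ℝ≥0∞} (hc : c ≠ ∞) (he : BigO e r) : BigO (fun n => c * e n) r := by
  have := (BigO.const hc).mul he fun _ => zero_le_one
  simpa only [one_mul] using this

theorem BigO.of_one_le {c : ℝ≥0∞} (hc : c ≠ ∞) (hr : ∀ᶠ n : ℕ in atTop, 1 ≤ r n) :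
    BigO (fun _ => c) r :=
  (BigO.const hc).mono_right one_pos (by filter_upwards [hr] with n hn; linarith)

end BigO

section Rates

theorem tendsto_natCast_rpow {q : ℝ} (hq : 0 < q) :
    Tendsto (fun n : ℕ => (n : ℝ) ^ q) atTop atTop :=
  (tendsto_rpow_atTop hq).comp tendsto_natCast_atTop_atTop

theorem eventually_const_mul_rpow_le {a b : ℝ} (hab : a < b) (C : ℝ) :
    ∀ᶠ n : ℕ in atTop, C * (n : ℝ) ^ a ≤ (n : ℝ) ^ b := by
  filter_upwards [(tendsto_natCast_rpow (sub_pos.2 hab)).eventually_ge_atTop C,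
    eventually_gt_atTop 0] with n h1 h2
  have hn : (0 : ℝ) < n := by exact_mod_cast h2
  calc C * (n : ℝ) ^ a ≤ (n : ℝ) ^ (b - a) * (n : ℝ) ^ a := by gcongr
    _ = (n : ℝ) ^ b := by rw [← Real.rpow_add hn, sub_add_cancel]

theorem eventually_one_le_rpow {a : ℝ} (ha : 0 ≤ a) : ∀ᶠ n : ℕ in atTop, 1 ≤ (n : ℝ) ^ a := by
  filter_upwards [eventually_ge_atTop 1] with n hn
  exact Real.one_le_rpow (by exact_mod_cast hn) ha

theorem eventually_exp_neg_le {c q : ℝ} (hc : 0 < c) (hq : 0 < q) (k : ℝ) :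
    ∀ᶠ n : ℕ in atTop, Real.exp (-(c * (n : ℝ) ^ q)) ≤ (n : ℝ) ^ (-k) := by
  have h := ((isLittleO_exp_neg_mul_rpow_atTop hc (-k / q)).bound one_pos)
  filter_upwards [(tendsto_natCast_rpow hq).eventually h, eventually_gt_atTop 0] with n h1 h2
  have hn : (0 : ℝ) ≤ n := Nat.cast_nonneg n
  rw [Real.norm_of_nonneg (Real.exp_nonneg _), one_mul,
    Real.norm_of_nonneg (Real.rpow_nonneg (Real.rpow_nonneg hn _) _), ← Real.rpow_mul hn] at h1
  have e : q * (-k / q) = -k := by field_simp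
  rw [e] at h1
  convert h1 using 2
  ring

theorem eventually_half_pow_le {ρ : ℝ} (h0 : 0 < ρ) (h1 : ρ < 1) {κ : ℕ} (hκ : 1 ≤ κ) (k : ℝ) :
    ∀ᶠ n : ℕ in atTop, ρ ^ ((n - 2) / 2 / κ) ≤ (n : ℝ) ^ (-k) := by
  have hlog : 0 < -Real.log ρ := neg_pos.2 (Real.log_neg h0 h1)
  have hκR : (1 : ℝ) ≤ κ := by exact_mod_cast hκ
  filter_upwards [eventually_exp_neg_le (c := -Real.log ρ / (4 * κ)) (q := 1) (by positivity)
    one_pos k, eventually_ge_atTop (4 * κ + 4)] with n hn hn2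
  refine le_trans ?_ hn
  rw [Real.rpow_one, ← Real.exp_log (pow_pos h0 _), Real.log_pow]
  refine Real.exp_le_exp.2 ?_
  have h3 : (n : ℝ) / (4 * κ) ≤ ((n - 2) / 2 / κ : ℕ) := by
    rw [Nat.div_div_eq_div_mul]
    have h4 := Nat.lt_mul_div_succ (n - 2) (show 0 < 2 * κ by omega)
    have h5 : n < 2 * κ * ((n - 2) / (2 * κ) + 1) + 2 := by omega
    have h6 : (n : ℝ) < 2 * κ * (((n - 2) / (2 * κ) : ℕ) + 1) + 2 := by exact_mod_cast h5
    have h7 : (4 * κ + 4 : ℝ) ≤ n := by exact_mod_cast hn2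
    rw [div_le_iff₀ (by positivity)]
    nlinarith
  have e : -(-Real.log ρ / (4 * κ) * n) = -((-Real.log ρ) * (n / (4 * κ))) := by ring
  rw [e]
  nlinarith

variable {P : Params}

theorem maxDeg_le_rpow (P : Params) (n : ℕ) : (maxDeg P n : ℝ) ≤ (n : ℝ) ^ P.ζ :=
  Nat.floor_le (Real.rpow_nonneg (Nat.cast_nonneg n) _)

theorem maxComm_le_rpow (P : Params) (n : ℕ) : (maxComm P n : ℝ) ≤ (n : ℝ) ^ P.τ :=
  Nat.floor_le (Real.rpow_nonneg (Nat.cast_nonneg n) _)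

theorem Params.Valid.τ_pos (hP : P.Valid) : 0 < P.τ := hP.ζ_pos.trans hP.ζ_lt_τ

theorem tendsto_maxDeg (hP : P.Valid) : Tendsto (maxDeg P) atTop atTop :=
  tendsto_nat_floor_atTop.comp (tendsto_natCast_rpow hP.ζ_pos)

theorem tendsto_maxComm (hP : P.Valid) : Tendsto (maxComm P) atTop atTop :=
  tendsto_nat_floor_atTop.comp (tendsto_natCast_rpow hP.τ_pos)

theorem rpow_le_two_mul_maxComm {n : ℕ} (h : 1 ≤ maxComm P n) :
    (n : ℝ) ^ P.τ ≤ 2 * maxComm P n := by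
  have h1 : (n : ℝ) ^ P.τ < maxComm P n + 1 := Nat.lt_floor_add_one _
  have h2 : (1 : ℝ) ≤ maxComm P n := by exact_mod_cast h
  linarith

theorem exists_le_meanSize (hP : P.Valid) : ∃ c : ℝ, 0 < c ∧ ∀ᶠ n : ℕ in atTop,
    ENNReal.ofReal (c * (n : ℝ) ^ (P.τ * (2 - P.β))) ≤ meanSize P n := by
  have hβ := hP.one_lt_β
  have hβ2 := hP.β_lt_two
  refine ⟨(P.β - 1) * 2 ^ (-P.β) / 2 * (1 / 2) ^ (2 - P.β),
    mul_pos (div_pos (mul_pos (by linarith) (by positivity)) two_pos) (by positivity), ?_⟩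
  filter_upwards [(tendsto_maxComm hP).eventually_ge_atTop (2 * P.s),
    (tendsto_maxComm hP).eventually_ge_atTop 1] with n h1 h2
  have hs : 1 ≤ P.s := by
    have := hP.δ_lt_s
    omega
  refine le_trans (ENNReal.ofReal_le_ofReal ?_) (le_Ex_tpl_id hβ hs h1)
  rw [mul_assoc]
  refine mul_le_mul_of_nonneg_left ?_
    (div_nonneg (mul_nonneg (by linarith) (by positivity)) two_pos.le)
  rw [Real.rpow_mul (Nat.cast_nonneg n), ← Real.mul_rpow (by norm_num) (by positivity)]
  refine Real.rpow_le_rpow (by positivity) ?_ (by linarith)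
  linarith [rpow_le_two_mul_maxComm h2]

theorem exists_meanSize_le (hP : P.Valid) : ∃ C : ℝ, 0 < C ∧ ∀ᶠ n : ℕ in atTop,
    meanSize P n ≤ ENNReal.ofReal (C * (n : ℝ) ^ (P.τ * (2 - P.β))) := by
  have hβ := hP.one_lt_β
  have hβ2 := hP.β_lt_two
  have hs : 1 ≤ P.s := by
    have := hP.δ_lt_s
    omega
  have hsR : (1 : ℝ) ≤ P.s := by exact_mod_cast hs
  refine ⟨(2 * P.s : ℝ) ^ P.β * (1 + 1 / (2 - P.β)),
    mul_pos (by positivity) (by have : 0 < 2 - P.β := by linarith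
                                positivity), ?_⟩
  filter_upwards [(tendsto_maxComm hP).eventually_ge_atTop (2 * P.s)] with n h1
  have h2 := Ex_tpl_rpow_le (γ := P.β) (by linarith) hs (show P.s ≤ maxComm P n by omega) 1
  simp only [Real.rpow_one, ENNReal.ofReal_natCast] at h2
  refine h2.trans (ENNReal.ofReal_le_ofReal ?_)
  rw [mul_assoc]
  gcongr
  refine (sum_Icc_rpow_le (by linarith) _).trans ?_
  rw [show 1 - P.β + 1 = 2 - P.β by ring, Real.rpow_mul (Nat.cast_nonneg n)]
  have : 0 < 2 - P.β := by linarith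
  gcongr
  exact maxComm_le_rpow P n

/-- The order of the number of communities. -/
noncomputable def commRate (P : Params) (n : ℕ) : ℝ := (n : ℝ) ^ (1 - P.τ * (2 - P.β))

theorem commRate_nonneg (P : Params) (n : ℕ) : 0 ≤ commRate P n :=
  Real.rpow_nonneg (Nat.cast_nonneg n) _

theorem Params.Valid.rate_pos (hP : P.Valid) : 0 < 1 - P.τ * (2 - P.β) := by
  nlinarith [hP.one_lt_β, hP.β_lt_two, hP.τ_lt_one, hP.τ_pos]

theorem eventually_one_le_commRate (hP : P.Valid) : ∀ᶠ n : ℕ in atTop, 1 ≤ commRate P n :=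
  eventually_one_le_rpow hP.rate_pos.le

theorem bigO_commCount (hP : P.Valid) : BigO (commCount P) (commRate P) := by
  obtain ⟨c, hc, h⟩ := exists_le_meanSize hP
  refine ⟨1 / c, by positivity, ?_⟩
  filter_upwards [h, eventually_gt_atTop 0] with n h1 h2
  have hn : (0 : ℝ) < n := by exact_mod_cast h2
  rw [commCount]
  refine (ENNReal.div_le_div_left h1 _).trans (le_of_eq ?_)
  rw [← ENNReal.ofReal_natCast, ← ENNReal.ofReal_div_of_pos (by positivity), commRate,
    Real.rpow_sub hn, Real.rpow_one]
  congr 1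
  field_simp

theorem eventually_badProb_le (hP : P.Valid) (k : ℝ) :
    ∀ᶠ n : ℕ in atTop, badProb P n ≤ ENNReal.ofReal ((n : ℝ) ^ (-k)) := by
  have hlog : 0 < -Real.log (3 / 4) := neg_pos.2 (Real.log_neg (by norm_num) (by norm_num))
  filter_upwards [eventually_exp_neg_le hlog one_pos (k + 1),
    eventually_exp_neg_le (c := 1 / 64) (by norm_num) (sub_pos.2 hP.τ_lt_one) (k + 1),
    eventually_ge_atTop 2, (tendsto_maxComm hP).eventually_ge_atTop 1] with n h1 h2 h3 h4
  have hn : (2 : ℝ) ≤ n := by exact_mod_cast h3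
  have hM : (1 : ℝ) ≤ maxComm P n := by exact_mod_cast h4
  rw [badProb, ← ENNReal.ofReal_add (by positivity) (by positivity)]
  refine ENNReal.ofReal_le_ofReal ?_
  have e1 : ((3 : ℝ) / 4) ^ n ≤ (n : ℝ) ^ (-(k + 1)) := by
    refine le_trans (le_of_eq ?_) h1
    rw [Real.rpow_one, ← Real.exp_log (pow_pos (by norm_num : (0 : ℝ) < 3 / 4) n), Real.log_pow]
    congr 1
    ring
  have e2 : Real.exp (-(n / (64 * maxComm P n))) ≤ (n : ℝ) ^ (-(k + 1)) := by
    refine le_trans (Real.exp_le_exp.2 (neg_le_neg ?_)) h2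
    rw [Real.rpow_sub (by linarith), Real.rpow_one, div_mul_div_comm, one_mul]
    gcongr
    exact maxComm_le_rpow P n
  have e3 : (n : ℝ) ^ (-(k + 1)) = (n : ℝ) ^ (-k) / n := by
    rw [neg_add, ← sub_eq_add_neg, Real.rpow_sub (by linarith), Real.rpow_one]
  have e4 : (n : ℝ) ^ (-k) / n ≤ (n : ℝ) ^ (-k) / 2 := by gcongr
  linarith

theorem eventually_sq_mul_maxDeg_le (hP : P.Valid) :
    ∀ᶠ n : ℕ in atTop, ((n ^ 2 * maxDeg P n ^ 4 : ℕ) : ℝ) ≤ (n : ℝ) ^ (6 : ℝ) := by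
  filter_upwards [eventually_ge_atTop 1] with n hn
  have hnR : (1 : ℝ) ≤ n := by exact_mod_cast hn
  have h1 : (maxDeg P n : ℝ) ≤ n := by
    refine (maxDeg_le_rpow P n).trans ?_
    calc (n : ℝ) ^ P.ζ ≤ (n : ℝ) ^ (1 : ℝ) :=
          Real.rpow_le_rpow_of_exponent_le hnR (hP.ζ_lt_τ.trans hP.τ_lt_one).le
      _ = n := Real.rpow_one _
  have e : (n : ℝ) ^ (6 : ℝ) = n ^ 2 * n ^ 4 := by
    rw [← pow_add]
    exact_mod_cast Real.rpow_natCast (n : ℝ) 6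
  rw [e]
  push_cast
  gcongr

theorem bigO_errorTerm (hP : P.Valid) : BigO (errorTerm P) fun _ => 1 := by
  refine ⟨9, by norm_num, ?_⟩
  filter_upwards [eventually_badProb_le hP 6, eventually_sq_mul_maxDeg_le hP,
    eventually_gt_atTop 0] with n h1 h2 h3
  have hn : (0 : ℝ) < n := by exact_mod_cast h3
  rw [errorTerm, ← ENNReal.ofReal_natCast]
  calc _ ≤ 9 * ENNReal.ofReal ((n : ℝ) ^ (6 : ℝ)) * ENNReal.ofReal ((n : ℝ) ^ (-6 : ℝ)) := by
        gcongr
    _ = 9 := by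
      rw [mul_assoc, ← ENNReal.ofReal_mul (by positivity), ← Real.rpow_add hn]
      norm_num
    _ = _ := by norm_num

/-- Bounds on a sum of powers over the range of the degrees. -/
theorem exists_sum_maxDeg_le (hP : P.Valid) {a : ℝ} (ha : a ≠ -1) : ∃ C : ℝ, 0 < C ∧
    ∀ᶠ n : ℕ in atTop, ∑ k ∈ Finset.Icc 1 (maxDeg P n), (k : ℝ) ^ a ≤
      C * (1 + (n : ℝ) ^ (P.ζ * (a + 1))) := by
  obtain ⟨C, hC, h⟩ := sum_Icc_rpow_le_one_add ha
  refine ⟨C * 2, by positivity, ?_⟩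
  filter_upwards [(tendsto_maxDeg hP).eventually_ge_atTop 1] with n hn
  have hnR : (1 : ℝ) ≤ maxDeg P n := by exact_mod_cast hn
  refine (h _).trans ?_
  rw [mul_assoc]
  refine mul_le_mul_of_nonneg_left ?_ hC.le
  have h0 : 0 ≤ (n : ℝ) ^ (P.ζ * (a + 1)) := by positivity
  rcases le_total 0 (a + 1) with h1 | h1
  · have : (maxDeg P n : ℝ) ^ (a + 1) ≤ (n : ℝ) ^ (P.ζ * (a + 1)) := by
      rw [Real.rpow_mul (Nat.cast_nonneg n)]
      exact Real.rpow_le_rpow (by positivity) (maxDeg_le_rpow P n) h1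
    linarith
  · have : (maxDeg P n : ℝ) ^ (a + 1) ≤ 1 := Real.rpow_le_one_of_one_le_of_nonpos hnR h1
    linarith

theorem exists_sum_maxDeg_le_log (hP : P.Valid) : ∃ C : ℝ, 0 < C ∧
    ∀ᶠ n : ℕ in atTop, ∑ k ∈ Finset.Icc 1 (maxDeg P n), (k : ℝ) ^ (-1 : ℝ) ≤ C * Real.log n := by
  refine ⟨2, two_pos, ?_⟩
  filter_upwards [(tendsto_maxDeg hP).eventually_ge_atTop 1, eventually_ge_atTop 3] with n hn h3
  have hnR : (1 : ℝ) ≤ maxDeg P n := by exact_mod_cast hn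
  have hn3 : (3 : ℝ) ≤ n := by exact_mod_cast h3
  refine (sum_Icc_rpow_neg_one_le _).trans ?_
  have h1 : Real.log (maxDeg P n) ≤ Real.log n := by
    refine Real.log_le_log (by linarith) ((maxDeg_le_rpow P n).trans ?_)
    calc (n : ℝ) ^ P.ζ ≤ (n : ℝ) ^ (1 : ℝ) :=
          Real.rpow_le_rpow_of_exponent_le (by linarith) (hP.ζ_lt_τ.trans hP.τ_lt_one).le
      _ = n := Real.rpow_one _
  have h2 : 1 ≤ Real.log n := by
    rw [Real.le_log_iff_exp_le (by linarith)]
    linarith [Real.exp_one_lt_d9]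
  linarith

theorem natCast_rpow_eq_ofReal (k : ℕ) {a : ℝ} (ha : 0 ≤ a) :
    (k : ℝ≥0∞) ^ a = ENNReal.ofReal ((k : ℝ) ^ a) := by
  rw [← ENNReal.ofReal_rpow_of_nonneg (Nat.cast_nonneg k) ha, ENNReal.ofReal_natCast]

theorem moment_le (hP : P.Valid) {n : ℕ} (hn : P.δ ≤ maxDeg P n) {a : ℝ} (ha : 0 ≤ a) :
    moment P n a ≤ ENNReal.ofReal ((2 * P.δ : ℝ) ^ P.γ *
      ∑ k ∈ Finset.Icc 1 (maxDeg P n), (k : ℝ) ^ (a - P.γ)) := by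
  simp only [moment, natCast_rpow_eq_ofReal _ ha]
  exact Ex_tpl_rpow_le (by linarith [hP.two_lt_γ]) hP.one_le_δ hn a

theorem bigO_moment_one (hP : P.Valid) {a : ℝ} (ha : 0 ≤ a) (ha' : a < P.γ - 1) :
    BigO (fun n => moment P n a) fun _ => 1 := by
  have hδ : (1 : ℝ) ≤ P.δ := by exact_mod_cast hP.one_le_δ
  have hpos : 0 < P.γ - a - 1 := by linarith
  refine ⟨(2 * P.δ : ℝ) ^ P.γ * (2 ^ (P.γ - a) / (P.γ - a - 1)), by positivity, ?_⟩
  filter_upwards [(tendsto_maxDeg hP).eventually_ge_atTop P.δ] with n hn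
  refine (moment_le hP hn ha).trans (ENNReal.ofReal_le_ofReal ?_)
  rw [mul_one]
  gcongr
  have := sum_Icc_rpow_neg_le (γ := P.γ - a) (by linarith) le_rfl (maxDeg P n)
  rw [Nat.cast_one, Real.one_rpow, mul_one, neg_sub] at this
  exact this

theorem bigO_moment_two (hP : P.Valid) :
    BigO (fun n => moment P n 2) fun n => (n : ℝ) ^ (P.ζ * (3 - P.γ)) := by
  have hδ : (1 : ℝ) ≤ P.δ := by exact_mod_cast hP.one_le_δ
  have hγ := hP.γ_lt_three
  have hpos : 0 < 3 - P.γ := by linarith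
  refine ⟨(2 * P.δ : ℝ) ^ P.γ * (1 + 1 / (3 - P.γ)), by positivity, ?_⟩
  filter_upwards [(tendsto_maxDeg hP).eventually_ge_atTop P.δ] with n hn
  refine (moment_le hP hn zero_le_two).trans (ENNReal.ofReal_le_ofReal ?_)
  rw [mul_assoc]
  gcongr
  refine (sum_Icc_rpow_le (by linarith) _).trans ?_
  rw [show 2 - P.γ + 1 = 3 - P.γ by ring, Real.rpow_mul (Nat.cast_nonneg n)]
  gcongr
  exact maxDeg_le_rpow P n

/-- The estimates hold for all large `n`. -/
theorem exists_eventually_regime (hP : P.Valid) : ∃ K : ℕ, ∀ᶠ n : ℕ in atTop, Regime P n K := by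
  have hγ := hP.two_lt_γ
  have hβ := hP.one_lt_β
  have hβ2 := hP.β_lt_two
  have hs : 1 ≤ P.s := by
    have := hP.δ_lt_s
    omega
  have hsR : (1 : ℝ) ≤ P.s := by exact_mod_cast hs
  -- a bound on the degrees of most nodes
  obtain ⟨K, hK, hK1⟩ : ∃ K : ℕ, (2 * P.δ : ℝ) ^ P.γ * (2 ^ P.γ / (P.γ - 1)) *
      (K : ℝ) ^ (1 - P.γ) ≤ 1 / 30 ∧ 1 ≤ K := by
    have h1 : Tendsto (fun K : ℕ => (2 * P.δ : ℝ) ^ P.γ * (2 ^ P.γ / (P.γ - 1)) *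
        (K : ℝ) ^ (1 - P.γ)) atTop (𝓝 0) := by
      have h2 := (tendsto_rpow_neg_atTop (show 0 < P.γ - 1 by linarith)).comp
        (tendsto_natCast_atTop_atTop (R := ℝ))
      have h3 := h2.const_mul ((2 * P.δ : ℝ) ^ P.γ * (2 ^ P.γ / (P.γ - 1)))
      rw [mul_zero] at h3
      refine h3.congr fun K => ?_
      simp only [Function.comp_apply, neg_sub]
    obtain ⟨K, hK⟩ := ((h1.eventually (ge_mem_nhds (show (0 : ℝ) < 1 / 30 by norm_num))).and
      (eventually_ge_atTop 1)).exists
    exact ⟨K, hK.1, hK.2⟩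
  refine ⟨K, ?_⟩
  obtain ⟨c, hc, hmean⟩ := exists_le_meanSize hP
  have hexp : P.ζ * (2 - P.β) < P.τ * (2 - P.β) :=
    mul_lt_mul_of_pos_right hP.ζ_lt_τ (by linarith)
  filter_upwards [(tendsto_maxComm hP).eventually_ge_atTop (2 * P.s),
    (tendsto_maxDeg hP).eventually_ge_atTop P.δ,
    eventually_const_mul_rpow_le hP.τ_lt_one (P.s + 1 : ℝ),
    eventually_const_mul_rpow_le (hP.ζ_lt_τ.trans hP.τ_lt_one) 8, hmean,
    eventually_const_mul_rpow_le hexp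
      (1000 * ((2 * P.s : ℝ) ^ P.β * (1 + 1 / (2 - P.β))) / c)] with n h1 h2 h3 h4 h5 h6
  have hsize : SizeRange P n := by
    refine ⟨?_, h1, ?_⟩
    · have := hP.δ_lt_s
      have := hP.one_le_δ
      omega
    · rw [Real.rpow_one] at h3
      have h7 := maxComm_le_rpow P n
      have h8 : (maxComm P n : ℝ) * (P.s + 1) ≤ n := by
        refine le_trans ?_ h3
        rw [mul_comm]
        gcongr
      exact_mod_cast h8
  refine ⟨hsize, h2, ?_, ?_, ?_⟩
  · refine (Pr_tpl_ge_le (by linarith) hP.one_le_δ h2 hK1).trans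
      ((ENNReal.ofReal_le_ofReal hK).trans (le_of_eq ?_))
    rw [ENNReal.ofReal_div_of_pos (by norm_num)]
    norm_num
  · rw [Real.rpow_one] at h4
    have h7 := maxDeg_le_rpow P n
    have h8 : 8 * (maxDeg P n : ℝ) ≤ n := by linarith
    exact_mod_cast h8
  · have h7 : Ex (sizeLaw P n) (fun a => if a ≤ maxDeg P n then (a : ℝ≥0∞) + 1 else 0) ≤
        ENNReal.ofReal (2 * ((2 * P.s : ℝ) ^ P.β * ((1 + 1 / (2 - P.β)) *
          (n : ℝ) ^ (P.ζ * (2 - P.β))))) := by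
      have h8 := Ex_tpl_ofReal_le (γ := P.β) (by linarith) hs
        (show P.s ≤ maxComm P n by omega) (fun a => if a ≤ maxDeg P n then (a : ℝ) else 0)
        (fun a => by split_ifs <;> positivity)
      rw [ENNReal.ofReal_mul two_pos.le]
      refine (Ex_mono_support (g := fun a => ENNReal.ofReal 2 * ENNReal.ofReal
        (if a ≤ maxDeg P n then (a : ℝ) else 0)) fun a ha => ?_).trans ?_
      · have ha1 := (hsize.mem_sizeLaw ha).1
        split_ifs
        · rw [ENNReal.ofReal_natCast, ENNReal.ofReal_ofNat, two_mul]
          have : (1 : ℝ≥0∞) ≤ a := by exact_mod_cast hs.trans ha1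
          gcongr
        · simp
      · rw [Ex_const_mul]
        refine mul_le_mul_right (h8.trans (ENNReal.ofReal_le_ofReal ?_)) _
        gcongr
        have h9 : ∑ k ∈ Finset.Icc 1 (maxComm P n),
            (k : ℝ) ^ (-P.β) * (if k ≤ maxDeg P n then (k : ℝ) else 0) ≤
            ∑ k ∈ Finset.Icc 1 (maxDeg P n), (k : ℝ) ^ (1 - P.β) := by
          simp only [mul_ite, mul_zero]
          rw [← Finset.sum_filter]
          refine (Finset.sum_le_sum fun k hk => le_of_eq ?_).trans
            (Finset.sum_le_sum_of_subset_of_nonneg (fun k hk => ?_) fun _ _ _ => by positivity)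
          · have hk1 : 1 ≤ k := (Finset.mem_Icc.1 (Finset.mem_filter.1 hk).1).1
            have hk0 : (0 : ℝ) < k := by exact_mod_cast hk1
            rw [show 1 - P.β = -P.β + 1 by ring, Real.rpow_add hk0, Real.rpow_one]
          · rw [Finset.mem_filter, Finset.mem_Icc] at hk
            exact Finset.mem_Icc.2 ⟨hk.1.1, hk.2⟩
        refine h9.trans ((sum_Icc_rpow_le (by linarith) _).trans ?_)
        rw [show 1 - P.β + 1 = 2 - P.β by ring, Real.rpow_mul (Nat.cast_nonneg n)]
        have : 0 < 2 - P.β := by linarith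
        gcongr
        exact maxDeg_le_rpow P n
    refine h7.trans ?_
    rw [ENNReal.le_div_iff_mul_le (by norm_num) (by norm_num)]
    refine le_trans ?_ h5
    rw [show (500 : ℝ≥0∞) = ENNReal.ofReal 500 by norm_num, ← ENNReal.ofReal_mul
      (by have : 0 < 2 - P.β := by linarith
          positivity)]
    refine ENNReal.ofReal_le_ofReal ?_
    have h8 := mul_le_mul_of_nonneg_left h6 hc.le
    refine le_trans (le_of_eq ?_) h8
    field_simp
    ring

end Rates

/-! ### Upper bounds on the orders of the expectations -/

section UpperBounds

variable {P : Params}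

theorem exists_roundRate_pow_le (hP : P.Valid) : ∃ κ : ℕ, 1 ≤ κ ∧ roundRate P ^ κ ≤ 1 / 4 := by
  obtain ⟨κ, hκ⟩ := exists_pow_lt_of_lt_one (show (0 : ℝ) < 1 / 4 by norm_num)
    (roundRate_lt_one hP)
  refine ⟨κ, Nat.one_le_iff_ne_zero.2 ?_, hκ.le⟩
  rintro rfl
  norm_num at hκ

theorem bigO_Sb (hP : P.Valid) :
    BigO (expect P fun _ G => G.Sb) fun n => (n : ℝ) ^ (P.ζ * (3 - P.γ)) := by
  obtain ⟨K, hK⟩ := exists_eventually_regime hP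
  obtain ⟨κ, _, hκ⟩ := exists_roundRate_pow_le hP
  refine ((bigO_moment_two hP).const_mul (c := 12 * κ) (by finiteness)).mono_left ?_
  filter_upwards [hK] with n hn using hn.Ex_Sb_le hP hκ

theorem bigO_moment_two_sq (hP : P.Valid) :
    BigO (fun n => moment P n 2 ^ 2) fun n => (n : ℝ) ^ (P.ζ * (6 - 2 * P.γ)) := by
  have h := (bigO_moment_two hP).mul (bigO_moment_two hP) fun n => by positivity
  simp only [← sq] at h
  refine h.mono_right one_pos (Eventually.of_forall fun n => le_of_eq ?_)
  rw [one_mul, ← Real.rpow_natCast, ← Real.rpow_mul (Nat.cast_nonneg n)]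
  congr 1
  push_cast
  ring

theorem bigO_Mb' (hP : P.Valid) :
    BigO (expect P fun _ G => G.Mb') fun n => (n : ℝ) ^ (P.ζ * (6 - 2 * P.γ)) := by
  obtain ⟨K, hK⟩ := exists_eventually_regime hP
  obtain ⟨κ, _, hκ⟩ := exists_roundRate_pow_le hP
  refine ((bigO_moment_two_sq hP).const_mul (c := 180 * κ ^ 2) (by finiteness)).mono_left ?_
  filter_upwards [hK] with n hn using hn.Ex_background_parallelPairs_le hP hκ

theorem expect_mono {X Y : (n : ℕ) → Outcome n → ℕ} (h : ∀ n G, X n G ≤ Y n G) (n : ℕ) :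
    expect P X n ≤ expect P Y n := by
  rw [expect_eq_Ex, expect_eq_Ex]
  exact Ex_mono fun G => Nat.cast_le.2 (h n G)

theorem Mc_le_Mc' {n : ℕ} (G : Outcome n) : G.Mc ≤ G.Mc' :=
  Finset.sum_le_sum fun _ _ => multiEdges_le_parallelPairs _

theorem Mb_le_Mb' {n : ℕ} (G : Outcome n) : G.Mb ≤ G.Mb' := multiEdges_le_parallelPairs _

/-- The probability that a community is large enough for a node of degree `a`. -/
theorem exists_admProb_le (hP : P.Valid) : ∃ C : ℝ, 0 < C ∧ ∀ᶠ n : ℕ in atTop, ∀ a : ℕ, 1 ≤ a →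
    admProb P n a ≤ ENNReal.ofReal (C * (a : ℝ) ^ (1 - P.β)) := by
  have hβ := hP.one_lt_β
  have hξ := hP.ξ_lt_one
  have hs : 1 ≤ P.s := by
    have := hP.δ_lt_s
    omega
  have hsR : (1 : ℝ) ≤ P.s := by exact_mod_cast hs
  set C₀ : ℝ := (2 * P.s : ℝ) ^ P.β * (2 ^ P.β / (P.β - 1)) with hC₀
  have hβ1 : 0 < P.β - 1 := by linarith
  have hC₀0 : 0 < C₀ := by positivity
  have hξ1 : 0 < (1 - P.ξ) / 2 := by linarith
  refine ⟨(1 + C₀) * ((1 - P.ξ) / 2) ^ (1 - P.β), by positivity, ?_⟩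
  filter_upwards [(tendsto_maxComm hP).eventually_ge_atTop P.s] with n hn a ha
  have haR : (1 : ℝ) ≤ a := by exact_mod_cast ha
  set x : ℝ := (1 - P.ξ) / 2 * a with hx
  have hx0 : 0 < x := by positivity
  rw [mul_assoc, ← Real.mul_rpow hξ1.le (by linarith), ← hx]
  rcases lt_or_ge x 1 with h1 | h1
  · refine (Ex_le_of_support (a := 1) fun z _ => adm_le_one _ _ _).trans ?_
    rw [← ENNReal.ofReal_one]
    refine ENNReal.ofReal_le_ofReal ?_
    have := Real.one_le_rpow_of_pos_of_le_one_of_nonpos hx0 h1.le (show 1 - P.β ≤ 0 by linarith)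
    nlinarith
  · set m := ⌈x⌉₊ with hm
    have hxm : x ≤ m := Nat.le_ceil x
    have hm1 : 1 ≤ m := Nat.one_le_iff_ne_zero.2 (Nat.ceil_pos.2 hx0).ne'
    have h2 : admProb P n a ≤ Pr (sizeLaw P n) {z | m ≤ z} := by
      refine Ex_mono fun z => ?_
      rw [adm]
      split_ifs with hz
      · have hmz : m ≤ z := by
          refine Nat.ceil_le.2 ?_
          push_cast at hz
          linarith
        simp [hmz]
      · exact zero_le
    refine h2.trans ((Pr_tpl_ge_le hβ hs hn hm1).trans (ENNReal.ofReal_le_ofReal ?_))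
    rw [← hC₀]
    have h3 : (m : ℝ) ^ (1 - P.β) ≤ x ^ (1 - P.β) :=
      Real.rpow_le_rpow_of_nonpos hx0 hxm (by linarith)
    have h4 : 0 ≤ x ^ (1 - P.β) := by positivity
    nlinarith

theorem ofReal_sq_mul {a : ℕ} {y : ℝ≥0∞} {C b : ℝ}
    (h : 1 ≤ a → y ≤ ENNReal.ofReal (C * (a : ℝ) ^ (1 - b))) :
    (a : ℝ≥0∞) ^ 2 * y ≤ ENNReal.ofReal (C * (a : ℝ) ^ (3 - b)) := by
  rcases Nat.eq_zero_or_pos a with rfl | ha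
  · simp
  · have haR : (0 : ℝ) < a := by exact_mod_cast ha
    refine (mul_le_mul_right (h ha) _).trans (le_of_eq ?_)
    rw [← ENNReal.ofReal_natCast, ← ENNReal.ofReal_pow haR.le,
      ← ENNReal.ofReal_mul (by positivity), show 3 - b = 2 + (1 - b) by ring,
      Real.rpow_add haR, Real.rpow_two]
    congr 1
    ring

theorem add_mul_le_mul_one_add (a b S : ℝ≥0∞) : a + b * S ≤ (a + b) * (1 + S) := by
  rw [mul_add, mul_one, add_mul a b S]
  exact add_le_add le_self_add le_add_self

/-- Community self-loops, in terms of a sum over the range of the degrees. -/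
theorem exists_expect_Sc_le (hP : P.Valid) : ∃ C : ℝ≥0∞, C ≠ ∞ ∧ ∀ᶠ n : ℕ in atTop,
    expect P (fun _ G => G.Sc) n ≤ C * commCount P n * (1 + ENNReal.ofReal
      (∑ k ∈ Finset.Icc 1 (maxDeg P n), (k : ℝ) ^ (3 - P.β - P.γ))) + errorTerm P n := by
  obtain ⟨K, hK⟩ := exists_eventually_regime hP
  obtain ⟨κ, _, hκ⟩ := exists_roundRate_pow_le hP
  obtain ⟨C, hC, hadm⟩ := exists_admProb_le hP
  have hβ2 := hP.β_lt_two
  refine ⟨12 * κ * 2 * ((K : ℝ≥0∞) ^ 2 + 2 * (ENNReal.ofReal C *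
    ENNReal.ofReal ((2 * P.δ : ℝ) ^ P.γ))), by finiteness, ?_⟩
  filter_upwards [hK, hadm] with n hn ha
  have h1 := hn.Ex_Sc_le hP hκ (G := fun a => ENNReal.ofReal (C * (a : ℝ) ^ (3 - P.β)))
    (fun a b hab => ENNReal.ofReal_le_ofReal (mul_le_mul_of_nonneg_left
      (Real.rpow_le_rpow (Nat.cast_nonneg a) (Nat.cast_le.2 hab) (by linarith)) hC.le))
    fun a => ofReal_sq_mul (ha a)
  refine h1.trans (add_le_add ?_ le_rfl)
  set S := ∑ k ∈ Finset.Icc 1 (maxDeg P n), (k : ℝ) ^ (3 - P.β - P.γ) with hS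
  have h2 : Ex (tpl P.γ P.δ (maxDeg P n)) (fun a => ENNReal.ofReal (C * (a : ℝ) ^ (3 - P.β))) ≤
      ENNReal.ofReal C * ENNReal.ofReal ((2 * P.δ : ℝ) ^ P.γ) * ENNReal.ofReal S := by
    simp only [ENNReal.ofReal_mul hC.le, Ex_const_mul]
    rw [mul_assoc]
    gcongr
    rw [← ENNReal.ofReal_mul (by positivity)]
    exact Ex_tpl_rpow_le (by linarith [hP.two_lt_γ]) hP.one_le_δ hn.deg _
  calc _ ≤ 12 * κ * (2 * commCount P n * ((K : ℝ≥0∞) ^ 2 + 2 * (ENNReal.ofReal C *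
        ENNReal.ofReal ((2 * P.δ : ℝ) ^ P.γ) * ENNReal.ofReal S))) := by gcongr
    _ ≤ 12 * κ * (2 * commCount P n * (((K : ℝ≥0∞) ^ 2 + 2 * (ENNReal.ofReal C *
        ENNReal.ofReal ((2 * P.δ : ℝ) ^ P.γ))) * (1 + ENNReal.ofReal S))) := by
        gcongr
        rw [← mul_assoc 2]
        exact add_mul_le_mul_one_add _ _ _
    _ = _ := by ring

theorem bigO_of_sum (hP : P.Valid) {e : ℕ → ℝ≥0∞} {S r : ℕ → ℝ} {C₀ : ℝ≥0∞} (hC₀ : C₀ ≠ ∞)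
    (he : ∀ᶠ n : ℕ in atTop, e n ≤ C₀ * commCount P n * (1 + ENNReal.ofReal (S n)) + errorTerm P n)
    {C : ℝ} (hC : 0 < C) (hS : ∀ᶠ n : ℕ in atTop, S n ≤ C * r n) (hr : ∀ n, 0 ≤ r n)
    {c : ℝ} (hc : 0 < c) (hr1 : ∀ᶠ n : ℕ in atTop, 1 ≤ c * r n) :
    BigO e fun n => commRate P n * r n := by
  have h1 : BigO (fun _ => (1 : ℝ≥0∞)) r :=
    (BigO.const ENNReal.one_ne_top).mono_right hc hr1
  have h2 : BigO (fun n => ENNReal.ofReal (S n)) r :=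
    ⟨C, hC, by filter_upwards [hS] with n hn using ENNReal.ofReal_le_ofReal hn⟩
  have h3 := ((bigO_commCount hP).const_mul hC₀).mul (h1.add h2 hr) (commRate_nonneg P)
  have h4 : BigO (errorTerm P) fun n => commRate P n * r n := by
    refine (bigO_errorTerm hP).mono_right hc ?_
    filter_upwards [eventually_one_le_commRate hP, hr1] with n h5 h6
    nlinarith
  exact (h3.add h4 fun n => mul_nonneg (commRate_nonneg P n) (hr n)).mono_left he

theorem bigO_Sc (hP : P.Valid) (h : P.γ + P.β ≠ 4) :
    BigO (expect P fun _ G => G.Sc) fun n => (n : ℝ) ^ (1 - P.τ * (2 - P.β)) *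
      (1 + (n : ℝ) ^ (P.ζ * (4 - P.γ - P.β))) := by
  obtain ⟨C₀, hC₀, he⟩ := exists_expect_Sc_le hP
  obtain ⟨C, hC, hS⟩ := exists_sum_maxDeg_le hP (a := 3 - P.β - P.γ) fun h' => h (by linarith)
  rw [show 3 - P.β - P.γ + 1 = 4 - P.γ - P.β by ring] at hS
  exact bigO_of_sum hP hC₀ he hC hS (fun n => by positivity) one_pos
    (Eventually.of_forall fun n => by
      have : 0 ≤ (n : ℝ) ^ (P.ζ * (4 - P.γ - P.β)) := by positivity
      linarith)

theorem eventually_one_le_log : ∀ᶠ n : ℕ in atTop, 1 ≤ 1 * Real.log n := by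
  filter_upwards [eventually_ge_atTop 3] with n hn
  have hn3 : (3 : ℝ) ≤ n := by exact_mod_cast hn
  rw [one_mul, Real.le_log_iff_exp_le (by linarith)]
  linarith [Real.exp_one_lt_d9]

theorem bigO_Sc_log (hP : P.Valid) (h : P.γ + P.β = 4) :
    BigO (expect P fun _ G => G.Sc) fun n => (n : ℝ) ^ (1 - P.τ * (2 - P.β)) * Real.log n := by
  obtain ⟨C₀, hC₀, he⟩ := exists_expect_Sc_le hP
  obtain ⟨C, hC, hS⟩ := exists_sum_maxDeg_le_log hP
  rw [show 3 - P.β - P.γ = -1 by linarith] at he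
  exact bigO_of_sum hP hC₀ he hC hS (fun n => Real.log_natCast_nonneg n) one_pos
    eventually_one_le_log

theorem Ex_comm {Ω Ω' : Type*} (p : PMF Ω) (q : PMF Ω') (f : Ω → Ω' → ℝ≥0∞) :
    Ex p (fun a => Ex q fun b => f a b) = Ex q fun b => Ex p fun a => f a b := by
  simp only [Ex, ← ENNReal.tsum_mul_left]
  rw [ENNReal.tsum_comm]
  exact tsum_congr fun b => tsum_congr fun a => mul_left_comm _ _ _

/-- The mixed moment of the degrees that governs the number of parallel edges: it is dominated by
pairs in which the larger degree determines the admissible communities. -/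
theorem Ex_max_min_le (hP : P.Valid) {n : ℕ} (hn : P.δ ≤ maxDeg P n) :
    Ex (tpl P.γ P.δ (maxDeg P n)) (fun a => Ex (tpl P.γ P.δ (maxDeg P n)) fun b =>
      ENNReal.ofReal ((max a b : ℕ) ^ (3 - P.β) * ((min a b : ℕ) : ℝ) ^ (2 : ℝ))) ≤
    ENNReal.ofReal (2 * ((2 * P.δ : ℝ) ^ P.γ * (1 + 1 / (3 - P.γ)) * ((2 * P.δ : ℝ) ^ P.γ *
      ∑ k ∈ Finset.Icc 1 (maxDeg P n), (k : ℝ) ^ (6 - P.β - 2 * P.γ)))) := by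
  have hγ := hP.two_lt_γ
  have hγ3 := hP.γ_lt_three
  have hβ2 := hP.β_lt_two
  set H : ℕ → ℕ → ℝ≥0∞ := fun a b => ENNReal.ofReal ((a : ℝ) ^ (3 - P.β)) *
    ENNReal.ofReal (if b ≤ a then (b : ℝ) ^ (2 : ℝ) else 0) with hH
  have h1 : ∀ a b : ℕ, ENNReal.ofReal ((max a b : ℕ) ^ (3 - P.β) *
      ((min a b : ℕ) : ℝ) ^ (2 : ℝ)) ≤ H a b + H b a := by
    intro a b
    rw [ENNReal.ofReal_mul (by positivity)]
    rcases le_total b a with h | h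
    · rw [max_eq_left h, min_eq_right h]
      simp only [hH, h, if_true]
      exact le_self_add
    · rw [max_eq_right h, min_eq_left h]
      simp only [hH, h, if_true]
      exact le_add_self
  have h2 : Ex (tpl P.γ P.δ (maxDeg P n)) (fun a => Ex (tpl P.γ P.δ (maxDeg P n)) (H a)) ≤
      ENNReal.ofReal ((2 * P.δ : ℝ) ^ P.γ * (1 + 1 / (3 - P.γ)) * ((2 * P.δ : ℝ) ^ P.γ *
      ∑ k ∈ Finset.Icc 1 (maxDeg P n), (k : ℝ) ^ (6 - P.β - 2 * P.γ))) := by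
    have h3 : ∀ a : ℕ, Ex (tpl P.γ P.δ (maxDeg P n)) (H a) ≤
        ENNReal.ofReal ((2 * P.δ : ℝ) ^ P.γ * (1 + 1 / (3 - P.γ))) *
          ENNReal.ofReal ((a : ℝ) ^ (6 - P.β - P.γ)) := by
      intro a
      simp only [hH, Ex_const_mul]
      have h4 := Ex_tpl_ofReal_le (γ := P.γ) (by linarith) hP.one_le_δ hn
        (fun b => if b ≤ a then (b : ℝ) ^ (2 : ℝ) else 0) fun b => by split_ifs <;> positivity
      have h5 : ∑ k ∈ Finset.Icc 1 (maxDeg P n), (k : ℝ) ^ (-P.γ) *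
          (if k ≤ a then (k : ℝ) ^ (2 : ℝ) else 0) ≤
          (1 + 1 / (3 - P.γ)) * (a : ℝ) ^ (3 - P.γ) := by
        simp only [mul_ite, mul_zero]
        rw [← Finset.sum_filter]
        have h6 := sum_Icc_rpow_le (a := 2 - P.γ) (by linarith) a
        rw [show 2 - P.γ + 1 = 3 - P.γ by ring] at h6
        refine le_trans ((Finset.sum_le_sum fun k hk => le_of_eq ?_).trans
          (Finset.sum_le_sum_of_subset_of_nonneg (fun k hk => ?_) fun _ _ _ => by positivity)) h6
        · have hk1 : 1 ≤ k := (Finset.mem_Icc.1 (Finset.mem_filter.1 hk).1).1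
          have hk0 : (0 : ℝ) < k := by exact_mod_cast hk1
          rw [← Real.rpow_add hk0]
          congr 1
          ring
        · rw [Finset.mem_filter, Finset.mem_Icc] at hk
          exact Finset.mem_Icc.2 ⟨hk.1.1, hk.2⟩
      have hpos : 0 < 3 - P.γ := by linarith
      calc _ ≤ ENNReal.ofReal ((a : ℝ) ^ (3 - P.β)) * ENNReal.ofReal ((2 * P.δ : ℝ) ^ P.γ *
            ((1 + 1 / (3 - P.γ)) * (a : ℝ) ^ (3 - P.γ))) := by
            refine mul_le_mul_right (h4.trans (ENNReal.ofReal_le_ofReal ?_)) _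
            gcongr
        _ = _ := by
            rw [← ENNReal.ofReal_mul (by positivity), ← ENNReal.ofReal_mul (by positivity),
              show 6 - P.β - P.γ = (3 - P.β) + (3 - P.γ) by ring,
              Real.rpow_add_of_nonneg (Nat.cast_nonneg a) (by linarith) (by linarith)]
            congr 1
            ring
    refine (Ex_mono h3).trans ?_
    rw [Ex_const_mul]
    have hpos : 0 < 3 - P.γ := by linarith
    rw [ENNReal.ofReal_mul (p := (2 * P.δ : ℝ) ^ P.γ * (1 + 1 / (3 - P.γ))) (by positivity)]
    gcongr
    have h7 := Ex_tpl_rpow_le (γ := P.γ) (by linarith) hP.one_le_δ hn (6 - P.β - P.γ)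
    rwa [show 6 - P.β - P.γ - P.γ = 6 - P.β - 2 * P.γ by ring] at h7
  refine (Ex_mono fun a => Ex_mono (h1 a)).trans ?_
  simp only [Ex_add]
  rw [Ex_comm _ _ fun a b => H b a, ENNReal.ofReal_mul two_pos.le, ENNReal.ofReal_ofNat, two_mul]
  exact add_le_add h2 h2

theorem exists_expect_parallelPairs_le (hP : P.Valid) : ∃ C : ℝ≥0∞, C ≠ ∞ ∧
    ∀ᶠ n : ℕ in atTop, expect P (fun _ G => G.Mc') n ≤ C * commCount P n * (1 + ENNReal.ofReal
      (∑ k ∈ Finset.Icc 1 (maxDeg P n), (k : ℝ) ^ (6 - P.β - 2 * P.γ))) + errorTerm P n := by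
  obtain ⟨K, hK⟩ := exists_eventually_regime hP
  obtain ⟨κ, _, hκ⟩ := exists_roundRate_pow_le hP
  obtain ⟨C, hC, hadm⟩ := exists_admProb_le hP
  have hβ2 := hP.β_lt_two
  have hγ3 := hP.γ_lt_three
  have hpos : 0 < 3 - P.γ := by linarith
  set A : ℝ≥0∞ := ENNReal.ofReal (C * (2 * P.δ : ℝ) ^ P.γ) with hA
  set B : ℝ≥0∞ := ENNReal.ofReal (C * (2 * ((2 * P.δ : ℝ) ^ P.γ * (1 + 1 / (3 - P.γ)) *
    (2 * P.δ : ℝ) ^ P.γ))) with hB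
  refine ⟨180 * κ ^ 2 * 2 * ((K : ℝ≥0∞) ^ 4 + (4 * (K : ℝ≥0∞) ^ 2 * A + 4 * B)),
    by finiteness, ?_⟩
  filter_upwards [hK, hadm] with n hn ha
  have h1 := hn.Ex_parallelPairs_le hP hκ (G := fun a => ENNReal.ofReal (C * (a : ℝ) ^ (3 - P.β)))
    (fun a b hab => ENNReal.ofReal_le_ofReal (mul_le_mul_of_nonneg_left
      (Real.rpow_le_rpow (Nat.cast_nonneg a) (Nat.cast_le.2 hab) (by linarith)) hC.le))
    (fun a => ofReal_sq_mul (ha a))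
    (G₂ := fun a b => ENNReal.ofReal C * ENNReal.ofReal ((max a b : ℕ) ^ (3 - P.β) *
      ((min a b : ℕ) : ℝ) ^ (2 : ℝ)))
    (fun a b a' b' h h' => by
      refine mul_le_mul_right (ENNReal.ofReal_le_ofReal (mul_le_mul ?_ ?_ (by positivity)
        (by positivity))) _
      · exact Real.rpow_le_rpow (by positivity) (Nat.cast_le.2 (max_le_max h h')) (by linarith)
      · exact Real.rpow_le_rpow (by positivity) (Nat.cast_le.2 (min_le_min h h')) two_pos.le)
    (fun a b => by
      have h2 : (a : ℝ≥0∞) ^ 2 * (b : ℝ≥0∞) ^ 2 =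
          ((min a b : ℕ) : ℝ≥0∞) ^ 2 * ((max a b : ℕ) : ℝ≥0∞) ^ 2 := by
        rcases le_total a b with h | h
        · rw [max_eq_right h, min_eq_left h]
        · rw [max_eq_left h, min_eq_right h, mul_comm]
      rw [h2, mul_assoc]
      refine (mul_le_mul_right (ofReal_sq_mul (ha (max a b))) _).trans
        (le_of_eq ?_)
      rw [← ENNReal.ofReal_natCast (min a b), ← ENNReal.ofReal_pow (Nat.cast_nonneg _),
        ← ENNReal.ofReal_mul (by positivity), ← ENNReal.ofReal_mul hC.le, Real.rpow_two]
      congr 1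
      ring)
  refine h1.trans (add_le_add ?_ le_rfl)
  set S := ∑ k ∈ Finset.Icc 1 (maxDeg P n), (k : ℝ) ^ (6 - P.β - 2 * P.γ) with hS
  have h2 : Ex (tpl P.γ P.δ (maxDeg P n)) (fun a => ENNReal.ofReal (C * (a : ℝ) ^ (3 - P.β))) ≤
      A * ENNReal.ofReal S := by
    simp only [ENNReal.ofReal_mul hC.le, Ex_const_mul]
    rw [hA, ENNReal.ofReal_mul hC.le, mul_assoc]
    gcongr
    rw [← ENNReal.ofReal_mul (by positivity)]
    refine (Ex_tpl_rpow_le (by linarith [hP.two_lt_γ]) hP.one_le_δ hn.deg _).trans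
      (ENNReal.ofReal_le_ofReal ?_)
    exact mul_le_mul_of_nonneg_left (Finset.sum_le_sum fun k hk =>
      Real.rpow_le_rpow_of_exponent_le (by exact_mod_cast (Finset.mem_Icc.1 hk).1)
        (by linarith)) (by positivity)
  have h3 : Ex (tpl P.γ P.δ (maxDeg P n)) (fun a => Ex (tpl P.γ P.δ (maxDeg P n)) fun b =>
      ENNReal.ofReal C * ENNReal.ofReal ((max a b : ℕ) ^ (3 - P.β) *
        ((min a b : ℕ) : ℝ) ^ (2 : ℝ))) ≤ B * ENNReal.ofReal S := by
    simp only [Ex_const_mul]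
    refine (mul_le_mul_right (Ex_max_min_le hP hn.deg) _).trans (le_of_eq ?_)
    rw [← ENNReal.ofReal_mul hC.le, hB, ← ENNReal.ofReal_mul (by positivity)]
    congr 1
    ring
  calc _ ≤ 180 * κ ^ 2 * (2 * commCount P n * ((K : ℝ≥0∞) ^ 4 +
        4 * (K : ℝ≥0∞) ^ 2 * (A * ENNReal.ofReal S) + 4 * (B * ENNReal.ofReal S))) := by gcongr
    _ = 180 * κ ^ 2 * (2 * commCount P n * ((K : ℝ≥0∞) ^ 4 +
        (4 * (K : ℝ≥0∞) ^ 2 * A + 4 * B) * ENNReal.ofReal S)) := by ring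
    _ ≤ 180 * κ ^ 2 * (2 * commCount P n * (((K : ℝ≥0∞) ^ 4 +
        (4 * (K : ℝ≥0∞) ^ 2 * A + 4 * B)) * (1 + ENNReal.ofReal S))) := by
        gcongr
        exact add_mul_le_mul_one_add _ _ _
    _ = _ := by ring

theorem bigO_Mc' (hP : P.Valid) (h : 2 * P.γ + P.β ≠ 7) :
    BigO (expect P fun _ G => G.Mc') fun n => (n : ℝ) ^ (1 - P.τ * (2 - P.β)) *
      (1 + (n : ℝ) ^ (P.ζ * (7 - 2 * P.γ - P.β))) := by
  obtain ⟨C₀, hC₀, he⟩ := exists_expect_parallelPairs_le hP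
  obtain ⟨C, hC, hS⟩ := exists_sum_maxDeg_le hP (a := 6 - P.β - 2 * P.γ)
    fun h' => h (by linarith)
  rw [show 6 - P.β - 2 * P.γ + 1 = 7 - 2 * P.γ - P.β by ring] at hS
  exact bigO_of_sum hP hC₀ he hC hS (fun n => by positivity) one_pos
    (Eventually.of_forall fun n => by
      have : 0 ≤ (n : ℝ) ^ (P.ζ * (7 - 2 * P.γ - P.β)) := by positivity
      linarith)

theorem bigO_Mc'_log (hP : P.Valid) (h : 2 * P.γ + P.β = 7) :
    BigO (expect P fun _ G => G.Mc') fun n =>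
      (n : ℝ) ^ (1 - P.τ * (2 - P.β)) * Real.log n := by
  obtain ⟨C₀, hC₀, he⟩ := exists_expect_parallelPairs_le hP
  obtain ⟨C, hC, hS⟩ := exists_sum_maxDeg_le_log hP
  rw [show 6 - P.β - 2 * P.γ = -1 by linarith] at he
  exact bigO_of_sum hP hC₀ he hC hS (fun n => Real.log_natCast_nonneg n) one_pos
    eventually_one_le_log

theorem bigO_quadratic (hP : P.Valid) (K : ℕ) {a : ℝ} (ha : 0 ≤ a) (ha' : a < P.γ - 1) :
    BigO (fun n => ((K : ℝ≥0∞) ^ a + 2 * moment P n a) ^ 2) fun _ => 1 := by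
  have hK : (K : ℝ≥0∞) ^ a ≠ ∞ := ENNReal.rpow_ne_top_of_nonneg ha (by simp)
  have h1 := (BigO.const hK).add ((bigO_moment_one hP ha ha').const_mul (c := 2) (by simp))
    fun _ => zero_le_one
  have h2 := h1.mul h1 fun _ => zero_le_one
  simpa only [← sq, one_pow] using h2

theorem bigO_Ex_size (hP : P.Valid) {b : ℝ} (hb : 0 < b) (hb' : b < P.β - 1) :
    BigO (fun n => Ex (sizeLaw P n) fun z => ((z + 1 : ℕ) : ℝ≥0∞) ^ b) fun _ => 1 := by
  have hs : 1 ≤ P.s := by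
    have := hP.δ_lt_s
    omega
  have hsR : (1 : ℝ) ≤ P.s := by exact_mod_cast hs
  have hpos : 0 < P.β - b - 1 := by linarith
  refine ⟨2 ^ b * ((2 * P.s : ℝ) ^ P.β * (2 ^ (P.β - b) / (P.β - b - 1))), by positivity, ?_⟩
  filter_upwards [(tendsto_maxComm hP).eventually_ge_atTop P.s] with n hn
  have h1 : Ex (sizeLaw P n) (fun z => ((z + 1 : ℕ) : ℝ≥0∞) ^ b) ≤
      Ex (sizeLaw P n) fun z => ENNReal.ofReal (2 ^ b) * ENNReal.ofReal ((z : ℝ) ^ b) := by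
    refine Ex_mono_support fun z hz => ?_
    have hz1 : 1 ≤ z := hs.trans (mem_support_tpl hs hn hz).1
    rw [natCast_rpow_eq_ofReal _ hb.le, ← ENNReal.ofReal_mul (by positivity),
      ← Real.mul_rpow two_pos.le (Nat.cast_nonneg z)]
    refine ENNReal.ofReal_le_ofReal (Real.rpow_le_rpow (by positivity) ?_ hb.le)
    exact_mod_cast (by omega : z + 1 ≤ 2 * z)
  refine h1.trans ?_
  rw [Ex_const_mul, mul_one, ENNReal.ofReal_mul (by positivity)]
  gcongr
  refine (Ex_tpl_rpow_le (by linarith) hs hn b).trans (ENNReal.ofReal_le_ofReal ?_)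
  gcongr
  have := sum_Icc_rpow_neg_le (γ := P.β - b) (by linarith) le_rfl (maxComm P n)
  rw [Nat.cast_one, Real.one_rpow, mul_one, neg_sub] at this
  exact this

/-- If `4 < γ + β`, there is an `a` such that the degrees have a moment of order `a` and the sizes
have a moment of order `2 - a`. -/
theorem bigO_Mc_of_lt (hP : P.Valid) (h : 4 < P.γ + P.β) :
    BigO (expect P fun _ G => G.Mc) (commRate P) := by
  obtain ⟨K, hK⟩ := exists_eventually_regime hP
  obtain ⟨κ, hκ1, hκ⟩ := exists_roundRate_pow_le hP
  have hγ := hP.two_lt_γ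
  have hγ3 := hP.γ_lt_three
  have hβ2 := hP.β_lt_two
  -- the midpoint of `3 - β` and `γ - 1`
  set a : ℝ := P.γ - 1 - (P.γ + P.β - 4) / 2 with ha
  have h1 := ((bigO_commCount hP).const_mul (c := 2) (by simp)).mul
    (bigO_Ex_size hP (b := 2 - a) (by linarith) (by linarith)) (commRate_nonneg P)
  have h2 := h1.mul (bigO_quadratic hP K (a := a) (by linarith) (by linarith))
    fun n => by simpa using commRate_nonneg P n
  have h3 := h2.const_mul (c := 180 * κ ^ 2) (by finiteness)
  simp only [mul_one] at h3
  have h4 : BigO (errorTerm P) (commRate P) :=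
    (bigO_errorTerm hP).mono_right one_pos (by
      filter_upwards [eventually_one_le_commRate hP] with n hn
      linarith)
  refine (h3.add h4 (commRate_nonneg P)).mono_left ?_
  filter_upwards [hK] with n hn
  exact hn.Ex_multiEdges_le hP hκ hκ1 (a := a) (by linarith) (by linarith)

theorem bigO_Mc (hP : P.Valid) :
    BigO (expect P fun _ G => G.Mc) fun n => (n : ℝ) ^ (1 - P.τ * (2 - P.β)) *
      (1 + (n : ℝ) ^ (P.ζ * (7 - 2 * P.γ - P.β))) := by
  by_cases h : 2 * P.γ + P.β = 7
  · -- the exponent of the second summand vanishes, but then `4 < γ + β` since `γ < 3`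
    refine (bigO_Mc_of_lt hP (by linarith [hP.γ_lt_three])).mono_right one_pos
      (Eventually.of_forall fun n => ?_)
    have h1 := commRate_nonneg P n
    have h2 : 0 ≤ (n : ℝ) ^ (P.ζ * (7 - 2 * P.γ - P.β)) := by positivity
    rw [commRate] at h1 ⊢
    nlinarith
  · exact (bigO_Mc' hP h).mono_left (Eventually.of_forall
      (expect_mono fun _ G => Mc_le_Mc' G))

theorem bigO_half_pow (hP : P.Valid) {κ : ℕ} (hκ : 1 ≤ κ) : BigO (fun n : ℕ =>
    3 * ENNReal.ofReal ((1 / 2) ^ ((n - 2) / 2 / κ)) * (n ^ 2 * maxDeg P n ^ 4 : ℕ))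
    fun _ => 1 := by
  refine ⟨3, by norm_num, ?_⟩
  filter_upwards [eventually_half_pow_le (ρ := 1 / 2) (by norm_num) (by norm_num) hκ 6,
    eventually_sq_mul_maxDeg_le hP, eventually_gt_atTop 0] with n h1 h2 h3
  have hn : (0 : ℝ) < n := by exact_mod_cast h3
  rw [← ENNReal.ofReal_natCast]
  calc _ ≤ 3 * ENNReal.ofReal ((n : ℝ) ^ (-6 : ℝ)) * ENNReal.ofReal ((n : ℝ) ^ (6 : ℝ)) := by
        gcongr
    _ = 3 := by
      rw [mul_assoc, ← ENNReal.ofReal_mul (by positivity), ← Real.rpow_add hn]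
      norm_num
    _ = _ := by norm_num

theorem bigO_Mbc_of_bigO (hP : P.Valid) {b : ℝ} (hb : 0 < b) (hb1 : b ≤ 1) {r : ℕ → ℝ}
    (hr : ∀ n, 0 ≤ r n) (hr1 : ∀ᶠ n in atTop, 1 ≤ r n) (h2 : BigO (fun n => moment P n 2) r)
    (h : ∀ K : ℕ, BigO (fun n => ((maxComm P n + 1 : ℕ) : ℝ≥0∞) ^ (1 - b) *
        ((K : ℝ≥0∞) ^ (1 + b) + 2 * moment P n (1 + b)) ^ 2) r) :
    BigO (expect P fun _ G => G.Mbc) r := by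
  obtain ⟨K, hK⟩ := exists_eventually_regime hP
  obtain ⟨κ, hκ1, hκ⟩ := exists_roundRate_pow_le hP
  have h3 : ∀ {e : ℕ → ℝ≥0∞}, BigO e (fun _ => 1) → BigO e r := fun he =>
    he.mono_right one_pos (by filter_upwards [hr1] with n hn; linarith)
  refine ((((h2.const_mul (c := 12 * κ) (by finiteness)).add
    ((h K).const_mul (c := 72 * κ ^ 2) (by finiteness)) hr).add
    (h3 (bigO_half_pow hP hκ1)) hr).add (h3 (bigO_errorTerm hP)) hr).mono_left ?_
  filter_upwards [hK] with n hn using hn.Ex_Mbc_le hP hκ hκ1 hb hb1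

theorem add_sq_le_four_mul (x y : ℝ≥0∞) : (x + y) ^ 2 ≤ 4 * (x ^ 2 + y ^ 2) := by
  have h : ∀ a b : ℝ≥0∞, a ≤ b → (a + b) ^ 2 ≤ 4 * (a ^ 2 + b ^ 2) := fun a b hab =>
    calc (a + b) ^ 2 ≤ (b + b) ^ 2 := by gcongr
      _ = 4 * b ^ 2 := by ring
      _ ≤ 4 * (a ^ 2 + b ^ 2) := by gcongr; exact le_add_self
  rcases le_total x y with hxy | hxy
  · exact h x y hxy
  · rw [add_comm x, add_comm (x ^ 2)]
    exact h y x hxy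

/-- A bound for the background edges that are also community edges, by the number of pairs of
parallel edges that a background graph and a community graph would have. -/
theorem bigO_Mbc (hP : P.Valid) :
    BigO (expect P fun _ G => G.Mbc) fun n => (n : ℝ) ^ (P.ζ * (6 - 2 * P.γ)) := by
  have hγ3 := hP.γ_lt_three
  have hpos : 0 ≤ P.ζ * (6 - 2 * P.γ) := mul_nonneg hP.ζ_pos.le (by linarith)
  have h2 : BigO (fun n => moment P n 2) fun n => (n : ℝ) ^ (P.ζ * (6 - 2 * P.γ)) := by
    refine (bigO_moment_two hP).mono_right one_pos ?_
    filter_upwards [eventually_ge_atTop 1] with n hn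
    rw [one_mul]
    refine Real.rpow_le_rpow_of_exponent_le (by exact_mod_cast hn) ?_
    nlinarith [hP.ζ_pos]
  refine bigO_Mbc_of_bigO hP one_pos le_rfl (fun n => by positivity)
    (eventually_one_le_rpow hpos) h2 fun K => ?_
  have h3 : BigO (fun n => 4 * ((K : ℝ≥0∞) ^ 2) ^ 2 + 16 * moment P n 2 ^ 2)
      fun n => (n : ℝ) ^ (P.ζ * (6 - 2 * P.γ)) :=
    (BigO.of_one_le (by finiteness) (eventually_one_le_rpow hpos)).add
      ((bigO_moment_two_sq hP).const_mul (by simp)) fun n => by positivity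
  refine h3.mono_left (Eventually.of_forall fun n => ?_)
  rw [sub_self, ENNReal.rpow_zero, one_mul, one_add_one_eq_two, ENNReal.rpow_two]
  calc ((K : ℝ≥0∞) ^ 2 + 2 * moment P n 2) ^ 2
      ≤ 4 * (((K : ℝ≥0∞) ^ 2) ^ 2 + (2 * moment P n 2) ^ 2) := add_sq_le_four_mul _ _
    _ = _ := by ring

/-- A bound for the background edges that are also community edges that takes the sizes of the
communities into account. -/
theorem bigO_Mbc_of_lt (hP : P.Valid) {ε : ℝ} (h0 : 0 < ε) (h1 : ε < P.γ - 2) :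
    BigO (expect P fun _ G => G.Mbc) fun n => (n : ℝ) ^ (P.τ * (3 - P.γ + ε)) := by
  have hγ3 := hP.γ_lt_three
  have hpos : 0 ≤ P.τ * (3 - P.γ + ε) := mul_nonneg hP.τ_pos.le (by linarith)
  have h2 : BigO (fun n => moment P n 2) fun n => (n : ℝ) ^ (P.τ * (3 - P.γ + ε)) := by
    refine (bigO_moment_two hP).mono_right one_pos ?_
    filter_upwards [eventually_ge_atTop 1] with n hn
    rw [one_mul]
    refine Real.rpow_le_rpow_of_exponent_le (by exact_mod_cast hn) ?_
    nlinarith [hP.ζ_pos, hP.ζ_lt_τ]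
  refine bigO_Mbc_of_bigO hP (b := P.γ - 2 - ε) (by linarith) (by linarith)
    (fun n => by positivity) (eventually_one_le_rpow hpos) h2 fun K => ?_
  have h3 : BigO (fun n => ((maxComm P n + 1 : ℕ) : ℝ≥0∞) ^ (1 - (P.γ - 2 - ε)))
      fun n => (n : ℝ) ^ (P.τ * (3 - P.γ + ε)) := by
    refine ⟨2 ^ (3 - P.γ + ε), by positivity, ?_⟩
    filter_upwards [(tendsto_maxComm hP).eventually_ge_atTop 1] with n hn
    rw [natCast_rpow_eq_ofReal _ (by linarith), Real.rpow_mul (Nat.cast_nonneg n),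
      ← Real.mul_rpow two_pos.le (by positivity), show 1 - (P.γ - 2 - ε) = 3 - P.γ + ε by ring]
    refine ENNReal.ofReal_le_ofReal (Real.rpow_le_rpow (by positivity) ?_ (by linarith))
    have h4 : (1 : ℝ) ≤ maxComm P n := by exact_mod_cast hn
    have h5 := maxComm_le_rpow P n
    push_cast
    linarith
  have h4 := h3.mul (bigO_quadratic hP K (a := 1 + (P.γ - 2 - ε)) (by linarith) (by linarith))
    fun n => by positivity
  simpa only [mul_one] using h4

end UpperBounds

/-! ### Lower bounds on the expected numbers of collisions in the communities -/

section LowerBounds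

variable {P : Params} {n K : ℕ}

/-- With probability at least one half, the degrees are typical, their sum is of order `n`, and the
nodes whose degrees are of the order of `a` are as numerous as expected. -/
theorem exists_half_le_Pr_degrees (hP : P.Valid) (hK : ∀ᶠ n : ℕ in atTop, Regime P n K) :
    ∃ C : ℝ, 0 < C ∧ ∀ᶠ n : ℕ in atTop, ∀ (a : ℕ) (q : ℝ), 0 ≤ q →
      ENNReal.ofReal q ≤ Pr (tpl P.γ P.δ (maxDeg P n)) {k | a ≤ k ∧ k < 2 * a} → 16 ≤ n * q →
      1 / 2 ≤ Pr (degrees P n) {d | GoodDegrees P n K d ∧ ((∑ i, d i : ℕ) : ℝ) ≤ C * n ∧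
        n * q / 8 ≤ (Finset.univ.filter fun i => a ≤ d i ∧ d i < 2 * a).card} := by
  obtain ⟨C, hC, hmom⟩ := bigO_moment_one hP (a := 1) zero_le_one (by linarith [hP.two_lt_γ])
  refine ⟨8 * C, by positivity, ?_⟩
  filter_upwards [hK, hmom, eventually_ge_atTop 8] with n hn hmom hn8 a q hq0 hq hnq
  have hnR : (8 : ℝ) ≤ n := by exact_mod_cast hn8
  set S := {d : Fin n → ℕ | GoodDegrees P n K d ∧ ((∑ i, d i : ℕ) : ℝ) ≤ 8 * C * n ∧
    n * q / 8 ≤ (Finset.univ.filter fun i => a ≤ d i ∧ d i < 2 * a).card} with hS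
  have b1 : Pr (degrees P n) {d | ¬ GoodDegrees P n K d} ≤ ENNReal.ofReal (1 / 8) := by
    refine (hn.Pr_not_goodDegrees_le hP).trans (ENNReal.ofReal_le_ofReal ?_)
    refine (pow_le_pow_of_le_one (by norm_num) (by norm_num) hn8).trans ?_
    norm_num
  have b2 : Pr (degrees P n) {d | ¬ ((∑ i, d i : ℕ) : ℝ) ≤ 8 * C * n} ≤
      ENNReal.ofReal (1 / 8) := by
    have h1 : ENNReal.ofReal (8 * C * n) * Pr (degrees P n)
        {d | ¬ ((∑ i, d i : ℕ) : ℝ) ≤ 8 * C * n} ≤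
        ENNReal.ofReal (8 * C * n) * ENNReal.ofReal (1 / 8) := by
      refine (mul_Pr_le_Ex (f := fun d => ∑ i, (d i : ℝ≥0∞) ^ (1 : ℝ)) fun d _ hd => ?_).trans
        ((Ex_degrees_sum_le (monotone_natCast_rpow zero_le_one)).trans ?_)
      · simp only [ENNReal.rpow_one]
        rw [← Nat.cast_sum, ← ENNReal.ofReal_natCast]
        exact ENNReal.ofReal_le_ofReal (not_le.1 hd).le
      · refine (mul_le_mul_right hmom _).trans (le_of_eq ?_)
        rw [← ENNReal.ofReal_natCast, ← ENNReal.ofReal_mul (by positivity),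
          ← ENNReal.ofReal_mul (by positivity)]
        congr 1
        ring
    exact (ENNReal.mul_le_mul_iff_right (by simpa using by positivity) (by finiteness)).1 h1
  have b3 : Pr (degrees P n) {d | ((Finset.univ.filter fun i => a ≤ d i ∧ d i < 2 * a).card : ℝ)
      + 1 ≤ n * q / 4} ≤ ENNReal.ofReal (1 / 8) := by
    refine (Pr_degrees_block_le hq0 hq).trans (ENNReal.ofReal_le_ofReal ?_)
    have h1 : Real.exp (-(n * q / 4)) ≤ Real.exp (-4) := Real.exp_le_exp.2 (by linarith)
    have h2 : (3 : ℝ) ≤ Real.exp 2 := by linarith [Real.add_one_le_exp (2 : ℝ)]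
    have h3 : (8 : ℝ) ≤ Real.exp 4 := by
      rw [show (4 : ℝ) = 2 + 2 by norm_num, Real.exp_add]
      nlinarith
    refine h1.trans ?_
    rw [Real.exp_neg, ← one_div]
    exact one_div_le_one_div_of_le (by norm_num) h3
  have hcompl : Pr (degrees P n) Sᶜ ≤ ENNReal.ofReal (1 / 2) := by
    refine (Pr_mono (t := {d | ¬ GoodDegrees P n K d} ∪
      {d | ¬ ((∑ i, d i : ℕ) : ℝ) ≤ 8 * C * n} ∪
      {d | ((Finset.univ.filter fun i => a ≤ d i ∧ d i < 2 * a).card : ℝ) + 1 ≤ n * q / 4})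
      fun d _ hd => ?_).trans ((Pr_union_le _ _ _).trans
        ((add_le_add ((Pr_union_le _ _ _).trans (add_le_add b1 b2)) b3).trans ?_))
    · by_contra hcon
      simp only [Set.mem_union, not_or] at hcon
      have h4 : n * q / 4 < (Finset.univ.filter fun i => a ≤ d i ∧ d i < 2 * a).card + 1 :=
        lt_of_not_ge hcon.2
      refine hd ⟨not_not.1 hcon.1.1, not_not.1 hcon.1.2, ?_⟩
      linarith
    · rw [← ENNReal.ofReal_add (by norm_num) (by norm_num),
        ← ENNReal.ofReal_add (by norm_num) (by norm_num)]
      exact ENNReal.ofReal_le_ofReal (by norm_num)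
  have h6 : (1 / 2 : ℝ≥0∞) + ENNReal.ofReal (1 / 2) ≤
      Pr (degrees P n) S + ENNReal.ofReal (1 / 2) := by
    calc (1 / 2 : ℝ≥0∞) + ENNReal.ofReal (1 / 2) = 1 := by
          rw [ENNReal.ofReal_div_of_pos two_pos, ENNReal.ofReal_one, ENNReal.ofReal_ofNat,
            ENNReal.add_halves]
      _ = Pr (degrees P n) S + Pr (degrees P n) Sᶜ := (Pr_add_compl _ S).symm
      _ ≤ _ := by gcongr
  exact (ENNReal.add_le_add_iff_right (by finiteness)).1 h6

/-- The community `j` has a size of the order of `Z`, at least `x` nodes of degree at least `a`, and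
a total degree of at most `T`. -/
def IsRich {c : List ℕ} (d : Fin n → ℕ) (Z a x : ℕ) (T : ℝ) (comm : Fin n → Option (Fin c.length))
    (j : Fin c.length) : Prop :=
  (Z ≤ c.get j ∧ c.get j ≤ 2 * Z) ∧ x ≤ highCount d a j comm ∧
    ((∑ i, if comm i = some j then d i else 0 : ℕ) : ℝ) ≤ T

open Classical in
/-- If every rich community contributes at least `v` to a statistic, then its expectation is at
least of the order of `v` times the expected number of communities whose size is of the order
of `Z`. -/
theorem exists_le_Ex_law (hP : P.Valid) : ∃ C : ℝ, 0 < C ∧ ∀ᶠ n : ℕ in atTop,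
    ∀ (a Z x : ℕ) (q : ℝ), 0 ≤ q →
      ENNReal.ofReal q ≤ Pr (tpl P.γ P.δ (maxDeg P n)) {k | a ≤ k ∧ k < 2 * a} → 16 ≤ n * q →
      2 * a ≤ Z → 2 ^ x * (Real.exp (-(Z * q / 32)) + (1 / 2) ^ (Z / 2)) ≤ (1 / 2 : ℝ) →
    ∀ (X : Outcome n → ℝ≥0∞) (v : ℝ≥0∞),
      (∀ d ∈ (degrees P n).support, ∀ (c : List ℕ) (comm : Fin n → Option (Fin c.length)),
        ∑ j, (if IsRich d Z a x (C * Z) comm j then v else 0) ≤ Ex (phase4 P d comm) X) →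
      v * (commCount P n * Pr (sizeLaw P n) {z | Z ≤ z ∧ z < 2 * Z}) ≤
        8 * Ex (law P n) X + 2 * v := by
  obtain ⟨K, hK⟩ := exists_eventually_regime hP
  obtain ⟨C, hC, hdeg⟩ := exists_half_le_Pr_degrees hP hK
  refine ⟨8 * (K + 2 * C), by positivity, ?_⟩
  filter_upwards [hK, hdeg, eventually_badProb_le hP 1, eventually_gt_atTop 0]
    with n hn hdeg hbad hn0 a Z x q hq0 hq hnq haZ hx X v hX
  have hnR : (0 : ℝ) < n := by exact_mod_cast hn0
  set B : List ℕ → ℝ≥0∞ := fun c => (c.map fun z => if Z ≤ z ∧ z ≤ 2 * Z then 1 else 0).sum with hB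
  -- given typical degrees and sizes
  have h1 : ∀ d ∈ (degrees P n).support, GoodDegrees P n K d → ((∑ i, d i : ℕ) : ℝ) ≤ C * n →
      n * q / 8 ≤ (Finset.univ.filter fun i => a ≤ d i ∧ d i < 2 * a).card →
      ∀ c, GoodSizes P n c → v / 4 * B c ≤
        Ex (commLaw P n c d) fun comm => Ex (phase4 P d comm) X := by
    intro d hd hd1 hd2 hd3 c hc
    refine le_trans ?_ (Ex_mono fun comm => hX d hd c comm)
    rw [Ex_sum, hB]
    dsimp only
    rw [← sum_get_eq c fun z => if Z ≤ z ∧ z ≤ 2 * Z then (1 : ℝ≥0∞) else 0, Finset.mul_sum]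
    refine Finset.sum_le_sum fun j _ => ?_
    split_ifs with hj
    · have hZR : (Z : ℝ) ≤ c.get j := by exact_mod_cast hj.1
      have hZR2 : ((c.get j : ℕ) : ℝ) ≤ 2 * Z := by exact_mod_cast hj.2
      have h2 := hc.quarter_le_Pr hP hd1 hC.le hd2 j (a := a) (x := x) (y := n * q / 8)
        (hd3.trans (Nat.cast_le.2 (Finset.card_le_card fun i hi => by
          simp only [Finset.mem_filter, Finset.mem_univ, true_and] at hi ⊢
          omega)))
        (by
          refine le_trans ?_ hx
          gcongr 2 ^ x * (Real.exp ?_ + ?_)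
          · have : ((c.get j : ℕ) : ℝ) * (n * q / 8) / (4 * n) = c.get j * q / 32 := by
              field_simp
              ring
            rw [this]
            gcongr
          · exact pow_le_pow_of_le_one (by norm_num) (by norm_num)
              (Nat.div_le_div_right hj.1))
      rw [mul_one, div_eq_mul_inv, ← one_div]
      refine (mul_le_mul_right h2 v).trans (mul_Pr_le_Ex fun comm _ hcomm => ?_)
      have : IsRich d Z a x (8 * (K + 2 * C) * Z) comm j := by
        refine ⟨hj, hcomm.1, hcomm.2.trans ?_⟩
        have : 0 ≤ K + 2 * C := by positivity
        nlinarith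
      rw [if_pos this]
    · simp
  -- atypical sizes
  have h2 : Ex (communitySizes P n) B ≤ Ex (communitySizes P n)
      (fun c => if GoodSizes P n c then B c else 0) + 1 := by
    refine (Ex_le_add_mul_Pr (s := {c | ¬ GoodSizes P n c}) (b := (n : ℝ≥0∞))
      (g := fun c => if GoodSizes P n c then B c else 0)
      (fun c hc hgood => ?_) (fun c hc => ?_)).trans ?_
    · rw [if_pos (not_not.1 hgood)]
    · obtain ⟨hs, hz⟩ := hn.mem_communitySizes hc
      have hle : B c ≤ (c.map fun z : ℕ => (z : ℝ≥0∞)).sum := by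
        refine List.sum_le_sum fun z hzc => ?_
        have := (hz z hzc).1
        have := hn.size.two_le
        split_ifs
        · exact_mod_cast (by omega : 1 ≤ z)
        · exact zero_le
      refine hle.trans (le_of_eq ?_)
      rw [← hs]
      exact (Nat.cast_list_sum c).symm
    · gcongr
      calc (n : ℝ≥0∞) * Pr (communitySizes P n) {c | ¬ GoodSizes P n c} ≤
            ENNReal.ofReal n * ENNReal.ofReal ((n : ℝ) ^ (-1 : ℝ)) := by
            rw [ENNReal.ofReal_natCast]
            gcongr
            exact (hn.Pr_not_goodSizes_le.trans le_add_self).trans hbad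
        _ = 1 := by
            rw [← ENNReal.ofReal_mul hnR.le, Real.rpow_neg_one, mul_inv_cancel₀ hnR.ne',
              ENNReal.ofReal_one]
  -- average over the degrees and sizes
  have h3 : v / 4 * Ex (communitySizes P n) (fun c => if GoodSizes P n c then B c else 0) *
      (1 / 2) ≤ Ex (law P n) X := by
    rw [Ex_law]
    refine (mul_le_mul_right (hdeg a q hq0 hq hnq) _).trans (mul_Pr_le_Ex fun d hd hdS => ?_)
    rw [← Ex_const_mul]
    refine Ex_mono fun c => ?_
    split_ifs with hc
    · exact h1 d hd hdS.1 hdS.2.1 hdS.2.2 c hc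
    · simp
  have h4 := hn.size.le_Ex_block Z
  have h0 : meanSize P n ≠ 0 := (lt_of_lt_of_le one_pos hn.size.one_le_meanSize).ne'
  rw [mul_comm (meanSize P n), ← ENNReal.div_le_iff_le_mul (Or.inl h0)
    (Or.inl hn.size.meanSize_ne_top)] at h4
  have h5 : commCount P n * Pr (sizeLaw P n) {z | Z ≤ z ∧ z < 2 * Z} ≤
      Ex (communitySizes P n) (fun c => if GoodSizes P n c then B c else 0) + 2 := by
    rw [commCount, div_eq_mul_inv, mul_right_comm, ← div_eq_mul_inv]
    refine h4.trans ((add_le_add h2 le_rfl).trans (le_of_eq ?_))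
    rw [add_assoc, one_add_one_eq_two]
  refine (mul_le_mul_right h5 v).trans ?_
  rw [mul_add, mul_comm v 2]
  refine add_le_add (le_trans (le_of_eq ?_) (mul_le_mul_right h3 8)) le_rfl
  set E := Ex (communitySizes P n) (fun c => if GoodSizes P n c then B c else 0)
  rw [div_eq_mul_inv]
  have : (8 : ℝ≥0∞) * ((4 : ℝ≥0∞)⁻¹ * (1 / 2)) = 1 := by
    rw [one_div, ← ENNReal.mul_inv (by simp) (by simp)]
    norm_num
    exact ENNReal.mul_inv_cancel (by simp) (by simp)
  calc v * E = v * E * (8 * ((4 : ℝ≥0∞)⁻¹ * (1 / 2))) := by rw [this, mul_one]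
    _ = _ := by ring

end LowerBounds

section RichCommunities

variable {P : Params} {n : ℕ} {d : Fin n → ℕ} {c : List ℕ} {comm : Fin n → Option (Fin c.length)}
  {Z a x : ℕ} {T : ℝ}

/-- The adjustment of the parity takes at most one community half-edge from a node. -/
theorem floor_sub_one_le_commDeg (hP : P.Valid) {y₀ : Fin n → ℕ} (hy : y₀ ∈ (roundLaw P d).support)
    {j : Fin c.length} {i : Fin n} (hi : a ≤ d i) (hj : comm i = some j) :
    ⌊(1 - P.ξ) * a⌋₊ - 1 ≤ commDeg comm (fixParity d comm y₀) j i := by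
  have h1 : ⌊(1 - P.ξ) * d i⌋₊ ≤ y₀ i := floor_le_randRound (mem_support_indep hy i)
  have h2 : ⌊(1 - P.ξ) * a⌋₊ ≤ ⌊(1 - P.ξ) * d i⌋₊ := by
    have := hP.ξ_lt_one
    gcongr
  have h3 := le_fixParity_add_one (d := d) (comm := comm) (y := y₀) i
  rw [commDeg, if_pos hj]
  omega

theorem IsRich.sum_commDeg_le {j : Fin c.length} (h : IsRich d Z a x T comm j) {y : Fin n → ℕ}
    (hy : ∀ i, y i ≤ d i) : ((∑ i, commDeg comm y j i : ℕ) : ℝ) ≤ T := by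
  refine le_trans (Nat.cast_le.2 (Finset.sum_le_sum fun i _ => ?_)) h.2.2
  rw [commDeg]
  split_ifs
  · exact hy i
  · exact le_rfl

open Classical in
/-- A node with two community half-edges has a self-loop with probability at least the inverse of
the degree sum of its community graph. -/
theorem sum_isRich_le_Ex_Sc (hP : P.Valid) (hd : Antitone d) (ha : 3 ≤ ⌊(1 - P.ξ) * a⌋₊) :
    ∑ j, (if IsRich d Z a 1 T comm j then (ENNReal.ofReal T)⁻¹ else 0) ≤
      Ex (phase4 P d comm) fun G => (G.Sc : ℝ≥0∞) := by
  simp only [Outcome.Sc, Nat.cast_sum]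
  refine le_of_le_of_eq (le_Ex_of_support fun y₀ hy₀ => Finset.sum_le_sum fun j _ => ?_)
    (Ex_phase4_sum_community (comm := comm) (fun g => (loops g : ℝ≥0∞))).symm
  split_ifs with hj
  · obtain ⟨i, hi⟩ := Finset.card_pos.1 (Nat.lt_of_succ_le hj.2.1)
    obtain ⟨-, hi1, hi2⟩ := Finset.mem_filter.1 hi
    have h1 := floor_sub_one_le_commDeg hP hy₀ hi1 hi2
    have hy := le_of_mem_roundLaw hP hy₀
    refine le_trans ?_ (le_Ex_loops (even_sum_commDeg hd hy j) (i := i) (by omega))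
    rw [one_div]
    refine ENNReal.inv_le_inv.2 ?_
    rw [← ENNReal.ofReal_natCast]
    exact ENNReal.ofReal_le_ofReal (hj.sum_commDeg_le (fixParity_le hy))
  · exact zero_le

open Classical in
/-- In a rich community all pairs of the `x` nodes of high degree are likely to be joined by
multi-edges, if the squares of their degrees are of the order of the degree sum. -/
theorem sum_isRich_le_Ex_Mc (hP : P.Valid) (hd : Antitone d) {y : ℕ} (hy5 : 5 ≤ y)
    (hya : y ≤ ⌊(1 - P.ξ) * a⌋₊ - 1) {C : ℝ} (hC : 1 ≤ C) (hT : T ≤ C * (y : ℝ) ^ 2) :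
    ∑ j, (if IsRich d Z a x T comm j then
      ((x * (x - 1) : ℕ) : ℝ≥0∞) * ENNReal.ofReal (1 / (50 * C ^ 2)) else 0) ≤
      Ex (phase4 P d comm) fun G => 2 * (G.Mc : ℝ≥0∞) := by
  simp only [Outcome.Mc, Nat.cast_sum, Finset.mul_sum]
  refine le_of_le_of_eq (le_Ex_of_support fun y₀ hy₀ => Finset.sum_le_sum fun j _ => ?_)
    (Ex_phase4_sum_community (comm := comm) (fun g => 2 * (multiEdges g : ℝ≥0∞))).symm
  split_ifs with hj
  · have hy := le_of_mem_roundLaw hP hy₀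
    set D := commDeg comm (fixParity d comm y₀) j with hD
    set H : Finset (Fin n) := Finset.univ.filter fun i => a ≤ d i ∧ comm i = some j with hH
    have hx : x ≤ H.card := hj.2.1
    have h1 : ∀ i ∈ H, y ≤ D i := fun i hi => by
      obtain ⟨-, hi1, hi2⟩ := Finset.mem_filter.1 hi
      exact hya.trans (floor_sub_one_le_commDeg hP hy₀ hi1 hi2)
    calc ((x * (x - 1) : ℕ) : ℝ≥0∞) * ENNReal.ofReal (1 / (50 * C ^ 2))
        ≤ (H.offDiag.card : ℝ≥0∞) * ENNReal.ofReal (1 / (50 * C ^ 2)) := by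
          gcongr
          rw [Finset.offDiag_card, ← Nat.mul_sub_one]
          exact Nat.mul_le_mul hx (Nat.sub_le_sub_right hx 1)
      _ = ∑ p ∈ H.offDiag, ENNReal.ofReal (1 / (50 * C ^ 2)) := by
          rw [Finset.sum_const, nsmul_eq_mul]
      _ ≤ ∑ p ∈ H.offDiag, Ex (configModel D)
            (fun g => if 2 ≤ mult g s(p.1, p.2) then (1 : ℝ≥0∞) else 0) := by
          refine Finset.sum_le_sum fun p hp => ?_
          obtain ⟨hp1, hp2, hne⟩ := Finset.mem_offDiag.1 hp
          exact le_Ex_two_le_mult (even_sum_commDeg hd hy j) hne hy5 (h1 _ hp1) (h1 _ hp2) hC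
            ((hj.sum_commDeg_le (fixParity_le hy)).trans hT)
      _ ≤ ∑ p ∈ (Finset.univ : Finset (Fin n)).offDiag, Ex (configModel D)
            (fun g => if 2 ≤ mult g s(p.1, p.2) then (1 : ℝ≥0∞) else 0) :=
          Finset.sum_le_sum_of_subset (Finset.offDiag_mono (Finset.subset_univ H))
      _ ≤ Ex (configModel D) fun g => 2 * (multiEdges g : ℝ≥0∞) := by
          rw [← Ex_sum]
          refine Ex_mono fun g => ?_
          have := (Nat.cast_le (α := ℝ≥0∞)).2 (sum_offDiag_le_two_mul_multiEdges g)
          push_cast at this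
          exact this
  · exact zero_le

end RichCommunities

section LowerAsymptotics

variable {P : Params}

theorem exists_le_commCount (hP : P.Valid) : ∃ c : ℝ, 0 < c ∧ ∀ᶠ n : ℕ in atTop,
    ENNReal.ofReal (c * commRate P n) ≤ commCount P n := by
  obtain ⟨C, hC, h⟩ := exists_meanSize_le hP
  refine ⟨1 / C, by positivity, ?_⟩
  filter_upwards [h, eventually_gt_atTop 0] with n h1 h2
  have hn : (0 : ℝ) < n := by exact_mod_cast h2
  rw [commCount]
  refine le_trans (le_of_eq ?_) (ENNReal.div_le_div_left h1 _)
  rw [← ENNReal.ofReal_natCast, ← ENNReal.ofReal_div_of_pos (by positivity), commRate,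
    Real.rpow_sub hn, Real.rpow_one]
  congr 1
  field_simp

/-- The expected number of communities whose size is of the order of `Z`. -/
theorem exists_le_block (hP : P.Valid) : ∃ c : ℝ, 0 < c ∧ ∀ᶠ n : ℕ in atTop, ∀ Z : ℕ, P.s ≤ Z →
    2 * Z ≤ maxComm P n → ENNReal.ofReal (c * (commRate P n * (Z : ℝ) ^ (1 - P.β))) ≤
      commCount P n * Pr (sizeLaw P n) {z | Z ≤ z ∧ z < 2 * Z} := by
  obtain ⟨c, hc, h⟩ := exists_le_commCount hP
  have hβ : 0 < P.β - 1 := by linarith [hP.one_lt_β]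
  have hs : 1 ≤ P.s := by
    have := hP.δ_lt_s
    omega
  refine ⟨c * ((P.β - 1) * 2 ^ (-P.β) * 2 ^ (-P.β)), by positivity, ?_⟩
  filter_upwards [h] with n h1 Z hZ hZ2
  refine le_trans (le_of_eq ?_) (mul_le_mul' h1 (le_Pr_tpl_block hP.one_lt_β hs hZ hZ2))
  rw [← ENNReal.ofReal_mul (mul_nonneg hc.le (commRate_nonneg P n))]
  congr 1
  ring

/-- The error `2 * v` is absorbed once the number of communities in question is at least `4`. -/
theorem mul_ofReal_le_of_le_add {v E B : ℝ≥0∞} {R : ℝ} (hv : v ≠ ∞) (hR : 4 ≤ R)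
    (hB : ENNReal.ofReal R ≤ B) (h : v * B ≤ 8 * E + 2 * v) : v * ENNReal.ofReal R ≤ 16 * E := by
  have h1 : v * ENNReal.ofReal (R / 2) + v * ENNReal.ofReal (R / 2) ≤
      8 * E + v * ENNReal.ofReal (R / 2) := by
    rw [← mul_add, ← ENNReal.ofReal_add (by linarith) (by linarith), add_halves]
    refine (mul_le_mul_right hB v).trans (h.trans (add_le_add le_rfl ?_))
    rw [mul_comm]
    gcongr
    rw [← ENNReal.ofReal_ofNat]
    exact ENNReal.ofReal_le_ofReal (by linarith)
  have h2 := (ENNReal.add_le_add_iff_right (ENNReal.mul_ne_top hv ENNReal.ofReal_ne_top)).1 h1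
  calc v * ENNReal.ofReal R = 2 * (v * ENNReal.ofReal (R / 2)) := by
        rw [show R = 2 * (R / 2) by ring, ENNReal.ofReal_mul two_pos.le, ENNReal.ofReal_ofNat,
          show 2 * (R / 2) / 2 = R / 2 by ring]
        ring
    _ ≤ 2 * (8 * E) := by gcongr
    _ = 16 * E := by ring

/-- A positive proportion of the communities of a suitable constant order of size has a self-loop
with a probability of constant order. -/
theorem exists_le_expect_Sc (hP : P.Valid) : ∃ c : ℝ, 0 < c ∧ ∀ᶠ n : ℕ in atTop,
    ENNReal.ofReal (c * commRate P n) ≤ expect P (fun _ G => G.Sc) n := by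
  obtain ⟨C, hC, h⟩ := exists_le_Ex_law hP
  obtain ⟨c, hc, hblock⟩ := exists_le_block hP
  have hξ : 0 < 1 - P.ξ := by linarith [hP.ξ_lt_one]
  have hγ : 0 < P.γ - 1 := by linarith [hP.two_lt_γ]
  have hδ := hP.one_le_δ
  set a : ℕ := ⌈3 / (1 - P.ξ)⌉₊ + P.δ with ha
  have haR : (0 : ℝ) < a := by exact_mod_cast (by omega : 0 < a)
  have ha3 : 3 ≤ ⌊(1 - P.ξ) * a⌋₊ := by
    refine Nat.le_floor ?_
    have h1 : 3 / (1 - P.ξ) ≤ a := (Nat.le_ceil _).trans (by exact_mod_cast (by omega))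
    rw [div_le_iff₀ hξ] at h1
    push_cast
    linarith
  set q : ℝ := (P.γ - 1) * 2 ^ (-P.γ) * 2 ^ (-P.γ) * (a : ℝ) ^ (1 - P.γ) with hq
  have hq0 : 0 < q := by positivity
  obtain ⟨Z, hZa, hZs, hZq⟩ : ∃ Z : ℕ, 2 * a + 6 ≤ Z ∧ P.s ≤ Z ∧ 224 ≤ Z * q := by
    refine ⟨max (max (2 * a + 6) P.s) ⌈224 / q⌉₊, by omega, by omega, ?_⟩
    rw [← div_le_iff₀ hq0]
    exact (Nat.le_ceil _).trans (by exact_mod_cast le_max_right _ _)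
  have hZR : (0 : ℝ) < Z := by exact_mod_cast (by omega : 0 < Z)
  have hx : (2 : ℝ) ^ 1 * (Real.exp (-(Z * q / 32)) + (1 / 2) ^ (Z / 2)) ≤ 1 / 2 := by
    have h1 : Real.exp (-(Z * q / 32)) ≤ 1 / 8 := by
      refine (Real.exp_le_exp.2 (show -(Z * q / 32) ≤ -7 by linarith)).trans ?_
      rw [Real.exp_neg, ← one_div]
      exact one_div_le_one_div_of_le (by norm_num) (by linarith [Real.add_one_le_exp (7 : ℝ)])
    have h2 : ((1 : ℝ) / 2) ^ (Z / 2) ≤ (1 / 2) ^ 3 :=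
      pow_le_pow_of_le_one (by norm_num) (by norm_num) (by omega)
    norm_num at h2 ⊢
    linarith
  refine ⟨(C * Z)⁻¹ * (c * (Z : ℝ) ^ (1 - P.β)) / 16, by positivity, ?_⟩
  have hrate : Tendsto (fun n : ℕ => c * (Z : ℝ) ^ (1 - P.β) * commRate P n) atTop atTop :=
    (tendsto_natCast_rpow hP.rate_pos).const_mul_atTop (by positivity)
  filter_upwards [h, hblock, (tendsto_maxDeg hP).eventually_ge_atTop (2 * a),
    (tendsto_maxComm hP).eventually_ge_atTop (2 * Z), hrate.eventually_ge_atTop 4,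
    (tendsto_natCast_atTop_atTop (R := ℝ)).eventually_ge_atTop (16 / q)]
    with n h hblock hD hM hrate hnq
  rw [div_le_iff₀ hq0] at hnq
  have h1 := h a Z 1 q hq0.le (le_Pr_tpl_block (by linarith) hδ (by omega) hD) hnq (by omega) hx
    (fun G => (G.Sc : ℝ≥0∞)) (ENNReal.ofReal (C * Z))⁻¹ fun d hd c comm =>
      sum_isRich_le_Ex_Sc hP (mem_support_degrees hδ (by omega) hd).1 ha3
  have hCZ : 0 < C * Z := by positivity
  have h2 := mul_ofReal_le_of_le_add (R := c * (Z : ℝ) ^ (1 - P.β) * commRate P n)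
    (by simpa using hCZ) hrate
    (le_of_eq_of_le (congrArg _ (by ring)) (hblock Z hZs hM)) h1
  rw [← ENNReal.ofReal_inv_of_pos hCZ, ← ENNReal.ofReal_mul (by positivity)] at h2
  rw [expect_eq_Ex, div_mul_eq_mul_div, ENNReal.ofReal_div_of_pos (by norm_num)]
  refine ENNReal.div_le_of_le_mul ?_
  rw [ENNReal.ofReal_ofNat, mul_comm _ (16 : ℝ≥0∞), mul_assoc]
  exact h2

theorem two_pow_mul_exp_add_le {A x : ℕ} {w : ℝ} (hA : 4 ≤ A) (hxA : x ≤ A) (hxw : x ≤ w)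
    (hw : 4 ≤ w) : (2 : ℝ) ^ x * (Real.exp (-(2 * w)) + (1 / 2) ^ (A * A / 2)) ≤ 1 / 2 := by
  have h1 : (2 : ℝ) ^ x ≤ Real.exp w := by
    calc (2 : ℝ) ^ x ≤ Real.exp 1 ^ x := by
          gcongr
          linarith [Real.add_one_le_exp (1 : ℝ)]
      _ = Real.exp x := by rw [← Real.exp_nat_mul, mul_one]
      _ ≤ Real.exp w := Real.exp_le_exp.2 hxw
  have h2 : (2 : ℝ) ^ x * Real.exp (-(2 * w)) ≤ 1 / 4 := by
    calc (2 : ℝ) ^ x * Real.exp (-(2 * w)) ≤ Real.exp w * Real.exp (-(2 * w)) := by gcongr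
      _ = (Real.exp w)⁻¹ := by
          rw [← Real.exp_add, ← Real.exp_neg]
          congr 1
          ring
      _ ≤ 1 / 4 := by
          rw [← one_div]
          exact one_div_le_one_div_of_le (by norm_num) (by linarith [Real.add_one_le_exp w])
  have h3 : (2 : ℝ) ^ x * (1 / 2) ^ (A * A / 2) ≤ 1 / 4 := by
    have h4 : x + 2 ≤ A * A / 2 := by
      have : 4 * A ≤ A * A := Nat.mul_le_mul_right _ (by omega)
      omega
    calc (2 : ℝ) ^ x * (1 / 2) ^ (A * A / 2) ≤ 2 ^ x * (1 / 2) ^ (x + 2) := by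
          refine mul_le_mul_of_nonneg_left ?_ (by positivity)
          exact pow_le_pow_of_le_one (by norm_num) (by norm_num) h4
      _ = 1 / 4 := by
          rw [pow_add, ← mul_assoc, ← mul_pow]
          norm_num
  rw [mul_add]
  linarith

theorem sq_div_four_le_floor_mul {w : ℝ} (hw : 4 ≤ w) :
    w ^ 2 / 4 ≤ ((⌊w⌋₊ * (⌊w⌋₊ - 1) : ℕ) : ℝ) := by
  have h1 : w < ⌊w⌋₊ + 1 := Nat.lt_floor_add_one _
  have h2 : 1 ≤ ⌊w⌋₊ := Nat.le_floor (by push_cast; linarith)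
  rw [Nat.cast_mul, Nat.cast_sub h2]
  push_cast
  nlinarith

set_option maxHeartbeats 400000 in
/-- In the communities whose size is of the order of `n ^ θ`, the pairs of nodes whose degrees are
of the order of `n ^ (θ / 2)` are joined by multi-edges with a probability of constant order. -/
theorem exists_le_expect_Mc (hP : P.Valid) {θ : ℝ} (h0 : 0 < θ) (hζ : θ ≤ 2 * P.ζ)
    (hτ : θ ≤ P.τ) : ∃ c : ℝ, 0 < c ∧ ∀ᶠ n : ℕ in atTop,
    ENNReal.ofReal (c * (n : ℝ) ^ (1 - P.τ * (2 - P.β) + θ * (4 - P.γ - P.β))) ≤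
      expect P (fun _ G => G.Mc) n := by
  obtain ⟨C, hC, h⟩ := exists_le_Ex_law hP
  obtain ⟨c, hc, hblock⟩ := exists_le_block hP
  have hξ : 0 < 1 - P.ξ := by linarith [hP.ξ_lt_one]
  have hξ0 := hP.ξ_pos
  have hγ2 := hP.two_lt_γ
  have hγ3 := hP.γ_lt_three
  have hβ1 := hP.one_lt_β
  have hβ2 := hP.β_lt_two
  have hτ1 := hP.τ_lt_one
  have hδ := hP.one_le_δ
  have hγ : 0 < P.γ - 1 := by linarith
  -- `c₀ * a ^ (1 - γ)` bounds the probability of a degree of the order of `a` from below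
  set c₀ : ℝ := (P.γ - 1) * 2 ^ (-P.γ) * 2 ^ (-P.γ) with hc₀
  have hc₀0 : 0 < c₀ := by positivity
  have hc₀2 : c₀ ≤ 2 := by
    have h1 : (2 : ℝ) ^ (-P.γ) ≤ 1 :=
      Real.rpow_le_one_of_one_le_of_nonpos one_le_two (by linarith)
    have h2 : (0 : ℝ) ≤ 2 ^ (-P.γ) := by positivity
    calc c₀ ≤ 2 * 1 * 1 := by
          rw [hc₀]
          gcongr
          linarith
      _ = 2 := by norm_num
  set c₁ : ℝ := c₀ / 64 with hc₁
  have hc₁0 : 0 < c₁ := by positivity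
  set C' : ℝ := 1 + C * 4 / (1 - P.ξ) ^ 2 with hC'
  have hC'0 : 0 < C * 4 / (1 - P.ξ) ^ 2 := by positivity
  -- degrees of the order of `n ^ (θ / 2)`, in communities whose size is of the order of its square
  set a : ℕ → ℕ := fun n => ⌊(n : ℝ) ^ (θ / 2) / 4⌋₊ with ha
  have hatop : Tendsto a atTop atTop := tendsto_nat_floor_atTop.comp
    ((tendsto_natCast_rpow (half_pos h0)).atTop_div_const (by norm_num))
  have hwtop : Tendsto (fun n => c₁ * (a n : ℝ) ^ (3 - P.γ)) atTop atTop :=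
    ((tendsto_natCast_rpow (by linarith)).comp hatop).const_mul_atTop hc₁0
  have hξtop : Tendsto (fun n => (1 - P.ξ) * (a n : ℝ)) atTop atTop :=
    (tendsto_natCast_atTop_atTop.comp hatop).const_mul_atTop hξ
  have hqtop : Tendsto (fun n : ℕ => c₀ * (n : ℝ) ^ (1 + θ / 2 * (1 - P.γ))) atTop atTop :=
    (tendsto_natCast_rpow (by nlinarith)).const_mul_atTop hc₀0
  have hRtop : Tendsto (fun n : ℕ => c * (n : ℝ) ^ (1 - P.τ * (2 - P.β) + θ * (1 - P.β)))
      atTop atTop := (tendsto_natCast_rpow (by nlinarith)).const_mul_atTop hc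
  refine ⟨(c₁ * (1 / 8) ^ (3 - P.γ)) ^ 2 / 4 * (1 / (50 * C' ^ 2)) * c / 32, by positivity, ?_⟩
  filter_upwards [h, hblock, hatop.eventually_ge_atTop (P.δ + P.s + 4),
    hwtop.eventually_ge_atTop 4, hξtop.eventually_ge_atTop 14, hqtop.eventually_ge_atTop 16,
    hRtop.eventually_ge_atTop 4, eventually_gt_atTop 0]
    with n h hblock haδ hw hξa hqn hRn hn0
  have hn : (0 : ℝ) < n := by exact_mod_cast hn0
  have hn1 : (1 : ℝ) ≤ n := by exact_mod_cast hn0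
  set b : ℝ := (n : ℝ) ^ (θ / 2) with hb
  have hb0 : 0 < b := by positivity
  set A : ℕ := a n with hA
  have hA4 : (4 : ℝ) ≤ A := by exact_mod_cast (by omega : 4 ≤ A)
  have hAb : (A : ℝ) ≤ b / 4 := Nat.floor_le (by positivity)
  have hbA : b ≤ 8 * A := by
    have : b / 4 < A + 1 := Nat.lt_floor_add_one _
    linarith
  have hA0 : (0 : ℝ) < A := by linarith
  set w : ℝ := c₁ * (A : ℝ) ^ (3 - P.γ) with hw'
  set x : ℕ := ⌊w⌋₊ with hx'
  have hxw : (x : ℝ) ≤ w := Nat.floor_le (by linarith)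
  set q : ℝ := c₀ * (A : ℝ) ^ (1 - P.γ) with hq
  have hq0 : 0 ≤ q := by positivity
  have hb2 : b * b = (n : ℝ) ^ θ := by
    rw [hb, ← Real.rpow_add hn, add_halves]
  -- the range of the degrees
  have hD : 2 * A ≤ maxDeg P n := by
    refine Nat.le_floor ?_
    have : b ≤ (n : ℝ) ^ P.ζ := Real.rpow_le_rpow_of_exponent_le hn1 (by linarith)
    push_cast
    linarith
  have hM : 2 * (A * A) ≤ maxComm P n := by
    refine Nat.le_floor ?_
    have : (n : ℝ) ^ θ ≤ (n : ℝ) ^ P.τ := Real.rpow_le_rpow_of_exponent_le hn1 hτ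
    push_cast
    nlinarith
  have hnq : 16 ≤ n * q := by
    refine hqn.trans ?_
    have h1 : b ^ (1 - P.γ) ≤ (A : ℝ) ^ (1 - P.γ) :=
      Real.rpow_le_rpow_of_nonpos hA0 (by linarith) (by linarith)
    rw [Real.rpow_add hn, Real.rpow_one, Real.rpow_mul hn.le, ← hb, hq]
    calc c₀ * (n * b ^ (1 - P.γ)) ≤ c₀ * (n * (A : ℝ) ^ (1 - P.γ)) := by gcongr
      _ = _ := by ring
  -- the number of nodes of high degree
  have hZq : ((A * A : ℕ) : ℝ) * q / 32 = 2 * w := by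
    have : (A : ℝ) ^ (3 - P.γ) = A * A * (A : ℝ) ^ (1 - P.γ) := by
      rw [show 3 - P.γ = 1 + 1 + (1 - P.γ) by ring, Real.rpow_add hA0, Real.rpow_add hA0,
        Real.rpow_one]
    rw [hw', hq, this, hc₁]
    push_cast
    ring
  have hwA : w ≤ A := by
    have h1 : (A : ℝ) ^ (3 - P.γ) ≤ (A : ℝ) ^ (1 : ℝ) :=
      Real.rpow_le_rpow_of_exponent_le (by linarith) (by linarith)
    rw [Real.rpow_one] at h1
    have h2 : c₁ ≤ 1 := by
      rw [hc₁]
      linarith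
    nlinarith [Real.rpow_nonneg hA0.le (3 - P.γ)]
  have hxA : x ≤ A := by exact_mod_cast hxw.trans hwA
  have hx : (2 : ℝ) ^ x * (Real.exp (-((A * A : ℕ) * q / 32)) + (1 / 2) ^ (A * A / 2)) ≤
      1 / 2 := by
    rw [hZq]
    exact two_pow_mul_exp_add_le (by omega) hxA hxw hw
  -- the community degrees of these nodes
  set y : ℕ := ⌊(1 - P.ξ) * A⌋₊ - 1 with hy
  have hfl : 14 ≤ ⌊(1 - P.ξ) * A⌋₊ := Nat.le_floor (by exact_mod_cast hξa)
  have hyR : (1 - P.ξ) * A / 2 ≤ y := by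
    have h1 : (1 - P.ξ) * A < ⌊(1 - P.ξ) * A⌋₊ + 1 := Nat.lt_floor_add_one _
    rw [hy, Nat.cast_sub (by omega)]
    push_cast
    linarith
  have hT : C * ((A * A : ℕ) : ℝ) ≤ C' * (y : ℝ) ^ 2 := by
    calc C * ((A * A : ℕ) : ℝ) = C * 4 / (1 - P.ξ) ^ 2 * ((1 - P.ξ) * A / 2) ^ 2 := by
          push_cast
          field_simp
          ring
      _ ≤ C' * (y : ℝ) ^ 2 := by
          gcongr
          linarith
  have h1 := h A (A * A) x q hq0 (le_Pr_tpl_block (by linarith) hδ (by omega) hD) hnq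
    (Nat.mul_le_mul_right _ (by omega)) hx
    (fun G => 2 * (G.Mc : ℝ≥0∞)) _ fun d hd c comm =>
      sum_isRich_le_Ex_Mc hP (mem_support_degrees hδ (by omega) hd).1 (y := y) (by omega) le_rfl
        (C := C') (by linarith) hT
  -- the resulting order
  have hZ1 : (n : ℝ) ^ (θ * (1 - P.β)) ≤ ((A * A : ℕ) : ℝ) ^ (1 - P.β) := by
    rw [Real.rpow_mul hn.le, ← hb2]
    refine Real.rpow_le_rpow_of_nonpos (by push_cast; exact mul_pos hA0 hA0) ?_ (by linarith)
    push_cast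
    nlinarith
  have hR : c * (n : ℝ) ^ (1 - P.τ * (2 - P.β) + θ * (1 - P.β)) ≤
      c * (commRate P n * ((A * A : ℕ) : ℝ) ^ (1 - P.β)) := by
    rw [Real.rpow_add hn, commRate]
    gcongr
  have h2 := mul_ofReal_le_of_le_add (R := c * (n : ℝ) ^ (1 - P.τ * (2 - P.β) + θ * (1 - P.β)))
    (ENNReal.mul_ne_top (ENNReal.natCast_ne_top _) ENNReal.ofReal_ne_top) hRn
    ((ENNReal.ofReal_le_ofReal hR).trans (hblock (A * A) (by nlinarith) hM)) h1
  rw [Ex_const_mul, ← ENNReal.ofReal_natCast, ← ENNReal.ofReal_mul (by positivity),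
    ← ENNReal.ofReal_mul (by positivity)] at h2
  have hxx : (c₁ * (1 / 8) ^ (3 - P.γ)) ^ 2 / 4 * (n : ℝ) ^ (θ * (3 - P.γ)) ≤
      ((x * (x - 1) : ℕ) : ℝ) := by
    have h3 : c₁ * (1 / 8) ^ (3 - P.γ) * b ^ (3 - P.γ) ≤ w := by
      rw [mul_assoc, ← Real.mul_rpow (by norm_num) hb0.le, hw']
      gcongr
      linarith
    have h4 : (n : ℝ) ^ (θ * (3 - P.γ)) = (b ^ (3 - P.γ)) ^ 2 := by
      rw [Real.rpow_mul hn.le, ← hb2, Real.mul_rpow hb0.le hb0.le, sq]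
    refine le_trans ?_ (sq_div_four_le_floor_mul hw)
    rw [h4, div_mul_eq_mul_div, ← mul_pow]
    gcongr
  rw [expect_eq_Ex]
  have h7 : (c₁ * (1 / 8) ^ (3 - P.γ)) ^ 2 / 4 * (1 / (50 * C' ^ 2)) * c / 32 *
      (n : ℝ) ^ (1 - P.τ * (2 - P.β) + θ * (4 - P.γ - P.β)) ≤
      (((x * (x - 1) : ℕ) : ℝ) * (1 / (50 * C' ^ 2)) *
        (c * (n : ℝ) ^ (1 - P.τ * (2 - P.β) + θ * (1 - P.β)))) / 32 := by
    have e : (n : ℝ) ^ (1 - P.τ * (2 - P.β) + θ * (4 - P.γ - P.β)) =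
        (n : ℝ) ^ (θ * (3 - P.γ)) * (n : ℝ) ^ (1 - P.τ * (2 - P.β) + θ * (1 - P.β)) := by
      rw [← Real.rpow_add hn]
      congr 1
      ring
    rw [e]
    calc _ = ((c₁ * (1 / 8) ^ (3 - P.γ)) ^ 2 / 4 * (n : ℝ) ^ (θ * (3 - P.γ))) *
          (1 / (50 * C' ^ 2)) * (c * (n : ℝ) ^ (1 - P.τ * (2 - P.β) + θ * (1 - P.β))) / 32 := by
          ring
      _ ≤ _ := by gcongr
  refine (ENNReal.ofReal_le_ofReal h7).trans ?_
  rw [ENNReal.ofReal_div_of_pos (by norm_num)]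
  refine ENNReal.div_le_of_le_mul (h2.trans (le_of_eq ?_))
  rw [show ENNReal.ofReal 32 = 16 * 2 by rw [ENNReal.ofReal_ofNat]; norm_num]
  ring

end LowerAsymptotics

/-! ### Comparisons with the number of communities -/

section Comparison

variable {P : Params} {e f : ℕ → ℝ≥0∞}

theorem LittleO.of_rpow {p q c : ℝ} (hpq : p < q) (hc : 0 < c)
    (he : BigO e fun n => (n : ℝ) ^ p)
    (hf : ∀ᶠ n : ℕ in atTop, ENNReal.ofReal (c * (n : ℝ) ^ q) ≤ f n) : LittleO e f := by
  obtain ⟨C, hC, he⟩ := he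
  intro ε hε
  filter_upwards [he, hf, eventually_const_mul_rpow_le hpq (C / (ε * c))] with n h1 h2 h3
  calc e n ≤ ENNReal.ofReal (C * (n : ℝ) ^ p) := h1
    _ ≤ ENNReal.ofReal (ε * (c * (n : ℝ) ^ q)) := by
        refine ENNReal.ofReal_le_ofReal ?_
        rw [div_mul_eq_mul_div, div_le_iff₀ (by positivity)] at h3
        linarith
    _ = ENNReal.ofReal ε * ENNReal.ofReal (c * (n : ℝ) ^ q) := ENNReal.ofReal_mul hε.le
    _ ≤ ENNReal.ofReal ε * f n := by gcongr

/-- If `2 * ζ ≤ τ`, then the comparison uses the communities whose size is of the order of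
`n ^ (2 * ζ)`, otherwise the largest ones. -/
theorem littleO_Mbc_Mc (hP : P.Valid) :
    LittleO (expect P fun _ G => G.Mbc) (expect P fun _ G => G.Mc) := by
  have hγ2 := hP.two_lt_γ
  have hβ1 := hP.one_lt_β
  have hτ1 := hP.τ_lt_one
  have hτ0 := hP.τ_pos
  have hζ0 := hP.ζ_pos
  rcases le_or_gt (2 * P.ζ) P.τ with h | h
  · obtain ⟨c, hc, hMc⟩ := exists_le_expect_Mc hP (θ := 2 * P.ζ) (by linarith) le_rfl h
    -- the exponents differ by `1 - τ (2 - β) - 2 ζ (β - 1) ≥ 1 - τ`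
    refine LittleO.of_rpow ?_ hc (bigO_Mbc hP) hMc
    nlinarith
  · obtain ⟨c, hc, hMc⟩ := exists_le_expect_Mc hP (θ := P.τ) hτ0 h.le le_rfl
    set ε := min ((P.γ - 2) / 2) ((1 - P.τ) / 2) with hε
    have h1 : 0 < ε := lt_min (by linarith) (by linarith)
    have h2 : ε ≤ (P.γ - 2) / 2 := min_le_left _ _
    have h3 : ε ≤ (1 - P.τ) / 2 := min_le_right _ _
    -- the exponents differ by `1 - τ - τ ε`
    refine LittleO.of_rpow ?_ hc (bigO_Mbc_of_lt hP h1 (by linarith)) hMc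
    nlinarith

theorem Whp.mono {E F : (n : ℕ) → Set (Outcome n)} (hE : Whp P E)
    (h : ∀ᶠ n in atTop, E n ⊆ F n) : Whp P F := by
  refine tendsto_of_tendsto_of_tendsto_of_le_of_le' hE tendsto_const_nhds ?_
    (Eventually.of_forall fun n => ?_)
  · filter_upwards [h] with n hn using MeasureTheory.measure_mono hn
  · rw [toOuterMeasure_eq_Ex]
    exact Pr_le_one _ _

theorem Whp.of_compl_le {E : (n : ℕ) → Set (Outcome n)} {δ : ℕ → ℝ≥0∞}
    (hδ : Tendsto δ atTop (𝓝 0)) (h : ∀ᶠ n in atTop, Pr (law P n) (E n)ᶜ ≤ δ n) : Whp P E := by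
  have h1 : Tendsto (fun n => 1 - δ n) atTop (𝓝 1) := by
    simpa using ENNReal.Tendsto.sub tendsto_const_nhds hδ (Or.inl ENNReal.one_ne_top)
  refine tendsto_of_tendsto_of_tendsto_of_le_of_le' h1 tendsto_const_nhds ?_
    (Eventually.of_forall fun n => ?_)
  · filter_upwards [h] with n hn
    rw [toOuterMeasure_eq_Ex, tsub_le_iff_right]
    exact (Pr_add_compl (law P n) (E n)).ge.trans (add_le_add le_rfl hn)
  · rw [toOuterMeasure_eq_Ex]
    exact Pr_le_one _ _

theorem Ex_phase4_L {n L : ℕ} {d : Fin n → ℕ} {comm : Fin n → Option (Fin L)} (F : ℕ → ℝ≥0∞) :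
    Ex (phase4 P d comm) (fun G => F G.L) = F L := by
  rw [Ex_phase4]
  simp only [Ex_const]

theorem Pr_law_L (P : Params) (n : ℕ) (Q : Set ℕ) :
    Pr (law P n) {G | G.L ∈ Q} = Pr (communitySizes P n) {c | c.length ∈ Q} := by
  have h := Ex_law P n fun G => Q.indicator (1 : ℕ → ℝ≥0∞) G.L
  simp only [Ex_phase4_L, Ex_const] at h
  exact h

/-- The number of communities has the order of its mean with high probability. -/
theorem exists_whp_L (hP : P.Valid) : ∃ c C : ℝ, 0 < c ∧ 0 < C ∧
    Whp P fun n => {G | c * commRate P n ≤ G.L ∧ (G.L : ℝ) ≤ C * commRate P n} := by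
  obtain ⟨K, hK⟩ := exists_eventually_regime hP
  obtain ⟨c, hc, hle⟩ := exists_le_meanSize hP
  obtain ⟨C, hC, hge⟩ := exists_meanSize_le hP
  have hτ : 0 < 1 - P.τ := by linarith [hP.τ_lt_one]
  refine ⟨1 / (16 * C), 8 / c, by positivity, by positivity,
    Whp.of_compl_le (δ := fun n : ℕ => ENNReal.ofReal (4 * (n : ℝ) ^ (-1 : ℝ))) ?_ ?_⟩
  · rw [← ENNReal.ofReal_zero]
    refine ENNReal.tendsto_ofReal ?_
    simpa using ((tendsto_rpow_neg_atTop one_pos).comp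
      (tendsto_natCast_atTop_atTop (R := ℝ))).const_mul 4
  filter_upwards [hK, hle, hge, eventually_gt_atTop 0,
    eventually_exp_neg_le one_pos hτ 1,
    eventually_exp_neg_le (c := 1 / 4) (by norm_num) hτ 1] with n hn hle hge hn0 h1 h2
  have hnR : (0 : ℝ) < n := by exact_mod_cast hn0
  have hM : (0 : ℝ) < maxComm P n := by exact_mod_cast hn.size.maxComm_pos
  obtain ⟨hμ1, -⟩ := hn.size.meanSize_toReal
  set μ := (meanSize P n).toReal with hμ
  have hμ0 : 0 < μ := by linarith
  have hμle : c * (n : ℝ) ^ (P.τ * (2 - P.β)) ≤ μ :=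
    (ENNReal.ofReal_le_iff_le_toReal hn.size.meanSize_ne_top).1 hle
  have hμge : μ ≤ C * (n : ℝ) ^ (P.τ * (2 - P.β)) :=
    ENNReal.toReal_le_of_le_ofReal (by positivity) hge
  have hrate : commRate P n = n / (n : ℝ) ^ (P.τ * (2 - P.β)) := by
    rw [commRate, Real.rpow_sub hnR, Real.rpow_one]
  have hlow : 1 / (16 * C) * commRate P n ≤ n / (16 * μ) := by
    rw [hrate, div_mul_div_comm, one_mul, mul_assoc]
    gcongr
  have hhigh : 8 * n / μ ≤ 8 / c * commRate P n := by
    rw [hrate, div_mul_div_comm]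
    gcongr
  have hnM : (n : ℝ) ^ (1 - P.τ) ≤ n / maxComm P n := by
    rw [Real.rpow_sub hnR, Real.rpow_one]
    gcongr
    exact maxComm_le_rpow P n
  have e1 : Real.exp (-(n / maxComm P n)) ≤ (n : ℝ) ^ (-1 : ℝ) :=
    (Real.exp_le_exp.2 (by linarith)).trans h1
  have e2 : Real.exp (1 - n / (4 * maxComm P n)) ≤ 3 * (n : ℝ) ^ (-1 : ℝ) := by
    have h3 : (n : ℝ) / (4 * maxComm P n) = 1 / 4 * (n / maxComm P n) := by ring
    rw [h3, sub_eq_add_neg, Real.exp_add]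
    refine mul_le_mul (by linarith [Real.exp_one_lt_d9]) ?_ (Real.exp_nonneg _) (by norm_num)
    exact (Real.exp_le_exp.2 (by linarith)).trans h2
  refine (Pr_mono (t := {G | G.L ∈ {l : ℕ | 8 * n / μ ≤ l}} ∪
    {G | G.L ∈ {l : ℕ | (l : ℝ) ≤ n / (16 * μ)}}) fun G _ hG => ?_).trans
    ((Pr_union_le _ _ _).trans ?_)
  · by_contra hcon
    simp only [Set.mem_union, not_or] at hcon
    have h3 : (G.L : ℝ) < 8 * n / μ := lt_of_not_ge hcon.1
    have h4 : (n : ℝ) / (16 * μ) < G.L := lt_of_not_ge hcon.2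
    exact hG ⟨by linarith, by linarith⟩
  · rw [Pr_law_L, Pr_law_L]
    refine (add_le_add hn.size.Pr_length_ge hn.size.Pr_length_le).trans ?_
    rw [← ENNReal.ofReal_add (by positivity) (by positivity)]
    exact ENNReal.ofReal_le_ofReal (by linarith)

theorem whpThetaL_of_bigO (hP : P.Valid) (he : BigO e (commRate P)) {c : ℝ} (hc : 0 < c)
    (he' : ∀ᶠ n : ℕ in atTop, ENNReal.ofReal (c * commRate P n) ≤ e n) : WhpThetaL P e := by
  obtain ⟨c', C', hc', hC', hL⟩ := exists_whp_L hP
  obtain ⟨C, hC, he⟩ := he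
  refine ⟨c / C', C / c', by positivity, by positivity, hL.mono ?_⟩
  filter_upwards [he, he'] with n h1 h2 G hG
  constructor
  · refine le_trans (ENNReal.ofReal_le_ofReal ?_) h2
    rw [div_mul_eq_mul_div, div_le_iff₀ hC', mul_assoc, mul_comm _ C']
    exact mul_le_mul_of_nonneg_left hG.2 hc.le
  · refine h1.trans (ENNReal.ofReal_le_ofReal ?_)
    rw [div_mul_eq_mul_div, le_div_iff₀ hc', mul_assoc, mul_comm _ c']
    exact mul_le_mul_of_nonneg_left hG.1 hC.le

theorem whpBigOL_of_bigO (hP : P.Valid) (he : BigO e (commRate P)) : WhpBigOL P e := by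
  obtain ⟨c', C', hc', hC', hL⟩ := exists_whp_L hP
  obtain ⟨C, hC, he⟩ := he
  refine ⟨C / c', by positivity, hL.mono ?_⟩
  filter_upwards [he] with n h1 G hG
  refine h1.trans (ENNReal.ofReal_le_ofReal ?_)
  rw [div_mul_eq_mul_div, le_div_iff₀ hc', mul_assoc, mul_comm _ c']
  exact mul_le_mul_of_nonneg_left hG.1 hC.le

theorem whpBigOmegaL_of_le (hP : P.Valid) {c : ℝ} (hc : 0 < c)
    (he' : ∀ᶠ n : ℕ in atTop, ENNReal.ofReal (c * commRate P n) ≤ e n) : WhpBigOmegaL P e := by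
  obtain ⟨c', C', hc', hC', hL⟩ := exists_whp_L hP
  refine ⟨c / C', by positivity, hL.mono ?_⟩
  filter_upwards [he'] with n h2 G hG
  refine le_trans (ENNReal.ofReal_le_ofReal ?_) h2
  rw [div_mul_eq_mul_div, div_le_iff₀ hC', mul_assoc, mul_comm _ C']
  exact mul_le_mul_of_nonneg_left hG.2 hc.le

theorem BigO.expect_add {X Y : (n : ℕ) → Outcome n → ℕ} {r : ℕ → ℝ} (hX : BigO (expect P X) r)
    (hY : BigO (expect P Y) r) (hr : ∀ n, 0 ≤ r n) :
    BigO (expect P fun n G => X n G + Y n G) r := by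
  refine (hX.add hY hr).mono_left (Eventually.of_forall fun n => le_of_eq ?_)
  simp only [expect_eq_Ex, Nat.cast_add, Ex_add]

theorem bigO_Sc_commRate (hP : P.Valid) (h : 4 < P.γ + P.β) :
    BigO (expect P fun _ G => G.Sc) (commRate P) := by
  refine (bigO_Sc hP h.ne').mono_right two_pos ?_
  filter_upwards [eventually_ge_atTop 1] with n hn
  have h1 : (n : ℝ) ^ (P.ζ * (4 - P.γ - P.β)) ≤ 1 :=
    Real.rpow_le_one_of_one_le_of_nonpos (by exact_mod_cast hn)
      (mul_nonpos_of_nonneg_of_nonpos hP.ζ_pos.le (by linarith))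
  rw [mul_comm (2 : ℝ) (commRate P n)]
  exact mul_le_mul_of_nonneg_left (by linarith) (commRate_nonneg P n)

theorem bigO_Mc'_commRate (hP : P.Valid) (h : 7 < 2 * P.γ + P.β) :
    BigO (expect P fun _ G => G.Mc') (commRate P) := by
  refine (bigO_Mc' hP h.ne').mono_right two_pos ?_
  filter_upwards [eventually_ge_atTop 1] with n hn
  have h1 : (n : ℝ) ^ (P.ζ * (7 - 2 * P.γ - P.β)) ≤ 1 :=
    Real.rpow_le_one_of_one_le_of_nonpos (by exact_mod_cast hn)
      (mul_nonpos_of_nonneg_of_nonpos hP.ζ_pos.le (by linarith))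
  rw [mul_comm (2 : ℝ) (commRate P n)]
  exact mul_le_mul_of_nonneg_left (by linarith) (commRate_nonneg P n)

theorem bigO_Mbc_commRate (hP : P.Valid) (h : 4 < P.γ + P.β) :
    BigO (expect P fun _ G => G.Mbc) (commRate P) := by
  refine (bigO_Mc_of_lt hP h).mono_left ?_
  filter_upwards [littleO_Mbc_Mc hP 1 one_pos] with n hn
  rwa [ENNReal.ofReal_one, one_mul] at hn

theorem BigO.commRate_of_rpow (he : BigO e fun n => (n : ℝ) ^ (P.ζ * (6 - 2 * P.γ)))
    (h : 2 * P.ζ * (3 - P.γ) + P.τ * (2 - P.β) ≤ 1) : BigO e (commRate P) := by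
  refine he.mono_right one_pos ?_
  filter_upwards [eventually_ge_atTop 1] with n hn
  rw [one_mul, commRate]
  exact Real.rpow_le_rpow_of_exponent_le (by exact_mod_cast hn) (by linarith)

theorem bigO_Sb_commRate (hP : P.Valid) (h : 2 * P.ζ * (3 - P.γ) + P.τ * (2 - P.β) ≤ 1) :
    BigO (expect P fun _ G => G.Sb) (commRate P) := by
  refine ((bigO_Sb hP).mono_right one_pos ?_).commRate_of_rpow h
  filter_upwards [eventually_ge_atTop 1] with n hn
  rw [one_mul]
  exact Real.rpow_le_rpow_of_exponent_le (by exact_mod_cast hn)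
    (mul_le_mul_of_nonneg_left (by linarith [hP.γ_lt_three]) hP.ζ_pos.le)

end Comparison

end ABCD

theorem mainTheorem3 (P : ABCD.Params) (hP : P.Valid) :
    -- 1. community self-loops
    (P.γ + P.β ≠ 4 →
      ABCD.BigO (ABCD.expect P fun _ G => G.Sc)
        fun n => (n : ℝ) ^ (1 - P.τ * (2 - P.β)) *
          (1 + (n : ℝ) ^ (P.ζ * (4 - P.γ - P.β)))) ∧
    (P.γ + P.β = 4 →
      ABCD.BigO (ABCD.expect P fun _ G => G.Sc)
        fun n => (n : ℝ) ^ (1 - P.τ * (2 - P.β)) * Real.log n) ∧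
    -- 2. community multi-edges
    ABCD.BigO (ABCD.expect P fun _ G => G.Mc)
      (fun n => (n : ℝ) ^ (1 - P.τ * (2 - P.β)) *
        (1 + (n : ℝ) ^ (P.ζ * (7 - 2 * P.γ - P.β)))) ∧
    (2 * P.γ + P.β ≠ 7 →
      ABCD.BigO (ABCD.expect P fun _ G => G.Mc')
        fun n => (n : ℝ) ^ (1 - P.τ * (2 - P.β)) *
          (1 + (n : ℝ) ^ (P.ζ * (7 - 2 * P.γ - P.β)))) ∧
    (2 * P.γ + P.β = 7 →
      ABCD.BigO (ABCD.expect P fun _ G => G.Mc')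
        fun n => (n : ℝ) ^ (1 - P.τ * (2 - P.β)) * Real.log n) ∧
    -- 3. background self-loops
    ABCD.BigO (ABCD.expect P fun _ G => G.Sb) (fun n => (n : ℝ) ^ (P.ζ * (3 - P.γ))) ∧
    -- 4. background multi-edges
    ABCD.BigO (ABCD.expect P fun _ G => G.Mb) (fun n => (n : ℝ) ^ (P.ζ * (6 - 2 * P.γ))) ∧
    ABCD.BigO (ABCD.expect P fun _ G => G.Mb') (fun n => (n : ℝ) ^ (P.ζ * (6 - 2 * P.γ))) ∧
    -- 5. background edges that are also community edges
    ABCD.LittleO (ABCD.expect P fun _ G => G.Mbc) (ABCD.expect P fun _ G => G.Mc) ∧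
    -- comparison with the number of communities
    ABCD.WhpBigOmegaL P (ABCD.expect P fun _ G => G.Sc) ∧
    (4 < P.γ + P.β →
      ABCD.WhpThetaL P (ABCD.expect P fun _ G => G.Sc + G.Mc + G.Mbc)) ∧
    (2 * P.ζ * (3 - P.γ) + P.τ * (2 - P.β) ≤ 1 →
      ABCD.WhpBigOL P (ABCD.expect P fun _ G => G.Sb + G.Mb)) ∧
    (4 < P.γ + P.β → 2 * P.ζ * (3 - P.γ) + P.τ * (2 - P.β) ≤ 1 →
      ABCD.WhpThetaL P (ABCD.expect P fun _ G => G.Sc + G.Mc + G.Sb + G.Mb + G.Mbc)) ∧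
    -- the last three comparisons when pairs of parallel edges are counted
    (7 < 2 * P.γ + P.β →
      ABCD.WhpThetaL P (ABCD.expect P fun _ G => G.Sc + G.Mc' + G.Mbc)) ∧
    (2 * P.ζ * (3 - P.γ) + P.τ * (2 - P.β) ≤ 1 →
      ABCD.WhpBigOL P (ABCD.expect P fun _ G => G.Sb + G.Mb')) ∧
    (7 < 2 * P.γ + P.β → 2 * P.ζ * (3 - P.γ) + P.τ * (2 - P.β) ≤ 1 →
      ABCD.WhpThetaL P (ABCD.expect P fun _ G => G.Sc + G.Mc' + G.Sb + G.Mb' + G.Mbc)) := by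
  have h0 := ABCD.commRate_nonneg P
  obtain ⟨c, hc, hSc⟩ := ABCD.exists_le_expect_Sc hP
  -- the self-loops of the community graphs alone give all lower bounds
  have hSc' : ∀ Y : (n : ℕ) → ABCD.Outcome n → ℕ, (∀ n G, G.Sc ≤ Y n G) →
      ∀ᶠ n : ℕ in atTop, ENNReal.ofReal (c * ABCD.commRate P n) ≤ ABCD.expect P Y n :=
    fun Y hY => hSc.mono fun n hn => hn.trans (ABCD.expect_mono hY n)
  have hMb : 2 * P.ζ * (3 - P.γ) + P.τ * (2 - P.β) ≤ 1 →
      ABCD.BigO (ABCD.expect P fun _ G => G.Mb) (ABCD.commRate P) := fun h =>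
    ((ABCD.bigO_Mb' hP).mono_left (Eventually.of_forall
      (ABCD.expect_mono fun _ G => ABCD.Mb_le_Mb' G))).commRate_of_rpow h
  have h47 : 7 < 2 * P.γ + P.β → 4 < P.γ + P.β := fun h => by linarith [hP.γ_lt_three]
  refine ⟨ABCD.bigO_Sc hP, ABCD.bigO_Sc_log hP, ABCD.bigO_Mc hP, ABCD.bigO_Mc' hP,
    ABCD.bigO_Mc'_log hP, ABCD.bigO_Sb hP,
    (ABCD.bigO_Mb' hP).mono_left (Eventually.of_forall
      (ABCD.expect_mono fun _ G => ABCD.Mb_le_Mb' G)),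
    ABCD.bigO_Mb' hP, ABCD.littleO_Mbc_Mc hP, ABCD.whpBigOmegaL_of_le hP hc hSc,
    fun h => ?_, fun h => ?_, fun h h' => ?_, fun h => ?_, fun h => ?_, fun h h' => ?_⟩
  · exact ABCD.whpThetaL_of_bigO hP
      (((ABCD.bigO_Sc_commRate hP h).expect_add (ABCD.bigO_Mc_of_lt hP h) h0).expect_add
        (ABCD.bigO_Mbc_commRate hP h) h0) hc (hSc' _ fun n G => by omega)
  · exact ABCD.whpBigOL_of_bigO hP ((ABCD.bigO_Sb_commRate hP h).expect_add (hMb h) h0)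
  · exact ABCD.whpThetaL_of_bigO hP
      (((((ABCD.bigO_Sc_commRate hP h).expect_add (ABCD.bigO_Mc_of_lt hP h) h0).expect_add
        (ABCD.bigO_Sb_commRate hP h') h0).expect_add (hMb h') h0).expect_add
        (ABCD.bigO_Mbc_commRate hP h) h0) hc (hSc' _ fun n G => by omega)
  · exact ABCD.whpThetaL_of_bigO hP
      (((ABCD.bigO_Sc_commRate hP (h47 h)).expect_add (ABCD.bigO_Mc'_commRate hP h) h0).expect_add
        (ABCD.bigO_Mbc_commRate hP (h47 h)) h0) hc (hSc' _ fun n G => by omega)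
  · exact ABCD.whpBigOL_of_bigO hP ((ABCD.bigO_Sb_commRate hP h).expect_add
      ((ABCD.bigO_Mb' hP).commRate_of_rpow h) h0)
  · exact ABCD.whpThetaL_of_bigO hP
      (((((ABCD.bigO_Sc_commRate hP (h47 h)).expect_add (ABCD.bigO_Mc'_commRate hP h)
        h0).expect_add (ABCD.bigO_Sb_commRate hP h') h0).expect_add
        ((ABCD.bigO_Mb' hP).commRate_of_rpow h') h0).expect_add
        (ABCD.bigO_Mbc_commRate hP (h47 h)) h0) hc (hSc' _ fun n G => by omega)
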